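/- **Setting.** Let $T$ be a string of length $n$ over a linearly ordered alphabet whose smallest character $\$$ occurs exactly once in $T$, namely at its end. For $1\le\delta\le n$ let $T_\delta$ be the suffix of $T$ of length $\delta$, let $x_1,\dots,x_\delta$ be the starting positions of the suffixes of $T_\delta$ in lexicographic order, let $L_\delta$ be the BWT of $T_\delta$ (its $i$-th character is the one at position $x_i-1$ of $T_\delta$, cyclically), let $F_\delta$ be the string of first characters of the sorted suffixes, and let $\mathsf{LF}_\delta(i)=j$ iff $x_j$ is the cyclic predecessor of $x_i$. A *DBWT* $D$ of $L_\delta$ is a sequence $1=p_1<\dots<p_k<p_{k+1}=\delta+1$ such that each $L_\delta[p_i..p_{i+1}-1]$ (a *DBWT-repetition*) consists of equal characters; the interval $[\mathsf{LF}_\delta(p_i),\mathsf{LF}_\delta(p_{i+1}-1)]$ is its *F-interval*. A DBWT-repetition (F-interval) is *$\alpha$-heavy* if its interval of positions contains at least $\alpha$ starting positions of F-intervals (of DBWT-repetitions). $D$ is *$\alpha$-balanced* if nothing is $\alpha$-heavy. The *LF-interval graph* $\mathsf{Grp}(D)$ has nodes $u_1,\dots,u_k$ (DBWT-repetitions) and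 $v_1,\dots,v_k$ (F-intervals), both $u_i$ and $v_i$ labelled with character and length; undirected edges $(u_i,v_i)$; a directed edge $u_i\to v_j$ with label $p_i-\mathsf{LF}_\delta(p_j)$ whenever the $j$-th F-interval contains $p_i$; and a directed edge $v_j\to u_i$ with label $\mathsf{LF}_\delta(p_j)-p_i$ whenever the $i$-th DBWT-repetition contains $\mathsf{LF}_\delta(p_j)$. It is stored with doubly linked lists of the $u$'s and of the $v$'s (both in the order of starting positions), two arrays holding the $\alpha$-heavy nodes, an order maintenance structure on the $u$'s, and a B-tree holding some of the nodes $v_i$, ordered by (character of $u_i$, position of $u_i$). *B-tree invariant:* the nodes in the B-tree are exactly the $v_g$ such that (i) $u_{g+1}$ has a character different from that of $u_g$ and from $\$$; or (ii) $u_{g+1}$ has character $\$$ and $u_{g+2}$ has a character different from that of $u_g$; or (iii) $u_g$ has character $\$$. Here a node $u_{g+1}$ or $u_{g+2}$ that does not exist (beyond the end of the list) counts as having a different character, other than $\$$. **The operation** $\mathsf{update}(\mathsf{Grp}(D),c)$, where $c\neq\$$ is the first character of $T_{\delta+1}$ and $u_i$ is the node labelled $(\$,1)$. It is applied if neither $u_{i-1}$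 nor $u_{i+1}$ has the character $c$. (I) It searches the B-tree for the last node $v_g$ whose key is smaller than $(u_i,c)$, replaces $u_i$ by a node $u_{i'}$ labelled $(c,1)$, removes $v_i$, and inserts $v_{i'}$ right after $v_g$ (at the front of the list if $v_g=v_i$). (II) If $v_g$ has a successor $v_{\mathsf{gnext}}$ and the edge from it to a node $u_j$ has a label $d>0$, it splits $u_j$ and $v_j$ into nodes $u_{j'},v_{j'}$ of length $d$ followed by nodes $u_{j'+1},v_{j'+1}$ of the remaining length. (III) It inserts a node $u_{x'}$ labelled $(\$,1)$ after $u_{j'}$ (if nothing was split: before the node to which $v_{\mathsf{gnext}}$ points, or at the end of the list if $v_{\mathsf{gnext}}$ does not exist), and $v_{x'}$ at the front of the list of the $v$'s. (IV) It updates the edges, the arrays and the order maintenance structure; and in the B-tree it deletes $v_i,v_{i-1},v_j$ where present, and inserts those of $v_{i-1},v_{i'},v_{x'},v_{j'+1}$ that satisfy (i), (ii) or (iii). Time is counted in elementary steps (reading or writing a memory cell or register, allocating a cell, visiting a B-tree node); an operation of the order maintenance structure takes a constant number $\tau$ of steps. **Statement.** For every $\tau$ there is a constant $C$ such that the following holds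 for all such $T$, all $1\le\delta<n$, all $\alpha\ge 2$ and all $\alpha$-balanced DBWTs $D$ of $L_\delta$ with $k$ DBWT-repetitions. Let $c$ be the first character of $T_{\delta+1}$, and suppose that neither $u_{i-1}$ nor $u_{i+1}$ has the character $c$, and that $\mathsf{Grp}(D)$ is stored with a B-tree that satisfies the B-tree invariant. Then: 1. $\mathsf{update}(\mathsf{Grp}(D),c)$ takes at most $C(\alpha+\log_2 k)$ steps; 2. its output is the stored LF-interval graph $\mathsf{Grp}(D')$ of a $(2\alpha+1)$-balanced DBWT $D'$ of $L_{\delta+1}$ with at most two $\alpha$-heavy DBWT-repetitions and at most two $\alpha$-heavy F-intervals; 3. the B-tree of the output satisfies the B-tree invariant for $D'$. -/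

import Mathlib

namespace RComp

/-! ## Strings, BWT, LF function

Positions are counted from 0.  The alphabet `σ` is a linear order with a least character `⊥`, which
plays the role of the special character `$`. -/

/-- `T` ends with `$`, and `$` occurs nowhere else. -/
def IsText {σ : Type} [LinearOrder σ] [OrderBot σ] (T : List σ) : Prop :=
  ∃ w : List σ, T = w ++ [⊥] ∧ ⊥ ∉ w

/-- The suffix `T_δ` of length `δ` (for `δ ≤ |T|`). -/
def suffixOf {σ : Type} (T : List σ) (δ : ℕ) : List σ := T.drop (T.length - δ)

/-- The starting positions of the suffixes of `S` in lexicographic order of the suffixes. -/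
def sufArr {σ : Type} [LinearOrder σ] (S : List σ) : List ℕ :=
  (List.range S.length).mergeSort (fun x y => decide (S.drop x ≤ S.drop y))

/-- The position preceding `x`, cyclically: the first position is preceded by the last one. -/
def cycPred {σ : Type} (S : List σ) (x : ℕ) : ℕ := (x + S.length - 1) % S.length

/-- The BWT of `S`: the characters preceding the sorted suffixes. -/
def bwt {σ : Type} [LinearOrder σ] [OrderBot σ] (S : List σ) : List σ :=
  (sufArr S).map (fun x => S.getD (cycPred S x) ⊥)

/-- The first characters of the sorted suffixes of `S`. -/
def firstCol {σ : Type} [LinearOrder σ] [OrderBot σ] (S : List σ) : List σ :=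
  (sufArr S).map (fun x => S.getD x ⊥)

/-- The LF function: `LF S i = j` if the suffix of rank `j` starts at the (cyclic) predecessor of the
starting position of the suffix of rank `i`. -/
def LF {σ : Type} [LinearOrder σ] (S : List σ) (i : ℕ) : ℕ :=
  (sufArr S).idxOf (cycPred S ((sufArr S).getD i 0))

/-! ## Divided BWT -/

/-- A division of the BWT of `S` into `k` nonempty repetitions of a single character: the `i`-th one
occupies the positions `p i ≤ x < p (i+1)`. -/
structure DBWT {σ : Type} [LinearOrder σ] [OrderBot σ] (S : List σ) where
  k : ℕ
  p : Fin (k + 1) → ℕ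
  p_zero : p 0 = 0
  p_last : p (Fin.last k) = S.length
  p_strictMono : StrictMono p
  repetition : ∀ (i : Fin k) (x : ℕ), p i.castSucc ≤ x → x < p i.succ →
    (bwt S)[x]? = (bwt S)[p i.castSucc]?

namespace DBWT

variable {σ : Type} [LinearOrder σ] [OrderBot σ] {S : List σ}

/-- First position of the `i`-th DBWT-repetition. -/
def lStart (D : DBWT S) (i : Fin D.k) : ℕ := D.p i.castSucc

/-- Last position of the `i`-th DBWT-repetition. -/
def lEnd (D : DBWT S) (i : Fin D.k) : ℕ := D.p i.succ - 1

/-- First position of the F-interval of the `i`-th DBWT-repetition. -/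
def fStart (D : DBWT S) (i : Fin D.k) : ℕ := LF S (D.lStart i)

/-- Last position of the F-interval of the `i`-th DBWT-repetition. -/
def fEnd (D : DBWT S) (i : Fin D.k) : ℕ := LF S (D.lEnd i)

/-- The `i`-th DBWT-repetition covers the starting position of the `j`-th F-interval. -/
def RepCovers (D : DBWT S) (i j : Fin D.k) : Prop :=
  D.lStart i ≤ D.fStart j ∧ D.fStart j ≤ D.lEnd i

/-- The `j`-th F-interval covers the starting position of the `i`-th DBWT-repetition. -/
def IntCovers (D : DBWT S) (j i : Fin D.k) : Prop :=
  D.fStart j ≤ D.lStart i ∧ D.lStart i ≤ D.fEnd j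

instance (D : DBWT S) (i j : Fin D.k) : Decidable (D.RepCovers i j) := by
  unfold RepCovers; infer_instance

instance (D : DBWT S) (i j : Fin D.k) : Decidable (D.IntCovers i j) := by
  unfold IntCovers; infer_instance

/-- The `α`-heavy DBWT-repetitions. -/
def heavyReps (D : DBWT S) (α : ℕ) : Finset (Fin D.k) :=
  Finset.univ.filter (fun i => α ≤ (Finset.univ.filter (fun j => D.RepCovers i j)).card)

/-- The `α`-heavy F-intervals. -/
def heavyInts (D : DBWT S) (α : ℕ) : Finset (Fin D.k) :=
  Finset.univ.filter (fun j => α ≤ (Finset.univ.filter (fun i => D.IntCovers j i)).card)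

def Balanced (D : DBWT S) (α : ℕ) : Prop := D.heavyReps α = ∅ ∧ D.heavyInts α = ∅

end DBWT

/-! ## LF-interval graph -/

/-- Node sets `U = {u_i}` and `V = {v_i}` are both indexed by `Fin k`; undirected edges `ELF ⊆ U × V`,
directed edges `EL ⊆ U × V` and `EF ⊆ V × U`, and labels of nodes and directed edges
(`BL`, `BF` matter on `EL`, `EF` only). -/
structure LFIntervalGraph (σ : Type) (k : ℕ) where
  ELF : Finset (Fin k × Fin k)
  EL : Finset (Fin k × Fin k)
  EF : Finset (Fin k × Fin k)
  BU : Fin k → σ × ℕ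
  BV : Fin k → σ × ℕ
  BL : Fin k → Fin k → ℕ
  BF : Fin k → Fin k → ℕ

namespace DBWT

variable {σ : Type} [LinearOrder σ] [OrderBot σ] {S : List σ}

/-- The LF-interval graph `Grp(D)`. -/
def graph (D : DBWT S) : LFIntervalGraph σ D.k where
  ELF := Finset.univ.filter (fun e => e.1 = e.2)
  EL := Finset.univ.filter (fun e => D.IntCovers e.2 e.1)
  EF := Finset.univ.filter (fun e => D.RepCovers e.2 e.1)
  BU := fun i => ((bwt S).getD (D.lStart i) ⊥, D.p i.succ - D.p i.castSucc)
  BV := fun i => ((firstCol S).getD (D.fStart i) ⊥, D.fEnd i - D.fStart i + 1)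
  BL := fun i j => D.lStart i - D.fStart j
  BF := fun j i => D.fStart j - D.lStart i

/-- The nodes of `U` in the order of the starting positions of the DBWT-repetitions. -/
def uOrder (D : DBWT S) : List (Fin D.k) := List.finRange D.k

/-- The nodes of `V` in the order of the starting positions of the F-intervals. -/
def vOrder (D : DBWT S) : List (Fin D.k) :=
  (List.finRange D.k).mergeSort (fun i j => decide (D.fStart i ≤ D.fStart j))

/-- The nodes of `V` in the order of their B-tree keys `(u_i, character)`: first by the character,
then by the position of `u_i` in `U`. -/
def keyOrder (D : DBWT S) : List (Fin D.k) :=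
  (List.finRange D.k).mergeSort (fun i j =>
    decide ((D.graph.BU i).1 < (D.graph.BU j).1 ∨ (D.graph.BU i).1 = (D.graph.BU j).1 ∧ i ≤ j))

/-- The character in the label of the `t`-th node of `U`, and `none` if there is no such node. -/
def charAt (D : DBWT S) (t : ℕ) : Option σ :=
  if h : t < D.k then some (D.graph.BU ⟨t, h⟩).1 else none

/-- The condition that decides whether `v_g` is kept in the B-tree:
(i) the next node `u_{g+1}` has a label with another character, which is not `$`; or
(ii) `u_{g+1}` has the label `$`, and `u_{g+2}` has a label with another character than `u_g`; or
(iii) `u_g` has the label `$`.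
A node beyond the end of `U` counts as one with another character (`none`). -/
def SearchCond (D : DBWT S) (g : Fin D.k) : Prop :=
  (D.charAt (g + 1) ≠ D.charAt g ∧ D.charAt (g + 1) ≠ some ⊥) ∨
  (D.charAt (g + 1) = some ⊥ ∧ D.charAt (g + 2) ≠ D.charAt g) ∨
  D.charAt g = some ⊥

/-- Neither neighbour in `U` of the node `u_i` with label `$` has a label with the character `c`. -/
def NeighboursAvoid (D : DBWT S) (c : σ) : Prop :=
  ∀ i : ℕ, D.charAt i = some ⊥ →
    (∀ h : ℕ, h + 1 = i → D.charAt h ≠ some c) ∧ D.charAt (i + 1) ≠ some c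

end DBWT

/-! ## The data structure -/

/-- A B-tree of order 3 (2-3 tree) whose entries are addresses of nodes. -/
inductive BTree where
  | leaf : BTree
  | node2 : BTree → ℕ → BTree → BTree
  | node3 : BTree → ℕ → BTree → ℕ → BTree → BTree

namespace BTree

/-- The entries from left to right. -/
def inorder : BTree → List ℕ
  | leaf => []
  | node2 l a r => l.inorder ++ a :: r.inorder
  | node3 l a m b r => l.inorder ++ a :: (m.inorder ++ b :: r.inorder)

def height : BTree → ℕ
  | leaf => 0
  | node2 l _ r => max l.height r.height + 1
  | node3 l _ m _ r => max l.height (max m.height r.height) + 1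

/-- All leaves have the same depth. -/
def Complete : BTree → Prop
  | leaf => True
  | node2 l _ r => l.Complete ∧ r.Complete ∧ l.height = r.height
  | node3 l _ m _ r => l.Complete ∧ m.Complete ∧ r.Complete ∧ l.height = m.height ∧
      m.height = r.height

end BTree

/-- A memory cell.  The two nodes `u ∈ U` and `v ∈ V` joined by an edge of `E_LF` share one cell (and
hence one address); their labels agree.
* `ch`, `len`: the label of `u` and of `v`;
* `uPrev`, `uNext`, `vPrev`, `vNext`: the pointers of the two doubly linked lists;
* `eL`, `bL`: head and label of the directed edge of `E_L` that leaves `u`;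
* `eF`, `bF`: head and label of the directed edge of `E_F` that leaves `v`;
* `inU`: the first node in the list of `V` whose edge of `E_F` points to `u`, if there is one (the
  others follow it consecutively in the list of `V`);
* `inV`: the first node in the list of `U` whose edge of `E_L` points to `v`, if there is one. -/
structure Cell (σ : Type) where
  ch : σ
  len : ℕ
  uPrev : Option ℕ
  uNext : Option ℕ
  vPrev : Option ℕ
  vNext : Option ℕ
  eL : ℕ
  bL : ℕ
  eF : ℕ
  bF : ℕ
  inU : Option ℕ
  inV : Option ℕ

/-- The machine: an addressable memory in which the addresses `< fresh` are allocated; the address of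
the node with label `$`; first and last nodes of the two doubly linked lists; the order maintenance
structure on `U` (its content, from first to last); the two arrays of heavy nodes; the B-tree; and the
number of steps executed so far. -/
structure Machine (σ : Type) where
  cell : ℕ → Cell σ
  fresh : ℕ
  dollar : ℕ
  uHead : Option ℕ
  uTail : Option ℕ
  vHead : Option ℕ
  vTail : Option ℕ
  order : List ℕ
  heavyU : List ℕ
  heavyV : List ℕ
  btree : BTree
  steps : ℕ

/-- The nodes `l` form a doubly linked list, from first to last. -/
def IsLinkedList (prev next : ℕ → Option ℕ) (head tail : Option ℕ) (l : List ℕ) : Prop :=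
  head = l.head? ∧ tail = l.getLast? ∧
  ∀ (t : ℕ) (h : t < l.length), next l[t] = l[t + 1]? ∧
    prev l[t] = if t = 0 then none else l[t - 1]?

/-- The machine state `m` stores the LF-interval graph of `D` together with its dynamic data
structures, where the nodes `u_i` and `v_i` are at the address `a i`, the arrays hold the `α`-heavy
nodes, and the B-tree holds the set `B` of nodes of `V`. -/
structure StoresGraph {σ : Type} [LinearOrder σ] [OrderBot σ] {S : List σ} (α : ℕ) (D : DBWT S)
    (a : Fin D.k → ℕ) (B : Finset (Fin D.k)) (m : Machine σ) : Prop where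
  allocated : ∀ i, a i < m.fresh
  edgesLF : ∀ i j, (i, j) ∈ D.graph.ELF ↔ a i = a j
  labelsU : ∀ i, D.graph.BU i = ((m.cell (a i)).ch, (m.cell (a i)).len)
  labelsV : ∀ i, D.graph.BV i = ((m.cell (a i)).ch, (m.cell (a i)).len)
  listU : IsLinkedList (fun x => (m.cell x).uPrev) (fun x => (m.cell x).uNext) m.uHead m.uTail
    (D.uOrder.map a)
  listV : IsLinkedList (fun x => (m.cell x).vPrev) (fun x => (m.cell x).vNext) m.vHead m.vTail
    (D.vOrder.map a)
  edgesL : ∀ i j, (i, j) ∈ D.graph.EL ↔ (m.cell (a i)).eL = a j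
  labelsL : ∀ i j, (i, j) ∈ D.graph.EL → (m.cell (a i)).bL = D.graph.BL i j
  edgesF : ∀ j i, (j, i) ∈ D.graph.EF ↔ (m.cell (a j)).eF = a i
  labelsF : ∀ j i, (j, i) ∈ D.graph.EF → (m.cell (a j)).bF = D.graph.BF j i
  entryU : ∀ i, (m.cell (a i)).inU =
    (D.vOrder.find? (fun j => decide ((j, i) ∈ D.graph.EF))).map a
  entryV : ∀ j, (m.cell (a j)).inV =
    (D.uOrder.find? (fun i => decide ((i, j) ∈ D.graph.EL))).map a
  dollar : ∀ i, (D.graph.BU i).1 = ⊥ ↔ m.dollar = a i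
  order : m.order = D.uOrder.map a
  arrayU : m.heavyU.Perm ((D.uOrder.filter (fun i => decide (i ∈ D.heavyReps α))).map a)
  arrayV : m.heavyV.Perm ((D.vOrder.filter (fun j => decide (j ∈ D.heavyInts α))).map a)
  btreeComplete : m.btree.Complete
  btreeInorder : m.btree.inorder = (D.keyOrder.filter (fun i => decide (i ∈ B))).map a

/-! ## Elementary operations and their cost

Programs are written in the state monad over `Machine`.  Each operation of this section is one step
of the machine, except that an operation of the order maintenance structure takes `τ` steps.  Between
two such operations a program does a bounded number of comparisons, additions and subtractions on
values it has read. -/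

abbrev Prog (σ : Type) (β : Type) : Type := StateM (Machine σ) β

section Operations

variable {σ : Type}

/-- Advance the step counter. -/
def tick (s : ℕ) : Prog σ Unit := modify (fun m => { m with steps := m.steps + s })

def readCell (x : ℕ) : Prog σ (Cell σ) := do
  tick 1
  return (← get).cell x

def updateCell (x : ℕ) (f : Cell σ → Cell σ) : Prog σ Unit := do
  tick 1
  modify (fun m => { m with cell := Function.update m.cell x (f (m.cell x)) })

/-- Allocate a new cell. -/
def allocCell (s : Cell σ) : Prog σ ℕ := do
  tick 1
  let x := (← get).fresh
  modify (fun m => { m with cell := Function.update m.cell x s, fresh := x + 1 })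
  return x

/-- Read a register (a field of constant size, or the root of the B-tree). -/
def readReg {β : Type} (f : Machine σ → β) : Prog σ β := do
  tick 1
  return f (← get)

def setDollar (x : ℕ) : Prog σ Unit := do
  tick 1
  modify (fun m => { m with dollar := x })

def setUTail (x : Option ℕ) : Prog σ Unit := do
  tick 1
  modify (fun m => { m with uTail := x })

def setVHead (x : Option ℕ) : Prog σ Unit := do
  tick 1
  modify (fun m => { m with vHead := x })

def setVTail (x : Option ℕ) : Prog σ Unit := do
  tick 1
  modify (fun m => { m with vTail := x })

def setBTree (t : BTree) : Prog σ Unit := do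
  tick 1
  modify (fun m => { m with btree := t })

def pushHeavyU (x : ℕ) : Prog σ Unit := do
  tick 1
  modify (fun m => { m with heavyU := x :: m.heavyU })

def pushHeavyV (x : ℕ) : Prog σ Unit := do
  tick 1
  modify (fun m => { m with heavyV := x :: m.heavyV })

/-- Order maintenance: does `x` precede `y`? -/
def precedes (τ : ℕ) (x y : ℕ) : Prog σ Bool := do
  tick τ
  let o := (← get).order
  return decide (o.idxOf x < o.idxOf y)

/-- Order maintenance: insert `x` right after `y`. -/
def orderInsertAfter (τ : ℕ) (x y : ℕ) : Prog σ Unit := do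
  tick τ
  modify (fun m => { m with order := m.order.insertIdx (m.order.idxOf y + 1) x })

end Operations

/-! ## B-tree operations -/

section BTreeOperations

variable {σ : Type} [LinearOrder σ]

/-- Is the key `(x, c)` smaller than the key `(y, c')`? -/
def pairLess (τ : ℕ) (x : ℕ) (c : σ) (y : ℕ) (c' : σ) : Prog σ Bool :=
  if c < c' then pure true else if c = c' then precedes τ x y else pure false

/-- Is the key of the node at `x` smaller than the key of the node at `y`? -/
def keyLess (τ : ℕ) (x y : ℕ) : Prog σ Bool := do
  let sx ← readCell x
  let sy ← readCell y
  pairLess τ x sx.ch y sy.ch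

/-- The last entry with a key smaller than `(x, c)`, and `best` if there is none. -/
def searchTree (τ : ℕ) (x : ℕ) (c : σ) : BTree → Option ℕ → Prog σ (Option ℕ)
  | .leaf, best => do
      tick 1
      return best
  | .node2 l a r, best => do
      tick 1
      let sa ← readCell a
      if (← pairLess τ a sa.ch x c) then searchTree τ x c r (some a)
      else searchTree τ x c l best
  | .node3 l a m b r, best => do
      tick 1
      let sa ← readCell a
      let sb ← readCell b
      if (← pairLess τ b sb.ch x c) then searchTree τ x c r (some b)
      else if (← pairLess τ a sa.ch x c) then searchTree τ x c m (some a)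
      else searchTree τ x c l best

/-- Result of an insertion into a subtree: it keeps its height, or it is split at an entry that moves
up. -/
inductive Grown where
  | fit : BTree → Grown
  | split : BTree → ℕ → BTree → Grown

def insertRec (τ : ℕ) (x : ℕ) : BTree → Prog σ Grown
  | .leaf => do
      tick 1
      return .split .leaf x .leaf
  | .node2 l a r => do
      tick 1
      if x = a then return .fit (.node2 l a r)
      else if (← keyLess τ x a) then
        match ← insertRec τ x l with
        | .fit t => return .fit (.node2 t a r)
        | .split t₁ b t₂ => return .fit (.node3 t₁ b t₂ a r)
      else
        match ← insertRec τ x r with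
        | .fit t => return .fit (.node2 l a t)
        | .split t₁ b t₂ => return .fit (.node3 l a t₁ b t₂)
  | .node3 l a m b r => do
      tick 1
      if x = a ∨ x = b then return .fit (.node3 l a m b r)
      else if (← keyLess τ x a) then
        match ← insertRec τ x l with
        | .fit t => return .fit (.node3 t a m b r)
        | .split t₁ e t₂ => return .split (.node2 t₁ e t₂) a (.node2 m b r)
      else if (← keyLess τ x b) then
        match ← insertRec τ x m with
        | .fit t => return .fit (.node3 l a t b r)
        | .split t₁ e t₂ => return .split (.node2 l a t₁) e (.node2 t₂ b r)
      else
        match ← insertRec τ x r with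
        | .fit t => return .fit (.node3 l a m b t)
        | .split t₁ e t₂ => return .split (.node2 l a m) b (.node2 t₁ e t₂)

/-- Insert the node at `x` into the B-tree. -/
def treeInsert (τ : ℕ) (x : ℕ) : Prog σ Unit := do
  let t ← readReg (fun m => m.btree)
  match ← insertRec τ x t with
  | .fit t' => setBTree t'
  | .split l a r => setBTree (.node2 l a r)

/-- Result of a deletion from a subtree: it keeps its height, or it has become one level lower. -/
inductive Shrunk where
  | same : BTree → Shrunk
  | lower : BTree → Shrunk

def Shrunk.tree : Shrunk → BTree
  | .same t => t
  | .lower t => t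

/-- Rebuild a node with two children, the left one having shrunk. -/
def mend21 : Shrunk → ℕ → BTree → Shrunk
  | .same t₁, a, t₂ => .same (.node2 t₁ a t₂)
  | .lower t₁, a, .node2 t₂ b t₃ => .lower (.node3 t₁ a t₂ b t₃)
  | .lower t₁, a, .node3 t₂ b t₃ c t₄ => .same (.node2 (.node2 t₁ a t₂) b (.node2 t₃ c t₄))
  | .lower t₁, a, .leaf => .same (.node2 t₁ a .leaf)

/-- Rebuild a node with two children, the right one having shrunk. -/
def mend22 : BTree → ℕ → Shrunk → Shrunk
  | t₁, a, .same t₂ => .same (.node2 t₁ a t₂)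
  | .node2 t₁ b t₂, a, .lower t₃ => .lower (.node3 t₁ b t₂ a t₃)
  | .node3 t₁ b t₂ c t₃, a, .lower t₄ => .same (.node2 (.node2 t₁ b t₂) c (.node2 t₃ a t₄))
  | .leaf, a, .lower t₂ => .same (.node2 .leaf a t₂)

/-- Rebuild a node with three children, the left one having shrunk. -/
def mend31 : Shrunk → ℕ → BTree → ℕ → BTree → Shrunk
  | .same t₁, a, t₂, b, t₃ => .same (.node3 t₁ a t₂ b t₃)
  | .lower t₁, a, .node2 t₂ b t₃, c, t₄ => .same (.node2 (.node3 t₁ a t₂ b t₃) c t₄)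
  | .lower t₁, a, .node3 t₂ b t₃ c t₄, d, t₅ =>
      .same (.node3 (.node2 t₁ a t₂) b (.node2 t₃ c t₄) d t₅)
  | .lower t₁, a, .leaf, b, t₃ => .same (.node3 t₁ a .leaf b t₃)

/-- Rebuild a node with three children, the middle one having shrunk. -/
def mend32 : BTree → ℕ → Shrunk → ℕ → BTree → Shrunk
  | t₁, a, .same t₂, b, t₃ => .same (.node3 t₁ a t₂ b t₃)
  | t₁, a, .lower t₂, b, .node2 t₃ c t₄ => .same (.node2 t₁ a (.node3 t₂ b t₃ c t₄))
  | t₁, a, .lower t₂, b, .node3 t₃ c t₄ d t₅ =>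
      .same (.node3 t₁ a (.node2 t₂ b t₃) c (.node2 t₄ d t₅))
  | t₁, a, .lower t₂, b, .leaf => .same (.node3 t₁ a t₂ b .leaf)

/-- Rebuild a node with three children, the right one having shrunk. -/
def mend33 : BTree → ℕ → BTree → ℕ → Shrunk → Shrunk
  | t₁, a, t₂, b, .same t₃ => .same (.node3 t₁ a t₂ b t₃)
  | t₁, a, .node2 t₂ b t₃, c, .lower t₄ => .same (.node2 t₁ a (.node3 t₂ b t₃ c t₄))
  | t₁, a, .node3 t₂ b t₃ c t₄, d, .lower t₅ =>
      .same (.node3 t₁ a (.node2 t₂ b t₃) c (.node2 t₄ d t₅))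
  | t₁, a, .leaf, b, .lower t₃ => .same (.node3 t₁ a .leaf b t₃)

/-- Remove the first entry of a subtree, and return it (`0` from the empty tree). -/
def removeMin : BTree → Prog σ (ℕ × Shrunk)
  | .leaf => do
      tick 1
      return (0, .same .leaf)
  | .node2 .leaf a _ => do
      tick 1
      return (a, .lower .leaf)
  | .node3 .leaf a _ b _ => do
      tick 1
      return (a, .same (.node2 .leaf b .leaf))
  | .node2 l a r => do
      tick 1
      let (x, s) ← removeMin l
      return (x, mend21 s a r)
  | .node3 l a m b r => do
      tick 1
      let (x, s) ← removeMin l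
      return (x, mend31 s a m b r)

def deleteRec (τ : ℕ) (x : ℕ) : BTree → Prog σ Shrunk
  | .leaf => do
      tick 1
      return .same .leaf
  | .node2 .leaf a r => do
      tick 1
      if x = a then return .lower .leaf else return .same (.node2 .leaf a r)
  | .node3 .leaf a m b r => do
      tick 1
      if x = a then return .same (.node2 .leaf b .leaf)
      else if x = b then return .same (.node2 .leaf a .leaf)
      else return .same (.node3 .leaf a m b r)
  | .node2 l a r => do
      tick 1
      if x = a then
        let (y, s) ← removeMin r
        return mend22 l y s
      else if (← keyLess τ x a) then return mend21 (← deleteRec τ x l) a r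
      else return mend22 l a (← deleteRec τ x r)
  | .node3 l a m b r => do
      tick 1
      if x = a then
        let (y, s) ← removeMin m
        return mend32 l y s b r
      else if x = b then
        let (y, s) ← removeMin r
        return mend33 l a m y s
      else if (← keyLess τ x a) then return mend31 (← deleteRec τ x l) a m b r
      else if (← keyLess τ x b) then return mend32 l a (← deleteRec τ x m) b r
      else return mend33 l a m b (← deleteRec τ x r)

/-- Delete the node at `x` from the B-tree. -/
def treeDelete (τ : ℕ) (x : ℕ) : Prog σ Unit := do
  let t ← readReg (fun m => m.btree)
  setBTree (← deleteRec τ x t).tree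

end BTreeOperations

/-! ## The update operation -/

section Update

variable {σ : Type}

/-- Link the node at `x` into the list of `U` right after the node at `y`. -/
def linkUAfter (x y : ℕ) : Prog σ Unit := do
  let n := (← readCell y).uNext
  updateCell x (fun s => { s with uPrev := some y, uNext := n })
  updateCell y (fun s => { s with uNext := some x })
  match n with
  | some w => updateCell w (fun s => { s with uPrev := some x })
  | none => setUTail (some x)

/-- Link the node at `x` into the list of `V` right after the node at `y`. -/
def linkVAfter (x y : ℕ) : Prog σ Unit := do
  let n := (← readCell y).vNext
  updateCell x (fun s => { s with vPrev := some y, vNext := n })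
  updateCell y (fun s => { s with vNext := some x })
  match n with
  | some w => updateCell w (fun s => { s with vPrev := some x })
  | none => setVTail (some x)

/-- From the node `y` on along the list of `V`, as long as the edges of `E_F` point to the node at `j`:
redirect them to the node at `z`, whose repetition starts `d` positions later.  The first argument of
this and the next two loops is the number of allocated addresses; it bounds the number of rounds and
is never used up. -/
def redirectF (j z d : ℕ) : ℕ → Option ℕ → Prog σ Unit
  | 0, _ => pure ()
  | _ + 1, none => pure ()
  | N + 1, some y => do
      let s ← readCell y
      if s.eF = j then
        updateCell y (fun s => { s with eF := z, bF := s.bF - d })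
        redirectF j z d N s.vNext

/-- Along the list of `U`, as long as the edges of `E_L` point to the node at `j`: redirect those with
a label `≥ d` to the node at `z`, whose F-interval starts `d` positions later.  Return the first node
whose edge was redirected. -/
def redirectL (j z d : ℕ) : ℕ → Option ℕ → Option ℕ → Prog σ (Option ℕ)
  | 0, _, first => pure first
  | _ + 1, none, first => pure first
  | N + 1, some y, first => do
      let s ← readCell y
      if s.eL = j then
        if d ≤ s.bL then
          updateCell y (fun s => { s with eL := z, bL := s.bL - d })
          redirectL j z d N s.uNext (first <|> some y)
        else redirectL j z d N s.uNext first
      else pure first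

/-- The repetition that contains the position `b` positions after the start of the repetition of `u`,
and the offset of the position in it. -/
def locate : ℕ → ℕ → ℕ → Prog σ (ℕ × ℕ)
  | 0, u, b => pure (u, b)
  | N + 1, u, b => do
      let s ← readCell u
      if b < s.len then pure (u, b)
      else match s.uNext with
        | none => pure (u, b)
        | some w => locate N w (b - s.len)

/-- Do at least `n` edges of `E_F`, counted from the one of the given node of `V` on, point to `u`? -/
def heavyTestU (u : ℕ) : ℕ → Option ℕ → Prog σ Bool
  | 0, _ => pure true
  | _ + 1, none => pure false
  | n + 1, some y => do
      let s ← readCell y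
      if s.eF = u then heavyTestU u n s.vNext else pure false

/-- Do at least `n` edges of `E_L`, counted from the one of the given node of `U` on, point to `v`? -/
def heavyTestV (v : ℕ) : ℕ → Option ℕ → Prog σ Bool
  | 0, _ => pure true
  | _ + 1, none => pure false
  | n + 1, some y => do
      let s ← readCell y
      if s.eL = v then heavyTestV v n s.uNext else pure false

/-- The character in the label of the node at the given address, if there is one. -/
def labelAt : Option ℕ → Prog σ (Option σ)
  | none => pure none
  | some x => do return some (← readCell x).ch

/-- Does the node of `V` at `x` satisfy the condition for being kept in the B-tree? -/
def searchTest [LinearOrder σ] [OrderBot σ] (x : ℕ) : Prog σ Bool := do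
  let s ← readCell x
  let c₁ ← labelAt s.uNext
  if s.ch = ⊥ then return true
  else if c₁ = some ⊥ then
    match s.uNext with
    | none => return true
    | some y => return decide ((← labelAt (← readCell y).uNext) ≠ some s.ch)
  else return decide (c₁ ≠ some s.ch)

def deleteIfStored [LinearOrder σ] [OrderBot σ] (τ : ℕ) (x : ℕ) : Prog σ Unit := do
  if (← searchTest x) then treeDelete τ x

def insertIfRequired [LinearOrder σ] [OrderBot σ] (τ : ℕ) (x : ℕ) : Prog σ Unit := do
  if (← searchTest x) then treeInsert τ x

/-- Split `u_j`, `v_j` (at the address `j`) after the first `d` characters.  The first parts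
`u_{j'}`, `v_{j'}` stay at `j`; the second parts `u_{j'+1}`, `v_{j'+1}` get the new address that is
returned.  Here `u_{j'+1}` is placed after the node at `x` in `U`, and `y` is the node of `V` whose
F-interval starts where `u_{j'+1}` starts. -/
def splitNode (τ α : ℕ) (j d x y : ℕ) : Prog σ ℕ := do
  let N ← readReg (fun m => m.fresh)
  let sj ← readCell j
  let z ← allocCell { sj with len := sj.len - d, inU := none, inV := none }
  updateCell j (fun s => { s with len := d })
  -- the lists and the order maintenance structure
  linkUAfter z x
  orderInsertAfter τ z x
  linkVAfter z j
  -- the edge of `E_L` from `u_{j'+1}`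
  updateCell z (fun s => { s with eL := y, bL := 0 })
  updateCell y (fun s => { s with inV := some z })
  -- the edges of `E_F` into `u_{j'+1}`
  redirectF j z d N (some y)
  updateCell z (fun s => { s with inU := some y })
  updateCell j (fun s => { s with inU := if s.inU = some y then none else s.inU })
  -- the edge of `E_F` from `v_{j'+1}`
  let tj ← readCell j
  let (h, b) ← locate (N + 1) tj.eF (tj.bF + d)
  updateCell z (fun s => { s with eF := h, bF := b })
  if h ≠ tj.eF then updateCell h (fun s => { s with inU := some z })
  -- the edges of `E_L` into `v_{j'+1}`
  let first ← redirectL j z d (N + 1) tj.inV none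
  updateCell z (fun s => { s with inV := first })
  updateCell j (fun s => { s with inV := if s.inV = first then none else s.inV })
  -- the arrays of heavy nodes
  let sh ← readCell h
  if (← heavyTestU h α sh.inU) then pushHeavyU h
  let h' := (← readCell z).eL
  let sh' ← readCell h'
  if (← heavyTestV h' α sh'.inV) then pushHeavyV h'
  return z

/-- The update operation for the input character `c`.  The cell of the node `u_i` with label `$` is
used again for the node `u_{i'}` with label `c` that replaces it. -/
def update [LinearOrder σ] [OrderBot σ] (τ α : ℕ) (c : σ) : Prog σ Unit := do
  -- find `u_i`, `v_g` and the successor of `v_g` in `V`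
  let i ← readReg (fun m => m.dollar)
  let si ← readCell i
  let root ← readReg (fun m => m.btree)
  let some g ← searchTree τ i c root none | return
  let gnext := (← readCell g).vNext
  -- find the node `u_j` to be split, and where; and the node `w` that precedes the new `$` in `U`
  let (w, cut) ← (match gnext with
    | none => do return (← readReg (fun m => m.uTail), none)
    | some y => do
        let sy ← readCell y
        if 0 < sy.bF then return (some sy.eF, some (sy.eF, sy.bF, y))
        else return ((← readCell sy.eF).uPrev, none) : Prog σ (Option ℕ × Option (ℕ × ℕ × ℕ)))
  let some w := w | return
  -- delete `v_i`, `v_{i-1}`, `v_j` from the B-tree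
  deleteIfStored τ i
  match si.uPrev with
  | some x => deleteIfStored τ x
  | none => pure ()
  match cut with
  | some (j, _, _) => deleteIfStored τ j
  | none => pure ()
  -- create `u_{x'}`, `v_{x'}` with label `$`; `v_{x'}` takes the place of `v_i` at the top of `V`
  let x ← allocCell
    { ch := ⊥, len := 1, uPrev := none, uNext := none, vPrev := none, vNext := si.vNext,
      eL := i, bL := 0, eF := si.eF, bF := 0, inU := some i, inV := some si.eF }
  setVHead (some x)
  match si.vNext with
  | some y => updateCell y (fun s => { s with vPrev := some x })
  | none => setVTail (some x)
  updateCell si.eF (fun s => { s with eL := x, bL := 0, inU := some x })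
  -- `u_i` becomes `u_{i'}`, and `v_{i'}` is inserted after `v_g` in `V`
  updateCell i (fun s => { s with ch := c, eF := x, bF := 0, inV := some x })
  linkVAfter i (if g = i then x else g)
  -- insert `u_{x'}` into `U`
  linkUAfter x w
  orderInsertAfter τ x w
  setDollar x
  -- split
  let z ← (match cut with
    | some (j, d, y) => do return some (← splitNode τ α j d x y)
    | none => pure none : Prog σ (Option ℕ))
  -- insert `v_{i-1}`, `v_{i'}`, `v_{x'}`, `v_{j'+1}` into the B-tree
  match si.uPrev with
  | some y => insertIfRequired τ y
  | none => pure ()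
  insertIfRequired τ i
  insertIfRequired τ x
  match z with
  | some z => insertIfRequired τ z
  | none => pure ()

end Update

end RComp

open RComp

/-! Let S = T_δ and let q be the rank of cS among the suffixes of cS. Prepending c does not disturb
the order of the suffixes of S, so every old rank r becomes `shift q r` (`rk_cons_succ`). In the BWT
the old `$`, at the rank of S, turns into c with LF value q; the new `$` sits at rank q with LF
value 0; everywhere else characters are kept and LF commutes with the shift (`cons_step_dollar`,
`cons_step_other`). In terms of nodes: the F-interval of u_i, of length 1, leaves the front of V and
re-enters at q, a new node takes the front place, and the repetition of the new node enters U at q.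
If q lies in the interior of a repetition, that repetition is cut there beforehand (`Layout.cons`,
`Layout.splitGrow`).

The place q is found by keys. LF sorts positions by (character, position) (`LF_lt_LF`), and LF(r) <
q holds exactly if the key of r is smaller than (c, rank of S) (`LF_lt_rk_cons`). No F-interval
straddles q, because a repetition of c cannot run across the `$`; hence the node wanted is the last
node v_g of V before q (`Layout.exists_insertion`). This v_g is in the B-tree: if u_g were followed
by a repetition with its own character, directly or behind the `$` only, then the maximality of v_g
would force the character to be c and the `$` to lie between the two. That rules out direct
adjacency, and the other case is excluded by the assumption on u_{i-1} (`Layout.condL_last`). So the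
search among the stored nodes agrees with a search among all of V. The membership condition of a
node depends on its successors only up to the first one that is not `$`, so it changes at no nodes
but those that the operation deletes and reinserts.

For the balance, edges into a node are counted. The new node takes over one existing edge and
receives one edge, so all numbers stay below α since α ≥ 2 (`countP_insert_lt`). A cut distributes
the edges into u_j (and v_j) over two parts and adds one new edge in either direction
(`countP_split_le`). Hence at most one repetition and one F-interval reach α, and none exceeds α
(`FewHeavy`); the output is even (α+1)-balanced.

For the time, each loop runs over edges that lead to one common node, or over repetitions that start
in the former F-interval of v_j, so it makes O(α) rounds. One search, at most three deletions and at
most four insertions in a 2-3 tree with at most k+2 entries cost O(log k).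

To speak about the program, positions are replaced by sums of lengths along the lists of addresses
(`off`). `Layout` states that lists with labels describe a DBWT, `Half` describes the edges of one
direction, and `storesGraph_iff` identifies the given notion of a stored graph with `Stored`, which
is phrased by them. The program is then executed phase by phase on such states. -/

namespace RComp

set_option linter.unusedSectionVars false

/-! ### Ranks of suffixes, the LF function, and their change when a character is prepended. -/

section Rank

variable {σ : Type} [LinearOrder σ]

/-- The rank of the suffix that starts at position `x`. -/
def rk (S : List σ) (x : ℕ) : ℕ := (sufArr S).idxOf x

theorem sufArr_perm (S : List σ) : (sufArr S).Perm (List.range S.length) :=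
  List.mergeSort_perm _ _

theorem length_sufArr (S : List σ) : (sufArr S).length = S.length := by
  simpa using (sufArr_perm S).length_eq

theorem nodup_sufArr (S : List σ) : (sufArr S).Nodup :=
  (sufArr_perm S).nodup_iff.2 List.nodup_range

theorem mem_sufArr {S : List σ} {x : ℕ} : x ∈ sufArr S ↔ x < S.length := by
  rw [(sufArr_perm S).mem_iff, List.mem_range]

theorem drop_injOn {S : List σ} {x y : ℕ} (hx : x < S.length) (hy : y < S.length)
    (h : S.drop x = S.drop y) : x = y := by
  have := congrArg List.length h
  simp only [List.length_drop] at this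
  omega

/-- The order is strict because suffixes that start at different positions have different lengths.
-/
theorem sufArr_pairwise (S : List σ) :
    (sufArr S).Pairwise (fun x y => S.drop x < S.drop y) := by
  have h : (sufArr S).Pairwise (fun x y => S.drop x ≤ S.drop y) := by
    have := List.pairwise_mergeSort (le := fun x y => decide (S.drop x ≤ S.drop y))
      (fun a b c => by simpa using le_trans) (fun a b => by simpa using le_total _ _)
      (List.range S.length)
    exact this.imp (by simp)
  refine (h.and (nodup_sufArr S)).imp_of_mem ?_
  intro a b ha hb hab
  exact lt_of_le_of_ne hab.1 fun e => hab.2 (drop_injOn (mem_sufArr.1 ha) (mem_sufArr.1 hb) e)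

theorem rk_lt {S : List σ} {x : ℕ} (hx : x < S.length) : rk S x < S.length := by
  rw [← length_sufArr S]
  exact List.idxOf_lt_length_iff.2 (mem_sufArr.2 hx)

theorem getD_rk {S : List σ} {x : ℕ} (hx : x < S.length) : (sufArr S).getD (rk S x) 0 = x := by
  have h := List.idxOf_lt_length_iff.2 (mem_sufArr.2 hx)
  rw [rk, List.getD_eq_getElem _ _ h]
  exact List.getElem_idxOf h

theorem exists_rk {S : List σ} {r : ℕ} (hr : r < S.length) : ∃ x < S.length, rk S x = r := by
  have h : r < (sufArr S).length := by rwa [length_sufArr]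
  exact ⟨(sufArr S)[r], mem_sufArr.1 (List.getElem_mem h), (nodup_sufArr S).idxOf_getElem r h⟩

theorem rk_lt_rk {S : List σ} {x y : ℕ} (hx : x < S.length) (hy : y < S.length) :
    rk S x < rk S y ↔ S.drop x < S.drop y := by
  have key : ∀ {x y : ℕ}, x < S.length → y < S.length → rk S x < rk S y →
      S.drop x < S.drop y := by
    intro x y hx hy h
    have h1 := List.idxOf_lt_length_iff.2 (mem_sufArr.2 hx)
    have h2 := List.idxOf_lt_length_iff.2 (mem_sufArr.2 hy)
    have := List.pairwise_iff_getElem.1 (sufArr_pairwise S) _ _ h1 h2 h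
    simpa [List.getElem_idxOf] using this
  refine ⟨key hx hy, fun h => ?_⟩
  rcases lt_trichotomy (rk S x) (rk S y) with h' | h' | h'
  · exact h'
  · have : x = y := by rw [← getD_rk hx, h', getD_rk hy]
    subst this; exact absurd h (lt_irrefl _)
  · exact absurd h (not_lt_of_gt (key hy hx h'))

theorem rk_inj {S : List σ} {x y : ℕ} (hx : x < S.length) (hy : y < S.length)
    (h : rk S x = rk S y) : x = y := by
  rw [← getD_rk hx, h, getD_rk hy]

/-- This form of the rank does not mention the sorted list, so that ranks in S and in c :: S can be
compared. -/
theorem rk_eq_card {S : List σ} {x : ℕ} (hx : x < S.length) :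
    rk S x = ((Finset.range S.length).filter (fun y => S.drop y < S.drop x)).card := by
  have : ((Finset.range S.length).filter (fun y => S.drop y < S.drop x)).image (rk S)
      = Finset.range (rk S x) := by
    ext r
    simp only [Finset.mem_image, Finset.mem_filter, Finset.mem_range]
    constructor
    · rintro ⟨y, ⟨hy, h⟩, rfl⟩
      exact (rk_lt_rk hy hx).2 h
    · intro h
      obtain ⟨y, hy, rfl⟩ := exists_rk (h.trans (rk_lt hx))
      exact ⟨y, ⟨hy, (rk_lt_rk hy hx).1 h⟩, rfl⟩
  have h2 := congrArg Finset.card this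
  rw [Finset.card_image_of_injOn, Finset.card_range] at h2
  · exact h2.symm
  · intro a ha b hb hab
    simp only [Finset.coe_filter, Set.mem_ofPred_eq, Finset.mem_range] at ha hb
    exact rk_inj ha.1 hb.1 hab

theorem cycPred_lt {S : List σ} {x : ℕ} (hx : x < S.length) : cycPred S x < S.length :=
  Nat.mod_lt _ (by omega)

theorem cycPred_succ {S : List σ} {x : ℕ} (hx : x + 1 < S.length) : cycPred S (x + 1) = x := by
  unfold cycPred
  rw [show x + 1 + S.length - 1 = x + S.length by omega, Nat.add_mod_right,
    Nat.mod_eq_of_lt (by omega)]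

theorem cycPred_zero {S : List σ} (h : 0 < S.length) : cycPred S 0 = S.length - 1 := by
  unfold cycPred
  rw [Nat.mod_eq_of_lt (by omega)]; omega

theorem LF_rk {S : List σ} {x : ℕ} (hx : x < S.length) : LF S (rk S x) = rk S (cycPred S x) := by
  rw [LF, getD_rk hx]; rfl

variable [OrderBot σ]

theorem length_bwt (S : List σ) : (bwt S).length = S.length := by
  simp [bwt, length_sufArr]

theorem getElem?_sufArr_rk {S : List σ} {x : ℕ} (hx : x < S.length) :
    (sufArr S)[rk S x]? = some x := by
  have h : rk S x < (sufArr S).length := by rw [length_sufArr]; exact rk_lt hx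
  have := getD_rk hx
  rw [List.getD_eq_getElem _ _ h] at this
  rw [List.getElem?_eq_getElem h, this]

theorem bwt_rk {S : List σ} {x : ℕ} (hx : x < S.length) :
    (bwt S)[rk S x]? = some (S.getD (cycPred S x) ⊥) := by
  simp [bwt, getElem?_sufArr_rk hx]

theorem firstCol_rk {S : List σ} {x : ℕ} (hx : x < S.length) :
    (firstCol S).getD (rk S x) ⊥ = S.getD x ⊥ := by
  simp [firstCol, List.getD_eq_getElem?_getD, getElem?_sufArr_rk hx]

theorem firstCol_LF {S : List σ} {r : ℕ} (hr : r < S.length) :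
    (firstCol S).getD (LF S r) ⊥ = (bwt S).getD r ⊥ := by
  obtain ⟨x, hx, rfl⟩ := exists_rk hr
  rw [LF_rk hx, firstCol_rk (cycPred_lt hx), List.getD_eq_getElem?_getD (l := bwt S), bwt_rk hx]
  rfl

theorem LF_lt {S : List σ} {r : ℕ} (hr : r < S.length) : LF S r < S.length := by
  obtain ⟨x, hx, rfl⟩ := exists_rk hr
  rw [LF_rk hx]; exact rk_lt (cycPred_lt hx)

theorem cycPred_inj {S : List σ} {x y : ℕ} (hx : x < S.length) (hy : y < S.length)
    (h : cycPred S x = cycPred S y) : x = y := by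
  rcases x with _ | x <;> rcases y with _ | y
  · rfl
  · rw [cycPred_zero hx, cycPred_succ hy] at h; omega
  · rw [cycPred_zero hy, cycPred_succ hx] at h; omega
  · rw [cycPred_succ hy, cycPred_succ hx] at h; omega

theorem LF_inj {S : List σ} {r s : ℕ} (hr : r < S.length) (hs : s < S.length)
    (h : LF S r = LF S s) : r = s := by
  obtain ⟨x, hx, rfl⟩ := exists_rk hr
  obtain ⟨y, hy, rfl⟩ := exists_rk hs
  rw [LF_rk hx, LF_rk hy] at h
  rw [cycPred_inj hx hy (rk_inj (cycPred_lt hx) (cycPred_lt hy) h)]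

/-- An injective map of a finite set into itself is surjective. -/
theorem exists_LF {S : List σ} {v : ℕ} (hv : v < S.length) : ∃ r < S.length, LF S r = v := by
  have h : Set.SurjOn (LF S) (Finset.range S.length) (Finset.range S.length) := by
    apply Finset.surjOn_of_injOn_of_card_le
    · intro r hr; simp at hr ⊢; exact LF_lt hr
    · intro r hr s hs; simp at hr hs; exact LF_inj hr hs
    · rfl
  obtain ⟨r, hr, h⟩ := h (by simpa using hv : v ∈ (Finset.range S.length : Set ℕ))
  exact ⟨r, by simpa using hr, h⟩

/-- A nonempty string that ends with `$`, which occurs nowhere else. -/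
theorem IsText.getD_eq_bot_iff {S : List σ} (hS : IsText S) {x : ℕ} (hx : x < S.length) :
    S.getD x ⊥ = ⊥ ↔ x = S.length - 1 := by
  obtain ⟨w, rfl, hw⟩ := hS
  simp only [List.length_append, List.length_singleton] at hx ⊢
  rw [List.getD_eq_getElem?_getD, List.getElem?_append]
  split_ifs with h
  · rw [List.getElem?_eq_getElem h, Option.getD_some]
    constructor
    · intro e; exact absurd (e ▸ List.getElem_mem h) hw
    · intro e; omega
  · have : x = w.length := by omega
    subst this; simp

theorem IsText.length_pos {S : List σ} (hS : IsText S) : 0 < S.length := by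
  obtain ⟨w, rfl, hw⟩ := hS; simp

theorem drop_eq_getD_cons {S : List σ} {x : ℕ} (hx : x < S.length) :
    S.drop x = S.getD x ⊥ :: S.drop (x + 1) := by
  rw [List.drop_eq_getElem_cons hx, List.getD_eq_getElem _ _ hx]

theorem cons_lt_cons_iff' {a b : σ} {l l' : List σ} :
    a :: l < b :: l' ↔ a < b ∨ a = b ∧ l < l' := by
  exact List.cons_lt_cons_iff

theorem rk_last {S : List σ} (hS : IsText S) : rk S (S.length - 1) = 0 := by
  have hn := hS.length_pos
  rw [rk_eq_card (by omega), Finset.card_eq_zero, Finset.filter_eq_empty_iff]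
  intro y hy hlt
  simp only [Finset.mem_range] at hy
  have h1 : S.drop (S.length - 1) = [⊥] := by
    rw [drop_eq_getD_cons (by omega), (hS.getD_eq_bot_iff (by omega)).2 rfl,
      show S.length - 1 + 1 = S.length by omega, List.drop_length]
  rw [h1, drop_eq_getD_cons hy, cons_lt_cons_iff'] at hlt
  rcases hlt with h | ⟨h, h'⟩
  · exact not_lt_bot h
  · exact absurd h' (List.not_lt_nil _)

/-- The suffix at the predecessor of x is the BWT character of x followed by the suffix at x, so the
comparison is lexicographic: first the character, then the old rank. -/
theorem LF_lt_LF_aux {S : List σ} (hS : IsText S) {r s : ℕ} (hr : r < S.length)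
    (hs : s < S.length)
    (h : (bwt S).getD r ⊥ < (bwt S).getD s ⊥ ∨ (bwt S).getD r ⊥ = (bwt S).getD s ⊥ ∧ r < s) :
    LF S r < LF S s := by
  obtain ⟨x, hx, rfl⟩ := exists_rk hr
  obtain ⟨y, hy, rfl⟩ := exists_rk hs
  have hx' := cycPred_lt hx
  have hy' := cycPred_lt hy
  have hn := hS.length_pos
  rw [LF_rk hx, LF_rk hy, rk_lt_rk hx' hy', drop_eq_getD_cons hx', drop_eq_getD_cons hy',
    cons_lt_cons_iff']
  simp only [List.getD_eq_getElem?_getD (l := bwt S), bwt_rk hx, bwt_rk hy, Option.getD_some] at h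
  refine h.imp id fun ⟨e, h⟩ => ⟨e, ?_⟩
  -- The cyclic wrap-around needs care: a common character `⊥` forces both predecessors to be the
  -- last position, and a different common character forbids x = 0 and y = 0.
  rcases eq_or_ne (S.getD (cycPred S x) ⊥) ⊥ with hb | hb
  · have h1 := (hS.getD_eq_bot_iff hx').1 hb
    have h2 := (hS.getD_eq_bot_iff hy').1 (e ▸ hb)
    rw [cycPred_inj hx hy (h1.trans h2.symm)] at h
    exact absurd h (lt_irrefl _)
  · rcases x with _ | x
    · rw [cycPred_zero hn] at hb
      exact absurd ((hS.getD_eq_bot_iff (by omega)).2 rfl) hb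
    · rcases y with _ | y
      · rw [e, cycPred_zero hn] at hb
        exact absurd ((hS.getD_eq_bot_iff (by omega)).2 rfl) hb
      · rw [cycPred_succ hx, cycPred_succ hy]
        exact (rk_lt_rk hx hy).1 h

theorem LF_lt_LF {S : List σ} (hS : IsText S) {r s : ℕ} (hr : r < S.length) (hs : s < S.length) :
    LF S r < LF S s ↔
      (bwt S).getD r ⊥ < (bwt S).getD s ⊥ ∨ (bwt S).getD r ⊥ = (bwt S).getD s ⊥ ∧ r < s := by
  refine ⟨fun h => ?_, LF_lt_LF_aux hS hr hs⟩
  by_contra hc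
  rcases eq_or_ne r s with rfl | hne
  · exact lt_irrefl _ h
  · apply lt_asymm h
    apply LF_lt_LF_aux hS hs hr
    push Not at hc
    rcases lt_trichotomy ((bwt S).getD r ⊥) ((bwt S).getD s ⊥) with h1 | h1 | h1
    · exact absurd hc.1 (not_le_of_gt h1)
    · have := hc.2 h1
      exact Or.inr ⟨h1.symm, by omega⟩
    · exact Or.inl h1

/-- A value strictly between would come from a position whose key lies strictly between two keys
with the same character and adjacent positions. This makes F-intervals contiguous. -/
theorem LF_succ {S : List σ} (hS : IsText S) {r : ℕ} (hr : r + 1 < S.length)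
    (h : (bwt S).getD r ⊥ = (bwt S).getD (r + 1) ⊥) : LF S (r + 1) = LF S r + 1 := by
  have h1 : LF S r < LF S (r + 1) :=
    (LF_lt_LF hS (by omega) hr).2 (Or.inr ⟨h, by omega⟩)
  by_contra hne
  have h2 : LF S r + 1 < LF S (r + 1) := by omega
  obtain ⟨s, hs, hv⟩ := exists_LF (S := S) (v := LF S r + 1) (h2.trans (LF_lt hr))
  have h3 := (LF_lt_LF hS (by omega) hs).1 (by omega : LF S r < LF S s)
  have h4 := (LF_lt_LF hS hs hr).1 (by omega : LF S s < LF S (r + 1))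
  rw [← h] at h4
  rcases h3 with h3 | ⟨h3, h3'⟩ <;> rcases h4 with h4 | ⟨h4, h4'⟩
  · exact lt_asymm h3 h4
  · rw [h4] at h3; exact lt_irrefl _ h3
  · rw [h3] at h4; exact lt_irrefl _ h4
  · omega

/-- Shift of the positions that are not smaller than `q`. -/
def shift (q r : ℕ) : ℕ := if q ≤ r then r + 1 else r

theorem isText_cons {S : List σ} (hS : IsText S) {c : σ} (hc : c ≠ ⊥) : IsText (c :: S) := by
  obtain ⟨w, rfl, hw⟩ := hS
  exact ⟨c :: w, by simp, by simp [hw, hc.symm]⟩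

/-- The suffixes of c :: S are those of S and the whole string, so the number of smaller suffixes
grows by one exactly if c :: S is itself smaller. -/
theorem rk_cons_succ {S : List σ} {c : σ} {x : ℕ} (hx : x < S.length) :
    rk (c :: S) (x + 1) = shift (rk (c :: S) 0) (rk S x) := by
  have hq : rk (c :: S) 0 = ((Finset.range S.length).filter (fun y => S.drop y < c :: S)).card := by
    rw [rk_eq_card (by simp)]
    rw [List.length_cons, Finset.range_add_one', Finset.filter_insert]
    simp only [List.drop_zero, lt_self_iff_false, if_false]
    rw [Finset.filter_map, Finset.card_map]
    rfl
  have h1 : rk (c :: S) (x + 1) = (if c :: S < S.drop x then 1 else 0) + rk S x := by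
    rw [rk_eq_card (by simpa using hx), rk_eq_card hx]
    rw [List.length_cons, Finset.range_add_one', Finset.filter_insert]
    simp only [List.drop_zero, List.drop_succ_cons]
    rw [Finset.filter_map]
    split_ifs
    · rw [Finset.card_insert_of_notMem (by simp), Finset.card_map, add_comm]
      rfl
    · rw [Finset.card_map, zero_add]
      rfl
  -- The sets of smaller suffixes are nested, so the comparison of two strings is a comparison of
  -- cardinalities.
  have h2 : (c :: S < S.drop x) ↔ rk (c :: S) 0 ≤ rk S x := by
    rw [hq, rk_eq_card hx]
    constructor
    · intro h
      apply Finset.card_le_card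
      intro y
      simp only [Finset.mem_filter]
      exact fun ⟨h1, h2⟩ => ⟨h1, h2.trans h⟩
    · intro h
      by_contra hc
      have hlt : S.drop x < c :: S := by
        rcases lt_trichotomy (c :: S) (S.drop x) with h' | h' | h'
        · exact absurd h' hc
        · have := congrArg List.length h'
          simp at this; omega
        · exact h'
      apply absurd h
      rw [not_le]
      apply Finset.card_lt_card
      rw [Finset.ssubset_iff_of_subset]
      · exact ⟨x, by simp [hx, hlt], by simp⟩
      · intro y
        simp only [Finset.mem_filter]
        exact fun ⟨h1, h2⟩ => ⟨h1, h2.trans hlt⟩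
  rw [h1, shift]
  simp only [h2]
  split_ifs <;> omega

theorem rk_zero_pos {S : List σ} (hS : IsText S) {c : σ} (hc : c ≠ ⊥) : 0 < rk (c :: S) 0 := by
  rcases Nat.eq_zero_or_pos (rk (c :: S) 0) with h | h
  · have h1 := rk_last (isText_cons hS hc)
    have h2 := rk_inj (by simp) (by simp) (h1.trans h.symm)
    have := hS.length_pos
    simp only [List.length_cons] at h2; omega
  · exact h

/-- The only `$` is the last character, and its cyclic successor is position 0. -/
theorem bwt_eq_bot_iff {S : List σ} (hS : IsText S) {r : ℕ} (hr : r < S.length) :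
    (bwt S).getD r ⊥ = ⊥ ↔ r = rk S 0 := by
  obtain ⟨x, hx, rfl⟩ := exists_rk hr
  have hn := hS.length_pos
  rw [List.getD_eq_getElem?_getD (l := bwt S), bwt_rk hx, Option.getD_some,
    hS.getD_eq_bot_iff (cycPred_lt hx)]
  constructor
  · intro h
    rw [← cycPred_zero hn] at h
    rw [cycPred_inj hx hn h]
  · intro h
    rw [rk_inj hx hn h, cycPred_zero hn]

theorem LF_rk_zero {S : List σ} (hS : IsText S) : LF S (rk S 0) = 0 := by
  rw [LF_rk hS.length_pos, cycPred_zero hS.length_pos, rk_last hS]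

/-- A rank other than that of S belongs to a position x + 1, whose predecessor x does not wrap
around; both positions merely move up by one in c :: S. -/
theorem cons_step_other {S : List σ} {c : σ} {r : ℕ} (hr : r < S.length)
    (hne : r ≠ rk S 0) :
    LF (c :: S) (shift (rk (c :: S) 0) r) = shift (rk (c :: S) 0) (LF S r) ∧
    (bwt (c :: S)).getD (shift (rk (c :: S) 0) r) ⊥ = (bwt S).getD r ⊥ := by
  obtain ⟨x, hx, rfl⟩ := exists_rk hr
  rcases x with _ | x
  · exact absurd rfl hne
  · have h1 : x + 1 + 1 < (c :: S).length := by simpa using hx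
    rw [← rk_cons_succ hx, LF_rk h1, LF_rk hx, cycPred_succ h1, cycPred_succ hx,
      ← rk_cons_succ (by omega)]
    refine ⟨rfl, ?_⟩
    simp only [List.getD_eq_getElem?_getD (l := bwt _), bwt_rk h1, bwt_rk hx, Option.getD_some]
    rw [cycPred_succ h1, cycPred_succ hx]
    simp

/-- In c :: S the suffix S is preceded by the new character at position 0 instead of by the final
`$`. -/
theorem cons_step_dollar {S : List σ} (hS : IsText S) {c : σ} :
    LF (c :: S) (shift (rk (c :: S) 0) (rk S 0)) = rk (c :: S) 0 ∧
    (bwt (c :: S)).getD (shift (rk (c :: S) 0) (rk S 0)) ⊥ = c := by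
  have hn := hS.length_pos
  have h1 : 0 + 1 < (c :: S).length := by simpa using hn
  rw [← rk_cons_succ hn, LF_rk h1, cycPred_succ h1]
  refine ⟨rfl, ?_⟩
  simp only [List.getD_eq_getElem?_getD (l := bwt _), bwt_rk h1, Option.getD_some]
  rw [cycPred_succ h1]
  simp

/-- If r is the rank of x + 1, the suffix at x is compared with c :: S: first the characters, then
the suffix at x + 1 with S. This turns the insertion rank into a comparison of keys. -/
theorem LF_lt_rk_cons {S : List σ} (hS : IsText S) {c : σ} {r : ℕ} (hr : r < S.length)
    (hne : r ≠ rk S 0) :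
    LF S r < rk (c :: S) 0 ↔
      (bwt S).getD r ⊥ < c ∨ (bwt S).getD r ⊥ = c ∧ r < rk S 0 := by
  obtain ⟨x, hx, rfl⟩ := exists_rk hr
  rcases x with _ | x
  · exact absurd rfl hne
  · have hx' : x < S.length := by omega
    -- A shift at q moves no rank across q.
    have : rk S x < rk (c :: S) 0 ↔ rk (c :: S) (x + 1) < rk (c :: S) 0 := by
      rw [rk_cons_succ hx', shift]; split_ifs <;> omega
    rw [LF_rk hx, cycPred_succ hx, this, rk_lt_rk (by simpa using hx') (by simp)]
    simp only [List.getD_eq_getElem?_getD (l := bwt _), bwt_rk hx, Option.getD_some]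
    rw [cycPred_succ hx, rk_lt_rk hx hS.length_pos]
    simp only [List.drop_succ_cons, List.drop_zero]
    rw [drop_eq_getD_cons hx', cons_lt_cons_iff']

end Rank

/-! ### Starting positions as sums of lengths along a list of nodes. -/

section Offsets

/-- Sum of the lengths of the nodes that precede `a` in a list. -/
def off (len : ℕ → ℕ) : List ℕ → ℕ → ℕ
  | [], _ => 0
  | b :: l, a => if a = b then 0 else len b + off len l a

/-- Sum of the lengths of the nodes of a list. -/
def tot (len : ℕ → ℕ) : List ℕ → ℕ
  | [] => 0
  | b :: l => len b + tot len l

variable {len len' : ℕ → ℕ} {l A B : List ℕ} {a b : ℕ}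

theorem tot_append : tot len (A ++ B) = tot len A + tot len B := by
  induction A with
  | nil => simp [tot]
  | cons b A ih => simp [tot, ih, add_assoc]

theorem tot_congr (h : ∀ b ∈ l, len b = len' b) : tot len l = tot len' l := by
  induction l with
  | nil => rfl
  | cons b l ih => simp_all [tot]

theorem tot_perm (h : A.Perm B) : tot len A = tot len B := by
  induction h with
  | nil => rfl
  | cons _ _ ih => simp [tot, ih]
  | swap => simp only [tot]; omega
  | trans _ _ ih1 ih2 => exact ih1.trans ih2

theorem off_congr (h : ∀ b ∈ l, len b = len' b) : off len l a = off len' l a := by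
  induction l with
  | nil => rfl
  | cons b l ih => simp_all [off]

theorem off_append_left (h : a ∈ A) : off len (A ++ B) a = off len A a := by
  induction A with
  | nil => simp at h
  | cons b A ih =>
    simp only [List.cons_append, off]
    split_ifs with hb
    · rfl
    · rw [ih (by simpa [hb] using h)]

theorem off_append_right (h : a ∉ A) : off len (A ++ B) a = tot len A + off len B a := by
  induction A with
  | nil => simp [tot]
  | cons b A ih =>
    simp only [List.mem_cons, not_or] at h
    simp only [List.cons_append, off, tot]
    rw [if_neg h.1, ih h.2, add_assoc]

theorem off_add_le (h : a ∈ l) : off len l a + len a ≤ tot len l := by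
  induction l with
  | nil => simp at h
  | cons b l ih =>
    simp only [off, tot]
    split_ifs with hb
    · subst hb; omega
    · have := ih (by simpa [hb] using h); omega

theorem exists_off {r : ℕ} (hl : l.Nodup) (h : r < tot len l) :
    ∃ a ∈ l, off len l a ≤ r ∧ r < off len l a + len a := by
  induction l generalizing r with
  | nil => simp [tot] at h
  | cons b l ih =>
    rw [List.nodup_cons] at hl
    by_cases hr : r < len b
    · exact ⟨b, by simp, by simp [off], by simpa [off] using hr⟩
    · obtain ⟨a, ha, h1, h2⟩ := ih (r := r - len b) hl.2 (by simp only [tot] at h; omega)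
      have hne : a ≠ b := fun e => hl.1 (e ▸ ha)
      refine ⟨a, by simp [ha], ?_, ?_⟩ <;> simp only [off, if_neg hne] <;> omega

/-- Intervals laid end to end are disjoint. The index is carried along because the order maintenance
structure compares indices. -/
theorem off_trichotomy (ha : a ∈ l) (hb : b ∈ l) (hne : a ≠ b) :
    off len l a + len a ≤ off len l b ∧ l.idxOf a < l.idxOf b ∨
    off len l b + len b ≤ off len l a ∧ l.idxOf b < l.idxOf a := by
  induction l with
  | nil => simp at ha
  | cons c l ih =>
    rcases eq_or_ne a c with rfl | hac
    · left; simp [off, hne.symm, List.idxOf_cons_ne _ hne]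
    · rcases eq_or_ne b c with rfl | hbc
      · right; simp [off, hne, List.idxOf_cons_ne _ hne.symm]
      · have := ih (by simpa [hac] using ha) (by simpa [hbc] using hb)
        simp only [off, if_neg hac, if_neg hbc, List.idxOf_cons_ne _ hac.symm,
          List.idxOf_cons_ne _ hbc.symm]
        omega

theorem off_lt_iff_idxOf (hpos : ∀ a ∈ l, 0 < len a) (ha : a ∈ l) (hb : b ∈ l) :
    off len l a < off len l b ↔ l.idxOf a < l.idxOf b := by
  rcases eq_or_ne a b with rfl | hne
  · simp
  · have := off_trichotomy (len := len) ha hb hne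
    have := hpos a ha
    have := hpos b hb
    omega

theorem off_inj (hpos : ∀ a ∈ l, 0 < len a) (ha : a ∈ l) (hb : b ∈ l)
    (h : off len l a = off len l b) : a = b := by
  by_contra hne
  have := off_trichotomy (len := len) ha hb hne
  have := hpos a ha
  have := hpos b hb
  omega

/-- Two nodes whose intervals share a position are equal. -/
theorem eq_of_off_add_eq {s t : ℕ} (ha : a ∈ l) (hb : b ∈ l) (hs : s < len a) (ht : t < len b)
    (h : off len l a + s = off len l b + t) : a = b := by
  by_contra hne
  have := off_trichotomy (len := len) ha hb hne
  omega

theorem pairwise_off (hl : l.Nodup) (hpos : ∀ a ∈ l, 0 < len a) :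
    l.Pairwise (fun a b => off len l a < off len l b) := by
  rw [List.pairwise_iff_getElem]
  intro i j hi hj hij
  rw [off_lt_iff_idxOf hpos (List.getElem_mem _) (List.getElem_mem _), hl.idxOf_getElem,
    hl.idxOf_getElem]
  exact hij

/-- Intervals in the order of their starting positions that tile `[m, n)`. -/
theorem eq_off_of_tiling {s : ℕ → ℕ} {m n : ℕ}
    (hl : l.Pairwise (fun a b => s a + len a ≤ s b)) (hpos : ∀ a ∈ l, 0 < len a)
    (hm : ∀ a ∈ l, m ≤ s a) (hn : ∀ a ∈ l, s a + len a ≤ n)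
    (hcov : ∀ r, m ≤ r → r < n → ∃ a ∈ l, s a ≤ r ∧ r < s a + len a) (ha : a ∈ l) :
    s a = m + off len l a := by
  induction l generalizing m with
  | nil => simp at ha
  | cons b l ih =>
    rw [List.pairwise_cons] at hl
    -- Whichever interval contains m starts at m; were it a later one, the first interval would have
    -- to end by m without starting before m.
    have hb : s b = m := by
      have h1 := hm b (by simp)
      have h2 := hn b (by simp)
      have h3 := hpos b (by simp)
      obtain ⟨a', ha', h4, h5⟩ := hcov m le_rfl (by omega)
      have h6 := hm a' ha'
      rcases List.mem_cons.1 ha' with rfl | h7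
      · omega
      · have := hl.1 a' h7
        omega
    simp only [off]
    split_ifs with hab
    · subst hab; omega
    · rw [ih (m := m + len b) hl.2 (fun a h => hpos a (by simp [h])) _
        (fun a h => hn a (by simp [h])) _ (by simpa [hab] using ha)]
      · omega
      · intro a h
        have := hl.1 a h
        omega
      · intro r h1 h2
        obtain ⟨a', ha', h4, h5⟩ := hcov r (by omega) h2
        rcases List.mem_cons.1 ha' with rfl | h7
        · omega
        · exact ⟨a', h7, h4, h5⟩

/-- The list in which every occurrence of `j` is followed by `z`. -/
def insAfter (j z : ℕ) : List ℕ → List ℕ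
  | [] => []
  | a :: l => if a = j then j :: z :: insAfter j z l else a :: insAfter j z l

variable {j z : ℕ}

theorem insAfter_append : insAfter j z (A ++ B) = insAfter j z A ++ insAfter j z B := by
  induction A with
  | nil => rfl
  | cons a A ih => simp only [List.cons_append, insAfter, ih]; split_ifs <;> rfl

theorem insAfter_of_notMem (h : j ∉ l) : insAfter j z l = l := by
  induction l with
  | nil => rfl
  | cons a l ih =>
    simp only [List.mem_cons, not_or] at h
    simp [insAfter, Ne.symm h.1, ih h.2]

theorem insAfter_eq (hA : j ∉ A) (hB : j ∉ B) : insAfter j z (A ++ j :: B) = A ++ j :: z :: B := by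
  simp [insAfter_append, insAfter, insAfter_of_notMem hA, insAfter_of_notMem hB]

theorem insAfter_cons_of_ne (h : a ≠ j) : insAfter j z (a :: l) = a :: insAfter j z l := by
  simp [insAfter, h]

theorem mem_insAfter (h : j ∈ l) : a ∈ insAfter j z l ↔ a = z ∨ a ∈ l := by
  have key : ∀ l : List ℕ, a ∈ insAfter j z l ↔ (a = z ∧ j ∈ l) ∨ a ∈ l := by
    intro l
    induction l with
    | nil => simp [insAfter]
    | cons b l ih =>
      simp only [insAfter]
      split_ifs with hb
      · subst hb; simp [ih]; tauto
      · simp [ih, Ne.symm hb]; tauto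
  simp [key, h]

theorem insAfter_perm (hl : l.Nodup) (h : j ∈ l) : (insAfter j z l).Perm (z :: l) := by
  obtain ⟨A, B, rfl⟩ := List.append_of_mem h
  rw [List.nodup_middle, List.nodup_cons, List.mem_append, not_or] at hl
  rw [insAfter_eq hl.1.1 hl.1.2]
  have := List.perm_middle (a := z) (l₁ := A ++ [j]) (l₂ := B)
  simpa using this

section Split

variable {d e : ℕ}

/-- The two parts together are as long as the former node, so nothing else moves. -/
theorem off_insAfter (hz : z ∉ l) (hj : len j = d + e) (hzj : z ≠ j) (ha : a ≠ z) :
    off (Function.update (Function.update len z e) j d) (insAfter j z l) a = off len l a := by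
  induction l with
  | nil => rfl
  | cons b l ih =>
    simp only [List.mem_cons, not_or] at hz
    simp only [insAfter]
    split_ifs with hb
    · subst hb
      simp only [off, Function.update_self, if_neg ha, Function.update_of_ne hzj, ih hz.2, hj]
      split_ifs <;> omega
    · simp only [off, ih hz.2]
      rw [Function.update_of_ne hb, Function.update_of_ne (Ne.symm hz.1)]

theorem off_insAfter_self (hz : z ∉ l) (hjl : j ∈ l) (hzj : z ≠ j) :
    off (Function.update (Function.update len z e) j d) (insAfter j z l) z = off len l j + d := by
  induction l with
  | nil => simp at hjl
  | cons b l ih =>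
    simp only [List.mem_cons, not_or] at hz
    simp only [insAfter]
    split_ifs with hb
    · subst hb
      simp [off, hzj]
    · simp only [off, ih hz.2 (by simpa [Ne.symm hb] using hjl), if_neg hz.1, if_neg (Ne.symm hb)]
      rw [Function.update_of_ne hb, Function.update_of_ne (Ne.symm hz.1)]
      omega

theorem tot_insAfter (hz : z ∉ l) (hj : len j = d + e) (hzj : z ≠ j) :
    tot (Function.update (Function.update len z e) j d) (insAfter j z l) = tot len l := by
  induction l with
  | nil => rfl
  | cons b l ih =>
    simp only [List.mem_cons, not_or] at hz
    simp only [insAfter]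
    split_ifs with hb
    · subst hb
      simp only [tot, Function.update_self, Function.update_of_ne hzj, ih hz.2, hj]
      omega
    · simp only [tot, ih hz.2]
      rw [Function.update_of_ne hb, Function.update_of_ne (Ne.symm hz.1)]

end Split

end Offsets

/-! ### Node lists that describe a DBWT, and the effect of a split and of a new first character on
them. -/

section Layout

variable {σ : Type} [LinearOrder σ] [OrderBot σ]

/-- The nodes in the lists `U` and `V`, with the labels `ch` and `len`, are the DBWT-repetitions and the
F-intervals of a DBWT of `S`. -/
structure Layout (S : List σ) (U V : List ℕ) (ch : ℕ → σ) (len : ℕ → ℕ) : Prop where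
  nodupU : U.Nodup
  perm : V.Perm U
  pos : ∀ a ∈ U, 0 < len a
  total : tot len U = S.length
  bwt : ∀ a ∈ U, ∀ t < len a, (bwt S).getD (off len U a + t) ⊥ = ch a
  LF : ∀ a ∈ U, ∀ t < len a, LF S (off len U a + t) = off len V a + t

namespace Layout

variable {S : List σ} {U V : List ℕ} {ch : ℕ → σ} {len : ℕ → ℕ}

theorem nodupV (h : Layout S U V ch len) : V.Nodup := h.perm.nodup_iff.2 h.nodupU

theorem posV (h : Layout S U V ch len) : ∀ a ∈ V, 0 < len a :=
  fun a ha => h.pos a (h.perm.mem_iff.1 ha)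

theorem totalV (h : Layout S U V ch len) : tot len V = S.length :=
  (tot_perm h.perm).trans h.total

theorem off_lt (h : Layout S U V ch len) {a t : ℕ} (ha : a ∈ U) (ht : t < len a) :
    off len U a + t < S.length := by
  have := off_add_le (len := len) ha
  rw [h.total] at this; omega

theorem bwt' (h : Layout S U V ch len) {a : ℕ} (ha : a ∈ U) :
    (RComp.bwt S).getD (off len U a) ⊥ = ch a := by
  simpa using h.bwt a ha 0 (h.pos a ha)

theorem LF' (h : Layout S U V ch len) {a : ℕ} (ha : a ∈ U) :
    RComp.LF S (off len U a) = off len V a := by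
  simpa using h.LF a ha 0 (h.pos a ha)

/-- The order of the F-intervals is the order of the keys. -/
theorem off_lt_off (h : Layout S U V ch len) (hS : IsText S) {a b : ℕ} (ha : a ∈ U) (hb : b ∈ U) :
    off len V a < off len V b ↔
      ch a < ch b ∨ ch a = ch b ∧ off len U a < off len U b := by
  rw [← h.LF' ha, ← h.LF' hb,
    LF_lt_LF hS (by simpa using h.off_lt ha (h.pos a ha)) (by simpa using h.off_lt hb (h.pos b hb)),
    h.bwt' ha, h.bwt' hb]

theorem exists_dollar (h : Layout S U V ch len) (hS : IsText S) : ∃ i ∈ U, ch i = ⊥ := by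
  obtain ⟨a, ha, h1, h2⟩ := exists_off h.nodupU (by rw [h.total]; exact rk_lt hS.length_pos)
  refine ⟨a, ha, ?_⟩
  rw [← h.bwt a ha (rk S 0 - off len U a) (by omega),
    show off len U a + (rk S 0 - off len U a) = rk S 0 by omega]
  exact (bwt_eq_bot_iff hS (rk_lt hS.length_pos)).2 rfl

/-- Every position of the repetition is the unique position of `$` in the BWT, so there is only one;
LF sends it to 0. -/
theorem off_dollar (h : Layout S U V ch len) (hS : IsText S) {i : ℕ} (hi : i ∈ U) (hc : ch i = ⊥) :
    off len U i = rk S 0 ∧ len i = 1 ∧ off len V i = 0 := by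
  have key : ∀ t < len i, off len U i + t = rk S 0 := fun t ht => by
    rw [← bwt_eq_bot_iff hS (h.off_lt hi ht), h.bwt i hi t ht, hc]
  have h0 := key 0 (h.pos i hi)
  refine ⟨by simpa using h0, ?_, ?_⟩
  · by_contra hne
    have := h.pos i hi
    have := key 1 (by omega)
    omega
  · rw [← h.LF' hi, show off len U i = rk S 0 by simpa using h0, LF_rk_zero hS]

theorem dollar_unique (h : Layout S U V ch len) (hS : IsText S) {i i' : ℕ} (hi : i ∈ U)
    (hc : ch i = ⊥) (hi' : i' ∈ U) (hc' : ch i' = ⊥) : i = i' :=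
  off_inj h.pos hi hi' ((h.off_dollar hS hi hc).1.trans (h.off_dollar hS hi' hc').1.symm)

theorem split (h : Layout S U V ch len) {j z d e : ℕ} (hj : j ∈ U) (hz : z ∉ U)
    (hlen : len j = d + e) (hd : 0 < d) (he : 0 < e) :
    Layout S (insAfter j z U) (insAfter j z V) (Function.update ch z (ch j))
      (Function.update (Function.update len z e) j d) := by
  have hjV : j ∈ V := h.perm.mem_iff.2 hj
  have hzV : z ∉ V := fun h' => hz (h.perm.mem_iff.1 h')
  have hzj : z ≠ j := fun e => hz (e ▸ hj)
  refine ⟨?_, ?_, ?_, ?_, ?_, ?_⟩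
  · rw [(insAfter_perm h.nodupU hj).nodup_iff]; exact List.nodup_cons.2 ⟨hz, h.nodupU⟩
  · exact (insAfter_perm h.nodupV hjV).trans ((h.perm.cons z).trans
      (insAfter_perm h.nodupU hj).symm)
  · intro a ha
    rw [mem_insAfter hj] at ha
    rcases eq_or_ne a j with rfl | haj
    · simpa using hd
    · rw [Function.update_of_ne haj]
      rcases eq_or_ne a z with rfl | haz
      · simpa using he
      · rw [Function.update_of_ne haz]; exact h.pos a (ha.resolve_left haz)
  · rw [tot_insAfter hz hlen hzj, h.total]
  · intro a ha t ht
    rw [mem_insAfter hj] at ha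
    rcases eq_or_ne a z with rfl | haz
    · rw [off_insAfter_self hz hj hzj, Function.update_self, add_assoc]
      rw [Function.update_of_ne hzj, Function.update_self] at ht
      exact h.bwt j hj (d + t) (by omega)
    · rw [off_insAfter hz hlen hzj haz, Function.update_of_ne haz]
      apply h.bwt a (ha.resolve_left haz) t
      rcases eq_or_ne a j with rfl | haj
      · rw [Function.update_self] at ht; omega
      · rwa [Function.update_of_ne haj, Function.update_of_ne haz] at ht
  · intro a ha t ht
    rw [mem_insAfter hj] at ha
    rcases eq_or_ne a z with rfl | haz
    · rw [off_insAfter_self hz hj hzj, off_insAfter_self hzV hjV hzj, add_assoc, add_assoc]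
      rw [Function.update_of_ne hzj, Function.update_self] at ht
      exact h.LF j hj (d + t) (by omega)
    · rw [off_insAfter hz hlen hzj haz, off_insAfter hzV hlen hzj haz]
      apply h.LF a (ha.resolve_left haz) t
      rcases eq_or_ne a j with rfl | haj
      · rw [Function.update_self] at ht; omega
      · rwa [Function.update_of_ne haj, Function.update_of_ne haz] at ht

end Layout

variable {len : ℕ → ℕ} {A B P G : List ℕ} {i x q y : ℕ}

/-- Since A ends exactly at q, the nodes of A start before q and those of B at or after q. -/
theorem off_insert_of_mem (hx : x ∉ A ++ B) (hA : tot len A = q)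
    (hpos : ∀ a ∈ A ++ B, 0 < len a) (hy : y ∈ A ++ B) :
    off (Function.update len x 1) (A ++ x :: B) y = shift q (off len (A ++ B) y) := by
  have hA' : ∀ b ∈ A, Function.update len x 1 b = len b := fun b hb =>
    Function.update_of_ne (by rintro rfl; simp [hb] at hx) _ _
  have hB' : ∀ b ∈ B, Function.update len x 1 b = len b := fun b hb =>
    Function.update_of_ne (by rintro rfl; simp [hb] at hx) _ _
  by_cases h : y ∈ A
  · rw [off_append_left h, off_append_left h, off_congr hA', shift, if_neg]
    have := off_add_le (len := len) h
    have := hpos y hy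
    omega
  · have hyx : y ≠ x := by rintro rfl; exact hx hy
    rw [off_append_right h, off_append_right h, off, if_neg hyx, off_congr hB', tot_congr hA',
      Function.update_self, shift, if_pos (by omega)]
    omega

theorem off_insert_self (hx : x ∉ A ++ B) (hA : tot len A = q) :
    off (Function.update len x 1) (A ++ x :: B) x = q := by
  have hA' : ∀ b ∈ A, Function.update len x 1 b = len b := fun b hb =>
    Function.update_of_ne (by rintro rfl; simp [hb] at hx) _ _
  rw [off_append_right (fun h => hx (by simp [h])), tot_congr hA', hA]
  simp [off]

/-- A string gets a new first character `c`: the node of `$` becomes a node of `c`, and a new node of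
`$` is inserted into `U` at the position where the F-interval of the former is inserted into `V`. -/
theorem Layout.cons {S : List σ} {ch : ℕ → σ} {c : σ} (hS : IsText S) (hc : c ≠ ⊥)
    (h : Layout S (A ++ B) (i :: (P ++ G)) ch len) (hi : ch i = ⊥) (hx : x ∉ A ++ B)
    (hA : tot len A = rk (c :: S) 0) (hP : tot len (i :: P) = rk (c :: S) 0) :
    (Layout (c :: S) (A ++ x :: B) (x :: (P ++ i :: G))
      (Function.update (Function.update ch x ⊥) i c) (Function.update len x 1)) ∧
    (∀ y ∈ A ++ B, off (Function.update len x 1) (A ++ x :: B) y =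
      shift (rk (c :: S) 0) (off len (A ++ B) y)) ∧
    off (Function.update len x 1) (A ++ x :: B) x = rk (c :: S) 0 ∧
    (∀ y ∈ A ++ B, y ≠ i → off (Function.update len x 1) (x :: (P ++ i :: G)) y =
      shift (rk (c :: S) 0) (off len (i :: (P ++ G)) y)) ∧
    off (Function.update len x 1) (x :: (P ++ i :: G)) i = rk (c :: S) 0 ∧
    off (Function.update len x 1) (x :: (P ++ i :: G)) x = 0 := by
  have hiU : i ∈ A ++ B := h.perm.mem_iff.1 (by simp)
  have hlen := (h.off_dollar hS hiU hi).2.1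
  have hxi : x ≠ i := by rintro rfl; exact hx hiU
  have hxV : x ∉ i :: (P ++ G) := fun h' => hx (h.perm.mem_iff.1 h')
  have hu : ∀ b, b ≠ x → Function.update len x 1 b = len b := fun b hb =>
    Function.update_of_ne hb _ _
  have hnd := h.nodupV
  rw [List.nodup_cons] at hnd
  have hiP : i ∉ P := fun h => hnd.1 (by simp [h])
  have hiG : i ∉ G := fun h => hnd.1 (by simp [h])
  have hP' : tot (Function.update len x 1) P = tot len P :=
    tot_congr fun b hb => hu b (by rintro rfl; simp [hb] at hxV)
  have e1 : ∀ y ∈ A ++ B, off (Function.update len x 1) (A ++ x :: B) y =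
      shift (rk (c :: S) 0) (off len (A ++ B) y) := fun y hy =>
    off_insert_of_mem hx hA h.pos hy
  have e2 : off (Function.update len x 1) (A ++ x :: B) x = rk (c :: S) 0 := off_insert_self hx hA
  have e3 : ∀ y ∈ A ++ B, y ≠ i → off (Function.update len x 1) (x :: (P ++ i :: G)) y =
      shift (rk (c :: S) 0) (off len (i :: (P ++ G)) y) := by
    intro y hy hyi
    have hyx : y ≠ x := by rintro rfl; exact hx hy
    have hyV : y ∈ i :: (P ++ G) := h.perm.mem_iff.2 hy
    by_cases hyP : y ∈ P
    · have := off_add_le (len := len) hyP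
      have := h.pos y hy
      simp only [off, if_neg hyx, if_neg hyi, Function.update_self, hlen]
      simp only [tot, hlen] at hP
      rw [off_append_left hyP, off_append_left hyP, shift, if_neg (by omega),
        off_congr fun b hb => hu b (by rintro rfl; simp [hb] at hxV)]
    · simp only [off, if_neg hyx, if_neg hyi, Function.update_self, hlen]
      simp only [tot, hlen] at hP
      rw [off_append_right hyP, off_append_right hyP, shift, if_pos (by omega)]
      simp only [off, if_neg hyi, hu i hxi.symm, hlen]
      rw [off_congr fun b hb => hu b (by rintro rfl; simp [hb] at hxV), hP']
      omega
  have e4 : off (Function.update len x 1) (x :: (P ++ i :: G)) i = rk (c :: S) 0 := by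
    simp only [off, if_neg hxi.symm, Function.update_self]
    simp only [tot, hlen] at hP
    rw [off_append_right hiP, hP']
    simp only [off, if_true]
    omega
  have e5 : off (Function.update len x 1) (x :: (P ++ i :: G)) x = 0 := by simp [off]
  refine ⟨⟨?_, ?_, ?_, ?_, ?_, ?_⟩, e1, e2, e3, e4, e5⟩
  · rw [List.nodup_middle]; exact List.nodup_cons.2 ⟨hx, h.nodupU⟩
  · have p1 : (x :: (P ++ i :: G)).Perm (x :: (i :: (P ++ G))) := List.perm_middle.cons x
    exact p1.trans ((h.perm.cons x).trans List.perm_middle.symm)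
  · intro a ha
    rcases eq_or_ne a x with rfl | hax
    · simp
    · rw [hu a hax]; exact h.pos a (by simpa [hax] using ha)
  · have := tot_perm (len := Function.update len x 1) (List.perm_middle (a := x) (l₁ := A) (l₂ := B))
    rw [this, tot, Function.update_self, tot_congr fun b hb => hu b (by rintro rfl; exact hx hb),
      h.total, List.length_cons, add_comm]
  · intro a ha t ht
    rcases eq_or_ne a x with rfl | hax
    · simp only [Function.update_self, Nat.lt_one_iff] at ht
      subst ht
      rw [e2, Function.update_of_ne hxi, Function.update_self, add_zero, bwt_eq_bot_iff
        (isText_cons hS hc) (rk_lt (by simp))]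
    · have haU : a ∈ A ++ B := by simpa [hax] using ha
      rw [hu a hax] at ht
      rw [e1 a haU]
      -- The list A ends at q, so no repetition straddles q and a whole repetition moves as a block.
      have hs : shift (rk (c :: S) 0) (off len (A ++ B) a) + t =
          shift (rk (c :: S) 0) (off len (A ++ B) a + t) := by
        by_cases haA : a ∈ A
        · have := off_add_le (len := len) haA
          rw [off_append_left haA]
          unfold shift; split_ifs <;> omega
        · rw [off_append_right haA]
          unfold shift; split_ifs <;> omega
      rw [hs]
      by_cases hai : a = i
      · subst hai
        have : t = 0 := by omega
        subst this
        rw [add_zero, Function.update_self, (h.off_dollar hS hiU hi).1, (cons_step_dollar hS).2]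
      · rw [(cons_step_other (h.off_lt haU ht) _).2, h.bwt a haU t ht, Function.update_of_ne hai,
          Function.update_of_ne hax]
        intro e
        rw [← bwt_eq_bot_iff hS (h.off_lt haU ht), h.bwt a haU t ht] at e
        exact hai (h.dollar_unique hS haU e hiU hi)
  · intro a ha t ht
    rcases eq_or_ne a x with rfl | hax
    · simp only [Function.update_self, Nat.lt_one_iff] at ht
      subst ht
      have h2 : (RComp.bwt (c :: S)).getD (rk (c :: S) 0) ⊥ = ⊥ :=
        (bwt_eq_bot_iff (isText_cons hS hc) (rk_lt (by simp))).2 rfl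
      rw [e2, e5, add_zero, LF_rk_zero (isText_cons hS hc)]
    · have haU : a ∈ A ++ B := by simpa [hax] using ha
      rw [hu a hax] at ht
      rw [e1 a haU]
      have hs : shift (rk (c :: S) 0) (off len (A ++ B) a) + t =
          shift (rk (c :: S) 0) (off len (A ++ B) a + t) := by
        by_cases haA : a ∈ A
        · have := off_add_le (len := len) haA
          rw [off_append_left haA]
          unfold shift; split_ifs <;> omega
        · rw [off_append_right haA]
          unfold shift; split_ifs <;> omega
      rw [hs]
      by_cases hai : a = i
      · subst hai
        have : t = 0 := by omega
        subst this
        rw [add_zero, (h.off_dollar hS hiU hi).1, (cons_step_dollar hS).1, e4, add_zero]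
      · have hne : off len (A ++ B) a + t ≠ rk S 0 := by
          intro e
          rw [← bwt_eq_bot_iff hS (h.off_lt haU ht), h.bwt a haU t ht] at e
          exact hai (h.dollar_unique hS haU e hiU hi)
        rw [(cons_step_other (h.off_lt haU ht) hne).1, h.LF a haU t ht, e3 a haU hai]
        have haV := h.perm.mem_iff.2 haU
        -- The same for F-intervals: the nodes of i :: P fill the positions below q exactly.
        by_cases haP : a ∈ i :: P
        · have := off_add_le (len := len) haP
          rw [← List.cons_append, off_append_left haP]
          unfold shift; split_ifs <;> omega
        · rw [← List.cons_append, off_append_right haP]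
          unfold shift; split_ifs <;> omega

end Layout

/-! ### Execution of the elementary operations on states with separate arrays. -/

/-- A machine state with one array for each field of the cells. -/
structure St (σ : Type) where
  ch : ℕ → σ
  len : ℕ → ℕ
  uPrev : ℕ → Option ℕ
  uNext : ℕ → Option ℕ
  vPrev : ℕ → Option ℕ
  vNext : ℕ → Option ℕ
  eL : ℕ → ℕ
  bL : ℕ → ℕ
  eF : ℕ → ℕ
  bF : ℕ → ℕ
  inU : ℕ → Option ℕ
  inV : ℕ → Option ℕ
  fresh : ℕ
  dollar : ℕ
  uHead : Option ℕ
  uTail : Option ℕ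
  vHead : Option ℕ
  vTail : Option ℕ
  order : List ℕ
  heavyU : List ℕ
  heavyV : List ℕ
  btree : BTree
  steps : ℕ


section States

variable {σ β γ : Type}

def St.get (s : St σ) (x : ℕ) : Cell σ :=
  ⟨s.ch x, s.len x, s.uPrev x, s.uNext x, s.vPrev x, s.vNext x, s.eL x, s.bL x, s.eF x, s.bF x,
    s.inU x, s.inV x⟩

def St.toM (s : St σ) : Machine σ :=
  ⟨s.get, s.fresh, s.dollar, s.uHead, s.uTail, s.vHead, s.vTail, s.order, s.heavyU, s.heavyV,
    s.btree, s.steps⟩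

def St.ofM (m : Machine σ) : St σ :=
  ⟨fun x => (m.cell x).ch, fun x => (m.cell x).len, fun x => (m.cell x).uPrev,
    fun x => (m.cell x).uNext, fun x => (m.cell x).vPrev, fun x => (m.cell x).vNext,
    fun x => (m.cell x).eL, fun x => (m.cell x).bL, fun x => (m.cell x).eF, fun x => (m.cell x).bF,
    fun x => (m.cell x).inU, fun x => (m.cell x).inV, m.fresh, m.dollar, m.uHead, m.uTail, m.vHead,
    m.vTail, m.order, m.heavyU, m.heavyV, m.btree, m.steps⟩

theorem St.toM_ofM (m : Machine σ) : (St.ofM m).toM = m := rfl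

/-- The result and the final state of a program. -/
def ex (p : Prog σ β) (m : Machine σ) : β × Machine σ := p.run m

theorem ex_bind (p : Prog σ β) (f : β → Prog σ γ) (m : Machine σ) :
    ex (p >>= f) m = ex (f (ex p m).1) (ex p m).2 := rfl

theorem ex_pure (b : β) (m : Machine σ) : ex (pure b : Prog σ β) m = (b, m) := rfl

theorem ex_map (p : Prog σ β) (f : β → γ) (m : Machine σ) :
    ex (f <$> p) m = (f (ex p m).1, (ex p m).2) := rfl

theorem ex_readCell (x : ℕ) (s : St σ) :
    ex (readCell x) s.toM = (s.get x, ({s with steps := s.steps + 1} : St σ).toM) := rfl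

theorem St.get_update (s : St σ) (x : ℕ) (c : Cell σ) :
    Function.update s.get x c = St.get {s with
      ch := Function.update s.ch x c.ch, len := Function.update s.len x c.len,
      uPrev := Function.update s.uPrev x c.uPrev, uNext := Function.update s.uNext x c.uNext,
      vPrev := Function.update s.vPrev x c.vPrev, vNext := Function.update s.vNext x c.vNext,
      eL := Function.update s.eL x c.eL, bL := Function.update s.bL x c.bL,
      eF := Function.update s.eF x c.eF, bF := Function.update s.bF x c.bF,
      inU := Function.update s.inU x c.inU, inV := Function.update s.inV x c.inV} := by
  funext y
  rcases eq_or_ne y x with rfl | h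
  · simp [St.get]
  · simp [St.get, h]

theorem ex_updateCell (x : ℕ) (f : Cell σ → Cell σ) (s : St σ) :
    ex (updateCell x f) s.toM = ((), ({s with
      ch := Function.update s.ch x (f (s.get x)).ch,
      len := Function.update s.len x (f (s.get x)).len,
      uPrev := Function.update s.uPrev x (f (s.get x)).uPrev,
      uNext := Function.update s.uNext x (f (s.get x)).uNext,
      vPrev := Function.update s.vPrev x (f (s.get x)).vPrev,
      vNext := Function.update s.vNext x (f (s.get x)).vNext,
      eL := Function.update s.eL x (f (s.get x)).eL,
      bL := Function.update s.bL x (f (s.get x)).bL,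
      eF := Function.update s.eF x (f (s.get x)).eF,
      bF := Function.update s.bF x (f (s.get x)).bF,
      inU := Function.update s.inU x (f (s.get x)).inU,
      inV := Function.update s.inV x (f (s.get x)).inV,
      steps := s.steps + 1} : St σ).toM) := by
  have := s.get_update x (f (s.get x))
  change ((), (⟨Function.update s.get x (f (s.get x)), _, _, _, _, _, _, _, _, _, _, _⟩ :
    Machine σ)) = _
  rw [this]; rfl

theorem ex_allocCell (c : Cell σ) (s : St σ) :
    ex (allocCell c) s.toM = (s.fresh, ({s with
      ch := Function.update s.ch s.fresh c.ch, len := Function.update s.len s.fresh c.len,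
      uPrev := Function.update s.uPrev s.fresh c.uPrev,
      uNext := Function.update s.uNext s.fresh c.uNext,
      vPrev := Function.update s.vPrev s.fresh c.vPrev,
      vNext := Function.update s.vNext s.fresh c.vNext,
      eL := Function.update s.eL s.fresh c.eL, bL := Function.update s.bL s.fresh c.bL,
      eF := Function.update s.eF s.fresh c.eF, bF := Function.update s.bF s.fresh c.bF,
      inU := Function.update s.inU s.fresh c.inU, inV := Function.update s.inV s.fresh c.inV,
      fresh := s.fresh + 1, steps := s.steps + 1} : St σ).toM) := by
  have := s.get_update s.fresh c
  change (s.fresh, (⟨Function.update s.get s.fresh c, _, _, _, _, _, _, _, _, _, _, _⟩ :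
    Machine σ)) = _
  rw [this]; rfl

theorem ex_setDollar (x : ℕ) (s : St σ) : ex (setDollar x) s.toM =
    ((), ({s with dollar := x, steps := s.steps + 1} : St σ).toM) := rfl

theorem ex_setUTail (x : Option ℕ) (s : St σ) : ex (setUTail x) s.toM =
    ((), ({s with uTail := x, steps := s.steps + 1} : St σ).toM) := rfl

theorem ex_setVHead (x : Option ℕ) (s : St σ) : ex (setVHead x) s.toM =
    ((), ({s with vHead := x, steps := s.steps + 1} : St σ).toM) := rfl

theorem ex_setVTail (x : Option ℕ) (s : St σ) : ex (setVTail x) s.toM =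
    ((), ({s with vTail := x, steps := s.steps + 1} : St σ).toM) := rfl

theorem ex_setBTree (t : BTree) (s : St σ) : ex (setBTree t) s.toM =
    ((), ({s with btree := t, steps := s.steps + 1} : St σ).toM) := rfl

theorem ex_pushHeavyU (x : ℕ) (s : St σ) : ex (pushHeavyU x) s.toM =
    ((), ({s with heavyU := x :: s.heavyU, steps := s.steps + 1} : St σ).toM) := rfl

theorem ex_pushHeavyV (x : ℕ) (s : St σ) : ex (pushHeavyV x) s.toM =
    ((), ({s with heavyV := x :: s.heavyV, steps := s.steps + 1} : St σ).toM) := rfl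

theorem ex_precedes (τ x y : ℕ) (s : St σ) : ex (precedes τ x y) s.toM =
    (decide (s.order.idxOf x < s.order.idxOf y), ({s with steps := s.steps + τ} : St σ).toM) := rfl

theorem ex_orderInsertAfter (τ x y : ℕ) (s : St σ) : ex (orderInsertAfter τ x y) s.toM =
    ((), ({s with
      steps := s.steps + τ,
      order := s.order.insertIdx (s.order.idxOf y + 1) x} : St σ).toM) := rfl

/-- Write `v` at the address `n`, if it exists. -/
def setAt {β : Type} (f : ℕ → β) (n : Option ℕ) (v : β) : ℕ → β :=
  n.elim f (fun w => Function.update f w v)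

/-- Both branches, with and without a successor of y, take four steps, so the cost needs no case
distinction. -/
theorem ex_linkUAfter {x y : ℕ} (s : St σ) : ex (linkUAfter x y) s.toM = ((), ({s with
      uPrev := setAt (Function.update s.uPrev x (some y)) (s.uNext y) (some x),
      uNext := Function.update (Function.update s.uNext x (s.uNext y)) y (some x),
      uTail := (s.uNext y).elim (some x) (fun _ => s.uTail),
      steps := s.steps + 4} : St σ).toM) := by
  unfold linkUAfter
  rcases h : s.uNext y with _ | w <;>
  simp [ex_bind, ex_readCell, ex_updateCell, St.get, ex_setUTail, setAt, h]

theorem ex_linkVAfter {x y : ℕ} (s : St σ) : ex (linkVAfter x y) s.toM = ((), ({s with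
      vPrev := setAt (Function.update s.vPrev x (some y)) (s.vNext y) (some x),
      vNext := Function.update (Function.update s.vNext x (s.vNext y)) y (some x),
      vTail := (s.vNext y).elim (some x) (fun _ => s.vTail),
      steps := s.steps + 4} : St σ).toM) := by
  unfold linkVAfter
  rcases h : s.vNext y with _ | w <;>
  simp [ex_bind, ex_readCell, ex_updateCell, St.get, ex_setVTail, setAt, h]

end States

/-! ### Doubly linked lists as two singly linked ones. -/

section LinkedLists

/-- Along the list `l`, each node points to the next one, and the last one to `n`. -/
def SegTo (next : ℕ → Option ℕ) : List ℕ → Option ℕ → Prop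
  | [], _ => True
  | a :: l, n => next a = (l.head? <|> n) ∧ SegTo next l n

variable {next next' prev : ℕ → Option ℕ} {A B l : List ℕ} {n : Option ℕ}

theorem segTo_append : SegTo next (A ++ B) n ↔ SegTo next A (B.head? <|> n) ∧ SegTo next B n := by
  induction A with
  | nil => simp [SegTo]
  | cons a A ih =>
    simp only [List.cons_append, SegTo, ih, and_assoc]
    cases A <;> simp

theorem SegTo.congr (h : SegTo next l n) (h' : ∀ a ∈ l, next' a = next a) : SegTo next' l n := by
  induction l with
  | nil => trivial
  | cons a l ih =>
    exact ⟨(h' a (by simp)).trans h.1, ih h.2 fun b hb => h' b (by simp [hb])⟩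

theorem segTo_iff_getElem : SegTo next l none ↔
    ∀ (t : ℕ) (h : t < l.length), next l[t] = l[t + 1]? := by
  induction l with
  | nil => simp [SegTo]
  | cons a l ih =>
    simp only [SegTo, ih]
    constructor
    · rintro ⟨h1, h2⟩ t ht
      rcases t with _ | t
      · simpa [List.head?_eq_getElem?] using h1
      · simpa using h2 t (by simpa using ht)
    · intro h
      refine ⟨?_, fun t ht => ?_⟩
      · have := h 0 (by simp)
        simp only [List.getElem_cons_zero] at this
        simpa [List.head?_eq_getElem?] using this
      · have := h (t + 1) (by simpa using ht)
        simp only [List.getElem_cons_succ] at this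
        simpa using this

/-- A doubly linked list, described by two singly linked ones. -/
def DLL (prev next : ℕ → Option ℕ) (head tail : Option ℕ) (l : List ℕ) : Prop :=
  head = l.head? ∧ tail = l.getLast? ∧ SegTo next l none ∧ SegTo prev l.reverse none

/-- Backward pointers along a list are forward pointers along its reverse; the form without indices
supports induction and concatenation. -/
theorem isLinkedList_iff {head tail : Option ℕ} :
    IsLinkedList prev next head tail l ↔ DLL prev next head tail l := by
  unfold IsLinkedList DLL
  refine and_congr_right fun _ => and_congr_right fun _ => ?_
  rw [segTo_iff_getElem, segTo_iff_getElem]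
  constructor
  · intro h
    refine ⟨fun t ht => (h t ht).1, fun t ht => ?_⟩
    rw [List.length_reverse] at ht
    rw [List.getElem_reverse, (h (l.length - 1 - t) (by omega)).2]
    split_ifs with h0
    · rw [eq_comm, List.getElem?_eq_none_iff, List.length_reverse]; omega
    · rw [List.getElem?_reverse (by omega)]
      congr 1
  · rintro ⟨h1, h2⟩ t ht
    refine ⟨h1 t ht, ?_⟩
    have := h2 (l.length - 1 - t) (by rw [List.length_reverse]; omega)
    rw [List.getElem_reverse] at this
    simp only [show l.length - 1 - (l.length - 1 - t) = t by omega] at this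
    rw [this]
    split_ifs with h0
    · rw [List.getElem?_eq_none_iff, List.length_reverse]; omega
    · rw [List.getElem?_reverse (by omega)]
      congr 1; omega

theorem DLL.next_eq {head tail : Option ℕ} {y : ℕ} (h : DLL prev next head tail (A ++ y :: B)) :
    next y = B.head? := by
  have := (segTo_append.1 h.2.2.1).2.1
  simpa using this

theorem DLL.prev_eq {head tail : Option ℕ} {y : ℕ} (h : DLL prev next head tail (A ++ y :: B)) :
    prev y = A.getLast? := by
  have := h.2.2.2
  rw [List.reverse_append, List.reverse_cons, List.append_assoc, segTo_append, List.singleton_append]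
    at this
  simpa using this.2.1

/-- The arrays in the conclusion are literally those that `ex_linkUAfter` and `ex_linkVAfter` leave
behind. -/
theorem DLL.insert {head tail : Option ℕ} {x y : ℕ} (h : DLL prev next head tail (A ++ y :: B))
    (hnd : (A ++ y :: B).Nodup) (hx : x ∉ A ++ y :: B) :
    DLL (setAt (Function.update prev x (some y)) (next y) (some x))
      (Function.update (Function.update next x (next y)) y (some x)) head
      ((next y).elim (some x) (fun _ => tail)) (A ++ y :: x :: B) := by
  have hn := h.next_eq
  obtain ⟨h1, h2, h3, h4⟩ := h
  have hnd' := hnd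
  rw [List.nodup_middle, List.nodup_cons, List.mem_append, not_or] at hnd
  obtain ⟨⟨hyA, hyB⟩, hnd⟩ := hnd
  rw [List.mem_append, List.mem_cons, not_or, not_or] at hx
  obtain ⟨hxA, hxy, hxB⟩ := hx
  refine ⟨?_, ?_, ?_, ?_⟩
  · rw [h1]; cases A <;> simp
  · rw [hn, h2]; cases B <;> simp
  · rw [segTo_append] at h3 ⊢
    refine ⟨?_, ?_, ?_, ?_⟩
    · refine SegTo.congr h3.1 fun a ha => ?_
      rw [Function.update_of_ne (by rintro rfl; exact hyA ha),
        Function.update_of_ne (by rintro rfl; exact hxA ha)]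
    · simp
    · simp [Function.update_of_ne hxy, hn]
    · refine SegTo.congr h3.2.2 fun a ha => ?_
      rw [Function.update_of_ne (by rintro rfl; exact hyB ha),
        Function.update_of_ne (by rintro rfl; exact hxB ha)]
  · rw [hn]
    rcases B with _ | ⟨w, B⟩
    · simp only [List.head?_nil, setAt, Option.elim, List.reverse_append, List.reverse_cons,
        List.reverse_nil, List.nil_append,
        List.cons_append] at h4 ⊢
      refine ⟨by simp, ?_⟩
      refine SegTo.congr h4 fun a ha => ?_
      rw [Function.update_of_ne]
      rintro rfl
      simp at ha; tauto
    · simp only [List.mem_cons, not_or] at hyB hxB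
      simp only [List.head?_cons, setAt, Option.elim, List.reverse_append, List.reverse_cons,
        List.append_assoc, List.cons_append, List.nil_append] at h4 ⊢
      rw [segTo_append] at h4 ⊢
      have hwB : w ∉ B := by
        intro hw; rw [List.nodup_append] at hnd; simp [hw] at hnd
      have hwA : w ∉ A := by
        intro hw; rw [List.nodup_append] at hnd; exact hnd.2.2 w hw w (by simp) rfl
      refine ⟨?_, ?_, ?_, ?_⟩
      · refine SegTo.congr h4.1 fun a ha => ?_
        simp only [List.mem_reverse] at ha
        rw [Function.update_of_ne (by rintro rfl; exact hwB ha),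
          Function.update_of_ne (by rintro rfl; exact hxB.2 ha)]
      · simp
      · rw [Function.update_of_ne hxB.1]; simp
      · refine SegTo.congr h4.2.2 fun a ha => ?_
        simp only [List.mem_cons, List.mem_reverse] at ha
        rw [Function.update_of_ne, Function.update_of_ne]
        · rintro rfl; tauto
        · rintro rfl; rcases ha with ha | ha
          · exact hyB.1 ha.symm
          · exact hwA ha

/-- The first node of a doubly linked list is replaced by a new one. -/
theorem DLL.replace_head {head tail : Option ℕ} {i x : ℕ} {l : List ℕ}
    (h : DLL prev next head tail (i :: l)) (hnd : (i :: l).Nodup) (hx : x ∉ i :: l) :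
    DLL (setAt (Function.update prev x none) l.head? (some x)) (Function.update next x l.head?)
      (some x) (l.head?.elim (some x) (fun _ => tail)) (x :: l) := by
  obtain ⟨h1, h2, h3, h4⟩ := h
  rw [List.nodup_cons] at hnd
  rw [List.mem_cons, not_or] at hx
  refine ⟨by simp, ?_, ⟨by simp, ?_⟩, ?_⟩
  · rw [h2]; cases l <;> simp
  · exact SegTo.congr h3.2 fun a ha => Function.update_of_ne (by rintro rfl; exact hx.2 ha) _ _
  · rcases l with _ | ⟨w, l⟩
    · simp [SegTo, setAt]
    · simp only [List.reverse_cons, List.append_assoc, List.singleton_append] at h4 ⊢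
      simp only [List.nodup_cons, List.mem_cons, not_or] at hnd hx
      rw [segTo_append] at h4 ⊢
      refine ⟨?_, ?_, ?_, trivial⟩
      · refine SegTo.congr h4.1 fun a ha => ?_
        simp only [List.mem_reverse] at ha
        simp only [List.head?_cons, setAt, Option.elim]
        rw [Function.update_of_ne (by rintro rfl; exact hnd.2.1 ha),
          Function.update_of_ne (by rintro rfl; exact hx.2.2 ha)]
      · simp [setAt]
      · simp [setAt, Function.update_of_ne hx.2.1]

end LinkedLists

/-! ### The loops along the linked lists, with their results and costs. -/

section Loops

variable {σ : Type}

/-- The loop stops at the first node whose edge does not lead to j, so it treats exactly the run M: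
a read and a write for each node, and at most one further read. -/
theorem ex_redirectF {j z d : ℕ} (M B : List ℕ) (N : ℕ) (s : St σ)
    (hnd : (M ++ B).Nodup)
    (hs : SegTo s.vNext (M ++ B) none) (hM : ∀ v ∈ M, s.eF v = j) (hB : ∀ v ∈ B.head?, s.eF v ≠ j)
    (hN : M.length ≤ N) :
    ∃ t ≤ 2 * M.length + 1, ex (redirectF j z d N (M ++ B).head?) s.toM = ((), ({s with
      eF := fun v => if v ∈ M then z else s.eF v
      bF := fun v => if v ∈ M then s.bF v - d else s.bF v
      steps := s.steps + t} : St σ).toM) := by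
  induction M generalizing N s with
  | nil =>
    rcases N with _ | N
    · exact ⟨0, by simp, by simp [redirectF, ex_pure]⟩
    · rcases B with _ | ⟨b, B⟩
      · exact ⟨0, by simp, by simp [redirectF, ex_pure]⟩
      · refine ⟨1, by simp, ?_⟩
        have := hB b (by simp)
        simp [redirectF, ex_bind, ex_readCell, St.get, this, ex_pure]
  | cons y M ih =>
    rcases N with _ | N
    · simp at hN
    · rw [List.cons_append, List.nodup_cons] at hnd
      have hy := hM y (by simp)
      obtain ⟨t, ht, h⟩ := ih N ({s with
        eF := Function.update s.eF y z, bF := Function.update s.bF y (s.bF y - d),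
        steps := s.steps + 2}) hnd.2 hs.2
        (fun v hv => by
          dsimp only
          change Function.update s.eF y z v = j
          rw [Function.update_of_ne]
          · exact hM v (by simp [hv])
          · rintro rfl; exact hnd.1 (by simp [hv]))
        (fun v hv => by
          dsimp only
          change Function.update s.eF y z v ≠ j
          rw [Function.update_of_ne]
          · exact hB v hv
          · rintro rfl; exact hnd.1 (by simp [List.mem_of_mem_head? hv]))
        (by simpa using hN)
      refine ⟨t + 2, by simp only [List.length_cons]; omega, ?_⟩
      have hn : s.vNext y = (M ++ B).head? := by simpa using hs.1
      simp only [List.cons_append, List.head?_cons, redirectF, ex_bind, ex_readCell, St.get, hy,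
        if_true, ex_updateCell, Function.update_eq_self]
      rw [hn]
      dsimp only at h
      refine Eq.trans ?_ (h.trans ?_)
      · congr 4
      · have hyM : y ∉ M := fun h => hnd.1 (by simp [h])
        congr 3
        · funext v
          rcases eq_or_ne v y with rfl | hv
          · simp [hyM]
          · simp [hv]
        · funext v
          rcases eq_or_ne v y with rfl | hv
          · simp [hyM]
          · simp [hv]
        · omega

theorem ex_redirectL_aux {j z d : ℕ} (M B : List ℕ) (N : ℕ) (s : St σ)
    (first : Option ℕ)
    (hnd : (M ++ B).Nodup)
    (hs : SegTo s.uNext (M ++ B) none) (hM : ∀ v ∈ M, s.eL v = j) (hB : ∀ v ∈ B.head?, s.eL v ≠ j)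
    (hN : M.length ≤ N) :
    ∃ t ≤ 2 * M.length + 1, ex (redirectL j z d N (M ++ B).head? first) s.toM =
      ((first <|> M.find? (fun v => decide (d ≤ s.bL v))), ({s with
      eL := fun v => if v ∈ M ∧ d ≤ s.bL v then z else s.eL v
      bL := fun v => if v ∈ M ∧ d ≤ s.bL v then s.bL v - d else s.bL v
      steps := s.steps + t} : St σ).toM) := by
  induction M generalizing N s first with
  | nil =>
    rcases N with _ | N
    · exact ⟨0, by simp, by simp [redirectL, ex_pure]⟩
    · rcases B with _ | ⟨b, B⟩
      · exact ⟨0, by simp, by simp [redirectL, ex_pure]⟩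
      · refine ⟨1, by simp, ?_⟩
        have := hB b (by simp)
        simp [redirectL, ex_bind, ex_readCell, St.get, this, ex_pure]
  | cons y M ih =>
    rcases N with _ | N
    · simp at hN
    · rw [List.cons_append, List.nodup_cons] at hnd
      have hyM : y ∉ M := fun h => hnd.1 (by simp [h])
      have hy := hM y (by simp)
      have hn : s.uNext y = (M ++ B).head? := by simpa using hs.1
      by_cases hd : d ≤ s.bL y
      · obtain ⟨t, ht, h⟩ := ih N ({s with
          eL := Function.update s.eL y z, bL := Function.update s.bL y (s.bL y - d),
          steps := s.steps + 2}) (first <|> some y) hnd.2 hs.2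
          (fun v hv => by
            dsimp only
            change Function.update s.eL y z v = j
            rw [Function.update_of_ne]
            · exact hM v (by simp [hv])
            · rintro rfl; exact hyM hv)
          (fun v hv => by
            dsimp only
            change Function.update s.eL y z v ≠ j
            rw [Function.update_of_ne]
            · exact hB v hv
            · rintro rfl; exact hnd.1 (by simp [List.mem_of_mem_head? hv]))
          (by simpa using hN)
        refine ⟨t + 2, by simp only [List.length_cons]; omega, ?_⟩
        simp only [List.cons_append, List.head?_cons, redirectL, ex_bind, ex_readCell, St.get, hy,
          if_true, ex_updateCell, Function.update_eq_self, hd]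
        rw [hn]
        dsimp only at h
        refine Eq.trans ?_ (h.trans ?_)
        · congr 4
        · refine Prod.ext ?_ ?_
          · simp only [List.find?_cons, hd, decide_true]
            cases first <;> simp
          · simp only
            congr 2
            · funext v
              rcases eq_or_ne v y with rfl | hv
              · simp [hyM, hd]
              · simp [hv]
            · funext v
              rcases eq_or_ne v y with rfl | hv
              · simp [hyM, hd]
              · simp [hv]
            · omega
      · obtain ⟨t, ht, h⟩ := ih N ({s with steps := s.steps + 1}) first hnd.2 hs.2
          (fun v hv => hM v (by simp [hv])) hB (by simpa using hN)
        refine ⟨t + 1, by simp only [List.length_cons]; omega, ?_⟩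
        simp only [List.cons_append, List.head?_cons, redirectL, ex_bind, ex_readCell, St.get, hy,
          if_true, hn, hd, if_false]
        refine Eq.trans h ?_
        refine Prod.ext ?_ ?_
        · simp only [List.find?_cons, hd, decide_false]
        · simp only
          congr 2
          · funext v
            rcases eq_or_ne v y with rfl | hv
            · simp [hyM, hd]
            · simp [hv]
          · funext v
            rcases eq_or_ne v y with rfl | hv
            · simp [hyM, hd]
            · simp [hv]
          · omega

/-- The loop is entered through the stored pointer to the first edge into j, which is absent if M is
empty; hence the start at the head of M rather than of M ++ B. -/
theorem ex_redirectL {j z d : ℕ} (M B : List ℕ) (N : ℕ) (s : St σ)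
    (hnd : (M ++ B).Nodup)
    (hs : SegTo s.uNext (M ++ B) none) (hM : ∀ v ∈ M, s.eL v = j) (hB : ∀ v ∈ B.head?, s.eL v ≠ j)
    (hN : M.length ≤ N) :
    ∃ t ≤ 2 * M.length + 1, ex (redirectL j z d N M.head? none) s.toM =
      (M.find? (fun v => decide (d ≤ s.bL v)), ({s with
      eL := fun v => if v ∈ M ∧ d ≤ s.bL v then z else s.eL v
      bL := fun v => if v ∈ M ∧ d ≤ s.bL v then s.bL v - d else s.bL v
      steps := s.steps + t} : St σ).toM) := by
  rcases M with _ | ⟨y, M⟩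
  · refine ⟨0, by simp, ?_⟩
    rcases N with _ | N <;> simp [redirectL, ex_pure]
  · simpa using ex_redirectL_aux (d := d) (y :: M) B N s none hnd hs hM hB hN

/-- The cost is expressed by the index of the node found, which is bounded later by a number of
edges. -/
theorem ex_locate (l : List ℕ) (N u b : ℕ) (s : St σ) (hs : SegTo s.uNext l none)
    (hu : l.head? = some u) (hb : b < tot s.len l) (hN : l.length ≤ N) (hnd : l.Nodup) :
    ∃ h b' t, h ∈ l ∧ off s.len l h + b' = b ∧ b' < s.len h ∧ t ≤ l.idxOf h + 1 ∧
      ex (locate N u b) s.toM = ((h, b'), ({s with steps := s.steps + t} : St σ).toM) := by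
  induction l generalizing N u b s with
  | nil => simp at hu
  | cons a l ih =>
    simp only [List.head?_cons, Option.some.injEq] at hu
    subst hu
    rcases N with _ | N
    · simp at hN
    · by_cases hb' : b < s.len a
      · refine ⟨a, b, 1, by simp, by simp [off], hb', by simp, ?_⟩
        simp [locate, ex_bind, ex_readCell, St.get, hb', ex_pure]
      · rw [List.nodup_cons] at hnd
        rcases l with _ | ⟨w, l⟩
        · simp only [tot] at hb; omega
        · have hn : s.uNext a = some w := by simpa using hs.1
          obtain ⟨h, b', t, h1, h2, h3, h4, h5⟩ := ih N w (b - s.len a)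
            ({s with steps := s.steps + 1}) hs.2 (by simp) (by simp only [tot] at hb ⊢; omega)
            (by simpa using hN) hnd.2
          dsimp only at h2 h3 h4 h5
          have hha : h ≠ a := by rintro rfl; exact hnd.1 h1
          refine ⟨h, b', t + 1, by simp only [List.mem_cons] at h1 ⊢; tauto, ?_, h3, ?_, ?_⟩
          · rw [off, if_neg hha]; omega
          · rw [List.idxOf_cons_ne _ hha.symm]; omega
          · simp only [locate, ex_bind, ex_readCell, St.get, hb', if_false, hn]
            rw [h5]
            simp only [Prod.mk.injEq, true_and]
            congr 2
            omega

theorem ex_heavyTestU_aux (u : ℕ) (M B : List ℕ) (n : ℕ) (s : St σ)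
    (hs : SegTo s.vNext (M ++ B) none) (hM : ∀ v ∈ M, s.eF v = u)
    (hB : ∀ v ∈ B.head?, s.eF v ≠ u) :
    ∃ t ≤ n, ex (heavyTestU u n (M ++ B).head?) s.toM = (decide (n ≤ M.length),
      ({s with steps := s.steps + t} : St σ).toM) := by
  induction M generalizing n s with
  | nil =>
    rcases n with _ | n
    · exact ⟨0, by simp, by simp [heavyTestU, ex_pure]⟩
    · rcases B with _ | ⟨b, B⟩
      · exact ⟨0, by simp, by simp [heavyTestU, ex_pure]⟩
      · refine ⟨1, by simp, ?_⟩
        have := hB b (by simp)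
        simp [heavyTestU, ex_bind, ex_readCell, St.get, this, ex_pure]
  | cons y M ih =>
    rcases n with _ | n
    · exact ⟨0, by simp, by simp [heavyTestU, ex_pure]⟩
    · have hy := hM y (by simp)
      have hn : s.vNext y = (M ++ B).head? := by simpa using hs.1
      obtain ⟨t, ht, h⟩ := ih n ({s with steps := s.steps + 1}) hs.2
        (fun v hv => hM v (by simp [hv])) hB
      refine ⟨t + 1, by omega, ?_⟩
      simp only [List.cons_append, List.head?_cons, heavyTestU, ex_bind, ex_readCell, St.get, hy,
        if_true, hn]
      rw [h]
      simp only [List.length_cons, Nat.add_le_add_iff_right, Prod.mk.injEq, true_and]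
      congr 2
      omega

/-- Counting ends after n nodes even if more edges lead to u, so the cost is at most n. -/
theorem ex_heavyTestU (u : ℕ) (M B : List ℕ) (n : ℕ) (s : St σ)
    (hs : SegTo s.vNext (M ++ B) none) (hM : ∀ v ∈ M, s.eF v = u)
    (hB : ∀ v ∈ B.head?, s.eF v ≠ u) :
    ∃ t ≤ n, ex (heavyTestU u n M.head?) s.toM = (decide (n ≤ M.length),
      ({s with steps := s.steps + t} : St σ).toM) := by
  rcases M with _ | ⟨y, M⟩
  · refine ⟨0, by simp, ?_⟩
    rcases n with _ | n <;> simp [heavyTestU, ex_pure]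
  · simpa using ex_heavyTestU_aux u (y :: M) B n s hs hM hB

theorem ex_heavyTestV_aux (u : ℕ) (M B : List ℕ) (n : ℕ) (s : St σ)
    (hs : SegTo s.uNext (M ++ B) none) (hM : ∀ v ∈ M, s.eL v = u)
    (hB : ∀ v ∈ B.head?, s.eL v ≠ u) :
    ∃ t ≤ n, ex (heavyTestV u n (M ++ B).head?) s.toM = (decide (n ≤ M.length),
      ({s with steps := s.steps + t} : St σ).toM) := by
  induction M generalizing n s with
  | nil =>
    rcases n with _ | n
    · exact ⟨0, by simp, by simp [heavyTestV, ex_pure]⟩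
    · rcases B with _ | ⟨b, B⟩
      · exact ⟨0, by simp, by simp [heavyTestV, ex_pure]⟩
      · refine ⟨1, by simp, ?_⟩
        have := hB b (by simp)
        simp [heavyTestV, ex_bind, ex_readCell, St.get, this, ex_pure]
  | cons y M ih =>
    rcases n with _ | n
    · exact ⟨0, by simp, by simp [heavyTestV, ex_pure]⟩
    · have hy := hM y (by simp)
      have hn : s.uNext y = (M ++ B).head? := by simpa using hs.1
      obtain ⟨t, ht, h⟩ := ih n ({s with steps := s.steps + 1}) hs.2
        (fun v hv => hM v (by simp [hv])) hB
      refine ⟨t + 1, by omega, ?_⟩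
      simp only [List.cons_append, List.head?_cons, heavyTestV, ex_bind, ex_readCell, St.get, hy,
        if_true, hn]
      rw [h]
      simp only [List.length_cons, Nat.add_le_add_iff_right, Prod.mk.injEq, true_and]
      congr 2
      omega

theorem ex_heavyTestV (u : ℕ) (M B : List ℕ) (n : ℕ) (s : St σ)
    (hs : SegTo s.uNext (M ++ B) none) (hM : ∀ v ∈ M, s.eL v = u)
    (hB : ∀ v ∈ B.head?, s.eL v ≠ u) :
    ∃ t ≤ n, ex (heavyTestV u n M.head?) s.toM = (decide (n ≤ M.length),
      ({s with steps := s.steps + t} : St σ).toM) := by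
  rcases M with _ | ⟨y, M⟩
  · refine ⟨0, by simp, ?_⟩
    rcases n with _ | n <;> simp [heavyTestV, ex_pure]
  · simpa using ex_heavyTestV_aux u (y :: M) B n s hs hM hB

variable [LinearOrder σ]

/-- The order of the keys, evaluated in a machine state. -/
def St.keyLt (s : St σ) (x : ℕ) (c : σ) (y : ℕ) (c' : σ) : Prop :=
  c < c' ∨ c = c' ∧ s.order.idxOf x < s.order.idxOf y

instance (s : St σ) (x : ℕ) (c : σ) (y : ℕ) (c' : σ) : Decidable (s.keyLt x c y c') := by
  unfold St.keyLt; infer_instance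

theorem ex_pairLess (τ x : ℕ) (c : σ) (y : ℕ) (c' : σ) (s : St σ) :
    ∃ t ≤ τ, ex (pairLess τ x c y c') s.toM = (decide (s.keyLt x c y c'),
      ({s with steps := s.steps + t} : St σ).toM) := by
  unfold pairLess St.keyLt
  by_cases h : c < c'
  · exact ⟨0, by simp, by simp [h, ex_pure]⟩
  · by_cases h' : c = c'
    · exact ⟨τ, le_rfl, by simp [h', ex_precedes]⟩
    · exact ⟨0, by simp, by simp [h, h', ex_pure]⟩

theorem ex_keyLess (τ x y : ℕ) (s : St σ) :
    ∃ t ≤ τ + 2, ex (keyLess τ x y) s.toM = (decide (s.keyLt x (s.ch x) y (s.ch y)),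
      ({s with steps := s.steps + t} : St σ).toM) := by
  obtain ⟨t, ht, h⟩ := ex_pairLess τ x (s.ch x) y (s.ch y) ({s with steps := s.steps + 2})
  refine ⟨t + 2, by omega, ?_⟩
  simp only [keyLess, ex_bind, ex_readCell, St.get]
  refine Eq.trans h ?_
  refine Prod.ext rfl ?_
  simp only
  congr 2
  omega

variable [OrderBot σ]

/-- The condition for being kept in the B-tree, evaluated in a machine state. -/
def St.cond (s : St σ) (x : ℕ) : Bool :=
  if s.ch x = ⊥ then true
  else match s.uNext x with
    | none => true
    | some y =>
      if s.ch y = ⊥ then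
        match s.uNext y with
        | none => true
        | some w => decide (s.ch w ≠ s.ch x)
      else decide (s.ch y ≠ s.ch x)

theorem ex_searchTest (x : ℕ) (s : St σ) :
    ∃ t ≤ 4, ex (searchTest x) s.toM = (s.cond x, ({s with steps := s.steps + t} : St σ).toM) := by
  unfold searchTest St.cond
  rcases h : s.uNext x with _ | y
  · by_cases hc : s.ch x = ⊥
    · exact ⟨1, by simp, by simp [ex_bind, ex_readCell, St.get, labelAt, ex_pure, h, hc]⟩
    · exact ⟨1, by simp, by simp [ex_bind, ex_readCell, St.get, labelAt, ex_pure, h, hc]⟩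
  · by_cases hc : s.ch x = ⊥
    · exact ⟨2, by simp, by simp [ex_bind, ex_map, ex_readCell, St.get, labelAt, h, hc]⟩
    · by_cases hy : s.ch y = ⊥
      · rcases h' : s.uNext y with _ | w
        · exact ⟨3, by simp,
            by simp [ex_bind, ex_readCell, St.get, labelAt, ex_pure, h, hc, hy, h']⟩
        · exact ⟨4, by simp,
            by simp [ex_bind, ex_map, ex_readCell, St.get, labelAt, h, hc, hy, h']; congr⟩
      · exact ⟨2, by simp, by
          simp [ex_bind, ex_readCell, St.get, labelAt, ex_pure, h, hc, hy]; congr⟩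

end Loops


/-! ### Search and insertion in 2-3 trees. -/

section Ticks

variable {σ : Type}

/-- Advance the number of steps. -/
def St.tk (s : St σ) (n : ℕ) : St σ := {s with steps := s.steps + n}

theorem St.tk_tk (s : St σ) (m n : ℕ) : (s.tk m).tk n = s.tk (m + n) := by
  simp [St.tk, add_assoc]

theorem St.ch_tk (s : St σ) (n : ℕ) : (s.tk n).ch = s.ch := rfl

theorem ex_tick (n : ℕ) (s : St σ) : ex (tick n) s.toM = ((), (s.tk n).toM) := rfl

theorem ex_readCell_tk (x : ℕ) (s : St σ) : ex (readCell x) s.toM = (s.get x, (s.tk 1).toM) := rfl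

end Ticks

section Trees

variable {σ : Type} [LinearOrder σ]

/-- Each inner node has at least two subtrees of equal height, so the number of entries plus one at
least doubles with each level. -/
theorem BTree.two_pow_height_le (t : BTree) (h : t.Complete) :
    2 ^ t.height ≤ t.inorder.length + 1 := by
  induction t with
  | leaf => simp [BTree.height, BTree.inorder]
  | node2 l a r ihl ihr =>
    obtain ⟨h1, h2, h3⟩ := h
    have := ihl h1
    have := ihr h2
    simp only [BTree.height, BTree.inorder, List.length_append, List.length_cons, pow_succ]
    rw [← h3, max_self] at *
    omega
  | node3 l a m b r ihl ihm ihr =>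
    obtain ⟨h1, h2, h3, h4, h5⟩ := h
    have := ihl h1
    have := ihm h2
    have := ihr h3
    simp only [BTree.height, BTree.inorder, List.length_append, List.length_cons, pow_succ]
    rw [← h5, ← h4, max_self, max_self] at *
    omega

theorem BTree.eq_leaf_of_height {t : BTree} (h : t.height = 0) : t = .leaf := by
  cases t <;> simp_all [BTree.height]

theorem ex_pairLess_tk (τ x : ℕ) (c : σ) (y : ℕ) (c' : σ) (s : St σ) (k : ℕ) :
    ∃ t ≤ τ, ex (pairLess τ x c y c') (s.tk k).toM = (decide (s.keyLt x c y c'),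
      (s.tk (k + t)).toM) := by
  obtain ⟨t, ht, h⟩ := ex_pairLess τ x c y c' (s.tk k)
  exact ⟨t, ht, by rw [← s.tk_tk]; exact h⟩

theorem ex_keyLess_tk (τ x y : ℕ) (s : St σ) (k : ℕ) :
    ∃ t ≤ τ + 2, ex (keyLess τ x y) (s.tk k).toM = (decide (s.keyLt x (s.ch x) y (s.ch y)),
      (s.tk (k + t)).toM) := by
  obtain ⟨t, ht, h⟩ := ex_keyLess τ x y (s.tk k)
  exact ⟨t, ht, by rw [← s.tk_tk]; exact h⟩

/-- The hypothesis says that the entries with smaller keys form an initial part of the tree order,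
which is all that a search needs. A level costs at most one visit, two reads and two comparisons,
hence 2τ + 3. -/
theorem ex_searchTree (τ x : ℕ) (c : σ) (t : BTree) (best : Option ℕ) (s : St σ)
    (ht : t.inorder.Pairwise (fun a b => s.keyLt b (s.ch b) x c → s.keyLt a (s.ch a) x c)) (k : ℕ) :
    ∃ n ≤ (2 * τ + 3) * (t.height + 1), ex (searchTree τ x c t best) (s.tk k).toM =
      ((t.inorder.filter (fun y => decide (s.keyLt y (s.ch y) x c))).getLast? <|> best,
        (s.tk (k + n)).toM) := by
  induction t generalizing best k with
  | leaf =>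
    refine ⟨1, by simp [BTree.height], ?_⟩
    simp only [searchTree, BTree.inorder, List.filter_nil, List.getLast?_nil, ex_bind, ex_tick,
      St.tk_tk, ex_pure]
    rfl
  | node2 l a r ihl ihr =>
    simp only [BTree.inorder, List.pairwise_append, List.pairwise_cons] at ht
    obtain ⟨n1, hn1, h1⟩ := ex_pairLess_tk τ a (s.ch a) x c s (k + 1 + 1)
    obtain ⟨n2, hn2, h2⟩ := ihl best ht.1 (k + 1 + 1 + n1)
    obtain ⟨n3, hn3, h3⟩ := ihr (some a) ht.2.1.2 (k + 1 + 1 + n1)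
    have hmax : ∀ k, k ≤ max l.height r.height → (2 * τ + 3) * (k + 1) ≤
        (2 * τ + 3) * (max l.height r.height + 1) := fun k hk => Nat.mul_le_mul_left _ (by omega)
    have hl := hmax l.height (by omega)
    have hr := hmax r.height (by omega)
    simp only [searchTree, ex_bind, ex_tick, ex_readCell_tk, St.tk_tk, St.get, St.ch_tk, h1,
      BTree.height]
    rw [Nat.mul_add _ (max l.height r.height + 1), Nat.mul_one]
    by_cases hP : s.keyLt a (s.ch a) x c
    · refine ⟨1 + 1 + n1 + n3, by omega, ?_⟩
      simp only [hP, decide_true, if_true, h3, BTree.inorder, List.filter_append, List.filter_cons]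
      refine Prod.ext ?_ (by simp only [add_assoc])
      rcases h : r.inorder.filter fun y => decide (s.keyLt y (s.ch y) x c) with _ | ⟨b, w⟩
      · simp
      · simp [List.getLast?_append, List.getLast?_cons]
    · refine ⟨1 + 1 + n1 + n2, by omega, ?_⟩
      -- An entry whose key is not smaller rejects everything to its right.
      have hr : r.inorder.filter (fun y => decide (s.keyLt y (s.ch y) x c)) = [] := by
        rw [List.filter_eq_nil_iff]
        intro b hb
        simpa using fun h => hP (ht.2.1.1 b hb h)
      simp only [hP, decide_false, Bool.false_eq_true, if_false, h2, BTree.inorder,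
        List.filter_append, List.filter_cons, hr, List.append_nil]
      simp only [add_assoc]
  | node3 l a m b r ihl ihm ihr =>
    simp only [BTree.inorder, List.pairwise_append, List.pairwise_cons, List.mem_append,
      List.mem_cons] at ht
    obtain ⟨n1, hn1, h1⟩ := ex_pairLess_tk τ b (s.ch b) x c s (k + 1 + 1 + 1)
    obtain ⟨n0, hn0, h0⟩ := ex_pairLess_tk τ a (s.ch a) x c s (k + 1 + 1 + 1 + n1)
    obtain ⟨n2, hn2, h2⟩ := ihl best ht.1 (k + 1 + 1 + 1 + n1 + n0)
    obtain ⟨n3, hn3, h3⟩ := ihm (some a) ht.2.1.2.1 (k + 1 + 1 + 1 + n1 + n0)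
    obtain ⟨n4, hn4, h4⟩ := ihr (some b) ht.2.1.2.2.1.2 (k + 1 + 1 + 1 + n1)
    have hmax : ∀ k, k ≤ max l.height (max m.height r.height) → (2 * τ + 3) * (k + 1) ≤
        (2 * τ + 3) * (max l.height (max m.height r.height) + 1) := fun k hk =>
          Nat.mul_le_mul_left _ (by omega)
    have hl := hmax l.height (by omega)
    have hm := hmax m.height (by omega)
    have hr := hmax r.height (by omega)
    simp only [searchTree, ex_bind, ex_tick, ex_readCell_tk, St.tk_tk, St.get, St.ch_tk, h1,
      BTree.height]
    rw [Nat.mul_add _ (max l.height _ + 1), Nat.mul_one]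
    by_cases hP : s.keyLt b (s.ch b) x c
    · refine ⟨1 + 1 + 1 + n1 + n4, by omega, ?_⟩
      have hQ : s.keyLt a (s.ch a) x c := ht.2.1.1 b (by simp) hP
      simp only [hP, hQ, decide_true, if_true, h4, BTree.inorder, List.filter_append,
        List.filter_cons]
      refine Prod.ext ?_ (by simp only [add_assoc])
      rcases h : r.inorder.filter fun y => decide (s.keyLt y (s.ch y) x c) with _ | ⟨b', w⟩
      · simp [List.getLast?_append, List.getLast?_cons]
      · simp [List.getLast?_append, List.getLast?_cons]
    · have hr' : r.inorder.filter (fun y => decide (s.keyLt y (s.ch y) x c)) = [] := by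
        rw [List.filter_eq_nil_iff]
        intro b' hb
        simpa using fun h => hP (ht.2.1.2.2.1.1 b' hb h)
      simp only [hP, decide_false, Bool.false_eq_true, if_false, ex_bind, h0]
      by_cases hQ : s.keyLt a (s.ch a) x c
      · refine ⟨1 + 1 + 1 + n1 + n0 + n3, by omega, ?_⟩
        simp only [hQ, decide_true, if_true, h3, BTree.inorder, List.filter_append,
          List.filter_cons, hr', hP, decide_false, Bool.false_eq_true, if_false]
        refine Prod.ext ?_ (by simp only [add_assoc])
        rcases h : m.inorder.filter fun y => decide (s.keyLt y (s.ch y) x c) with _ | ⟨b', w⟩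
        · simp [List.getLast?_append, List.getLast?_cons]
        · simp [List.getLast?_append, List.getLast?_cons]
      · have hm' : m.inorder.filter (fun y => decide (s.keyLt y (s.ch y) x c)) = [] := by
          rw [List.filter_eq_nil_iff]
          intro b' hb
          simpa using fun h => hQ (ht.2.1.1 b' (by simp [hb]) h)
        refine ⟨1 + 1 + 1 + n1 + n0 + n2, by omega, ?_⟩
        simp only [hQ, decide_false, Bool.false_eq_true, if_false, h2, BTree.inorder,
          List.filter_append, List.filter_cons, hr', hm', hP, List.append_nil]
        simp only [add_assoc]

def Grown.inorder : Grown → List ℕ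
  | .fit t => t.inorder
  | .split l a r => l.inorder ++ a :: r.inorder

/-- The subtrees in the result of an insertion are complete and have height `h`. -/
def Grown.Ok (h : ℕ) : Grown → Prop
  | .fit t => t.Complete ∧ t.height = h
  | .split l _ r => l.Complete ∧ r.Complete ∧ l.height = h ∧ r.height = h

/-- The comparisons of the key of `x` with those of the entries in `l` follow the rank `r`. -/
def St.Compares (s : St σ) (r : ℕ → ℕ) (x : ℕ) (l : List ℕ) : Prop :=
  ∀ y ∈ l, y ≠ x → (s.keyLt x (s.ch x) y (s.ch y) ∧ r x < r y) ∨
    (¬ s.keyLt x (s.ch x) y (s.ch y) ∧ r y < r x)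


/-- For an insertion into one subtree: its entries M become M', which differs by x at most, between
unchanged surroundings. -/
theorem pairwise_replace {R : ℕ → ℕ → Prop} {x : ℕ} {pre M post M' : List ℕ}
    (h : (pre ++ M ++ post).Pairwise R) (h' : M'.Pairwise R) (hM : ∀ y ∈ M', y = x ∨ y ∈ M)
    (hpre : ∀ a ∈ pre, R a x) (hpost : ∀ b ∈ post, R x b) : (pre ++ M' ++ post).Pairwise R := by
  simp only [List.pairwise_append, List.mem_append] at h ⊢
  refine ⟨⟨h.1.1, h', fun a ha b hb => ?_⟩, h.2.1, fun a ha b hb => ?_⟩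
  · rcases hM b hb with rfl | hb
    · exact hpre a ha
    · exact h.1.2.2 a ha b hb
  · rcases ha with ha | ha
    · exact h.2.2 a (Or.inl ha) b hb
    · rcases hM a ha with rfl | ha
      · exact hpost b hb
      · exact h.2.2 a (Or.inr ha) b hb

theorem mem_replace {x : ℕ} {pre M post M' : List ℕ} (hM : ∀ y, y ∈ M' ↔ y = x ∨ y ∈ M) (y : ℕ) :
    y ∈ pre ++ M' ++ post ↔ y = x ∨ y ∈ pre ++ M ++ post := by
  simp only [List.mem_append, hM]
  tauto

-- The conclusion speaks of members and sortedness instead of a list because x may be stored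
-- already. A level costs one visit and at most two comparisons with τ + 2 steps each, hence 2τ + 5.
set_option maxHeartbeats 1000000 in
theorem ex_insertRec (τ x : ℕ) (r : ℕ → ℕ) (t : BTree) (s : St σ) (ht : t.Complete)
    (hsort : t.inorder.Pairwise (fun a b => r a < r b)) (hk : s.Compares r x t.inorder) (k : ℕ) :
    ∃ g, ∃ n ≤ (2 * τ + 5) * (t.height + 1), ex (insertRec τ x t) (s.tk k).toM =
      (g, (s.tk (k + n)).toM) ∧
      (∀ y, y ∈ g.inorder ↔ y = x ∨ y ∈ t.inorder) ∧
      g.inorder.Pairwise (fun a b => r a < r b) ∧ g.Ok t.height := by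
  induction t generalizing k with
  | leaf =>
    refine ⟨.split .leaf x .leaf, 1, by simp [BTree.height], ?_, ?_, ?_, ?_⟩
    · simp only [insertRec, ex_bind, ex_tick, ex_pure, St.tk_tk]
    · simp [Grown.inorder, BTree.inorder]
    · simp [Grown.inorder, BTree.inorder]
    · simp [Grown.Ok, BTree.height, BTree.Complete]
  | node2 l a q ihl ihr =>
    obtain ⟨c1, c2, c3⟩ := ht
    have hmax : ∀ k, k ≤ max l.height q.height → (2 * τ + 5) * (k + 1) ≤
        (2 * τ + 5) * (max l.height q.height + 1) := fun k hk => Nat.mul_le_mul_left _ (by omega)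
    have hl := hmax l.height (by omega)
    have hq := hmax q.height (by omega)
    simp only [BTree.inorder, BTree.height]
    rw [Nat.mul_add _ (max l.height _ + 1), Nat.mul_one]
    by_cases hxa : x = a
    · subst hxa
      refine ⟨.fit (.node2 l x q), 1, by omega, ?_, ?_, ?_, ?_⟩
      · simp only [insertRec, ex_bind, ex_tick, St.tk_tk, if_true, ex_pure]
      · simp only [Grown.inorder, BTree.inorder, List.mem_append, List.mem_cons]; tauto
      · simpa [Grown.inorder, BTree.inorder] using hsort
      · simp [Grown.Ok, BTree.height, BTree.Complete, c1, c2, c3]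
    · obtain ⟨n1, hn1, h1⟩ := ex_keyLess_tk τ x a s (k + 1)
      simp only [insertRec, ex_bind, ex_tick, St.tk_tk, if_neg hxa, h1]
      have hs0 := hsort
      simp only [BTree.inorder] at hs0
      simp only [BTree.inorder, List.pairwise_append, List.pairwise_cons, List.mem_cons] at hsort
      have hka := hk a (by simp [BTree.inorder]) (Ne.symm hxa)
      rcases hka with ⟨hka, hra⟩ | ⟨hka, hra⟩
      · obtain ⟨g, n2, hn2, h2, h3, h4, h5⟩ := ihl c1 hsort.1
          (fun y hy => hk y (by simp [BTree.inorder, hy])) (k + 1 + n1)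
        have hm' := mem_replace (x := x) (pre := []) (post := a :: q.inorder) h3
        have hs' := pairwise_replace (x := x) (pre := [])
          (M := l.inorder) (post := a :: q.inorder) (by simpa using hs0) h4
          (fun y hy => (h3 y).1 hy) (by simp) (by
            simp only [List.mem_cons, forall_eq_or_imp]
            exact ⟨hra, fun b hb => hra.trans (hsort.2.1.1 b hb)⟩)
        simp only [hka, decide_true, if_true, ex_bind, h2]
        rcases g with t | ⟨t₁, b, t₂⟩
        · refine ⟨.fit (.node2 t a q), 1 + n1 + n2, by omega, by simp only [ex_pure, add_assoc], ?_, ?_, ?_⟩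
          · simpa [Grown.inorder, BTree.inorder] using hm'
          · simpa [Grown.inorder, BTree.inorder] using hs'
          · obtain ⟨d1, d2⟩ := h5
            exact ⟨⟨d1, c2, by omega⟩, by simp only [BTree.height]; omega⟩
        · refine ⟨.fit (.node3 t₁ b t₂ a q), 1 + n1 + n2, by omega, by simp only [ex_pure, add_assoc], ?_, ?_, ?_⟩
          · simpa [Grown.inorder, BTree.inorder] using hm'
          · simpa [Grown.inorder, BTree.inorder] using hs'
          · obtain ⟨d1, d2, d3, d4⟩ := h5
            exact ⟨⟨d1, d2, c2, by omega, by omega⟩, by simp only [BTree.height]; omega⟩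
      · obtain ⟨g, n2, hn2, h2, h3, h4, h5⟩ := ihr c2
          hsort.2.1.2 (fun y hy => hk y (by simp [BTree.inorder, hy])) (k + 1 + n1)
        have hm' := mem_replace (x := x) (pre := l.inorder ++ [a]) (post := []) h3
        have hs' := pairwise_replace (x := x) (pre := l.inorder ++ [a])
          (M := q.inorder) (post := []) (by simpa using hs0) h4
          (fun y hy => (h3 y).1 hy) (by
            simp only [List.mem_append, List.mem_singleton, or_imp, forall_and, forall_eq]
            exact ⟨fun b hb => (hsort.2.2 b hb a (by simp)).trans hra, hra⟩) (by simp)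
        simp only [hka, decide_false, Bool.false_eq_true, if_false, ex_bind, h2]
        rcases g with t | ⟨t₁, b, t₂⟩
        · refine ⟨.fit (.node2 l a t), 1 + n1 + n2, by omega, by simp only [ex_pure, add_assoc], ?_, ?_, ?_⟩
          · simpa [Grown.inorder, BTree.inorder] using hm'
          · simpa [Grown.inorder, BTree.inorder] using hs'
          · obtain ⟨d1, d2⟩ := h5
            exact ⟨⟨c1, d1, by omega⟩, by simp only [BTree.height]; omega⟩
        · refine ⟨.fit (.node3 l a t₁ b t₂), 1 + n1 + n2, by omega, by simp only [ex_pure, add_assoc], ?_, ?_, ?_⟩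
          · simpa [Grown.inorder, BTree.inorder] using hm'
          · simpa [Grown.inorder, BTree.inorder] using hs'
          · obtain ⟨d1, d2, d3, d4⟩ := h5
            exact ⟨⟨c1, d1, d2, by omega, by omega⟩, by simp only [BTree.height]; omega⟩
  | node3 l a m b q ihl ihm ihr =>
    obtain ⟨c1, c2, c3, c4, c5⟩ := ht
    have hmax : ∀ k, k ≤ max l.height (max m.height q.height) → (2 * τ + 5) * (k + 1) ≤
        (2 * τ + 5) * (max l.height (max m.height q.height) + 1) := fun k hk =>
          Nat.mul_le_mul_left _ (by omega)
    have hl := hmax l.height (by omega)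
    have hm := hmax m.height (by omega)
    have hq := hmax q.height (by omega)
    simp only [BTree.inorder, BTree.height]
    rw [Nat.mul_add _ (max l.height _ + 1), Nat.mul_one]
    by_cases hxab : x = a ∨ x = b
    · refine ⟨.fit (.node3 l a m b q), 1, by omega, ?_, ?_, ?_, ?_⟩
      · simp only [insertRec, ex_bind, ex_tick, St.tk_tk, if_pos hxab, ex_pure]
      · simp only [Grown.inorder, BTree.inorder, List.mem_append, List.mem_cons]
        intro y
        constructor
        · exact Or.inr
        · rintro (rfl | h)
          · tauto
          · exact h
      · simpa [Grown.inorder, BTree.inorder] using hsort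
      · simp [Grown.Ok, BTree.height, BTree.Complete, c1, c2, c3, c4, c5]
    · have hxa : a ≠ x := fun h => hxab (Or.inl h.symm)
      have hxb : b ≠ x := fun h => hxab (Or.inr h.symm)
      obtain ⟨n1, hn1, h1⟩ := ex_keyLess_tk τ x a s (k + 1)
      obtain ⟨n0, hn0, h0⟩ := ex_keyLess_tk τ x b s (k + 1 + n1)
      simp only [insertRec, ex_bind, ex_tick, St.tk_tk, if_neg hxab, h1]
      have hs0 := hsort
      simp only [BTree.inorder] at hs0
      simp only [BTree.inorder, List.pairwise_append, List.pairwise_cons, List.mem_cons,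
        List.mem_append] at hsort
      have hka := hk a (by simp [BTree.inorder]) hxa
      have hkb := hk b (by simp [BTree.inorder]) hxb
      rcases hka with ⟨hka, hra⟩ | ⟨hka, hra⟩
      · obtain ⟨g, n2, hn2, h2, h3, h4, h5⟩ := ihl c1 hsort.1
          (fun y hy => hk y (by simp [BTree.inorder, hy])) (k + 1 + n1)
        have hm' := mem_replace (x := x) (pre := []) (post := a :: (m.inorder ++ b :: q.inorder)) h3
        have hs' := pairwise_replace (x := x) (pre := [])
          (M := l.inorder) (post := a :: (m.inorder ++ b :: q.inorder)) (by simpa using hs0) h4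
          (fun y hy => (h3 y).1 hy) (by simp) (by
            simp only [List.mem_cons, List.mem_append, forall_eq_or_imp]
            exact ⟨hra, fun b hb => hra.trans (hsort.2.1.1 b hb)⟩)
        simp only [hka, decide_true, if_true, ex_bind, h2]
        clear hkb
        rcases g with t | ⟨t₁, e, t₂⟩
        · refine ⟨.fit (.node3 t a m b q), 1 + n1 + n2, by omega, by simp only [ex_pure, add_assoc], ?_, ?_, ?_⟩
          · simpa [Grown.inorder, BTree.inorder] using hm'
          · simpa [Grown.inorder, BTree.inorder] using hs'
          · obtain ⟨d1, d2⟩ := h5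
            exact ⟨⟨d1, c2, c3, by omega, by omega⟩, by simp only [BTree.height]; omega⟩
        · refine ⟨.split (.node2 t₁ e t₂) a (.node2 m b q), 1 + n1 + n2, by omega, by simp only [ex_pure, add_assoc], ?_, ?_, ?_⟩
          · simpa [Grown.inorder, BTree.inorder] using hm'
          · simpa [Grown.inorder, BTree.inorder] using hs'
          · obtain ⟨d1, d2, d3, d4⟩ := h5
            exact ⟨⟨d1, d2, by omega⟩, ⟨c2, c3, by omega⟩, by simp only [BTree.height]; omega,
              by simp only [BTree.height]; omega⟩
      · simp only [hka, decide_false, Bool.false_eq_true, if_false, ex_bind, h0]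
        rcases hkb with ⟨hkb, hrb⟩ | ⟨hkb, hrb⟩
        · obtain ⟨g, n2, hn2, h2, h3, h4, h5⟩ := ihm c2
            hsort.2.1.2.1 (fun y hy => hk y (by simp [BTree.inorder, hy])) (k + 1 + n1 + n0)
          have hm' := mem_replace (x := x) (pre := l.inorder ++ [a]) (post := b :: q.inorder) h3
          have hs' := pairwise_replace (x := x) (pre := l.inorder ++ [a])
            (M := m.inorder) (post := b :: q.inorder) (by simpa using hs0) h4
            (fun y hy => (h3 y).1 hy) (by
              simp only [List.mem_append, List.mem_singleton, or_imp, forall_and, forall_eq]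
              exact ⟨fun b hb => (hsort.2.2 b hb a (by simp)).trans hra, hra⟩) (by
              simp only [List.mem_cons, forall_eq_or_imp]
              exact ⟨hrb, fun y hy => hrb.trans (hsort.2.1.2.2.1.1 y hy)⟩)
          simp only [hkb, decide_true, if_true, ex_bind, h2]
          rcases g with t | ⟨t₁, e, t₂⟩
          · refine ⟨.fit (.node3 l a t b q), 1 + n1 + n0 + n2, by omega, by simp only [ex_pure, add_assoc], ?_, ?_, ?_⟩
            · simpa [Grown.inorder, BTree.inorder] using hm'
            · simpa [Grown.inorder, BTree.inorder] using hs'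
            · obtain ⟨d1, d2⟩ := h5
              exact ⟨⟨c1, d1, c3, by omega, by omega⟩, by simp only [BTree.height]; omega⟩
          · refine ⟨.split (.node2 l a t₁) e (.node2 t₂ b q), 1 + n1 + n0 + n2, by omega, by simp only [ex_pure, add_assoc], ?_, ?_, ?_⟩
            · simpa [Grown.inorder, BTree.inorder] using hm'
            · simpa [Grown.inorder, BTree.inorder] using hs'
            · obtain ⟨d1, d2, d3, d4⟩ := h5
              exact ⟨⟨c1, d1, by omega⟩, ⟨d2, c3, by omega⟩, by simp only [BTree.height]; omega,
                by simp only [BTree.height]; omega⟩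
        · obtain ⟨g, n2, hn2, h2, h3, h4, h5⟩ := ihr c3
            hsort.2.1.2.2.1.2 (fun y hy => hk y (by simp [BTree.inorder, hy])) (k + 1 + n1 + n0)
          have hm' := mem_replace (x := x) (pre := l.inorder ++ a :: (m.inorder ++ [b])) (post := []) h3
          have hs' := pairwise_replace (x := x) (pre := l.inorder ++ a :: (m.inorder ++ [b]))
            (M := q.inorder) (post := []) (by simpa using hs0) h4
            (fun y hy => (h3 y).1 hy) (by
              simp only [List.mem_append, List.mem_cons, List.not_mem_nil, or_false, or_imp,
                forall_and, forall_eq]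
              exact ⟨fun y hy => (hsort.2.2 y hy a (by simp)).trans hra, hra,
                fun y hy => (hsort.2.1.2.2.2 y hy b (by simp)).trans hrb, hrb⟩) (by simp)
          simp only [hkb, decide_false, Bool.false_eq_true, if_false, ex_bind, h2]
          rcases g with t | ⟨t₁, e, t₂⟩
          · refine ⟨.fit (.node3 l a m b t), 1 + n1 + n0 + n2, by omega, by simp only [ex_pure, add_assoc], ?_, ?_, ?_⟩
            · simpa [Grown.inorder, BTree.inorder] using hm'
            · simpa [Grown.inorder, BTree.inorder] using hs'
            · obtain ⟨d1, d2⟩ := h5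
              exact ⟨⟨c1, c2, d1, by omega, by omega⟩, by simp only [BTree.height]; omega⟩
          · refine ⟨.split (.node2 l a m) b (.node2 t₁ e t₂), 1 + n1 + n0 + n2, by omega, by simp only [ex_pure, add_assoc], ?_, ?_, ?_⟩
            · simpa [Grown.inorder, BTree.inorder] using hm'
            · simpa [Grown.inorder, BTree.inorder] using hs'
            · obtain ⟨d1, d2, d3, d4⟩ := h5
              exact ⟨⟨c1, c2, by omega⟩, ⟨d1, d2, by omega⟩, by simp only [BTree.height]; omega,
                by simp only [BTree.height]; omega⟩

/-- The additional two steps read and write the root; if the split reaches the top, a new root is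
created and all leaves get deeper by one. -/
theorem ex_treeInsert (τ x : ℕ) (r : ℕ → ℕ) (s : St σ) (ht : s.btree.Complete)
    (hsort : s.btree.inorder.Pairwise (fun a b => r a < r b))
    (hk : s.Compares r x s.btree.inorder) :
    ∃ t, ∃ n ≤ (2 * τ + 5) * (s.btree.height + 1) + 2, ex (treeInsert τ x) s.toM =
      ((), ({s with btree := t, steps := s.steps + n} : St σ).toM) ∧
      (∀ y, y ∈ t.inorder ↔ y = x ∨ y ∈ s.btree.inorder) ∧
      t.inorder.Pairwise (fun a b => r a < r b) ∧ t.Complete := by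
  obtain ⟨g, n, hn, h1, h2, h3, h4⟩ := ex_insertRec τ x r s.btree s ht hsort hk 1
  have e : ex (readReg (fun m : Machine σ => m.btree)) s.toM = (s.btree, (s.tk 1).toM) := rfl
  rcases g with t | ⟨t₁, a, t₂⟩
  · refine ⟨t, n + 2, by omega, ?_, h2, h3, h4.1⟩
    simp only [treeInsert, ex_bind, e, h1, ex_setBTree]
    simp only [St.tk]
    rw [show s.steps + (1 + n) + 1 = s.steps + (n + 2) by omega]
  · refine ⟨.node2 t₁ a t₂, n + 2, by omega, ?_, h2, h3, ⟨h4.1, h4.2.1, by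
      rw [h4.2.2.1, h4.2.2.2]⟩⟩
    simp only [treeInsert, ex_bind, e, h1, ex_setBTree]
    simp only [St.tk]
    rw [show s.steps + (1 + n) + 1 = s.steps + (n + 2) by omega]

end Trees


/-! ### Deletion from 2-3 trees. -/

section Deletion

/-- The result of a deletion from a complete tree of height `h`. -/
def Shrunk.Ok (h : ℕ) : Shrunk → Prop
  | .same t => t.Complete ∧ t.height = h
  | .lower t => t.Complete ∧ t.height + 1 = h

theorem Shrunk.Ok.complete {h : ℕ} {s : Shrunk} (hs : s.Ok h) : s.tree.Complete := by
  cases s <;> exact hs.1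

/-- Borrowing and merging regroup the subtrees without changing the order of the entries; this holds
even in the degenerate case of a leaf as sibling. -/
theorem mend21_inorder (s : Shrunk) (a : ℕ) (t : BTree) :
    (mend21 s a t).tree.inorder = s.tree.inorder ++ a :: t.inorder := by
  rcases s with s | s <;> rcases t with _ | _ | _ <;>
  simp [mend21, Shrunk.tree, BTree.inorder]

/-- A subtree that has become lower had positive height, so its sibling is not a leaf and can give a
subtree away or be merged. -/
theorem mend21_ok (s : Shrunk) (a : ℕ) (t : BTree) {h : ℕ} (hs : s.Ok h)
    (ht : t.Complete) (ht' : t.height = h) : (mend21 s a t).Ok (h + 1) := by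
  rcases s with s | s <;> rcases t with _ | _ | _ <;>
  simp_all [mend21, Shrunk.Ok, BTree.height, BTree.Complete] <;> omega

theorem mend22_inorder (t : BTree) (a : ℕ) (s : Shrunk) :
    (mend22 t a s).tree.inorder = t.inorder ++ a :: s.tree.inorder := by
  rcases s with s | s <;> rcases t with _ | _ | _ <;>
  simp [mend22, Shrunk.tree, BTree.inorder]

theorem mend22_ok (t : BTree) (a : ℕ) (s : Shrunk) {h : ℕ} (hs : s.Ok h)
    (ht : t.Complete) (ht' : t.height = h) : (mend22 t a s).Ok (h + 1) := by
  rcases s with s | s <;> rcases t with _ | _ | _ <;>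
  simp_all [mend22, Shrunk.Ok, BTree.height, BTree.Complete] <;> omega

theorem mend31_inorder (s : Shrunk) (a : ℕ) (t : BTree) (b : ℕ) (u : BTree) :
    (mend31 s a t b u).tree.inorder = s.tree.inorder ++ a :: (t.inorder ++ b :: u.inorder) := by
  rcases s with s | s <;> rcases t with _ | _ | _ <;>
  simp [mend31, Shrunk.tree, BTree.inorder]

theorem mend31_ok (s : Shrunk) (a : ℕ) (t : BTree) (b : ℕ) (u : BTree) {h : ℕ} (hs : s.Ok h)
    (ht : t.Complete) (ht' : t.height = h) (hu : u.Complete) (hu' : u.height = h) : (mend31 s a t b u).Ok (h + 1) := by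
  rcases s with s | s <;> rcases t with _ | _ | _ <;>
  simp_all [mend31, Shrunk.Ok, BTree.height, BTree.Complete] <;> omega

theorem mend32_inorder (t : BTree) (a : ℕ) (s : Shrunk) (b : ℕ) (u : BTree) :
    (mend32 t a s b u).tree.inorder = t.inorder ++ a :: (s.tree.inorder ++ b :: u.inorder) := by
  rcases s with s | s <;> rcases u with _ | _ | _ <;>
  simp [mend32, Shrunk.tree, BTree.inorder]

theorem mend32_ok (t : BTree) (a : ℕ) (s : Shrunk) (b : ℕ) (u : BTree) {h : ℕ} (hs : s.Ok h)
    (ht : t.Complete) (ht' : t.height = h) (hu : u.Complete) (hu' : u.height = h) : (mend32 t a s b u).Ok (h + 1) := by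
  rcases s with s | s <;> rcases u with _ | _ | _ <;>
  simp_all [mend32, Shrunk.Ok, BTree.height, BTree.Complete] <;> omega

theorem mend33_inorder (t : BTree) (a : ℕ) (u : BTree) (b : ℕ) (s : Shrunk) :
    (mend33 t a u b s).tree.inorder = t.inorder ++ a :: (u.inorder ++ b :: s.tree.inorder) := by
  rcases s with s | s <;> rcases u with _ | _ | _ <;>
  simp [mend33, Shrunk.tree, BTree.inorder]

theorem mend33_ok (t : BTree) (a : ℕ) (u : BTree) (b : ℕ) (s : Shrunk) {h : ℕ} (hs : s.Ok h)
    (ht : t.Complete) (ht' : t.height = h) (hu : u.Complete) (hu' : u.height = h) : (mend33 t a u b s).Ok (h + 1) := by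
  rcases s with s | s <;> rcases u with _ | _ | _ <;>
  simp_all [mend33, Shrunk.Ok, BTree.height, BTree.Complete] <;> omega

variable {σ : Type}

theorem ex_removeMin (t : BTree) (s : St σ) (ht : t.Complete) (hne : t ≠ .leaf) (k : ℕ) :
    ∃ y sh, ∃ n ≤ t.height, ex (removeMin t) (s.tk k).toM = ((y, sh), (s.tk (k + n)).toM) ∧
      t.inorder = y :: sh.tree.inorder ∧ sh.Ok t.height := by
  induction t generalizing k with
  | leaf => exact absurd rfl hne
  | node2 l a r ihl ihr =>
    obtain ⟨c1, c2, c3⟩ := ht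
    by_cases hl : l = .leaf
    · subst hl
      have hr := BTree.eq_leaf_of_height c3.symm
      subst hr
      refine ⟨a, .lower .leaf, 1, by simp [BTree.height], ?_, ?_, ?_⟩
      · simp only [removeMin, ex_bind, ex_tick, ex_pure, St.tk_tk]
      · simp [BTree.inorder, Shrunk.tree]
      · simp [Shrunk.Ok, BTree.height, BTree.Complete]
    · obtain ⟨y, sh, n, hn, h1, h2, h3⟩ := ihl c1 hl (k + 1)
      refine ⟨y, mend21 sh a r, n + 1, by simp only [BTree.height]; omega, ?_, ?_, ?_⟩
      -- The equation of the general case for two children, valid because the left child is not a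
      -- leaf; the patterns overlap.
      · rw [removeMin.eq_4 _ _ _ hl]
        simp only [ex_bind, ex_tick, ex_pure, St.tk_tk, h1]
        simp only [add_comm, add_left_comm]
      · rw [mend21_inorder, BTree.inorder, h2, List.cons_append]
      · have := mend21_ok sh a r h3 c2 c3.symm
        simpa [BTree.height, ← c3] using this
  | node3 l a m b r ihl ihm ihr =>
    obtain ⟨c1, c2, c3, c4, c5⟩ := ht
    by_cases hl : l = .leaf
    · subst hl
      have hm := BTree.eq_leaf_of_height c4.symm
      subst hm
      have hr := BTree.eq_leaf_of_height c5.symm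
      subst hr
      refine ⟨a, .same (.node2 .leaf b .leaf), 1, by simp [BTree.height], ?_, ?_, ?_⟩
      · simp only [removeMin, ex_bind, ex_tick, ex_pure, St.tk_tk]
      · simp [BTree.inorder, Shrunk.tree]
      · simp [Shrunk.Ok, BTree.height, BTree.Complete]
    · obtain ⟨y, sh, n, hn, h1, h2, h3⟩ := ihl c1 hl (k + 1)
      refine ⟨y, mend31 sh a m b r, n + 1, by simp only [BTree.height]; omega, ?_, ?_, ?_⟩
      · rw [removeMin.eq_5 _ _ _ _ _ hl]
        simp only [ex_bind, ex_tick, ex_pure, St.tk_tk, h1]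
        simp only [add_comm, add_left_comm]
      · rw [mend31_inorder, BTree.inorder, h2, List.cons_append]
      · have := mend31_ok sh a m b r h3 c2 c4.symm c3 (by omega)
        simpa [BTree.height, ← c4, ← c5] using this

theorem filter_ne_eq_self {l : List ℕ} {x : ℕ} (h : x ∉ l) : l.filter (fun y => y ≠ x) = l := by
  rw [List.filter_eq_self]
  intro y hy
  simp only [ne_eq, decide_eq_true_eq]
  rintro rfl
  exact h hy

variable [LinearOrder σ]

-- If x is met in an inner node above the lowest level, it is replaced by the least entry of the
-- subtree to its right, so the search path continues down that subtree and the cost stays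
-- proportional to the height.
set_option maxHeartbeats 1000000 in
theorem ex_deleteRec (τ x : ℕ) (r : ℕ → ℕ) (t : BTree) (s : St σ) (ht : t.Complete)
    (hsort : t.inorder.Pairwise (fun a b => r a < r b)) (hk : s.Compares r x t.inorder) (k : ℕ) :
    ∃ sh, ∃ n ≤ (2 * τ + 5) * (t.height + 1), ex (deleteRec τ x t) (s.tk k).toM =
      (sh, (s.tk (k + n)).toM) ∧
      sh.tree.inorder = t.inorder.filter (fun y => y ≠ x) ∧ sh.Ok t.height := by
  induction t generalizing k with
  | leaf =>
    refine ⟨.same .leaf, 1, by simp [BTree.height], ?_, ?_, ?_⟩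
    · simp only [deleteRec, ex_bind, ex_tick, ex_pure, St.tk_tk]
    · simp [Shrunk.tree, BTree.inorder]
    · simp [Shrunk.Ok, BTree.height, BTree.Complete]
  | node2 l a q ihl ihr =>
    obtain ⟨c1, c2, c3⟩ := ht
    have hB : BTree.height (.node2 l a q) = q.height + 1 := by simp only [BTree.height]; omega
    rw [hB] at *
    rw [c3] at ihl
    -- This absorbs the cost of `removeMin`, one step for each level.
    have hlin : q.height + 1 ≤ (2 * τ + 5) * (q.height + 1) :=
      Nat.le_mul_of_pos_left _ (by omega)
    rw [Nat.mul_add _ (q.height + 1), Nat.mul_one]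
    simp only [BTree.inorder, List.pairwise_append, List.pairwise_cons, List.mem_cons] at hsort
    by_cases hleaf : l = .leaf
    · subst hleaf
      have hr := BTree.eq_leaf_of_height c3.symm
      subst hr
      by_cases hxa : x = a
      · subst hxa
        refine ⟨.lower .leaf, 1, by omega, ?_, ?_, ?_⟩
        · simp only [deleteRec, ex_bind, ex_tick, ex_pure, St.tk_tk, if_true]
        · simp [BTree.inorder, Shrunk.tree]
        · simp [Shrunk.Ok, BTree.height, BTree.Complete]
      · refine ⟨.same (.node2 .leaf a .leaf), 1, by omega, ?_, ?_, ?_⟩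
        · simp only [deleteRec, ex_bind, ex_tick, ex_pure, St.tk_tk, if_neg hxa]
        · simp [BTree.inorder, Shrunk.tree, Ne.symm hxa]
        · simp [Shrunk.Ok, BTree.height, BTree.Complete]
    · have hqleaf : q ≠ .leaf := by
        rintro rfl; exact hleaf (BTree.eq_leaf_of_height c3)
      rw [deleteRec.eq_4 _ _ _ _ _ hleaf]
      simp only [BTree.inorder, List.filter_append, List.filter_cons]
      by_cases hxa : x = a
      · subst hxa
        -- The entry y moves into the place of x; as it was the next one after x, the list of
        -- entries only loses x.
        obtain ⟨y, sh, n, hn, h1, h2, h3⟩ := ex_removeMin q s c2 hqleaf (k + 1)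
        have hxl : x ∉ l.inorder := fun h => lt_irrefl _ (hsort.2.2 x h x (by simp))
        have hxq : x ∉ q.inorder := fun h => lt_irrefl _ (hsort.2.1.1 x h)
        refine ⟨mend22 l y sh, n + 1, by omega, ?_, ?_, ?_⟩
        · simp only [ex_bind, ex_tick, ex_pure, St.tk_tk, if_true, h1]
          simp only [add_comm, add_left_comm]
        · rw [mend22_inorder, ← h2, filter_ne_eq_self hxl, filter_ne_eq_self hxq]
          simp
        · exact mend22_ok l y sh h3 c1 c3
      · obtain ⟨n1, hn1, h1⟩ := ex_keyLess_tk τ x a s (k + 1)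
        have hka := hk a (by simp [BTree.inorder]) (Ne.symm hxa)
        simp only [ex_bind, ex_tick, St.tk_tk, if_neg hxa, h1]
        have hxa' : decide (a ≠ x) = true := by simpa using Ne.symm hxa
        simp only [hxa', if_true]
        rcases hka with ⟨hka, hra⟩ | ⟨hka, hra⟩
        · obtain ⟨sh, n2, hn2, h2, h3, h4⟩ := ihl c1 hsort.1
            (fun y hy => hk y (by simp [BTree.inorder, hy])) (k + 1 + n1)
          have hxq : x ∉ q.inorder := fun h => lt_asymm hra (hsort.2.1.1 x h)
          refine ⟨mend21 sh a q, 1 + n1 + n2, by omega, ?_, ?_, ?_⟩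
          · simp only [hka, decide_true, if_true, ex_bind, h2, ex_pure]
            simp only [add_assoc]
          · rw [mend21_inorder, h3, filter_ne_eq_self hxq]
          · exact mend21_ok sh a q h4 c2 rfl
        · obtain ⟨sh, n2, hn2, h2, h3, h4⟩ := ihr c2 hsort.2.1.2
            (fun y hy => hk y (by simp [BTree.inorder, hy])) (k + 1 + n1)
          have hxl : x ∉ l.inorder := fun h => lt_asymm hra (hsort.2.2 x h a (by simp))
          refine ⟨mend22 l a sh, 1 + n1 + n2, by omega, ?_, ?_, ?_⟩
          · simp only [hka, decide_false, Bool.false_eq_true, if_false, ex_bind, h2,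
              ex_pure]
            simp only [add_assoc]
          · rw [mend22_inorder, h3, filter_ne_eq_self hxl]
          · exact mend22_ok l a sh h4 c1 c3
  | node3 l a m b q ihl ihm ihr =>
    obtain ⟨c1, c2, c3, c4, c5⟩ := ht
    have hB : BTree.height (.node3 l a m b q) = q.height + 1 := by simp only [BTree.height]; omega
    have hl : l.height = q.height := by omega
    rw [hB] at *
    rw [hl] at ihl
    rw [c5] at ihm
    have hlin : q.height + 1 ≤ (2 * τ + 5) * (q.height + 1) :=
      Nat.le_mul_of_pos_left _ (by omega)
    rw [Nat.mul_add _ (q.height + 1), Nat.mul_one]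
    simp only [BTree.inorder, List.pairwise_append, List.pairwise_cons, List.mem_cons,
      List.mem_append] at hsort
    obtain ⟨s1, ⟨s2, s3, ⟨s4, s5⟩, s6⟩, s7⟩ := hsort
    by_cases hleaf : l = .leaf
    · subst hleaf
      have hr := BTree.eq_leaf_of_height hl.symm
      subst hr
      have hm := BTree.eq_leaf_of_height c5
      subst hm
      have hab : a ≠ b := fun e => by
        have := s2 b (by simp); rw [e] at this; exact lt_irrefl _ this
      by_cases hxa : x = a
      · subst hxa
        refine ⟨.same (.node2 .leaf b .leaf), 1, by omega, ?_, ?_, ?_⟩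
        · simp only [deleteRec, ex_bind, ex_tick, ex_pure, St.tk_tk, if_true]
        · simp [BTree.inorder, Shrunk.tree, hab.symm]
        · simp [Shrunk.Ok, BTree.height, BTree.Complete]
      · by_cases hxb : x = b
        · subst hxb
          refine ⟨.same (.node2 .leaf a .leaf), 1, by omega, ?_, ?_, ?_⟩
          · simp only [deleteRec, ex_bind, ex_tick, ex_pure, St.tk_tk, if_true, if_neg hxa]
          · simp [BTree.inorder, Shrunk.tree, hab]
          · simp [Shrunk.Ok, BTree.height, BTree.Complete]
        · refine ⟨.same (.node3 .leaf a .leaf b .leaf), 1, by omega, ?_, ?_, ?_⟩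
          · simp only [deleteRec, ex_bind, ex_tick, ex_pure, St.tk_tk, if_neg hxa, if_neg hxb]
          · simp [BTree.inorder, Shrunk.tree, Ne.symm hxa, Ne.symm hxb]
          · simp [Shrunk.Ok, BTree.height, BTree.Complete]
    · have hqleaf : q ≠ .leaf := by
        rintro rfl; exact hleaf (BTree.eq_leaf_of_height hl)
      have hmleaf : m ≠ .leaf := by
        rintro rfl; exact hleaf (BTree.eq_leaf_of_height c4)
      rw [deleteRec.eq_5 _ _ _ _ _ _ _ hleaf]
      simp only [BTree.inorder, List.filter_append, List.filter_cons]
      by_cases hxa : x = a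
      · subst hxa
        obtain ⟨y, sh, n, hn, h1, h2, h3⟩ := ex_removeMin m s c2 hmleaf (k + 1)
        rw [c5] at h3 hn
        have hxl : x ∉ l.inorder := fun h => lt_irrefl _ (s7 x h x (by simp))
        have hxm : x ∉ m.inorder := fun h => lt_irrefl _ (s2 x (by simp [h]))
        have hxq : x ∉ q.inorder := fun h => lt_irrefl _ (s2 x (by simp [h]))
        have hxb : b ≠ x := by
          rintro rfl; exact lt_irrefl _ (s2 b (by simp))
        refine ⟨mend32 l y sh b q, n + 1, by omega, ?_, ?_, ?_⟩
        · simp only [ex_bind, ex_tick, ex_pure, St.tk_tk, if_true, h1]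
          simp only [add_comm, add_left_comm]
        · rw [mend32_inorder, filter_ne_eq_self hxl, filter_ne_eq_self hxm, filter_ne_eq_self hxq, h2]
          simp [hxb]
        · exact mend32_ok l y sh b q h3 c1 hl c3 rfl
      · have hxa' : decide (a ≠ x) = true := by simpa using Ne.symm hxa
        simp only [hxa', if_true]
        by_cases hxb : x = b
        · subst hxb
          obtain ⟨y, sh, n, hn, h1, h2, h3⟩ := ex_removeMin q s c3 hqleaf (k + 1)
          have hxl : x ∉ l.inorder := fun h => lt_irrefl _ (s7 x h x (by simp))
          have hxm : x ∉ m.inorder := fun h => lt_irrefl _ (s6 x h x (by simp))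
          have hxq : x ∉ q.inorder := fun h => lt_irrefl _ (s4 x h)
          refine ⟨mend33 l a m y sh, n + 1, by omega, ?_, ?_, ?_⟩
          · simp only [ex_bind, ex_tick, ex_pure, St.tk_tk, if_true, h1, if_neg hxa]
            simp only [add_comm, add_left_comm]
          · rw [mend33_inorder, filter_ne_eq_self hxl, filter_ne_eq_self hxm, filter_ne_eq_self hxq,
              h2]
            simp
          · exact mend33_ok l a m y sh h3 c1 hl c2 c5
        · have hxb' : decide (b ≠ x) = true := by simpa using Ne.symm hxb
          simp only [hxb', if_true]
          obtain ⟨n1, hn1, h1⟩ := ex_keyLess_tk τ x a s (k + 1)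
          obtain ⟨n0, hn0, h0⟩ := ex_keyLess_tk τ x b s (k + 1 + n1)
          have hka := hk a (by simp [BTree.inorder]) (Ne.symm hxa)
          have hkb := hk b (by simp [BTree.inorder]) (Ne.symm hxb)
          have hrab := s2 b (by simp)
          simp only [ex_bind, ex_tick, St.tk_tk, if_neg hxa, if_neg hxb, h1]
          rcases hka with ⟨hka, hra⟩ | ⟨hka, hra⟩
          · obtain ⟨sh, n2, hn2, h2, h3, h4⟩ := ihl c1 s1
              (fun y hy => hk y (by simp [BTree.inorder, hy])) (k + 1 + n1)
            have hxm : x ∉ m.inorder := fun h => lt_asymm hra (s2 x (by simp [h]))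
            have hxq : x ∉ q.inorder := fun h => lt_asymm hra (s2 x (by simp [h]))
            refine ⟨mend31 sh a m b q, 1 + n1 + n2, by omega, ?_, ?_, ?_⟩
            · simp only [hka, decide_true, if_true, ex_bind, h2, ex_pure]
              simp only [add_assoc]
            · rw [mend31_inorder, h3, filter_ne_eq_self hxm, filter_ne_eq_self hxq]
            · exact mend31_ok sh a m b q h4 c2 c5 c3 rfl
          · have hxl : x ∉ l.inorder := fun h => lt_asymm hra (s7 x h a (by simp))
            simp only [hka, decide_false, Bool.false_eq_true, if_false, ex_bind, h0]
            rcases hkb with ⟨hkb, hrb⟩ | ⟨hkb, hrb⟩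
            · obtain ⟨sh, n2, hn2, h2, h3, h4⟩ := ihm c2 s3
                (fun y hy => hk y (by simp [BTree.inorder, hy])) (k + 1 + n1 + n0)
              have hxq : x ∉ q.inorder := fun h => lt_asymm hrb (s4 x h)
              refine ⟨mend32 l a sh b q, 1 + n1 + n0 + n2, by omega, ?_, ?_, ?_⟩
              · simp only [hkb, decide_true, if_true, ex_bind, h2, ex_pure]
                simp only [add_assoc]
              · rw [mend32_inorder, h3, filter_ne_eq_self hxl, filter_ne_eq_self hxq]
              · exact mend32_ok l a sh b q h4 c1 hl c3 rfl
            · obtain ⟨sh, n2, hn2, h2, h3, h4⟩ := ihr c3 s5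
                (fun y hy => hk y (by simp [BTree.inorder, hy])) (k + 1 + n1 + n0)
              have hxm : x ∉ m.inorder := fun h => lt_asymm hrb (s6 x h b (by simp))
              refine ⟨mend33 l a m b sh, 1 + n1 + n0 + n2, by omega, ?_, ?_, ?_⟩
              · simp only [hkb, decide_false, Bool.false_eq_true, if_false, ex_bind, h2,
                  ex_pure]
                simp only [add_assoc]
              · rw [mend33_inorder, h3, filter_ne_eq_self hxl, filter_ne_eq_self hxm]
              · exact mend33_ok l a m b sh h4 c1 hl c2 c5

theorem ex_treeDelete (τ x : ℕ) (r : ℕ → ℕ) (s : St σ) (ht : s.btree.Complete)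
    (hsort : s.btree.inorder.Pairwise (fun a b => r a < r b))
    (hk : s.Compares r x s.btree.inorder) :
    ∃ t, ∃ n ≤ (2 * τ + 5) * (s.btree.height + 1) + 2, ex (treeDelete τ x) s.toM =
      ((), ({s with btree := t, steps := s.steps + n} : St σ).toM) ∧
      t.inorder = s.btree.inorder.filter (fun y => y ≠ x) ∧ t.Complete := by
  obtain ⟨sh, n, hn, h1, h2, h3⟩ := ex_deleteRec τ x r s.btree s ht hsort hk 1
  have e : ex (readReg (fun m : Machine σ => m.btree)) s.toM = (s.btree, (s.tk 1).toM) := rfl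
  refine ⟨sh.tree, n + 2, by omega, ?_, h2, h3.complete⟩
  simp only [treeDelete, ex_bind, e, h1, ex_setBTree]
  simp only [St.tk]
  rw [show s.steps + (1 + n) + 1 = s.steps + (n + 2) by omega]

end Deletion


/-! ### Translation between DBWTs and node lists. -/

section Prefixes

variable {len : ℕ → ℕ} {l : List ℕ}

theorem off_getElem (hl : l.Nodup) {i : ℕ} (hi : i < l.length) :
    off len l l[i] = tot len (l.take i) := by
  have key : ∀ (A B : List ℕ) (x : ℕ), (A ++ x :: B).Nodup →
      off len (A ++ x :: B) x = tot len A := by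
    intro A B x h
    have h2 : x ∉ A := fun h3 => (List.nodup_append.1 h).2.2 _ h3 _ (by simp) rfl
    simp only [off_append_right h2, off]
    simp
  have := key (l.take i) (l.drop (i + 1)) l[i] (by simpa using hl)
  simpa using this

theorem tot_take_succ {i : ℕ} (hi : i < l.length) :
    tot len (l.take (i + 1)) = tot len (l.take i) + len l[i] := by
  rw [List.take_succ_eq_append_getElem hi, tot_append]
  simp [tot]

end Prefixes

section Translation

variable {σ : Type} [LinearOrder σ] [OrderBot σ] {S : List σ}

namespace DBWT

variable (D : DBWT S)

theorem vOrder_perm : D.vOrder.Perm (List.finRange D.k) := List.mergeSort_perm _ _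

theorem vOrder_nodup : D.vOrder.Nodup := D.vOrder_perm.nodup_iff.2 (List.nodup_finRange _)

theorem mem_vOrder (i : Fin D.k) : i ∈ D.vOrder := D.vOrder_perm.mem_iff.2 (List.mem_finRange i)

theorem vOrder_pairwise : D.vOrder.Pairwise (fun i j => D.fStart i ≤ D.fStart j) := by
  have := List.pairwise_mergeSort (le := fun i j : Fin D.k => decide (D.fStart i ≤ D.fStart j))
    (fun a b c => by simpa using le_trans) (fun a b => by simpa using le_total _ _)
    (List.finRange D.k)
  exact this.imp (by simp)

end DBWT

/-- The nodes of a DBWT and their addresses in the lists `U` and `V`. -/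
structure Matches (D : DBWT S) (a : Fin D.k → ℕ) (U V : List ℕ) (len : ℕ → ℕ) : Prop where
  inj : Function.Injective a
  U_eq : U = D.uOrder.map a
  V_eq : V = D.vOrder.map a
  len_eq : ∀ i, D.p i.succ - D.p i.castSucc = len (a i)
  lStart : ∀ i, D.lStart i = off len U (a i)
  fStart : ∀ i, D.fStart i = off len V (a i)

theorem DBWT.p_lt_succ (D : DBWT S) (i : Fin D.k) : D.p i.castSucc < D.p i.succ :=
  D.p_strictMono Fin.castSucc_lt_succ

/-- The nodes of a DBWT at given addresses. -/
theorem DBWT.matches_layout (D : DBWT S) (hS : IsText S) {a : Fin D.k → ℕ}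
    (hinj : Function.Injective a) {ch : ℕ → σ} {len : ℕ → ℕ}
    (hlen : ∀ i, D.p i.succ - D.p i.castSucc = len (a i))
    (hch : ∀ i, (bwt S).getD (D.lStart i) ⊥ = ch (a i)) :
    Matches D a (D.uOrder.map a) (D.vOrder.map a) len ∧
      Layout S (D.uOrder.map a) (D.vOrder.map a) ch len := by
  set U := D.uOrder.map a with hU
  set V := D.vOrder.map a with hV
  have hUl : U.length = D.k := by simp [hU, DBWT.uOrder]
  have hUn : U.Nodup := (List.nodup_finRange _).map hinj
  have hVU : V.Perm U := D.vOrder_perm.map a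
  have hUi : ∀ i : Fin D.k, U[(i : ℕ)]'(by rw [hUl]; exact i.2) = a i := by
    intro i; simp [hU, DBWT.uOrder]
  have hmem : ∀ x, x ∈ U ↔ ∃ i, a i = x := by intro x; simp [hU, DBWT.uOrder]
  -- The division points are the partial sums of the lengths of the repetitions.
  have hp : ∀ (n : ℕ) (hn : n < D.k + 1), D.p ⟨n, hn⟩ = tot len (U.take n) := by
    intro n
    induction n with
    | zero => intro _; simpa [tot] using D.p_zero
    | succ n ih =>
      intro hn
      have hn' : n < D.k := by omega
      rw [tot_take_succ (by omega), ← ih (by omega)]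
      have h1 := hlen ⟨n, hn'⟩
      have h2 := D.p_lt_succ ⟨n, hn'⟩
      rw [hUi ⟨n, hn'⟩, ← h1]
      simp only [Fin.succ_mk, Fin.castSucc_mk] at h2 ⊢
      omega
  have hl : ∀ i, D.lStart i = off len U (a i) := by
    intro i
    rw [← hUi i, off_getElem hUn]
    exact hp i (by omega)
  have htot : tot len U = S.length := by
    rw [← D.p_last]
    have := hp D.k (by omega)
    rw [List.take_of_length_le hUl.le] at this
    rw [← this]
    rfl
  have hpos : ∀ x ∈ U, 0 < len x := by
    intro x hx
    obtain ⟨i, rfl⟩ := (hmem x).1 hx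
    rw [← hlen i]
    have := D.p_lt_succ i
    omega
  have hb : ∀ i, ∀ t < len (a i), (bwt S).getD (D.lStart i + t) ⊥ = ch (a i) := by
    intro i t ht
    rw [← hlen i] at ht
    rw [← hch i, List.getD_eq_getElem?_getD, List.getD_eq_getElem?_getD,
      D.repetition i (D.lStart i + t) (by simp [DBWT.lStart]) (by simp only [DBWT.lStart]; omega)]
    rfl
  -- Inside a repetition LF increases by one at each step, so a repetition is mapped onto its
  -- F-interval by a translation.
  have hLF : ∀ i, ∀ t < len (a i), LF S (D.lStart i + t) = D.fStart i + t := by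
    intro i t
    induction t with
    | zero => intro _; rfl
    | succ t ih =>
      intro ht
      have h1 := off_add_le (len := len) ((hmem _).2 ⟨i, rfl⟩ : a i ∈ U)
      rw [htot, ← hl i] at h1
      rw [← add_assoc, LF_succ hS (by omega), ih (by omega), add_assoc]
      rw [hb i t (by omega), add_assoc, hb i (t + 1) ht]
  -- F-intervals sorted by their starts are disjoint: a start inside another F-interval would be an
  -- LF value of two different positions.
  have hVp : V.Pairwise (fun x y => LF S (off len U x) + len x ≤ LF S (off len U y)) := by
    rw [hV, List.pairwise_map]
    refine (D.vOrder_pairwise.and D.vOrder_nodup).imp ?_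
    rintro i j ⟨h1, h2⟩
    rw [← hl, ← hl]
    change D.fStart i + len (a i) ≤ D.fStart j
    by_contra hc
    have h3 := hLF i (D.fStart j - D.fStart i) (by omega)
    rw [show D.fStart i + (D.fStart j - D.fStart i) = D.fStart j by omega] at h3
    have hai : a i ∈ U := (hmem _).2 ⟨i, rfl⟩
    have haj : a j ∈ U := (hmem _).2 ⟨j, rfl⟩
    have h4 := off_add_le (len := len) hai
    have h5 := off_add_le (len := len) haj
    rw [htot, ← hl] at h4 h5
    have h6 := LF_inj (by omega) (by have := hpos _ haj; omega)
      (h3 : _ = LF S (D.lStart j))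
    rw [hl, hl] at h6
    have h7 := eq_of_off_add_eq (t := 0) hai haj (by omega) (hpos _ haj) h6
    exact h2 (hinj h7)
  -- Surjectivity of LF makes the F-intervals cover all positions, so they tile and their starts are
  -- partial sums.
  have hf : ∀ i, D.fStart i = off len V (a i) := by
    intro i
    have := eq_off_of_tiling (len := len) (s := fun x => LF S (off len U x)) (m := 0)
      (n := S.length) (a := a i) hVp (fun x hx => hpos x (hVU.mem_iff.1 hx)) (by simp) ?_ ?_
      (hVU.mem_iff.2 ((hmem _).2 ⟨i, rfl⟩))
    · rw [zero_add] at this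
      rw [← this, ← hl]; rfl
    · intro x hx
      obtain ⟨j, rfl⟩ := (hmem x).1 (hVU.mem_iff.1 hx)
      have haj : a j ∈ U := (hmem _).2 ⟨j, rfl⟩
      have h1 := hLF j (len (a j) - 1) (by have := hpos _ haj; omega)
      have h5 := off_add_le (len := len) haj
      have := hpos _ haj
      rw [htot, ← hl] at h5
      have h6 := LF_lt (S := S) (r := D.lStart j + (len (a j) - 1)) (by omega)
      rw [← hl]
      change D.fStart j + _ ≤ _
      omega
    · intro r _ hr
      obtain ⟨w, hw, rfl⟩ := exists_LF hr
      rw [← htot] at hw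
      obtain ⟨x, hx, h1, h2⟩ := exists_off hUn hw
      obtain ⟨j, rfl⟩ := (hmem x).1 hx
      refine ⟨a j, hVU.mem_iff.2 hx, ?_⟩
      rw [← hl] at h1 h2
      have h3 := hLF j (w - D.lStart j) (by omega)
      rw [show D.lStart j + (w - D.lStart j) = w by omega] at h3
      rw [h3, ← hl]
      change D.fStart j ≤ _ ∧ _ < D.fStart j + _
      omega
  refine ⟨⟨hinj, hU, hV, hlen, hl, hf⟩, ⟨hUn, hVU, hpos, htot, ?_, ?_⟩⟩
  · intro x hx t ht
    obtain ⟨i, rfl⟩ := (hmem x).1 hx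
    rw [← hl]; exact hb i t ht
  · intro x hx t ht
    obtain ⟨i, rfl⟩ := (hmem x).1 hx
    rw [← hl, ← hf]; exact hLF i t ht

/-- The DBWT with given nodes. -/
theorem Layout.exists_matches {U V : List ℕ} {ch : ℕ → σ} {len : ℕ → ℕ}
    (h : Layout S U V ch len) : ∃ (D : DBWT S) (a : Fin D.k → ℕ), Matches D a U V len := by
  have hp : ∀ i (hi : i < U.length), off len U U[i] = tot len (U.take i) := fun i hi =>
    off_getElem h.nodupU hi
  let D : DBWT S :=
    { k := U.length
      p := fun i => tot len (U.take i)
      p_zero := by simp [tot]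
      p_last := by simpa using h.total
      p_strictMono := by
        rw [Fin.strictMono_iff_lt_succ]
        intro i
        have := tot_take_succ (len := len) i.2
        have := h.pos U[i] (List.getElem_mem _)
        simp only [Fin.val_castSucc, Fin.val_succ]
        simp only [Fin.getElem_fin] at this
        omega
      repetition := by
        intro i x hx hx'
        have h1 := tot_take_succ (len := len) i.2
        have h2 := h.pos U[i] (List.getElem_mem _)
        simp only [Fin.getElem_fin, Fin.val_castSucc, Fin.val_succ] at *
        have h3 := h.bwt _ (List.getElem_mem i.2) (x - tot len (U.take i)) (by omega)
        have h4 := h.bwt _ (List.getElem_mem i.2) 0 (by omega)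
        have h5 := h.off_lt (List.getElem_mem i.2) (t := x - tot len (U.take i)) (by omega)
        rw [hp] at h3 h4 h5
        rw [show tot len (U.take i) + (x - tot len (U.take i)) = x by omega] at h3 h5
        rw [← length_bwt] at h5
        rw [List.getD_eq_getElem _ _ h5] at h3
        rw [add_zero, List.getD_eq_getElem _ _ (by omega)] at h4
        rw [List.getElem?_eq_getElem h5, List.getElem?_eq_getElem (by omega), h3, h4] }
  have hl : ∀ i : Fin D.k, D.lStart i = off len U U[i] := fun i => (hp i i.2).symm
  have hf : ∀ i : Fin D.k, D.fStart i = off len V U[i] := fun i => by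
    rw [DBWT.fStart, hl i]; exact h.LF' (List.getElem_mem i.2)
  have hinj : Function.Injective (fun i : Fin D.k => U[i]) := by
    intro i j hij
    ext
    exact (h.nodupU.getElem_inj_iff).1 hij
  have hU : U = D.uOrder.map (fun i => U[i]) := by
    apply List.ext_getElem
    · simp [DBWT.uOrder, D]
    · intro n h1 h2
      simp [DBWT.uOrder]
  refine ⟨D, fun i => U[i], hinj, hU, ?_, ?_, hl, hf⟩
  -- Two permutations of the same nodes that are both sorted by the injective starting position
  -- coincide.
  · apply List.Perm.eq_of_pairwise (le := fun x y => off len V x ≤ off len V y)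
    · intro x y hx hy h1 h2
      obtain ⟨i, -, rfl⟩ := List.mem_map.1 hy
      exact off_inj h.posV hx (h.perm.mem_iff.2 (List.getElem_mem _)) (le_antisymm h1 h2)
    · exact (pairwise_off h.nodupV h.posV).imp le_of_lt
    · rw [List.pairwise_map]
      exact D.vOrder_pairwise.imp fun hij => by rwa [hf, hf] at hij
    · refine h.perm.trans ?_
      conv_lhs => rw [hU]
      exact (D.vOrder_perm.map _).symm
  · intro i
    have := tot_take_succ (len := len) i.2
    simp only [D, Fin.val_succ, Fin.val_castSucc] at this ⊢
    rw [this]; simp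

end Translation


/-! ### One notion for the directed edges of both kinds. -/

/-- The directed edges from the nodes `N` to the nodes `K`: the edge from `y` leads to the interval
(with starting position `base` and length `len`) that contains the starting position `pos y`, and its
label is the offset; `first k` is the first node whose edge leads to `k`. -/
structure Half (N K : List ℕ) (pos base len e b : ℕ → ℕ) (first : ℕ → Option ℕ) : Prop where
  mem : ∀ y ∈ N, e y ∈ K
  eq : ∀ y ∈ N, base (e y) + b y = pos y
  lt : ∀ y ∈ N, b y < len (e y)
  none : ∀ k ∈ K, first k = none → ∀ y ∈ N, e y ≠ k
  some : ∀ k ∈ K, ∀ y, first k = some y → y ∈ N ∧ e y = k ∧ ∀ w ∈ N, e w = k → pos y ≤ pos w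

section Halves

/-- In a list sorted by f, the first hit has the least value of f among all hits. -/
theorem find?_eq_some_iff_pos {β : Type} {l : List β} {p : β → Bool} {f : β → ℕ}
    (hs : l.Pairwise (fun i j => f i < f j)) {y : β} (h : l.find? p = some y) :
    y ∈ l ∧ p y ∧ ∀ w ∈ l, p w → f y ≤ f w := by
  induction l with
  | nil => simp at h
  | cons c l ih =>
    rw [List.pairwise_cons] at hs
    by_cases hp : p c
    · simp only [List.find?_cons_of_pos hp, Option.some.injEq] at h
      subst h
      refine ⟨by simp, hp, fun w hw _ => ?_⟩
      rcases List.mem_cons.1 hw with rfl | hw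
      · rfl
      · exact (hs.1 w hw).le
    · rw [List.find?_cons_of_neg hp] at h
      obtain ⟨h1, h2, h3⟩ := ih hs.2 h
      refine ⟨by simp [h1], h2, fun w hw hw' => ?_⟩
      rcases List.mem_cons.1 hw with rfl | hw
      · exact absurd hw' hp
      · exact h3 w hw hw'

variable {k : ℕ} {a : Fin k → ℕ} {l : List (Fin k)} {N : List ℕ} {pos base len e b : ℕ → ℕ}
  {first : ℕ → Option ℕ} {R : Fin k → Fin k → Prop} [DecidableRel R]

/-- By the last two hypotheses each source is covered by exactly one target, so that "edge" and
"covers" determine each other. It is used once for `E_L` and once for `E_F`. -/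
theorem half_iff (hinj : Function.Injective a) (hl : ∀ i, i ∈ l)
    (hs : l.Pairwise (fun i j => pos (a i) < pos (a j))) (hN : ∀ x, x ∈ N ↔ ∃ i, a i = x)
    (hR : ∀ i j, R i j ↔ base (a j) ≤ pos (a i) ∧ pos (a i) < base (a j) + len (a j))
    (hex : ∀ i, ∃ j, R i j) (huniq : ∀ i j j', R i j → R i j' → j = j') :
    ((∀ i j, R i j ↔ e (a i) = a j) ∧ (∀ i j, R i j → b (a i) = pos (a i) - base (a j)) ∧
      ∀ j, first (a j) = (l.find? (fun i => decide (R i j))).map a) ↔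
    Half N N pos base len e b first := by
  constructor
  · rintro ⟨h1, h2, h3⟩
    have key : ∀ y ∈ N, ∃ i j, a i = y ∧ R i j ∧ e y = a j := by
      intro y hy
      obtain ⟨i, rfl⟩ := (hN y).1 hy
      obtain ⟨j, hj⟩ := hex i
      exact ⟨i, j, rfl, hj, (h1 i j).1 hj⟩
    refine ⟨?_, ?_, ?_, ?_, ?_⟩
    · intro y hy
      obtain ⟨i, j, rfl, hj, he⟩ := key y hy
      exact (hN _).2 ⟨j, he.symm⟩
    · intro y hy
      obtain ⟨i, j, rfl, hj, he⟩ := key y hy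
      have := (hR i j).1 hj
      rw [he, h2 i j hj]; omega
    · intro y hy
      obtain ⟨i, j, rfl, hj, he⟩ := key y hy
      have := (hR i j).1 hj
      rw [he, h2 i j hj]; omega
    · intro x hx hf y hy he
      obtain ⟨j, rfl⟩ := (hN x).1 hx
      obtain ⟨i, j', rfl, hj, he'⟩ := key y hy
      obtain rfl := hinj (he'.symm.trans he)
      rw [h3, Option.map_eq_none_iff, List.find?_eq_none] at hf
      exact hf i (hl i) (by simpa using hj)
    · intro x hx y hf
      obtain ⟨j, rfl⟩ := (hN x).1 hx
      rw [h3, Option.map_eq_some_iff] at hf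
      obtain ⟨i, hf, rfl⟩ := hf
      obtain ⟨-, h5, h6⟩ := find?_eq_some_iff_pos hs hf
      refine ⟨(hN _).2 ⟨i, rfl⟩, (h1 i j).1 (by simpa using h5), fun w hw he => ?_⟩
      obtain ⟨i', rfl⟩ := (hN w).1 hw
      exact h6 i' (hl i') (by simpa using (h1 i' j).2 he)
  · intro h
    have h1 : ∀ i j, R i j ↔ e (a i) = a j := by
      intro i j
      have hi := (hN (a i)).2 ⟨i, rfl⟩
      obtain ⟨j', hj'⟩ := (hN _).1 (h.mem _ hi)
      have e1 := h.eq _ hi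
      have e2 := h.lt _ hi
      have hR' : R i j' := (hR i j').2 (by rw [hj']; omega)
      constructor
      · intro hj
        rw [huniq i j j' hj hR', hj']
      · intro he
        rw [he] at hj'
        rwa [← hinj hj']
    refine ⟨h1, fun i j hj => ?_, fun j => ?_⟩
    · have := h.eq (a i) ((hN _).2 ⟨i, rfl⟩)
      rw [(h1 i j).1 hj] at this
      omega
    · have hj := (hN (a j)).2 ⟨j, rfl⟩
      rcases hf : first (a j) with _ | y
      · rw [eq_comm, Option.map_eq_none_iff, List.find?_eq_none]
        intro i _ hi
        exact h.none _ hj hf (a i) ((hN _).2 ⟨i, rfl⟩) ((h1 i j).1 (by simpa using hi))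
      · obtain ⟨h4, h5, h6⟩ := h.some _ hj y hf
        obtain ⟨i, rfl⟩ := (hN y).1 h4
        rcases hg : l.find? (fun i => decide (R i j)) with _ | i'
        · rw [List.find?_eq_none] at hg
          exact absurd ((h1 i j).2 h5) (by simpa using hg i (hl i))
        · obtain ⟨g1, g2, g3⟩ := find?_eq_some_iff_pos hs hg
          have g4 := g3 i (hl i) (by simpa using (h1 i j).2 h5)
          have g5 := h6 (a i') ((hN _).2 ⟨i', rfl⟩) ((h1 i' j).1 (by simpa using g2))
          -- Each of the two nodes is a first one, so they start at the same position, and the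
          -- starts in a sorted list are distinct.
          have : i = i' := by
            by_contra hne
            exact List.Pairwise.forall_of_forall_of_flip (l := l)
              (R := fun i j => i ≠ j → pos (a i) ≠ pos (a j)) (fun x _ h => absurd rfl h)
              (hs.imp fun h _ => h.ne) (hs.imp fun h _ => h.ne') (hl i) (hl i') hne (by omega)
          simp [this]

end Halves

/-! ### Equivalence of the given notion of a stored graph with the one on node lists. -/

section Bridge

variable {σ : Type} [LinearOrder σ] [OrderBot σ] {S : List σ}

/-- The state `s` stores the graph and the lists of the nodes `U` and `V`. -/
structure Stored (S : List σ) (U V : List ℕ) (s : St σ) : Prop where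
  layout : Layout S U V s.ch s.len
  alloc : ∀ x ∈ U, x < s.fresh
  dllU : DLL s.uPrev s.uNext s.uHead s.uTail U
  dllV : DLL s.vPrev s.vNext s.vHead s.vTail V
  halfL : Half U U (off s.len U) (off s.len V) s.len s.eL s.bL s.inV
  halfF : Half U U (off s.len V) (off s.len U) s.len s.eF s.bF s.inU
  order : s.order = U
  dollar_mem : s.dollar ∈ U
  dollar_ch : s.ch s.dollar = ⊥

variable {D : DBWT S} {a : Fin D.k → ℕ} {U V : List ℕ} {s : St σ}

namespace Matches

section

variable {ch : ℕ → σ} {len : ℕ → ℕ}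

theorem mem_U (M : Matches D a U V len) (x : ℕ) : x ∈ U ↔ ∃ i, a i = x := by
  rw [M.U_eq]; simp [DBWT.uOrder]

theorem BU (M : Matches D a U V len) (L : Layout S U V ch len) (i : Fin D.k) :
    D.graph.BU i = (ch (a i), len (a i)) := by
  simp only [DBWT.graph, M.len_eq, M.lStart, L.bwt' ((M.mem_U _).2 ⟨i, rfl⟩)]

theorem fEnd (M : Matches D a U V len) (L : Layout S U V ch len) (i : Fin D.k) :
    D.fEnd i + 1 = off len V (a i) + len (a i) := by
  have hi := (M.mem_U _).2 ⟨i, rfl⟩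
  have h1 := L.pos _ hi
  have h2 := L.LF _ hi (len (a i) - 1) (by omega)
  rw [← M.lStart] at h2
  have h3 : D.lEnd i = D.lStart i + (len (a i) - 1) := by
    have := D.p_lt_succ i
    simp only [DBWT.lEnd, DBWT.lStart, ← M.len_eq]; omega
  rw [DBWT.fEnd, h3, h2]; omega

theorem BV (M : Matches D a U V len) (L : Layout S U V ch len) (i : Fin D.k) :
    D.graph.BV i = (ch (a i), len (a i)) := by
  have hi := (M.mem_U _).2 ⟨i, rfl⟩
  have h0 := M.fEnd L i
  have h1 := L.pos _ hi
  have h2 := M.fStart i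
  have h3 : D.lStart i < S.length := by
    have := L.off_lt hi h1
    rwa [add_zero, ← M.lStart] at this
  simp only [DBWT.graph, DBWT.fStart, firstCol_LF h3]
  rw [M.lStart i, L.bwt' hi]
  rw [show LF S (off len U (a i)) = off len V (a i) from L.LF' hi]
  congr 1; omega

theorem repCovers (M : Matches D a U V len) (L : Layout S U V ch len) (i j : Fin D.k) :
    D.RepCovers i j ↔ off len U (a i) ≤ off len V (a j) ∧
      off len V (a j) < off len U (a i) + len (a i) := by
  have h1 := D.p_lt_succ i
  have h2 := M.len_eq i
  have h3 := M.lStart i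
  simp only [DBWT.RepCovers, ← M.fStart, ← h3, ← h2, DBWT.lEnd, DBWT.lStart]
  omega

theorem intCovers (M : Matches D a U V len) (L : Layout S U V ch len) (j i : Fin D.k) :
    D.IntCovers j i ↔ off len V (a j) ≤ off len U (a i) ∧
      off len U (a i) < off len V (a j) + len (a j) := by
  have h1 := M.fEnd L j
  simp only [DBWT.IntCovers, ← M.fStart, ← M.lStart] at *
  omega

theorem charAt (M : Matches D a U V len) (L : Layout S U V ch len) (t : ℕ) :
    D.charAt t = U[t]?.map ch := by
  have hk : U.length = D.k := by rw [M.U_eq]; simp [DBWT.uOrder]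
  unfold DBWT.charAt
  split_ifs with h
  · rw [List.getElem?_eq_getElem (by omega), M.BU L]
    simp [M.U_eq, DBWT.uOrder]
  · rw [List.getElem?_eq_none (by omega)]; rfl

/-- LF sorts by character and then by position, so the order of the keys is the order of the
F-intervals. Thus the B-tree stores a sublist of V in the order of V. -/
theorem keyOrder (M : Matches D a U V len) (L : Layout S U V ch len) (hS : IsText S) :
    D.keyOrder = D.vOrder := by
  unfold DBWT.keyOrder DBWT.vOrder
  congr 1
  funext i j
  have hi := (M.mem_U _).2 ⟨i, rfl⟩
  have hj := (M.mem_U _).2 ⟨j, rfl⟩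
  have h1 := L.off_lt_off hS hj hi
  have h3 : off len V (a i) ≤ off len V (a j) ↔ _ := not_lt.symm.trans (not_congr h1)
  rw [decide_eq_decide, M.BU L, M.BU L, M.fStart, M.fStart, h3, ← M.lStart, ← M.lStart]
  have h2 : D.lStart j < D.lStart i ↔ j < i := by
    simp only [DBWT.lStart]
    exact D.p_strictMono.lt_iff_lt
  rw [h2]
  simp only
  constructor
  · rintro (h | ⟨h, h'⟩) (g | ⟨g, g'⟩)
    · exact lt_asymm h g
    · exact h.ne' g
    · exact g.ne' h
    · omega
  · intro h
    push Not at h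
    rcases h.1.lt_or_eq with g | g
    · exact Or.inl g
    · exact Or.inr ⟨g, h.2 g.symm⟩

/-- A missing successor counts as `none`, which differs from every character; this matches the
branches of `St.cond` that return `true`. -/
theorem searchCond (M : Matches D a U V s.len) (L : Layout S U V s.ch s.len)
    (hD : DLL s.uPrev s.uNext s.uHead s.uTail U) (i : Fin D.k) :
    D.SearchCond i ↔ s.cond (a i) = true := by
  have hk : U.length = D.k := by rw [M.U_eq]; simp [DBWT.uOrder]
  have h0 : ∀ (t : ℕ) (h : t < U.length), s.uNext U[t] = U[t + 1]? := segTo_iff_getElem.1 hD.2.2.1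
  have hi : U[(i : ℕ)]'(by omega) = a i := by simp [M.U_eq, DBWT.uOrder]
  have h1 := h0 i (by omega)
  rw [hi] at h1
  unfold DBWT.SearchCond St.cond
  rw [M.charAt L, M.charAt L, M.charAt L, h1, List.getElem?_eq_getElem (by omega : (i : ℕ) < _), hi]
  by_cases hc : s.ch (a i) = ⊥
  · simp [hc]
  · rcases h2 : U[(i : ℕ) + 1]? with _ | y
    · simp [hc]
    · obtain ⟨h3, rfl⟩ := List.getElem?_eq_some_iff.1 h2
      have h4 := h0 _ h3
      rw [add_assoc] at h4
      by_cases hy : s.ch U[(i : ℕ) + 1] = ⊥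
      · rcases h5 : U[(i : ℕ) + 2]? with _ | w
        · simp [hc, hy, h4, h5]
        · simp [hc, hy, h4, h5]
      · simp [hc, hy]

end

end Matches

theorem card_filter_univ {k : ℕ} {a : Fin k → ℕ} {l : List (Fin k)} (hl : l.Perm (List.finRange k))
    (R : Fin k → Prop) [DecidablePred R] {p : ℕ → Bool} (h : ∀ i, R i ↔ p (a i) = true) :
    (Finset.univ.filter R).card = (l.map a).countP p := by
  rw [(hl.map a).countP_eq, List.countP_map, List.countP_eq_length_filter]
  rw [show Finset.univ.filter R = ((List.finRange k).filter (p ∘ a)).toFinset by ext; simp [h],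
    List.toFinset_card_of_nodup ((List.nodup_finRange k).filter _)]

/-- Read from left to right it supplies the state before the update, from right to left the
statement about the state afterwards. Heaviness becomes a count of edges. -/
theorem storesGraph_iff (hS : IsText S) {α : ℕ} {B : Finset (Fin D.k)}
    (M : Matches D a U V s.len) (L : Layout S U V s.ch s.len)
    (hB : ∀ g, g ∈ B ↔ D.SearchCond g) :
    StoresGraph α D a B s.toM ↔ Stored S U V s ∧
      (s.heavyU.Perm (U.filter fun x => α ≤ U.countP fun y => s.eF y = x) ∧
      s.heavyV.Perm (V.filter fun x => α ≤ U.countP fun y => s.eL y = x)) ∧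
      s.btree.Complete ∧ s.btree.inorder = V.filter s.cond := by
  have hmem := M.mem_U
  have hm : ∀ i, a i ∈ U := fun i => (hmem _).2 ⟨i, rfl⟩
  have hmV : ∀ i, a i ∈ V := fun i => L.perm.mem_iff.2 (hm i)
  have hsU : D.uOrder.Pairwise (fun i j => off s.len U (a i) < off s.len U (a j)) := by
    have := pairwise_off L.nodupU L.pos
    conv at this => arg 2; rw [M.U_eq]
    rwa [List.pairwise_map] at this
  have hsV : D.vOrder.Pairwise (fun i j => off s.len V (a i) < off s.len V (a j)) := by
    have := pairwise_off L.nodupV L.posV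
    conv at this => arg 2; rw [M.V_eq]
    rwa [List.pairwise_map] at this
  -- Existence and uniqueness of the covering interval hold because the F-intervals tile the
  -- positions.
  have HL : _ ↔ Half U U (off s.len U) (off s.len V) s.len s.eL s.bL s.inV :=
    half_iff (l := D.uOrder) (R := fun i j => D.IntCovers j i) M.inj
      (fun i => by simp [DBWT.uOrder]) hsU hmem (fun i j => M.intCovers L j i)
      (fun i => by
        obtain ⟨x, hx, h1, h2⟩ := exists_off (len := s.len) L.nodupV (r := off s.len U (a i))
          (by rw [L.totalV]; simpa using L.off_lt (hm i) (L.pos _ (hm i)))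
        obtain ⟨j, rfl⟩ := (hmem x).1 (L.perm.mem_iff.1 hx)
        exact ⟨j, (M.intCovers L j i).2 ⟨h1, h2⟩⟩)
      (fun i j j' h h' => by
        rw [M.intCovers L] at h h'
        apply M.inj
        exact eq_of_off_add_eq (len := s.len) (s := off s.len U (a i) - off s.len V (a j))
          (t := off s.len U (a i) - off s.len V (a j')) (hmV j) (hmV j') (by omega) (by omega)
          (by omega))
  have HF : _ ↔ Half U U (off s.len V) (off s.len U) s.len s.eF s.bF s.inU :=
    half_iff (l := D.vOrder) (R := fun j i => D.RepCovers i j) M.inj D.mem_vOrder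
      hsV hmem (fun i j => M.repCovers L j i)
      (fun i => by
        obtain ⟨x, hx, h1, h2⟩ := exists_off (len := s.len) L.nodupU (r := off s.len V (a i))
          (by have := off_add_le (len := s.len) (hmV i)
              have := L.pos _ (hm i)
              have := L.totalV
              rw [L.total]; omega)
        obtain ⟨j, rfl⟩ := (hmem x).1 hx
        exact ⟨j, (M.repCovers L j i).2 ⟨h1, h2⟩⟩)
      (fun i j j' h h' => by
        rw [M.repCovers L] at h h'
        apply M.inj
        exact eq_of_off_add_eq (len := s.len) (s := off s.len V (a i) - off s.len U (a j))
          (t := off s.len V (a i) - off s.len U (a j')) (hm j) (hm j') (by omega) (by omega)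
          (by omega))
  have EL : ∀ i j, (i, j) ∈ D.graph.EL ↔ D.IntCovers j i := fun i j => by simp [DBWT.graph]
  have EF : ∀ i j, (i, j) ∈ D.graph.EF ↔ D.RepCovers j i := fun i j => by simp [DBWT.graph]
  have fU : ∀ j, D.uOrder.find? (fun i => decide ((i, j) ∈ D.graph.EL)) =
      D.uOrder.find? (fun i => decide (D.IntCovers j i)) := fun j => by simp only [EL]
  have fV : ∀ j, D.vOrder.find? (fun i => decide ((i, j) ∈ D.graph.EF)) =
      D.vOrder.find? (fun i => decide (D.RepCovers j i)) := fun j => by simp only [EF]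
  have bL : ∀ i j, D.graph.BL i j = off s.len U (a i) - off s.len V (a j) := fun i j => by
    rw [← M.lStart, ← M.fStart]; rfl
  have bF : ∀ i j, D.graph.BF i j = off s.len V (a i) - off s.len U (a j) := fun i j => by
    rw [← M.lStart, ← M.fStart]; rfl
  have pU : D.uOrder.Perm (List.finRange D.k) := .refl _
  -- The F-intervals that start in a repetition are the sources of the edges of `E_F` into it, so
  -- their number is a count along the list.
  have aU : (∀ i j, D.RepCovers i j ↔ s.eF (a j) = a i) →
      (D.uOrder.filter (fun i => decide (i ∈ D.heavyReps α))).map a =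
        U.filter (fun x => α ≤ U.countP fun y => s.eF y = x) := by
    intro h
    conv_rhs => arg 2; rw [M.U_eq]
    rw [List.filter_map]
    congr 1
    apply List.filter_congr
    intro i _
    simp only [DBWT.heavyReps, Finset.mem_filter, Finset.mem_univ, true_and, Function.comp]
    rw [card_filter_univ pU _ (p := fun y => decide (s.eF y = a i)) (fun j => by simpa using h i j),
      ← M.U_eq]
  have aV : (∀ i j, D.IntCovers i j ↔ s.eL (a j) = a i) →
      (D.vOrder.filter (fun i => decide (i ∈ D.heavyInts α))).map a =
        V.filter (fun x => α ≤ U.countP fun y => s.eL y = x) := by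
    intro h
    conv_rhs => arg 2; rw [M.V_eq]
    rw [List.filter_map]
    congr 1
    apply List.filter_congr
    intro i _
    simp only [DBWT.heavyInts, Finset.mem_filter, Finset.mem_univ, true_and, Function.comp]
    rw [card_filter_univ pU _ (p := fun y => decide (s.eL y = a i)) (fun j => by simpa using h i j),
      ← M.U_eq]
  have tr : DLL s.uPrev s.uNext s.uHead s.uTail U →
      (D.keyOrder.filter (fun i => decide (i ∈ B))).map a = V.filter s.cond := by
    intro h
    conv_rhs => rw [M.V_eq]
    rw [List.filter_map, M.keyOrder L hS]
    congr 1
    apply List.filter_congr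
    intro i _
    rw [Bool.eq_iff_iff, decide_eq_true_iff, hB, M.searchCond L h]; rfl
  constructor
  · intro h
    have dU : DLL s.uPrev s.uNext s.uHead s.uTail U := by
      rw [M.U_eq]; exact isLinkedList_iff.1 h.listU
    have dV : DLL s.vPrev s.vNext s.vHead s.vTail V := by
      rw [M.V_eq]; exact isLinkedList_iff.1 h.listV
    -- A node with character `⊥` exists since the repetitions cover the position of `$`; the
    -- register must hold its address.
    have hd : s.dollar ∈ U ∧ s.ch s.dollar = ⊥ := by
      obtain ⟨x, hx, hc⟩ := L.exists_dollar hS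
      obtain ⟨i, rfl⟩ := (hmem x).1 hx
      have : s.dollar = a i := (h.dollar i).1 (by rw [M.BU L]; exact hc)
      rw [this]; exact ⟨hx, hc⟩
    have e1 : ∀ i j, D.IntCovers j i ↔ s.eL (a i) = a j := fun i j =>
      (EL i j).symm.trans (h.edgesL i j)
    have e2 : ∀ i j, D.RepCovers j i ↔ s.eF (a i) = a j := fun i j =>
      (EF i j).symm.trans (h.edgesF i j)
    refine ⟨⟨L, ?_, dU, dV, ?_, ?_, ?_, hd.1, hd.2⟩, ⟨?_, ?_⟩, h.btreeComplete,
      h.btreeInorder.trans (tr dU)⟩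
    · intro x hx
      obtain ⟨i, rfl⟩ := (hmem x).1 hx
      exact h.allocated i
    · exact HL.1 ⟨e1, fun i j hij => (h.labelsL i j ((EL i j).2 hij)).trans (bL i j),
        fun j => (h.entryV j).trans (by rw [fU])⟩
    · exact HF.1 ⟨e2, fun i j hij => (h.labelsF i j ((EF i j).2 hij)).trans (bF i j),
        fun j => (h.entryU j).trans (by rw [fV])⟩
    · rw [M.U_eq]; exact h.order
    · rw [← aU (fun i j => e2 j i)]; exact h.arrayU
    · rw [← aV (fun i j => e1 j i)]; exact h.arrayV
  · rintro ⟨h, ⟨hU, hV⟩, hc, ht⟩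
    obtain ⟨l1, l2, l3⟩ := HL.2 h.halfL
    obtain ⟨f1, f2, f3⟩ := HF.2 h.halfF
    refine ⟨fun i => h.alloc _ (hm i), ?_, M.BU L, M.BV L, ?_, ?_, ?_, ?_, ?_, ?_, ?_, ?_, ?_, ?_,
      ?_, ?_, hc, ?_⟩
    · intro i j
      simp [DBWT.graph, M.inj.eq_iff]
    · rw [isLinkedList_iff, ← M.U_eq]; exact h.dllU
    · rw [isLinkedList_iff, ← M.V_eq]; exact h.dllV
    · exact fun i j => (EL i j).trans (l1 i j)
    · exact fun i j hij => (l2 i j ((EL i j).1 hij)).trans (bL i j).symm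
    · exact fun i j => (EF i j).trans (f1 i j)
    · exact fun i j hij => (f2 i j ((EF i j).1 hij)).trans (bF i j).symm
    · exact fun i => (f3 i).trans (by rw [fV])
    · exact fun i => (l3 i).trans (by rw [fU])
    · intro i
      rw [M.BU L]
      constructor
      · intro hi
        exact L.dollar_unique hS h.dollar_mem h.dollar_ch (hm i) hi
      · intro hi
        change s.dollar = a i at hi
        rw [← hi]; exact h.dollar_ch
    · rw [← M.U_eq]; exact h.order
    · rw [aU (fun i j => f1 j i)]; exact hU
    · rw [aV (fun i j => l1 j i)]; exact hV
    · rw [tr h.dllU]; exact ht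

end Bridge


/-! ### Changes of the directed edges: new nodes, split targets, and the numbers of edges. -/

open Function (update_self update_of_ne)

section HalfOperations

variable {N N' K K' : List ℕ} {pos pos' base base' len len' e e' b b' : ℕ → ℕ}
  {first first' : ℕ → Option ℕ}

namespace Half

/-- Only the values at the nodes matter, so arrays that differ at other addresses, and lists in
another order, serve as well. -/
theorem congr (h : Half N K pos base len e b first) (hN : ∀ y, y ∈ N' ↔ y ∈ N)
    (hK : ∀ y, y ∈ K' ↔ y ∈ K) (hp : ∀ y ∈ N, pos' y = pos y)
    (hk : ∀ k ∈ K, base' k = base k) (hl : ∀ k ∈ K, len' k = len k)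
    (he : ∀ y ∈ N, e' y = e y) (hb : ∀ y ∈ N, b' y = b y)
    (hf : ∀ k ∈ K, first' k = first k) : Half N' K' pos' base' len' e' b' first' where
  mem y hy := by rw [hN] at hy; rw [he y hy, hK]; exact h.mem y hy
  eq y hy := by
    rw [hN] at hy; rw [he y hy, hb y hy, hk _ (h.mem y hy), hp y hy]; exact h.eq y hy
  lt y hy := by rw [hN] at hy; rw [he y hy, hb y hy, hl _ (h.mem y hy)]; exact h.lt y hy
  none k hk' hf' y hy := by
    rw [hN] at hy; rw [hK] at hk'
    rw [hf k hk'] at hf'; rw [he y hy]; exact h.none k hk' hf' y hy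
  some k hk' y hf' := by
    rw [hK] at hk'
    rw [hf k hk'] at hf'
    obtain ⟨h1, h2, h3⟩ := h.some k hk' y hf'
    refine ⟨(hN y).2 h1, by rw [he y h1, h2], fun w hw hw' => ?_⟩
    rw [hN] at hw
    rw [he w hw] at hw'
    rw [hp y h1, hp w hw]; exact h3 w hw hw'

/-- A new node `x` takes over the edge from `s` to `t`, and the edge from `s` leads to `x` instead. -/
theorem insert (h : Half N K pos base len e b first) {s t x : ℕ} (hs : s ∈ N) (ht : e s = t)
    (hxN : x ∉ N) (hxK : x ∉ K) (h1 : ∀ y ∈ N, y ≠ s → base' (e y) + b y = pos' y)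
    (h2 : base' x = pos' s) (h3 : base' t = pos' x) (hlen : ∀ k ∈ K, len' k = len k)
    (hx : len' x = 1)
    (hmono : ∀ y ∈ N, ∀ w ∈ N, y ≠ s → w ≠ s → pos y ≤ pos w → pos' y ≤ pos' w)
    (h4 : ∀ w ∈ N, w ≠ s → e w = t → pos' x ≤ pos' w) :
    Half (x :: N) (x :: K) pos' base' len' (Function.update (Function.update e x t) s x)
      (Function.update (Function.update b x 0) s 0)
      (Function.update (Function.update first x (Option.some s)) t (Option.some x)) := by
  have htK : t ∈ K := ht ▸ h.mem s hs
  have hxs : x ≠ s := by rintro rfl; exact hxN hs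
  have hxt : x ≠ t := by rintro rfl; exact hxK htK
  have hne : ∀ y ∈ N, y ≠ x := by rintro y hy rfl; exact hxN hy
  have hneK : ∀ y ∈ K, y ≠ x := by rintro y hy rfl; exact hxK hy
  have ex : Function.update (Function.update e x t) s x x = t := by rw [update_of_ne hxs, update_self]
  have bx : Function.update (Function.update b x 0) s 0 x = 0 := by rw [update_of_ne hxs, update_self]
  have ey : ∀ y ∈ N, y ≠ s → Function.update (Function.update e x t) s x y = e y := fun y hy hys => by
    rw [update_of_ne hys, update_of_ne (hne y hy)]
  have by' : ∀ y ∈ N, y ≠ s → Function.update (Function.update b x 0) s 0 y = b y := fun y hy hys => by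
    rw [update_of_ne hys, update_of_ne (hne y hy)]
  refine ⟨?_, ?_, ?_, ?_, ?_⟩
  · intro y hy
    rcases List.mem_cons.1 hy with rfl | hy
    · rw [ex]; simp [htK]
    · rcases eq_or_ne y s with rfl | hys
      · simp
      · rw [ey y hy hys]; exact List.mem_cons_of_mem _ (h.mem y hy)
  · intro y hy
    rcases List.mem_cons.1 hy with rfl | hy
    · rw [ex, bx, h3]; rfl
    · rcases eq_or_ne y s with rfl | hys
      · rw [update_self, update_self, h2]; rfl
      · rw [ey y hy hys, by' y hy hys]; exact h1 y hy hys
  · intro y hy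
    rcases List.mem_cons.1 hy with rfl | hy
    · rw [ex, bx, hlen t htK]
      have := h.lt s hs
      rw [ht] at this; omega
    · rcases eq_or_ne y s with rfl | hys
      · rw [update_self, update_self, hx]; omega
      · rw [ey y hy hys, by' y hy hys, hlen _ (h.mem y hy)]; exact h.lt y hy
  · intro k hk hf y hy hey
    rcases eq_or_ne k t with rfl | hkt
    · rw [update_self] at hf; cases hf
    · rw [update_of_ne hkt] at hf
      rcases eq_or_ne k x with rfl | hkx
      · rw [update_self] at hf; cases hf
      · rw [update_of_ne hkx] at hf
        have hk' : k ∈ K := (List.mem_cons.1 hk).resolve_left hkx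
        rcases List.mem_cons.1 hy with rfl | hy
        · exact hkt (hey.symm.trans ex)
        · rcases eq_or_ne y s with rfl | hys
          · rw [update_self] at hey; exact hkx hey.symm
          · rw [ey y hy hys] at hey; exact h.none k hk' hf y hy hey
  · intro k hk y hf
    rcases eq_or_ne k t with rfl | hkt
    · rw [update_self, Option.some.injEq] at hf
      subst hf
      refine ⟨by simp, ex, fun w hw hew => ?_⟩
      rcases List.mem_cons.1 hw with rfl | hw
      · rfl
      · rcases eq_or_ne w s with rfl | hws
        · rw [update_self] at hew; exact absurd hew hxt
        · rw [ey w hw hws] at hew; exact h4 w hw hws hew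
    · rw [update_of_ne hkt] at hf
      rcases eq_or_ne k x with rfl | hkx
      · rw [update_self, Option.some.injEq] at hf
        subst hf
        refine ⟨by simp [hs], by simp, fun w hw hew => ?_⟩
        rcases List.mem_cons.1 hw with rfl | hw
        · exact absurd (hew.symm.trans ex) hxt
        · rcases eq_or_ne w s with rfl | hws
          · rfl
          · rw [ey w hw hws] at hew
            exact absurd hew (hneK _ (h.mem w hw))
      · rw [update_of_ne hkx] at hf
        have hk' : k ∈ K := (List.mem_cons.1 hk).resolve_left hkx
        obtain ⟨g1, g2, g3⟩ := h.some k hk' y hf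
        have hys : y ≠ s := by rintro rfl; exact hkt (g2.symm.trans ht)
        refine ⟨by simp [g1], by rw [ey y g1 hys, g2], fun w hw hew => ?_⟩
        rcases List.mem_cons.1 hw with rfl | hw
        · exact absurd (hew.symm.trans ex) hkt
        · rcases eq_or_ne w s with rfl | hws
          · rw [update_self] at hew; exact absurd hew.symm hkx
          · rw [ey w hw hws] at hew
            exact hmono y g1 w hw hys hws (g3 w hw hew)

/-- The interval of `j` is split after its first `d` positions. -/
theorem splitTarget (h : Half N K pos base len e b first) {j z d : ℕ} {f : Option ℕ} (hj : j ∈ K)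
    (hz : z ∉ K) (hb : ∀ k ∈ K, base' k = base k) (hbz : base' z = base j + d)
    (hlen : ∀ k ∈ K, k ≠ j → len' k = len k) (hlj : len' j = d)
    (hinj : ∀ y ∈ N, ∀ w ∈ N, pos y = pos w → y = w) (hlz : len j ≤ len' z + d)
    (hf0 : f = Option.none → ∀ y ∈ N, e y = j → b y < d)
    (hf1 : ∀ y, f = Option.some y → y ∈ N ∧ e y = j ∧ d ≤ b y ∧
      ∀ w ∈ N, e w = j → d ≤ b w → pos y ≤ pos w) :
    Half N (z :: K) pos base' len' (fun y => if e y = j ∧ d ≤ b y then z else e y)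
      (fun y => if e y = j ∧ d ≤ b y then b y - d else b y)
      (Function.update (Function.update first z f) j (if first j = f then Option.none else first j)) := by
  have hzj : z ≠ j := by rintro rfl; exact hz hj
  have hmem : ∀ y ∈ N, e y ≠ z := by intro y hy hc; exact hz (hc ▸ h.mem y hy)
  -- Among edges into the same node labels grow with the position of the source, so the redirected
  -- edges are the last ones.
  have hmono : ∀ y ∈ N, ∀ w ∈ N, e y = j → e w = j → pos y ≤ pos w → b y ≤ b w := by
    intro y hy w hw hey hew hp
    have h1 := h.eq y hy
    have h2 := h.eq w hw
    rw [hey] at h1; rw [hew] at h2; omega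
  refine ⟨?_, ?_, ?_, ?_, ?_⟩
  · intro y hy
    split_ifs
    · simp
    · exact List.mem_cons_of_mem _ (h.mem y hy)
  · intro y hy
    have := h.eq y hy
    split_ifs with hc
    · rw [hbz]; rw [hc.1] at this; omega
    · rw [hb _ (h.mem y hy)]; exact this
  · intro y hy
    have := h.lt y hy
    split_ifs with hc
    · rw [hc.1] at this; omega
    · by_cases hej : e y = j
      · rw [hej, hlj]; by_contra hcc; exact hc ⟨hej, by omega⟩
      · rwa [hlen _ (h.mem y hy) hej]
  · intro k hk hf y hy
    rcases eq_or_ne k j with rfl | hkj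
    · rw [update_self] at hf
      split_ifs with hc
      · exact hzj
      · intro hey
        split_ifs at hf with hc'
        · rcases hfe : f with _ | y0
          · exact h.none k hj (hc'.trans hfe) y hy hey
          · obtain ⟨g1, g2, g3, g4⟩ := hf1 y0 hfe
            have g5 := (h.some k hj y0 (hc'.trans hfe)).2.2 y hy hey
            have := hmono y0 g1 y hy g2 hey g5
            exact hc ⟨hey, by omega⟩
        · exact h.none k hj hf y hy hey
    · rw [update_of_ne hkj] at hf
      rcases eq_or_ne k z with rfl | hkz
      · rw [update_self] at hf
        split_ifs with hc
        · have := hf0 hf y hy hc.1; omega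
        · exact hmem y hy
      · rw [update_of_ne hkz] at hf
        have hk' := (List.mem_cons.1 hk).resolve_left hkz
        split_ifs with hc
        · exact hkz.symm
        · exact h.none k hk' hf y hy
  · intro k hk y hf
    rcases eq_or_ne k j with rfl | hkj
    · rw [update_self] at hf
      split_ifs at hf with hc'
      obtain ⟨g1, g2, g3⟩ := h.some k hj y hf
      -- If the first edge into j were redirected, it would also be the first redirected one, that
      -- is f, and the entry of j would have been erased.
      have hby : ¬ d ≤ b y := by
        intro hd
        rcases hfe : f with _ | y0
        · have := hf0 hfe y g1 g2; omega
        · obtain ⟨p1, p2, p3, p4⟩ := hf1 y0 hfe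
          have q1 := p4 y g1 g2 hd
          have q2 := g3 y0 p1 p2
          have q3 : y = y0 := hinj y g1 y0 p1 (by omega)
          exact hc' (by rw [hf, hfe, q3])
      refine ⟨g1, by rw [if_neg (by simp [hby]), g2], fun w hw hew => ?_⟩
      split_ifs at hew with hc
      · exact absurd hew hzj
      · exact g3 w hw hew
    · rw [update_of_ne hkj] at hf
      rcases eq_or_ne k z with rfl | hkz
      · rw [update_self] at hf
        obtain ⟨g1, g2, g3, g4⟩ := hf1 y hf
        refine ⟨g1, by rw [if_pos ⟨g2, g3⟩], fun w hw hew => ?_⟩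
        split_ifs at hew with hc
        · exact g4 w hw hc.1 hc.2
        · exact absurd hew (hmem w hw)
      · rw [update_of_ne hkz] at hf
        have hk' := (List.mem_cons.1 hk).resolve_left hkz
        obtain ⟨g1, g2, g3⟩ := h.some k hk' y hf
        refine ⟨g1, by rw [if_neg (by rintro ⟨h1, -⟩; exact hkj (g2.symm.trans h1)), g2],
          fun w hw hew => ?_⟩
        split_ifs at hew with hc
        · exact absurd hew.symm hkz
        · exact g3 w hw hew

/-- A new source `z` whose edge is the first one that leads to `k`. -/
theorem addSource_first (h : Half N K pos base len e b first) {z k m : ℕ} (hz : z ∉ N)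
    (hk : k ∈ K) (hp : base k + m = pos z) (hm : m < len k)
    (hmin : ∀ w ∈ N, e w = k → pos z ≤ pos w) :
    Half (z :: N) K pos base len (Function.update e z k) (Function.update b z m)
      (Function.update first k (Option.some z)) := by
  have ey : ∀ y ∈ N, Function.update e z k y = e y := fun y hy =>
    update_of_ne (by rintro rfl; exact hz hy) _ _
  have by' : ∀ y ∈ N, Function.update b z m y = b y := fun y hy =>
    update_of_ne (by rintro rfl; exact hz hy) _ _
  refine ⟨?_, ?_, ?_, ?_, ?_⟩
  · intro y hy
    rcases List.mem_cons.1 hy with rfl | hy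
    · simpa
    · rw [ey y hy]; exact h.mem y hy
  · intro y hy
    rcases List.mem_cons.1 hy with rfl | hy
    · simpa
    · rw [ey y hy, by' y hy]; exact h.eq y hy
  · intro y hy
    rcases List.mem_cons.1 hy with rfl | hy
    · simpa
    · rw [ey y hy, by' y hy]; exact h.lt y hy
  · intro k' hk' hf y hy hey
    rcases eq_or_ne k' k with rfl | hkk
    · rw [update_self] at hf; cases hf
    · rw [update_of_ne hkk] at hf
      rcases List.mem_cons.1 hy with rfl | hy
      · rw [update_self] at hey; exact hkk hey.symm
      · rw [ey y hy] at hey; exact h.none k' hk' hf y hy hey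
  · intro k' hk' y hf
    rcases eq_or_ne k' k with rfl | hkk
    · rw [update_self, Option.some.injEq] at hf
      subst hf
      refine ⟨by simp, by simp, fun w hw hew => ?_⟩
      rcases List.mem_cons.1 hw with rfl | hw
      · rfl
      · rw [ey w hw] at hew; exact hmin w hw hew
    · rw [update_of_ne hkk] at hf
      obtain ⟨g1, g2, g3⟩ := h.some k' hk' y hf
      refine ⟨by simp [g1], by rw [ey y g1, g2], fun w hw hew => ?_⟩
      rcases List.mem_cons.1 hw with rfl | hw
      · rw [update_self] at hew; exact absurd hew.symm hkk
      · rw [ey w hw] at hew; exact g3 w hw hew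

/-- A new source `z` whose edge is not the first one that leads to `k`. -/
theorem addSource (h : Half N K pos base len e b first) {z k m : ℕ} (hz : z ∉ N)
    (hk : k ∈ K) (hp : base k + m = pos z) (hm : m < len k) {w0 : ℕ} (hw0 : w0 ∈ N)
    (hew0 : e w0 = k) (hpw : pos w0 ≤ pos z) :
    Half (z :: N) K pos base len (Function.update e z k) (Function.update b z m) first := by
  have ey : ∀ y ∈ N, Function.update e z k y = e y := fun y hy =>
    update_of_ne (by rintro rfl; exact hz hy) _ _
  have by' : ∀ y ∈ N, Function.update b z m y = b y := fun y hy =>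
    update_of_ne (by rintro rfl; exact hz hy) _ _
  refine ⟨?_, ?_, ?_, ?_, ?_⟩
  · intro y hy
    rcases List.mem_cons.1 hy with rfl | hy
    · simpa
    · rw [ey y hy]; exact h.mem y hy
  · intro y hy
    rcases List.mem_cons.1 hy with rfl | hy
    · simpa
    · rw [ey y hy, by' y hy]; exact h.eq y hy
  · intro y hy
    rcases List.mem_cons.1 hy with rfl | hy
    · simpa
    · rw [ey y hy, by' y hy]; exact h.lt y hy
  · intro k' hk' hf y hy hey
    rcases List.mem_cons.1 hy with rfl | hy
    · rw [update_self] at hey; subst hey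
      exact h.none k hk' hf w0 hw0 hew0
    · rw [ey y hy] at hey; exact h.none k' hk' hf y hy hey
  · intro k' hk' y hf
    obtain ⟨g1, g2, g3⟩ := h.some k' hk' y hf
    refine ⟨by simp [g1], by rw [ey y g1, g2], fun w hw hew => ?_⟩
    rcases List.mem_cons.1 hw with rfl | hw
    · rw [update_self] at hew; subst hew
      exact (g3 w0 hw0 hew0).trans hpw
    · rw [ey w hw] at hew; exact g3 w hw hew

end Half

/-- A sorted list falls into the parts before, in, and after an interval. -/
theorem exists_append_of_sorted {l : List ℕ} (hs : l.Pairwise (fun a b => pos a < pos b))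
    (lo hi : ℕ) (hlh : lo ≤ hi) : ∃ A M B, l = A ++ (M ++ B) ∧ (∀ w ∈ A, pos w < lo) ∧
      (∀ w ∈ M, lo ≤ pos w ∧ pos w < hi) ∧ ∀ w ∈ B, hi ≤ pos w := by
  induction l with
  | nil => exact ⟨[], [], [], by simp⟩
  | cons c l ih =>
    rw [List.pairwise_cons] at hs
    obtain ⟨A, M, B, rfl, h1, h2, h3⟩ := ih hs.2
    by_cases hc : pos c < lo
    · exact ⟨c :: A, M, B, by simp, by simpa [hc] using h1, h2, h3⟩
    · have hA : A = [] := by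
        rcases A with _ | ⟨a, A⟩
        · rfl
        · have := hs.1 a (by simp)
          have := h1 a (by simp)
          omega
      subst hA
      by_cases hc' : pos c < hi
      · refine ⟨[], c :: M, B, by simp, by simp, ?_, h3⟩
        intro w hw
        rcases List.mem_cons.1 hw with rfl | hw
        · omega
        · exact h2 w hw
      · have hM : M = [] := by
          rcases M with _ | ⟨a, M⟩
          · rfl
          · have := hs.1 a (by simp)
            have := h2 a (by simp)
            omega
        subst hM
        refine ⟨[], [], c :: B, by simp, by simp, by simp, ?_⟩
        intro w hw
        rcases List.mem_cons.1 hw with rfl | hw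
        · omega
        · exact h3 w hw

/-- The nodes whose edges lead to `k` are consecutive. -/
theorem Half.exists_run (h : Half N K pos base len e b first) {l : List ℕ} {k : ℕ}
    (hl : ∀ x, x ∈ l ↔ x ∈ N) (hs : l.Pairwise (fun a b => pos a < pos b)) (hk : k ∈ K)
    (hd : ∀ w ∈ N, base k ≤ pos w → pos w < base k + len k → e w = k) :
    ∃ A M B, l = A ++ (M ++ B) ∧ (∀ w ∈ A, e w ≠ k) ∧ (∀ w ∈ M, e w = k) ∧ (∀ w ∈ B, e w ≠ k) ∧
      M.head? = first k := by
  obtain ⟨A, M, B, rfl, h1, h2, h3⟩ := exists_append_of_sorted hs (base k) (base k + len k)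
    (by omega)
  have hA : ∀ w ∈ A, e w ≠ k := by
    rintro w hw rfl
    have := h1 w hw
    have := h.eq w ((hl w).1 (by simp [hw]))
    omega
  have hM : ∀ w ∈ M, e w = k := fun w hw =>
    hd w ((hl w).1 (by simp [hw])) (h2 w hw).1 (h2 w hw).2
  have hB : ∀ w ∈ B, e w ≠ k := by
    rintro w hw rfl
    have := h3 w hw
    have h5 : w ∈ N := (hl w).1 (by simp [hw])
    have := h.eq w h5
    have := h.lt w h5
    omega
  refine ⟨A, M, B, rfl, hA, hM, hB, ?_⟩
  rcases hf : first k with _ | y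
  · rcases M with _ | ⟨m, M⟩
    · rfl
    · exact absurd (hM m (by simp)) (h.none k hk hf m ((hl m).1 (by simp)))
  · obtain ⟨g1, g2, g3⟩ := h.some k hk y hf
    -- The first edge into k is in the run, and its position is minimal, so it is the head of the
    -- run.
    have hyM : y ∈ M := by
      have := (hl y).2 g1
      simp only [List.mem_append] at this
      rcases this with h' | h' | h'
      · exact absurd g2 (hA y h')
      · exact h'
      · exact absurd g2 (hB y h')
    rcases M with _ | ⟨m, M⟩
    · simp at hyM
    · have h4 := g3 m ((hl m).1 (by simp)) (hM m (by simp))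
      rcases List.mem_cons.1 hyM with rfl | hyM
      · rfl
      · have := (List.pairwise_append.1 (List.pairwise_append.1 hs).2.1).1
        have := (List.pairwise_cons.1 this).1 y hyM
        omega

theorem countP_run {A M B : List ℕ} {k : ℕ} (hA : ∀ w ∈ A, e w ≠ k) (hM : ∀ w ∈ M, e w = k)
    (hB : ∀ w ∈ B, e w ≠ k) : (A ++ (M ++ B)).countP (fun w => e w = k) = M.length := by
  rw [List.countP_append, List.countP_append, (List.countP_eq_zero (l := A)).2 (by simpa using hA), (List.countP_eq_zero (l := B)).2 (by simpa using hB),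
    List.countP_eq_length.2 (by simpa using hM)]
  omega

/-- Numbers of edges after `Half.insert`. -/
theorem countP_insert_lt {α s x : ℕ} (hN : N.Nodup) (hs : s ∈ N) (hxN : x ∉ N)
    (hx : ∀ y ∈ N, e y ≠ x) (hα : 2 ≤ α) (h : ∀ k, N.countP (fun y => e y = k) < α) (k : ℕ) :
    (x :: N).countP (fun y => Function.update (Function.update e x (e s)) s x y = k) < α := by
  have hp := List.perm_cons_erase hs
  have hxs : x ≠ s := by rintro rfl; exact hxN hs
  have h1 := h k
  rw [hp.countP_eq, List.countP_cons] at h1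
  have h2 : (N.erase s).countP (fun y => Function.update (Function.update e x (e s)) s x y = k) =
      (N.erase s).countP (fun y => e y = k) := by
    apply List.countP_congr
    intro y hy
    have hy1 : y ∈ N := List.mem_of_mem_erase hy
    have hy2 : y ≠ s := by rintro rfl; exact hN.not_mem_erase hy
    have hy3 : y ≠ x := by rintro rfl; exact hxN hy1
    rw [update_of_ne hy2, update_of_ne hy3]
  rw [List.countP_cons, hp.countP_eq, List.countP_cons, h2, update_self, update_of_ne hxs,
    update_self]
  -- The new node receives the edge of s and no other, and 1 < α. For any other k the edge of x
  -- replaces the former edge of s.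
  by_cases hk : x = k
  · have h3 : (N.erase s).countP (fun y => e y = k) = 0 := by
      rw [List.countP_eq_zero]
      intro y hy
      simpa [← hk] using hx y (List.mem_of_mem_erase hy)
    have h4 : e s ≠ k := hk ▸ hx s hs
    simp [h3, h4, hk]; omega
  · simp only [hk, decide_false, Bool.false_eq_true, if_false, add_zero]
    exact h1

/-- Numbers of edges after `Half.splitTarget`. -/
theorem countP_split_le {z j d : ℕ} (hz : ∀ y ∈ N, e y ≠ z) {k : ℕ} :
    N.countP (fun y => (if e y = j ∧ d ≤ b y then z else e y) = k) ≤
      N.countP (fun y => e y = if k = z then j else k) := by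
  apply List.countP_mono_left
  intro y hy
  simp only [decide_eq_true_eq]
  have := hz y hy
  split_ifs with h1 h2 h2 <;> intro h3
  · exact h1.1
  · exact absurd h3.symm h2
  · exact absurd (h3.trans h2) this
  · exact h3

theorem length_le_of_nodup_lt {l : List ℕ} (hl : l.Nodup) {n : ℕ} (h : ∀ x ∈ l, x < n) :
    l.length ≤ n := by
  have := (hl.subperm (fun x hx => List.mem_range.2 (h x hx))).length_le
  simpa using this

theorem filter_eq_ite {l : List ℕ} {p : ℕ → Bool} {h : ℕ} (hl : l.Nodup) (hh : h ∈ l)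
    (hp : ∀ x ∈ l, p x → x = h) : l.filter p = if p h then [h] else [] := by
  split_ifs with hph
  · have : l.filter p = l.filter (fun x => x == h) := by
      apply List.filter_congr
      intro x hx
      rw [Bool.eq_iff_iff, beq_iff_eq]
      exact ⟨hp x hx, fun e => e ▸ hph⟩
    rw [this, List.filter_beq, List.count_eq_one_of_mem hl hh]
    rfl
  · rw [List.filter_eq_nil_iff]
    intro x hx hpx
    exact hph (hp x hx hpx ▸ hpx)

end HalfOperations


/-! ### The condition for the B-tree in terms of the following nodes. -/

section SearchCondition

variable {σ : Type} [LinearOrder σ] [OrderBot σ]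

/-- The condition for being kept in the B-tree for a node `y` that is followed in `U` by the nodes
`B`. -/
def condL (ch : ℕ → σ) (y : ℕ) (B : List ℕ) : Bool :=
  if ch y = ⊥ then true else
  match B with
  | [] => true
  | w :: B => if ch w = ⊥ then (match B with | [] => true | v :: _ => decide (ch v ≠ ch y))
      else decide (ch w ≠ ch y)

theorem St.cond_eq {s : St σ} {A B : List ℕ} {y : ℕ} {hd tl : Option ℕ}
    (h : DLL s.uPrev s.uNext hd tl (A ++ y :: B)) : s.cond y = condL s.ch y B := by
  unfold St.cond condL
  rw [h.next_eq]
  rcases B with _ | ⟨w, B⟩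
  · rfl
  · have h' : DLL s.uPrev s.uNext hd tl ((A ++ [y]) ++ w :: B) := by simpa using h
    simp only [List.head?_cons]
    rw [h'.next_eq]
    rcases B with _ | ⟨v, B⟩ <;> rfl

/-- If the next node is not `$`, the nodes behind it do not matter. -/
theorem condL_congr {ch ch' : ℕ → σ} {y b : ℕ} {B B' : List ℕ} (hy : ch' y = ch y)
    (hb : ch b ≠ ⊥) (hb' : ch' b = ch b) : condL ch' y (b :: B') = condL ch y (b :: B) := by
  unfold condL
  simp only [hy, hb', if_neg hb]

/-- The condition looks past a `$`; inserting one behind y therefore changes nothing if no other `$`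
follows. -/
theorem condL_dollar {ch ch' : ℕ → σ} {x y : ℕ} {B : List ℕ} (hy : ch' y = ch y)
    (hx : ch' x = ⊥) (hB : ∀ b ∈ B.head?, ch b ≠ ⊥ ∧ ch' b = ch b) :
    condL ch' y (x :: B) = condL ch y B := by
  unfold condL
  rcases B with _ | ⟨b, B⟩
  · simp [hx]
  · obtain ⟨h1, h2⟩ := hB b (by simp)
    simp [hx, hy, h1, h2]

end SearchCondition

/-! ### The place of the new F-interval and the node lists after the update. -/

section Insertion

variable {σ : Type} [LinearOrder σ] [OrderBot σ] {S : List σ} {U V A B P G : List ℕ} {ch : ℕ → σ}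
  {len : ℕ → ℕ} {c : σ} {i q : ℕ}

/-- No interval straddles a position at which an initial part of the list ends. -/
theorem off_add_le_of_lt (hA : tot len A = q) {k : ℕ} (hk : k ∈ A ++ B) (h : off len (A ++ B) k < q) :
    off len (A ++ B) k + len k ≤ q := by
  by_cases hkA : k ∈ A
  · rw [off_append_left hkA, ← hA]; exact off_add_le hkA
  · rw [off_append_right hkA] at h; omega

/-- The list `V` falls into the nodes before and after the place of the new F-interval. -/
theorem Layout.exists_insertion (L : Layout S U V ch len) (hS : IsText S) (hc : c ≠ ⊥) (hi : i ∈ U)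
    (hci : ch i = ⊥) : ∃ P G, V = i :: (P ++ G) ∧ tot len (i :: P) = rk (c :: S) 0 ∧
      ∀ y ∈ U, (y ∈ i :: P ↔ off len V y < rk (c :: S) 0) ∧
        (off len V y < rk (c :: S) 0 ↔ ch y < c ∨ ch y = c ∧ off len U y < off len U i) := by
  set q := rk (c :: S) 0 with hq
  have hq0 : 0 < q := rk_zero_pos hS hc
  obtain ⟨hi1, hi2, hi3⟩ := L.off_dollar hS hi hci
  -- `LF_lt_rk_cons`, position by position. The node of `$` is excluded there and treated
  -- separately: its only LF value is 0 < q, and `⊥` < c.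
  have hkey : ∀ y ∈ U, ∀ t < len y, off len V y + t < q ↔
      ch y < c ∨ ch y = c ∧ off len U y + t < off len U i := by
    intro y hy t ht
    rcases eq_or_ne y i with rfl | hne
    · have : t = 0 := by omega
      subst this
      simp only [hi3, hci, bot_lt_iff_ne_bot.2 hc, true_or, iff_true]
      exact hq0
    · have hne' : off len U y + t ≠ rk S 0 := by
        rw [← hi1]
        intro h
        exact hne (eq_of_off_add_eq (s := t) (t := 0) hy hi ht (by omega) (by omega))
      rw [← L.LF y hy t ht, LF_lt_rk_cons hS (L.off_lt hy ht) hne', L.bwt y hy t ht, hi1]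
  -- If q were inside the F-interval, the repetition would have the character c and contain the
  -- position of `$`.
  have hbd : ∀ y ∈ U, off len V y < q → off len V y + len y ≤ q := by
    intro y hy h
    by_contra hcon
    have h1 := (hkey y hy 0 (L.pos y hy)).1 (by simpa using h)
    have h2 := (hkey y hy (q - off len V y) (by omega)).not.1 (by omega)
    push Not at h2
    rcases h1 with h1 | ⟨h1, h3⟩
    · exact absurd h1 (not_lt.2 h2.1)
    · have h4 := h2.2 h1
      have h5 := eq_of_off_add_eq (len := len) (s := off len U i - off len U y) (t := 0) hy hi
        (by omega) (by omega) (by omega)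
      subst h5
      exact hc (h1.symm.trans hci)
  obtain ⟨A, M, B, hV, h1, h2, h3⟩ := exists_append_of_sorted (pairwise_off L.nodupV L.posV) q q le_rfl
  have hM : M = [] := by
    rcases M with _ | ⟨m, M⟩
    · rfl
    · have := h2 m (by simp); omega
  subst hM
  rw [List.nil_append] at hV
  have hiV : i ∈ V := L.perm.mem_iff.2 hi
  -- The F-interval of i starts at 0 < q, so i is the first node of V and belongs to the part before
  -- q.
  have hA : A.head? = some i := by
    rcases A with _ | ⟨a, A⟩
    · rw [hV, List.nil_append] at hiV
      have := h3 i hiV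
      omega
    · have ha : off len V a = 0 := by rw [hV]; simp [off]
      have haV : a ∈ V := by rw [hV]; simp
      rw [off_inj L.posV haV hiV (by omega)]; rfl
  obtain ⟨P, rfl⟩ : ∃ P, A = i :: P := by
    rcases A with _ | ⟨a, A⟩
    · simp at hA
    · simp only [List.head?_cons, Option.some.injEq] at hA; exact ⟨A, by rw [hA]⟩
  have hnd : ((i :: P) ++ B).Nodup := hV ▸ L.nodupV
  -- The last node before q ends by q, and the first node behind it, if any, starts at q or later.
  have htot : tot len (i :: P) = q := by
    apply le_antisymm
    · obtain ⟨A', g, hA'⟩ : ∃ A' g, i :: P = A' ++ [g] :=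
        ⟨(i :: P).dropLast, (i :: P).getLast (by simp), (List.dropLast_append_getLast _).symm⟩
      have hgA : g ∉ A' := by
        intro hg
        rw [hA', List.append_assoc, List.nodup_append] at hnd
        exact hnd.2.2 g hg g (by simp) rfl
      have hg1 : g ∈ i :: P := by rw [hA']; simp
      have e1 : off len V g = tot len A' := by
        rw [hV, off_append_left hg1, hA', off_append_right hgA]; simp [off]
      have := hbd g (L.perm.mem_iff.1 (by rw [hV]; exact List.mem_append_left _ hg1)) (h1 g hg1)
      rw [hA', tot_append]
      simp only [tot]
      omega
    · rcases B with _ | ⟨y, B⟩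
      -- If no node follows, the sum is the length of S, and q is at most that as a rank in c :: S.
      · have := L.totalV
        rw [hV, List.append_nil] at this
        rw [this]
        have := rk_lt (S := c :: S) (x := 0) (by simp)
        simp only [List.length_cons] at this
        omega
      · have hy := h3 y (by simp)
        have hyA : y ∉ i :: P := fun h => (List.nodup_append.1 hnd).2.2 y h y (by simp) rfl
        rw [hV, off_append_right hyA] at hy
        simpa [off] using hy
  refine ⟨P, B, by simpa using hV, htot, fun y hy => ⟨⟨h1 y, fun h => ?_⟩,
    by simpa using hkey y hy 0 (L.pos y hy)⟩⟩
  have hyV : y ∈ V := L.perm.mem_iff.2 hy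
  rw [hV] at hyV
  rcases List.mem_append.1 hyV with h' | h'
  · exact h'
  · have := h3 y h'; omega

/-- The last node before the place of the new F-interval is kept in the B-tree. -/
theorem Layout.condL_last (L : Layout S U V ch len) (hS : IsText S) (hi : i ∈ U)
    (hci : ch i = ⊥) {g : ℕ} (hg : g ∈ U)
    (hkey : ∀ y ∈ U, off len V y < q ↔ ch y < c ∨ ch y = c ∧ off len U y < off len U i)
    (hgq : off len V g < q) (hmax : ∀ y ∈ U, off len V y < q → off len V y ≤ off len V g)
    (hU : U = A ++ g :: B) (havoid : B.head? = some i → ch g ≠ c) : condL ch g B = true := by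
  -- A later repetition with the character of g has a larger key than g, so by maximality not a
  -- smaller key than (c, position of i). Hence the character is c and the `$` lies between.
  have hnext : ∀ w ∈ U, ch w = ch g → off len U g < off len U w →
      ch g = c ∧ off len U g < off len U i ∧ off len U i ≤ off len U w := by
    intro w hw hcw ho
    have h1 : off len V g < off len V w := (L.off_lt_off hS hg hw).2 (Or.inr ⟨hcw.symm, ho⟩)
    have h2 : ¬ off len V w < q := fun h => by have := hmax w hw h; omega
    rw [hkey w hw, hcw] at h2
    push Not at h2
    rcases (hkey g hg).1 hgq with h3 | ⟨h3, h4⟩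
    · exact absurd h3 (not_lt.2 h2.1)
    · exact ⟨h3, h4, h2.2 h3⟩
  have hnd := L.nodupU
  have hpos := L.pos
  have hgA : g ∉ A := by
    rw [hU, List.nodup_append] at hnd
    exact fun h => hnd.2.2 g h g (by simp) rfl
  have hog : off len U g = tot len A := by rw [hU, off_append_right hgA]; simp [off]
  have hgpos := hpos g hg
  unfold condL
  split_ifs with h0
  · rfl
  · rcases B with _ | ⟨w, B⟩
    · rfl
    · have hwU : w ∈ U := by rw [hU]; simp
      have hwA : w ∉ A ++ [g] := by
        rw [hU, List.append_cons, List.nodup_append] at hnd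
        exact fun h => hnd.2.2 w h w (by simp) rfl
      have how : off len U w = tot len A + len g := by
        rw [hU, List.append_cons, off_append_right hwA, tot_append]; simp [off, tot]
      have hwpos := hpos w hwU
      simp only
      split_ifs with h1
      · have hwi : w = i := L.dollar_unique hS hwU h1 hi hci
        rcases B with _ | ⟨v, B⟩
        · rfl
        · have hvU : v ∈ U := by rw [hU]; simp
          have hvA : v ∉ A ++ [g] ++ [w] := by
            rw [hU, List.append_cons, List.append_cons, List.nodup_append] at hnd
            exact fun h => hnd.2.2 v h v (by simp) rfl
          have hov : off len U v = tot len A + len g + len w := by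
            rw [hU, List.append_cons, List.append_cons, off_append_right hvA, tot_append, tot_append]
            simp [off, tot]
          simp only [decide_eq_true_eq]
          intro hv
          -- Here g immediately precedes the `$` and has the character c, which is what the
          -- assumption excludes.
          exact havoid (by rw [hwi]; rfl) (hnext v hvU hv (by omega)).1
      · simp only [decide_eq_true_eq]
        intro hw
        -- The `$` would start after g and not after its immediate successor w, so it would be w,
        -- whose character is not `⊥`.
        obtain ⟨h2, h3, h4⟩ := hnext w hwU hw (by omega)
        have h5 : i ≠ w := by rintro rfl; exact h1 hci
        rcases off_trichotomy (len := len) hi hg (by rintro rfl; omega) with h6 | h6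
        · omega
        · exact h5 (eq_of_off_add_eq (len := len) (s := 0) (t := 0) hi hwU (by have := hpos i hi; omega)
            hwpos (by omega))

/-- The starting positions of DBWT-repetitions and F-intervals before and after the insertion of the
first character. -/
structure Shifted (q i x : ℕ) (N : List ℕ) (lst fst lst' fst' : ℕ → ℕ) : Prop where
  lst_eq : ∀ y ∈ N, lst' y = shift q (lst y)
  lst_new : lst' x = q
  fst_eq : ∀ y ∈ N, y ≠ i → fst' y = shift q (fst y)
  fst_old : fst' i = q
  fst_new : fst' x = 0

theorem Layout.grow (L : Layout S (A ++ B) (i :: (P ++ G)) ch len) (hS : IsText S) (hc : c ≠ ⊥)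
    (hci : ch i = ⊥) {x : ℕ} (hx : x ∉ A ++ B) (hA : tot len A = rk (c :: S) 0)
    (hP : tot len (i :: P) = rk (c :: S) 0) :
    Layout (c :: S) (A ++ x :: B) (x :: (P ++ i :: G))
      (Function.update (Function.update ch x ⊥) i c) (Function.update len x 1) ∧
    Shifted (rk (c :: S) 0) i x (A ++ B) (off len (A ++ B)) (off len (i :: (P ++ G)))
      (off (Function.update len x 1) (A ++ x :: B))
      (off (Function.update len x 1) (x :: (P ++ i :: G))) := by
  obtain ⟨h1, h2, h3, h4, h5, h6⟩ := L.cons hS hc hci hx hA hP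
  exact ⟨h1, h2, h3, h4, h5, h6⟩

/-- The cut comes first, still in S; then q is a boundary between repetitions and `Layout.grow`
applies. The program makes the changes in the opposite order, so the array updates are commuted at
the end. -/
theorem Layout.splitGrow {j d x z : ℕ} (L : Layout S (A ++ j :: B) (i :: (P ++ G)) ch len)
    (hS : IsText S) (hc : c ≠ ⊥) (hci : ch i = ⊥) (hx : x ∉ A ++ j :: B) (hz : z ∉ A ++ j :: B)
    (hxz : x ≠ z) (hji : j ≠ i) (hd : 0 < d) (hdl : d < len j) (hA : tot len A + d = rk (c :: S) 0)
    (hP : tot len (i :: P) = rk (c :: S) 0) :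
    ∃ V' ch' len', V' = insAfter j z (x :: (P ++ i :: G)) ∧
    ch' = Function.update (Function.update (Function.update ch x ⊥) i c) z (ch j) ∧
    len' = Function.update (Function.update (Function.update len x 1) z (len j - d)) j d ∧
    Layout (c :: S) (A ++ j :: x :: z :: B) V' ch' len' ∧
    Shifted (rk (c :: S) 0) i x (A ++ j :: B) (off len (A ++ j :: B)) (off len (i :: (P ++ G)))
      (off len' (A ++ j :: x :: z :: B)) (off len' V') ∧
    off len' (A ++ j :: x :: z :: B) z = rk (c :: S) 0 + 1 ∧ off len' V' z = off len' V' j + d := by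
  have hj : j ∈ A ++ j :: B := by simp
  have hiU : i ∈ A ++ j :: B := L.perm.mem_iff.1 (by simp)
  have hzj : z ≠ j := by rintro rfl; exact hz hj
  have hxj : x ≠ j := by rintro rfl; exact hx hj
  have hzi : z ≠ i := by rintro rfl; exact hz hiU
  have hxi : x ≠ i := by rintro rfl; exact hx hiU
  have hzV : z ∉ i :: (P ++ G) := fun h => hz (L.perm.mem_iff.1 h)
  have hjV : j ∈ i :: (P ++ G) := L.perm.mem_iff.2 hj
  have hlen : len j = d + (len j - d) := by omega
  have hndU := L.nodupU
  rw [List.nodup_middle, List.nodup_cons, List.mem_append, not_or] at hndU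
  obtain ⟨⟨hjA, hjB⟩, -⟩ := hndU
  have L1 := L.split hj hz hlen hd (by omega)
  rw [insAfter_eq hjA hjB, insAfter_cons_of_ne hji.symm, insAfter_append] at L1
  rw [List.append_cons] at L1
  have hxU1 : x ∉ (A ++ [j]) ++ z :: B := by
    simp only [List.mem_append, List.mem_cons, not_or, List.not_mem_nil] at hx ⊢
    tauto
  have htA : ∀ l, z ∉ l → j ∉ l →
      tot (Function.update (Function.update len z (len j - d)) j d) l = tot len l := by
    intro l h1 h2
    apply tot_congr
    intro b hb
    rw [Function.update_of_ne (by rintro rfl; exact h2 hb),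
      Function.update_of_ne (by rintro rfl; exact h1 hb)]
  have hzA : z ∉ A := fun h => hz (by simp [h])
  have hzP : z ∉ i :: P := fun h => hzV (by
    rcases List.mem_cons.1 h with h | h <;> simp [h])
  have hA1 : tot (Function.update (Function.update len z (len j - d)) j d) (A ++ [j]) =
      rk (c :: S) 0 := by
    rw [tot_append, htA A hzA hjA, ← hA]; simp [tot]
  have hP1 : tot (Function.update (Function.update len z (len j - d)) j d)
      (i :: insAfter j z P) = rk (c :: S) 0 := by
    rw [← insAfter_cons_of_ne hji.symm, tot_insAfter hzP hlen hzj, hP]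
  obtain ⟨L2, h2⟩ := L1.grow hS hc (by rw [Function.update_of_ne hzi.symm]; exact hci) hxU1 hA1 hP1
  have hzU1 : z ∈ (A ++ [j]) ++ z :: B := by simp
  have eU : (A ++ [j]) ++ z :: B = insAfter j z (A ++ j :: B) := by
    rw [insAfter_eq hjA hjB]; simp
  have eV : i :: (insAfter j z P ++ insAfter j z G) = insAfter j z (i :: (P ++ G)) := by
    rw [insAfter_cons_of_ne hji.symm, insAfter_append]
  have eV' : x :: (insAfter j z P ++ i :: insAfter j z G) = insAfter j z (x :: (P ++ i :: G)) := by
    rw [insAfter_cons_of_ne hxj, insAfter_append, insAfter_cons_of_ne hji.symm]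
  have eU' : (A ++ [j]) ++ x :: z :: B = A ++ j :: x :: z :: B := by simp
  have ech : Function.update (Function.update (Function.update ch z (ch j)) x ⊥) i c =
      Function.update (Function.update (Function.update ch x ⊥) i c) z (ch j) := by
    rw [Function.update_comm hxz.symm, Function.update_comm hzi]
  have elen : Function.update (Function.update (Function.update len z (len j - d)) j d) x 1 =
      Function.update (Function.update (Function.update len x 1) z (len j - d)) j d := by
    rw [Function.update_comm hxj.symm, Function.update_comm hxz.symm]
  rw [eV', eU', ech, elen] at L2
  rw [eU, eV, eV', eU', elen] at h2
  have hU' : ∀ y ∈ A ++ j :: B, y ∈ insAfter j z (A ++ j :: B) := fun y hy =>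
    (mem_insAfter hj).2 (Or.inr hy)
  have hyz : ∀ y ∈ A ++ j :: B, y ≠ z := by rintro y hy rfl; exact hz hy
  refine ⟨_, _, _, rfl, rfl, rfl, L2, ⟨?_, h2.lst_new, ?_, h2.fst_old, h2.fst_new⟩, ?_, ?_⟩
  · intro y hy
    rw [h2.lst_eq y (hU' y hy), off_insAfter hz hlen hzj (hyz y hy)]
  · intro y hy hyi
    rw [h2.fst_eq y (hU' y hy) hyi, off_insAfter hzV hlen hzj (hyz y hy)]
  · rw [h2.lst_eq z (by rw [← eU]; exact hzU1), off_insAfter_self hz hj hzj,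
      off_append_right hjA]
    simp [off, hA, shift]
  · rw [h2.fst_eq z (by rw [← eU]; exact hzU1) hzi, h2.fst_eq j (hU' j hj) hji,
      off_insAfter_self hzV hjV hzj, off_insAfter hzV hlen hzj hzj.symm]
    -- The former F-interval of j does not straddle q, so both of its parts are shifted alike.
    have h5 := off_add_le_of_lt (B := G) hP (k := j) (by simpa using hjV)
    rw [List.cons_append] at h5
    simp only [shift]
    split_ifs <;> omega

end Insertion


/-! ### Decomposition of the program into phases. -/

section Phases

variable {σ β : Type}

def optM (o : Option β) (f : β → Prog σ Unit) : Prog σ Unit :=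
  match o with
  | some x => f x
  | none => pure ()

/-- The first part of `splitNode`: the new node is created and linked, and its edge of `E_L` is set. -/
def splitLink (τ j d x y : ℕ) (sj : Cell σ) : Prog σ ℕ := do
  let z ← allocCell { sj with len := sj.len - d, inU := none, inV := none }
  updateCell j (fun s => { s with len := d })
  linkUAfter z x
  orderInsertAfter τ z x
  linkVAfter z j
  updateCell z (fun s => { s with eL := y, bL := 0 })
  updateCell y (fun s => { s with inV := some z })
  return z

/-- The second part of `splitNode`: the edges of `E_F` into the new node. -/
def splitInU (j d N z y : ℕ) : Prog σ Unit := do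
  redirectF j z d N (some y)
  updateCell z (fun s => { s with inU := some y })
  updateCell j (fun s => { s with inU := if s.inU = some y then none else s.inU })

/-- The third part of `splitNode`: the edge of `E_F` from the new node. -/
def splitOutV (d N z : ℕ) (tj : Cell σ) : Prog σ ℕ := do
  let (h, b) ← locate (N + 1) tj.eF (tj.bF + d)
  updateCell z (fun s => { s with eF := h, bF := b })
  if h ≠ tj.eF then updateCell h (fun s => { s with inU := some z })
  return h

/-- The fourth part of `splitNode`: the edges of `E_L` into the new node. -/
def splitInV (j d N z : ℕ) (o : Option ℕ) : Prog σ Unit := do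
  let first ← redirectL j z d (N + 1) o none
  updateCell z (fun s => { s with inV := first })
  updateCell j (fun s => { s with inV := if s.inV = first then none else s.inV })

/-- The last part of `splitNode`: the arrays of heavy nodes. -/
def splitHeavy (α z h : ℕ) : Prog σ Unit := do
  let sh ← readCell h
  if (← heavyTestU h α sh.inU) then pushHeavyU h
  let h' := (← readCell z).eL
  let sh' ← readCell h'
  if (← heavyTestV h' α sh'.inV) then pushHeavyV h'

def splitParts (τ α j d x y : ℕ) : Prog σ ℕ := do
  let N ← readReg (fun m => m.fresh)
  let sj ← readCell j
  let z ← splitLink τ j d x y sj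
  splitInU j d N z y
  let tj ← readCell j
  let h ← splitOutV d N z tj
  splitInV j d N z tj.inV
  splitHeavy α z h
  return z

/-- Only the associativity and unit laws of the state monad are involved. -/
theorem splitNode_eq (τ α j d x y : ℕ) :
    splitNode (σ := σ) τ α j d x y = splitParts τ α j d x y := by
  simp only [splitNode, splitParts, splitLink, splitInU, splitOutV, splitInV, splitHeavy, bind_assoc,
    pure_bind]
  repeat' first
    | with_reducible rfl
    | refine bind_congr fun _ => ?_
    | split_ifs
    | simp only [bind_assoc, pure_bind]

variable [LinearOrder σ] [OrderBot σ]

/-- The deletions from the B-tree. -/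
def deletePhase (τ i : ℕ) (p j : Option ℕ) : Prog σ Unit := do
  deleteIfStored τ i
  optM p (deleteIfStored τ)
  optM j (deleteIfStored τ)

/-- The new node with label `$` is created and inserted, and the old one gets the label `c`. -/
def insertNode (τ : ℕ) (c : σ) (i : ℕ) (si : Cell σ) (g w : ℕ) : Prog σ ℕ := do
  let x ← allocCell
    { ch := ⊥, len := 1, uPrev := none, uNext := none, vPrev := none, vNext := si.vNext,
      eL := i, bL := 0, eF := si.eF, bF := 0, inU := some i, inV := some si.eF }
  setVHead (some x)
  match si.vNext with
  | some y => updateCell y (fun s => { s with vPrev := some x })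
  | none => setVTail (some x)
  updateCell si.eF (fun s => { s with eL := x, bL := 0, inU := some x })
  updateCell i (fun s => { s with ch := c, eF := x, bF := 0, inV := some x })
  linkVAfter i (if g = i then x else g)
  linkUAfter x w
  orderInsertAfter τ x w
  setDollar x
  return x

/-- The insertions into the B-tree. -/
def insertPhase (τ i x : ℕ) (p z : Option ℕ) : Prog σ Unit := do
  optM p (insertIfRequired τ)
  insertIfRequired τ i
  insertIfRequired τ x
  optM z (insertIfRequired τ)

/-- The part of `update` that modifies the state. -/
def updateTail (τ α : ℕ) (c : σ) (i : ℕ) (si : Cell σ) (g w : ℕ) (cut : Option (ℕ × ℕ × ℕ)) :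
    Prog σ Unit := do
  deletePhase τ i si.uPrev (cut.map (fun t => t.1))
  let x ← insertNode τ c i si g w
  let z ← (match cut with
    | some (j, d, y) => do return some (← splitNode τ α j d x y)
    | none => pure none : Prog σ (Option ℕ))
  insertPhase τ i x si.uPrev z

/-- The node `w` that is going to precede the new `$`, and the node to be split with the place of
the split and the node of `V` that starts there. -/
def St.findCut (s : St σ) (g : ℕ) : Option ℕ × Option (ℕ × ℕ × ℕ) :=
  match s.vNext g with
  | none => (s.uTail, none)
  | some y => if 0 < s.bF y then (some (s.eF y), some (s.eF y, s.bF y, y))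
      else (s.uPrev (s.eF y), none)

/-- The node before the new `$` and the place of the split, found from the successor of `v_g`. -/
def findCut (gnext : Option ℕ) : Prog σ (Option ℕ × Option (ℕ × ℕ × ℕ)) :=
  match gnext with
  | none => do return (← readReg (fun m => m.uTail), none)
  | some y => do
      let sy ← readCell y
      if 0 < sy.bF then return (some sy.eF, some (sy.eF, sy.bF, y))
      else return ((← readCell sy.eF).uPrev, none)

theorem update_eq (τ α : ℕ) (c : σ) : update τ α c = (do
    let i ← readReg (fun m => m.dollar)
    let si ← readCell i
    let root ← readReg (fun m => m.btree)
    match ← searchTree τ i c root none with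
    | none => pure ()
    | some g =>
      let sg ← readCell g
      let r ← findCut sg.vNext
      match r.1 with
      | none => pure ()
      | some w => updateTail τ α c i si g w r.2 : Prog σ Unit) := by
  unfold update
  refine bind_congr fun i => bind_congr fun si => bind_congr fun root => bind_congr fun o => ?_
  rcases o with _ | g
  · rfl
  refine bind_congr fun sg => ?_
  refine bind_congr fun r => ?_
  rcases r with ⟨_ | w, cut⟩
  · rfl
  simp only [updateTail, deletePhase, insertNode, insertPhase, bind_assoc]
  refine bind_congr fun _ => ?_
  rcases cut with _ | ⟨j, d, y⟩ <;> rcases hp : si.uPrev with _ | p <;>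
    rcases hv : si.vNext with _ | v <;>
    simp only [optM, bind_assoc, pure_bind, Option.map_none, Option.map_some]

/-- Up to this point the program only reads: three reads, the search with n steps, the read of the
cell of g, and one or two reads in `findCut`. Hence the state is unchanged except for the step
counter. -/
theorem ex_update (τ α : ℕ) (c : σ) (s : St σ) {g w n : ℕ} {cut : Option (ℕ × ℕ × ℕ)}
    (hsearch : ex (searchTree τ s.dollar c s.btree none) (s.tk 3).toM = (some g, (s.tk (3 + n)).toM))
    (hcut : s.findCut g = (some w, cut)) :
    ∃ k ≤ n + 6, ex (update τ α c) s.toM =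
      ex (updateTail τ α c s.dollar (s.get s.dollar) g w cut) (s.tk k).toM := by
  have h1 : ex (readReg (fun m : Machine σ => m.dollar)) s.toM = (s.dollar, (s.tk 1).toM) := rfl
  have h2 : ex (readCell s.dollar) (s.tk 1).toM = (s.get s.dollar, (s.tk 2).toM) := rfl
  have h3 : ex (readReg (fun m : Machine σ => m.btree)) (s.tk 2).toM = (s.btree, (s.tk 3).toM) := rfl
  have h4 : ∀ k, ex (readCell g) (s.tk k).toM = (s.get g, (s.tk (k + 1)).toM) := fun k => rfl
  have h5 : ∀ k, ex (readReg (fun m : Machine σ => m.uTail)) (s.tk k).toM =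
    (s.uTail, (s.tk (k + 1)).toM) := fun k => rfl
  have h6 : ∀ y k, ex (readCell y) (s.tk k).toM = (s.get y, (s.tk (k + 1)).toM) := fun y k => rfl
  unfold St.findCut at hcut
  rcases hv : s.vNext g with _ | y
  · rw [hv] at hcut
    simp only [Prod.mk.injEq] at hcut
    obtain ⟨hw, rfl⟩ := hcut
    refine ⟨3 + n + 2, by omega, ?_⟩
    simp only [update_eq, findCut, ex_bind, h1, h2, h3, hsearch, h6, St.get, hv, h5, ex_pure, hw]
  · rw [hv] at hcut
    simp only at hcut
    split_ifs at hcut with hb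
    · simp only [Prod.mk.injEq, Option.some.injEq] at hcut
      obtain ⟨hw, rfl⟩ := hcut
      refine ⟨3 + n + 2, by omega, ?_⟩
      simp only [update_eq, findCut, ex_bind, h1, h2, h3, hsearch, h6, St.get, hv, if_pos hb, ex_pure, hw]
    · simp only [Prod.mk.injEq] at hcut
      obtain ⟨hw, rfl⟩ := hcut
      refine ⟨3 + n + 3, by omega, ?_⟩
      simp only [update_eq, findCut, ex_bind, h1, h2, h3, hsearch, h6, St.get, hv, if_neg hb, ex_pure, hw]

end Phases


/-! ### The states after the individual phases. -/

section PhaseStates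

variable {σ β : Type}

/-- A write to a cell touches every array; where the field is not meant to change, its old value is
written back and the write disappears. -/
theorem update_update_same {γ : Type} {f : ℕ → γ} {a b : ℕ} {v : γ} (h : b ≠ a) :
    Function.update (Function.update f a v) b (f b) = Function.update f a v := by
  rw [← Function.update_of_ne h v f, Function.update_eq_self]

/-- The state after `splitLink`. -/
def St.splitLink (s : St σ) (j d x y : ℕ) : St σ :=
  {s with
      ch := Function.update s.ch s.fresh (s.ch j)
      len := Function.update (Function.update s.len s.fresh (s.len j - d)) j d
      uPrev := setAt (Function.update s.uPrev s.fresh (some x)) (s.uNext x) (some s.fresh)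
      uNext := Function.update (Function.update s.uNext s.fresh (s.uNext x)) x (some s.fresh)
      uTail := (s.uNext x).elim (some s.fresh) (fun _ => s.uTail)
      vPrev := setAt (Function.update s.vPrev s.fresh (some j)) (s.vNext j) (some s.fresh)
      vNext := Function.update (Function.update s.vNext s.fresh (s.vNext j)) j (some s.fresh)
      vTail := (s.vNext j).elim (some s.fresh) (fun _ => s.vTail)
      eL := Function.update s.eL s.fresh y
      bL := Function.update s.bL s.fresh 0
      eF := Function.update s.eF s.fresh (s.eF j)
      bF := Function.update s.bF s.fresh (s.bF j)
      inU := Function.update s.inU s.fresh none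
      inV := Function.update (Function.update s.inV s.fresh none) y (some s.fresh)
      order := s.order.insertIdx (s.order.idxOf x + 1) s.fresh
      fresh := s.fresh + 1 }

/-- The 12 steps are an allocation, three writes and twice four steps for linking. -/
theorem ex_splitLink (τ j d x y : ℕ) (s : St σ) (hy : y ≠ s.fresh) (hj : j ≠ s.fresh)
    (hx : x ≠ s.fresh) : ex (splitLink τ j d x y (s.get j)) s.toM =
      (s.fresh, ((s.splitLink j d x y).tk (12 + τ)).toM) := by
  simp [splitLink, ex_bind, ex_map, ex_allocCell, ex_updateCell, ex_linkUAfter, ex_linkVAfter,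
    ex_orderInsertAfter, St.get, update_update_same, Function.update_of_ne, hy, hj, hx,
    St.splitLink, St.tk]
  congr 2
  omega

/-- The state after `splitInU`. -/
def St.splitInU (s : St σ) (M : List ℕ) (j d z y : ℕ) : St σ :=
  {s with
    eF := fun v => if v ∈ M then z else s.eF v
    bF := fun v => if v ∈ M then s.bF v - d else s.bF v
    inU := Function.update (Function.update s.inU z (some y)) j
      (if s.inU j = some y then none else s.inU j) }

theorem ex_splitInU {j d N z y : ℕ} (M B : List ℕ) (s : St σ) (hzj : z ≠ j)
    (hnd : (M ++ B).Nodup) (hhd : (M ++ B).head? = some y)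
    (hs : SegTo s.vNext (M ++ B) none) (hM : ∀ v ∈ M, s.eF v = j) (hB : ∀ v ∈ B.head?, s.eF v ≠ j)
    (hN : M.length ≤ N) :
    ∃ t ≤ 2 * M.length + 3, ex (splitInU j d N z y) s.toM = ((), ((s.splitInU M j d z y).tk t).toM) := by
  obtain ⟨t, ht, h⟩ := ex_redirectF (z := z) (d := d) M B N s hnd hs hM hB hN
  refine ⟨t + 2, by omega, ?_⟩
  rw [hhd] at h
  simp [splitInU, ex_bind, h, ex_updateCell, St.get, Function.update_of_ne, hzj.symm,
    St.splitInU, St.tk]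
  congr 1

/-- The state after `splitOutV`. -/
def St.splitOutV (s : St σ) (z h b k : ℕ) : St σ :=
  {s with
    eF := Function.update s.eF z h
    bF := Function.update s.bF z b
    inU := if h ≠ k then Function.update s.inU h (some z) else s.inU }

theorem ex_splitOutV {d N z h b t : ℕ} {tj : Cell σ} (s : St σ)
    (hl : ex (locate (N + 1) tj.eF (tj.bF + d)) s.toM = ((h, b), (s.tk t).toM)) :
    ∃ t' ≤ t + 2, ex (splitOutV d N z tj) s.toM = (h, ((s.splitOutV z h b tj.eF).tk t').toM) := by
  by_cases hh : h = tj.eF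
  · refine ⟨t + 1, by omega, ?_⟩
    simp [splitOutV, ex_bind, ex_map, hl, hh, St.tk, ex_updateCell, St.get, St.splitOutV]
    congr 1
  · refine ⟨t + 2, by omega, ?_⟩
    simp [splitOutV, ex_bind, ex_map, hl, hh, St.tk, ex_updateCell, St.get, St.splitOutV]
    congr 1

/-- The state after `splitInV`. -/
def St.splitInV (s : St σ) (M : List ℕ) (j d z : ℕ) (f : Option ℕ) : St σ :=
  {s with
    eL := fun v => if v ∈ M ∧ d ≤ s.bL v then z else s.eL v
    bL := fun v => if v ∈ M ∧ d ≤ s.bL v then s.bL v - d else s.bL v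
    inV := Function.update (Function.update s.inV z f) j (if s.inV j = f then none else s.inV j) }

theorem ex_splitInV {j d N z : ℕ} (M B : List ℕ) (s : St σ) (hzj : z ≠ j)
    (hnd : (M ++ B).Nodup)
    (hs : SegTo s.uNext (M ++ B) none) (hM : ∀ v ∈ M, s.eL v = j) (hB : ∀ v ∈ B.head?, s.eL v ≠ j)
    (hN : M.length ≤ N + 1) :
    ∃ t ≤ 2 * M.length + 3, ex (splitInV j d N z M.head?) s.toM = ((),
      ((s.splitInV M j d z (M.find? (fun v => decide (d ≤ s.bL v)))).tk t).toM) := by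
  obtain ⟨t, ht, h⟩ := ex_redirectL (z := z) (d := d) M B (N + 1) s hnd hs hM hB hN
  refine ⟨t + 2, by omega, ?_⟩
  simp [splitInV, ex_bind, h, ex_updateCell, St.get, Function.update_of_ne, hzj.symm,
    St.splitInV, St.tk]
  congr 1

/-- The state after `splitHeavy`. -/
def St.splitHeavy (s : St σ) (h h' : ℕ) (p p' : Prop) [Decidable p] [Decidable p'] : St σ :=
  {s with
    heavyU := if p then h :: s.heavyU else s.heavyU
    heavyV := if p' then h' :: s.heavyV else s.heavyV }

theorem ex_splitHeavy {α z h : ℕ} (s : St σ) (M B M' B' : List ℕ)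
    (hs : SegTo s.vNext (M ++ B) none) (hM : ∀ v ∈ M, s.eF v = h) (hB : ∀ v ∈ B.head?, s.eF v ≠ h)
    (hM0 : M.head? = s.inU h)
    (hs' : SegTo s.uNext (M' ++ B') none) (hM' : ∀ v ∈ M', s.eL v = s.eL z)
    (hB' : ∀ v ∈ B'.head?, s.eL v ≠ s.eL z) (hM0' : M'.head? = s.inV (s.eL z)) :
    ∃ t ≤ 2 * α + 5, ex (splitHeavy α z h) s.toM = ((),
      ((s.splitHeavy h (s.eL z) (α ≤ M.length) (α ≤ M'.length)).tk t).toM) := by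
  obtain ⟨t1, ht1, h1⟩ := ex_heavyTestU h M B α (s.tk 1) hs hM hB
  -- The second test reads only these three fields, so it does not depend on the outcome of the
  -- first one.
  have key : ∀ s1 : St σ, s1.uNext = s.uNext → s1.eL = s.eL → s1.inV = s.inV →
      ∃ t2 ≤ α + 3, ex (do
        let h' := (← readCell z).eL
        let sh' ← readCell h'
        if (← heavyTestV h' α sh'.inV) then pushHeavyV h' : Prog σ Unit) s1.toM =
        ((), ({s1 with
          heavyV := if α ≤ M'.length then s.eL z :: s1.heavyV else s1.heavyV
          steps := s1.steps + t2} : St σ).toM) := by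
    intro s1 e1 e2 e3
    obtain ⟨t2, ht2, h2⟩ := ex_heavyTestV (s.eL z) M' B' α (s1.tk 2) (by simpa [St.tk, e1] using hs')
      (by simpa [St.tk, e2] using hM') (by simpa [St.tk, e2] using hB')
    rw [hM0'] at h2
    by_cases hc : α ≤ M'.length
    · refine ⟨t2 + 3, by omega, ?_⟩
      simp only [ex_bind, ex_readCell, St.get, e2, e3, St.tk] at h2 ⊢
      rw [h2]
      simp only [hc, decide_true, if_true, ex_pushHeavyV]
      congr 2
      simp; omega
    · refine ⟨t2 + 2, by omega, ?_⟩
      simp only [ex_bind, ex_readCell, St.get, e2, e3, St.tk] at h2 ⊢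
      rw [h2]
      simp only [hc, decide_false, if_false, ex_pure, Bool.false_eq_true]
      congr 2
      simp; omega
  rw [hM0] at h1
  by_cases hc : α ≤ M.length
  · obtain ⟨t2, ht2, h2⟩ := key ({s with heavyU := h :: s.heavyU, steps := s.steps + (t1 + 2)}) rfl rfl rfl
    refine ⟨t1 + 2 + t2, by omega, ?_⟩
    unfold splitHeavy
    rw [ex_bind, ex_readCell]
    simp only [St.get, St.tk] at h1 ⊢
    rw [ex_bind, h1]
    simp only [hc, decide_true, if_true]
    rw [ex_bind, ex_pushHeavyU]
    rw [show s.steps + 1 + t1 + 1 = s.steps + (t1 + 2) by omega]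
    refine h2.trans ?_
    simp only [St.splitHeavy]
    congr 2
    simp; omega
  · obtain ⟨t2, ht2, h2⟩ := key ({s with steps := s.steps + (t1 + 1)}) rfl rfl rfl
    refine ⟨t1 + 1 + t2, by omega, ?_⟩
    unfold splitHeavy
    rw [ex_bind, ex_readCell]
    simp only [St.get, St.tk] at h1 ⊢
    rw [ex_bind, h1]
    simp only [hc, decide_false, Bool.false_eq_true, if_false]
    rw [show s.steps + 1 + t1 = s.steps + (t1 + 1) by omega]
    refine h2.trans ?_
    simp only [St.splitHeavy]
    congr 2
    simp; omega

variable [LinearOrder σ] [OrderBot σ]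

/-- The state after `insertNode`. -/
def St.insertNode (s : St σ) (c : σ) (i g w : ℕ) : St σ :=
  let x := s.fresh
  let hd := s.eF i
  let vPrev := setAt (Function.update s.vPrev x none) (s.vNext i) (some x)
  let vNext := Function.update s.vNext x (s.vNext i)
  let vTail := (s.vNext i).elim (some x) (fun _ => s.vTail)
  let y := if g = i then x else g
  {s with
    ch := Function.update (Function.update s.ch x ⊥) i c
    len := Function.update s.len x 1
    uPrev := setAt (Function.update s.uPrev x (some w)) (s.uNext w) (some x)
    uNext := Function.update (Function.update s.uNext x (s.uNext w)) w (some x)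
    uTail := (s.uNext w).elim (some x) (fun _ => s.uTail)
    vPrev := setAt (Function.update vPrev i (some y)) (vNext y) (some i)
    vNext := Function.update (Function.update vNext i (vNext y)) y (some i)
    vHead := some x
    vTail := (vNext y).elim (some i) (fun _ => vTail)
    eL := Function.update (Function.update s.eL x i) hd x
    bL := Function.update (Function.update s.bL x 0) hd 0
    eF := Function.update (Function.update s.eF x hd) i x
    bF := Function.update (Function.update s.bF x 0) i 0
    inU := Function.update (Function.update s.inU x (some i)) hd (some x)
    inV := Function.update (Function.update s.inV x (some hd)) i (some x)
    order := s.order.insertIdx (s.order.idxOf w + 1) x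
    dollar := x
    fresh := x + 1 }

/-- The nodes that are read or written must differ from the new address, since otherwise the
allocation would overwrite them. The 14 steps are an allocation, two register writes, three steps
for the old successor of i and the two edges, and twice four steps for linking. -/
theorem ex_insertNode (τ : ℕ) (c : σ) (i g w : ℕ) (s : St σ) (hi : i ≠ s.fresh) (hw : w ≠ s.fresh)
    (hhd : s.eF i ≠ s.fresh) (hv : s.vNext i ≠ some s.fresh) :
    ex (insertNode τ c i (s.get i) g w) s.toM = (s.fresh, ((s.insertNode c i g w).tk (14 + τ)).toM) := by
  rcases hn : s.vNext i with _ | v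
  · have e := update_update_same (f := s.vNext) (v := none) hi
    rw [hn] at e
    simp [insertNode, ex_bind, ex_map, ex_allocCell, ex_updateCell, ex_linkUAfter, ex_linkVAfter,
      ex_orderInsertAfter, St.get, update_update_same, Function.update_of_ne, hi, hw, hhd, hn,
      ex_setVHead, ex_setVTail, ex_setDollar, St.insertNode, setAt, St.tk]
    rw [e]
    congr 2
    omega
  · have hv' : v ≠ s.fresh := by rintro rfl; exact hv hn
    have e := update_update_same (f := s.vNext) (v := some v) hi
    rw [hn] at e
    simp [insertNode, ex_bind, ex_map, ex_allocCell, ex_updateCell, ex_linkUAfter, ex_linkVAfter,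
      ex_orderInsertAfter, St.get, update_update_same, Function.update_of_ne, hi, hw, hhd, hn,
      ex_setVHead, ex_setDollar, St.insertNode, setAt, hv', St.tk]
    rw [e]
    congr 2
    omega

end PhaseStates


/-! ### The deletions from and the insertions into the B-tree. -/

section TreePhases

variable {σ : Type} [LinearOrder σ] [OrderBot σ] {S : List σ} {U V : List ℕ} {s : St σ}

/-- A bound for the steps of a B-tree operation with `n` nodes. -/
def treeCost (τ n : ℕ) : ℕ := (2 * τ + 5) * (Nat.log 2 (n + 1) + 1) + 6

/-- The 2 pays for reading and writing the root, the 4 for the test of the condition. -/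
theorem treeCost_bound {t : BTree} {τ n : ℕ} (ht : t.Complete) (hn : t.inorder.length ≤ n) :
    (2 * τ + 5) * (t.height + 1) + 2 + 4 ≤ treeCost τ n := by
  have h1 := t.two_pow_height_le ht
  have h2 : t.height ≤ Nat.log 2 (n + 1) :=
    Nat.le_log_of_pow_le (by norm_num) (by omega)
  unfold treeCost
  have := Nat.mul_le_mul_left (2 * τ + 5) (Nat.add_le_add_right h2 1)
  omega

/-- The order of the keys is that of the starts of the F-intervals, so `off` along V serves as the
rank for the tree operations. -/
theorem Stored.compares (h : Stored S U V s) (hS : IsText S) {x : ℕ} (hx : x ∈ U) {l : List ℕ}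
    (hl : ∀ y ∈ l, y ∈ U) : s.Compares (off s.len V) x l := by
  intro y hy hne
  have hyU := hl y hy
  have h1 : s.keyLt x (s.ch x) y (s.ch y) ↔ off s.len V x < off s.len V y := by
    rw [h.layout.off_lt_off hS hx hyU, off_lt_iff_idxOf h.layout.pos hx hyU, ← h.order]; rfl
  rw [h1]
  have h2 : off s.len V x ≠ off s.len V y := fun e =>
    hne (off_inj h.layout.posV (h.layout.perm.mem_iff.2 hyU) (h.layout.perm.mem_iff.2 hx) e.symm)
  omega

theorem Stored.with_btree (h : Stored S U V s) (t : BTree) (n : ℕ) :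
    Stored S U V ({s with btree := t, steps := n} : St σ) :=
  ⟨h.layout, h.alloc, h.dllU, h.dllV, h.halfL, h.halfF, h.order, h.dollar_mem, h.dollar_ch⟩

/-- The predicate p describes what is left after earlier deletions. A node that fails the condition
is not stored, so skipping its deletion is harmless. -/
theorem ex_deleteIfStored (τ : ℕ) {x : ℕ} {p : ℕ → Bool} (h : Stored S U V s) (hS : IsText S)
    (hx : x ∈ U) (hc : s.btree.Complete) (hin : s.btree.inorder = V.filter p)
    (hp : p x = true → s.cond x = true) :
    ∃ t, ∃ n ≤ treeCost τ V.length, ex (deleteIfStored τ x) s.toM =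
      ((), ({s with btree := t, steps := s.steps + n} : St σ).toM) ∧ t.Complete ∧
      t.inorder = V.filter (fun y => p y && decide (y ≠ x)) := by
  obtain ⟨n1, hn1, h1⟩ := ex_searchTest x s
  have hlen : s.btree.inorder.length ≤ V.length := by rw [hin]; exact List.length_filter_le _ _
  have hb := treeCost_bound (τ := τ) hc hlen
  by_cases hcx : s.cond x = true
  · have hst : Stored S U V ({s with steps := s.steps + n1} : St σ) := h.with_btree s.btree _
    obtain ⟨t, n2, hn2, h2, h3, h4⟩ := ex_treeDelete τ x (off s.len V)
      ({s with steps := s.steps + n1} : St σ) hc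
      (by change s.btree.inorder.Pairwise _
          rw [hin]; exact (pairwise_off h.layout.nodupV h.layout.posV).filter _)
      (hst.compares hS hx fun y hy => by
        change y ∈ s.btree.inorder at hy
        rw [hin] at hy
        exact h.layout.perm.mem_iff.1 (List.mem_filter.1 hy).1)
    refine ⟨t, n1 + n2, ?_, ?_, h4, ?_⟩
    · change n2 ≤ (2 * τ + 5) * (s.btree.height + 1) + 2 at hn2
      omega
    · simp only [deleteIfStored, ex_bind, h1, hcx, if_true, h2, add_assoc]
    · rw [h3]
      change s.btree.inorder.filter _ = _
      rw [hin, List.filter_filter]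
      apply List.filter_congr
      intro y _
      rw [Bool.and_comm]
  · refine ⟨s.btree, n1, by omega, ?_, hc, ?_⟩
    · simp only [deleteIfStored, ex_bind, h1, hcx, Bool.false_eq_true, if_false, ex_pure]
    · rw [hin]
      apply List.filter_congr
      intro y _
      rcases eq_or_ne y x with rfl | hne
      · have : ¬ p y = true := fun e => hcx (hp e)
        simp [this]
      · simp [hne]

theorem ex_optM_delete (τ : ℕ) {o : Option ℕ} {p : ℕ → Bool} (h : Stored S U V s) (hS : IsText S)
    (hx : ∀ x ∈ o, x ∈ U) (hc : s.btree.Complete) (hin : s.btree.inorder = V.filter p)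
    (hp : ∀ x, p x = true → s.cond x = true) :
    ∃ t, ∃ n ≤ treeCost τ V.length, ex (optM o (deleteIfStored τ)) s.toM =
      ((), ({s with btree := t, steps := s.steps + n} : St σ).toM) ∧ t.Complete ∧
      t.inorder = V.filter (fun y => p y && decide (some y ≠ o)) := by
  rcases o with _ | x
  · exact ⟨s.btree, 0, by omega, rfl, hc, by simpa using hin⟩
  · simpa [optM] using ex_deleteIfStored τ h hS (hx x (by simp)) hc hin (hp x)

theorem ex_deletePhase (τ : ℕ) {i : ℕ} {o j : Option ℕ} (h : Stored S U V s) (hS : IsText S)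
    (hi : i ∈ U) (ho : ∀ x ∈ o, x ∈ U) (hj : ∀ x ∈ j, x ∈ U)
    (hc : s.btree.Complete) (hin : s.btree.inorder = V.filter s.cond) :
    ∃ t, ∃ n ≤ 3 * treeCost τ V.length, ex (deletePhase τ i o j) s.toM =
      ((), ({s with btree := t, steps := s.steps + n} : St σ).toM) ∧ t.Complete ∧
      t.inorder = V.filter (fun y => s.cond y && decide (y ≠ i ∧ some y ≠ o ∧ some y ≠ j)) := by
  obtain ⟨t1, n1, hn1, e1, c1, i1⟩ := ex_deleteIfStored τ h hS hi hc hin id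
  obtain ⟨t2, n2, hn2, e2, c2, i2⟩ := ex_optM_delete (s := {s with btree := t1, steps := s.steps + n1})
    (o := o) τ (h.with_btree _ _) hS ho c1 i1 (fun x hx => by
      change s.cond x = true
      simp only [Bool.and_eq_true] at hx; exact hx.1)
  obtain ⟨t3, n3, hn3, e3, c3, i3⟩ := ex_optM_delete
    (s := {s with btree := t2, steps := s.steps + n1 + n2})
    (o := j) τ (h.with_btree _ _) hS hj c2 i2 (fun x hx => by
      change s.cond x = true
      simp only [Bool.and_eq_true] at hx; exact hx.1.1)
  refine ⟨t3, n1 + n2 + n3, by omega, ?_, c3, ?_⟩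
  · simp only [deletePhase, ex_bind, e1]
    rw [e2, e3]
    simp only [add_assoc]
  · rw [i3]
    apply List.filter_congr
    intro y _
    rw [Bool.eq_iff_iff]
    simp only [Bool.and_eq_true, decide_eq_true_eq, and_assoc]

theorem ex_insertIfRequired (τ : ℕ) {x : ℕ} (h : Stored S U V s) (hS : IsText S) (hx : x ∈ U)
    (hc : s.btree.Complete) (hsub : ∀ y ∈ s.btree.inorder, y ∈ V)
    (hsort : s.btree.inorder.Pairwise (fun a b => off s.len V a < off s.len V b)) :
    ∃ t, ∃ n ≤ treeCost τ V.length, ex (insertIfRequired τ x) s.toM =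
      ((), ({s with btree := t, steps := s.steps + n} : St σ).toM) ∧ t.Complete ∧
      t.inorder.Pairwise (fun a b => off s.len V a < off s.len V b) ∧
      ∀ y, y ∈ t.inorder ↔ y ∈ s.btree.inorder ∨ (y = x ∧ s.cond y = true) := by
  obtain ⟨n1, hn1, h1⟩ := ex_searchTest x s
  have hnd : s.btree.inorder.Nodup := hsort.imp fun h => by rintro rfl; exact lt_irrefl _ h
  have hlen : s.btree.inorder.length ≤ V.length := (hnd.subperm hsub).length_le
  have hb := treeCost_bound (τ := τ) hc hlen
  by_cases hcx : s.cond x = true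
  · have hst : Stored S U V ({s with steps := s.steps + n1} : St σ) := h.with_btree s.btree _
    obtain ⟨t, n2, hn2, h2, h3, h4, h5⟩ := ex_treeInsert τ x (off s.len V)
      ({s with steps := s.steps + n1} : St σ) hc hsort
      (hst.compares hS hx fun y hy => h.layout.perm.mem_iff.1 (hsub y hy))
    refine ⟨t, n1 + n2, ?_, ?_, h5, h4, fun y => ?_⟩
    · change n2 ≤ (2 * τ + 5) * (s.btree.height + 1) + 2 at hn2
      omega
    · simp only [insertIfRequired, ex_bind, h1, hcx, if_true, h2, add_assoc]
    · rw [h3, or_comm]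
      refine or_congr Iff.rfl ⟨fun e => ⟨e, e ▸ hcx⟩, And.left⟩
  · refine ⟨s.btree, n1, by omega, ?_, hc, hsort, fun y => ?_⟩
    · simp only [insertIfRequired, ex_bind, h1, hcx, Bool.false_eq_true, if_false, ex_pure]
    · exact ⟨Or.inl, fun e => e.elim id fun ⟨e1, e2⟩ => absurd (e1 ▸ e2) hcx⟩

theorem ex_optM_insert (τ : ℕ) {o : Option ℕ} (h : Stored S U V s) (hS : IsText S)
    (hx : ∀ x ∈ o, x ∈ U)
    (hc : s.btree.Complete) (hsub : ∀ y ∈ s.btree.inorder, y ∈ V)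
    (hsort : s.btree.inorder.Pairwise (fun a b => off s.len V a < off s.len V b)) :
    ∃ t, ∃ n ≤ treeCost τ V.length, ex (optM o (insertIfRequired τ)) s.toM =
      ((), ({s with btree := t, steps := s.steps + n} : St σ).toM) ∧ t.Complete ∧
      t.inorder.Pairwise (fun a b => off s.len V a < off s.len V b) ∧
      ∀ y, y ∈ t.inorder ↔ y ∈ s.btree.inorder ∨ (some y = o ∧ s.cond y = true) := by
  rcases o with _ | x
  · exact ⟨s.btree, 0, by omega, rfl, hc, hsort, by simp⟩
  · simpa [optM] using ex_insertIfRequired τ h hS (hx x (by simp)) hc hsub hsort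

/-- It suffices that the tree is right at the nodes that are not inserted now, and that it contains
no wrong node among those that are. -/
theorem ex_insertPhase (τ : ℕ) {i x : ℕ} {o z : Option ℕ} (h : Stored S U V s) (hS : IsText S)
    (hi : i ∈ U) (hx : x ∈ U) (ho : ∀ x ∈ o, x ∈ U) (hz : ∀ x ∈ z, x ∈ U)
    (hc : s.btree.Complete) (hsub : ∀ y ∈ s.btree.inorder, y ∈ V)
    (hsort : s.btree.inorder.Pairwise (fun a b => off s.len V a < off s.len V b))
    (hcond : ∀ y ∈ U, y ≠ i → y ≠ x → some y ≠ o → some y ≠ z →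
      (y ∈ s.btree.inorder ↔ s.cond y = true))
    (hdel : ∀ y ∈ s.btree.inorder, y = i ∨ y = x ∨ some y = o ∨ some y = z → s.cond y = true) :
    ∃ t, ∃ n ≤ 4 * treeCost τ V.length, ex (insertPhase τ i x o z) s.toM =
      ((), ({s with btree := t, steps := s.steps + n} : St σ).toM) ∧ t.Complete ∧
      t.inorder = V.filter s.cond := by
  have hV : ∀ y ∈ U, y ∈ V := fun y hy => h.layout.perm.mem_iff.2 hy
  obtain ⟨t1, n1, hn1, e1, c1, s1, i1⟩ := ex_optM_insert (o := o) τ h hS ho hc hsub hsort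
  have b1 : ∀ y ∈ t1.inorder, y ∈ V := fun y hy => by
    rcases (i1 y).1 hy with h' | ⟨h', -⟩
    · exact hsub y h'
    · exact hV y (ho y h'.symm)
  obtain ⟨t2, n2, hn2, e2, c2, s2, i2⟩ := ex_insertIfRequired
    (s := {s with btree := t1, steps := s.steps + n1}) τ (h.with_btree _ _) hS hi c1 b1 s1
  have b2 : ∀ y ∈ t2.inorder, y ∈ V := fun y hy => by
    rcases (i2 y).1 hy with h' | ⟨h', -⟩
    · exact b1 y h'
    · exact hV y (h' ▸ hi)
  obtain ⟨t3, n3, hn3, e3, c3, s3, i3⟩ := ex_insertIfRequired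
    (s := {s with btree := t2, steps := s.steps + n1 + n2}) τ (h.with_btree _ _) hS hx c2 b2 s2
  have b3 : ∀ y ∈ t3.inorder, y ∈ V := fun y hy => by
    rcases (i3 y).1 hy with h' | ⟨h', -⟩
    · exact b2 y h'
    · exact hV y (h' ▸ hx)
  obtain ⟨t4, n4, hn4, e4, c4, s4, i4⟩ := ex_optM_insert (o := z)
    (s := {s with btree := t3, steps := s.steps + n1 + n2 + n3}) τ (h.with_btree _ _) hS hz c3 b3 s3
  refine ⟨t4, n1 + n2 + n3 + n4, by omega, ?_, c4, ?_⟩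
  · simp only [insertPhase, ex_bind, e1]
    rw [e2, e3, e4]
    simp only [add_assoc]
  · have hmem : ∀ y, y ∈ t4.inorder ↔ y ∈ V.filter s.cond := by
      intro y
      rw [i4, List.mem_filter]
      change (y ∈ t3.inorder ∨ some y = z ∧ s.cond y = true) ↔ _
      rw [i3]
      change ((y ∈ t2.inorder ∨ y = x ∧ s.cond y = true) ∨ some y = z ∧ s.cond y = true) ↔ _
      rw [i2]
      change (((y ∈ t1.inorder ∨ y = i ∧ s.cond y = true) ∨ y = x ∧ s.cond y = true) ∨
        some y = z ∧ s.cond y = true) ↔ _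
      rw [i1]
      constructor
      · rintro ((((h1 | ⟨h1, h2⟩) | ⟨h1, h2⟩) | ⟨h1, h2⟩) | ⟨h1, h2⟩)
        · refine ⟨hsub y h1, ?_⟩
          by_cases hs : y = i ∨ y = x ∨ some y = o ∨ some y = z
          · exact hdel y h1 hs
          · push Not at hs
            exact (hcond y (h.layout.perm.mem_iff.1 (hsub y h1)) hs.1 hs.2.1 hs.2.2.1 hs.2.2.2).1 h1
        · exact ⟨hV y (ho y h1.symm), h2⟩
        · exact ⟨hV y (h1 ▸ hi), h2⟩
        · exact ⟨hV y (h1 ▸ hx), h2⟩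
        · exact ⟨hV y (hz y h1.symm), h2⟩
      · rintro ⟨h1, h2⟩
        by_cases hs : y = i ∨ y = x ∨ some y = o ∨ some y = z
        · tauto
        · push Not at hs
          have := (hcond y (h.layout.perm.mem_iff.1 h1) hs.1 hs.2.1 hs.2.2.1 hs.2.2.2).2 h2
          tauto
    have s4' : t4.inorder.Pairwise (fun a b => off s.len V a < off s.len V b) := s4
    have sV : (V.filter s.cond).Pairwise (fun a b => off s.len V a < off s.len V b) :=
      (pairwise_off h.layout.nodupV h.layout.posV).filter _
    have nd : ∀ {l : List ℕ}, l.Pairwise (fun a b => off s.len V a < off s.len V b) → l.Nodup :=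
      fun hl => hl.imp fun h => by rintro rfl; exact lt_irrefl _ h
    -- Both lists are strictly sorted by the same rank and have the same members.
    exact List.Perm.eq_of_pairwise (fun a b _ _ h1 h2 => absurd h1 (lt_asymm h2)) s4' sV
      ((List.perm_ext_iff_of_nodup (nd s4') (nd sV)).2 hmem)

end TreePhases


/-! ### The state after the insertion of the new node of `$`, without a split. -/

section InsertNode

variable {N K : List ℕ} {pos pos' base base' len len' e b : ℕ → ℕ} {first : ℕ → Option ℕ} {q : ℕ}

theorem shift_mono {a b : ℕ} (h : a ≤ b) : shift q a ≤ shift q b := by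
  simp only [shift]; split_ifs <;> omega

/-- An offset inside an interval survives the shift if the interval does not straddle q; thus labels
of edges need not change. -/
theorem shift_add {a b l : ℕ} (hb : b < l) (h : a < q → a + l ≤ q) :
    shift q a + b = shift q (a + b) := by
  simp only [shift]; split_ifs <;> omega

/-- The edges of `E_F` when the F-interval of `i` moves to the position `q`, where a new DBWT-repetition
`x` is inserted. -/
theorem Half.insertF (h : Half N K pos base len e b first) {i x : ℕ} (hq : 0 < q) (hi : i ∈ N)
    (hi0 : pos i = 0) (hxN : x ∉ N) (hxK : x ∉ K)
    (hbd : ∀ k ∈ K, base k < q → base k + len k ≤ q)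
    (hp : ∀ y ∈ N, y ≠ i → pos' y = shift q (pos y)) (hpi : pos' i = q) (hpx : pos' x = 0)
    (hb : ∀ k ∈ K, base' k = shift q (base k)) (hbx : base' x = q)
    (hlen : ∀ k ∈ K, len' k = len k) (hx : len' x = 1) :
    Half (x :: N) (x :: K) pos' base' len' (Function.update (Function.update e x (e i)) i x)
      (Function.update (Function.update b x 0) i 0)
      (Function.update (Function.update first x (Option.some i)) (e i) (Option.some x)) := by
  refine h.insert hi rfl hxN hxK ?_ (hbx.trans hpi.symm) ?_ hlen hx ?_ ?_
  · intro y hy hyi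
    rw [hb _ (h.mem y hy), hp y hy hyi, ← h.eq y hy, shift_add (h.lt y hy) (hbd _ (h.mem y hy))]
  · have := h.eq i hi
    rw [hb _ (h.mem i hi), hpx, shift, if_neg (by omega)]; omega
  · intro y hy w hw hyi hwi hyw
    rw [hp y hy hyi, hp w hw hwi]; exact shift_mono hyw
  · intro w _ _ _; omega

/-- The edges of `E_L` when the F-interval of `i` moves to the position `q`, where a new DBWT-repetition
`x` is inserted. -/
theorem Half.insertL (h : Half N K pos base len e b first) {i x s : ℕ} (hq : 0 < q) (hi : i ∈ K)
    (hinj : ∀ y ∈ N, ∀ w ∈ N, pos y = pos w → y = w)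
    (hli : len i = 1) (hs : s ∈ N) (hes : e s = i) (hs0 : pos s = 0) (hxN : x ∉ N) (hxK : x ∉ K)
    (hbd : ∀ k ∈ K, base k < q → base k + len k ≤ q)
    (hp : ∀ y ∈ N, pos' y = shift q (pos y)) (hpx : pos' x = q)
    (hb : ∀ k ∈ K, k ≠ i → base' k = shift q (base k)) (hbi : base' i = q) (hbx : base' x = 0)
    (hlen : ∀ k ∈ K, len' k = len k) (hx : len' x = 1) :
    Half (x :: N) (x :: K) pos' base' len' (Function.update (Function.update e x i) s x)
      (Function.update (Function.update b x 0) s 0)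
      (Function.update (Function.update first x (Option.some s)) i (Option.some x)) := by
  -- The interval of i has length 1, so only the source at its single position has an edge to it.
  have hne : ∀ y ∈ N, y ≠ s → e y ≠ i := by
    intro y hy hys hey
    have h1 := h.eq y hy
    have h2 := h.lt y hy
    have h3 := h.eq s hs
    rw [hey] at h1 h2
    rw [hes] at h3
    exact hys (hinj y hy s hs (by omega))
  refine h.insert hs hes hxN hxK ?_ ?_ (hbi.trans hpx.symm) hlen hx ?_ ?_
  · intro y hy hys
    rw [hb _ (h.mem y hy) (hne y hy hys), hp y hy, ← h.eq y hy,
      shift_add (h.lt y hy) (hbd _ (h.mem y hy))]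
  · rw [hbx, hp s hs, hs0, shift, if_neg (by omega)]
  · intro y hy w hw _ _ hyw
    rw [hp y hy, hp w hw]; exact shift_mono hyw
  · intro w hw hws hew
    exact absurd hew (hne w hw hws)

theorem insertIdx_idxOf {A B : List ℕ} {w x : ℕ} (hw : w ∉ A) :
    (A ++ w :: B).insertIdx ((A ++ w :: B).idxOf w + 1) x = A ++ w :: x :: B := by
  have h1 : (A ++ w :: B).idxOf w = A.length := by
    rw [List.idxOf_append_of_notMem hw]; simp
  rw [h1]
  clear hw h1
  induction A with
  | nil => rfl
  | cons a A ih => simpa using ih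

variable {σ : Type} [LinearOrder σ] [OrderBot σ] {S : List σ} {U V : List ℕ} {s : St σ}

/-- The target is determined by containing the start of the source, since the repetitions are
disjoint. -/
theorem Stored.eF_eq (h : Stored S U V s) {w k : ℕ} (hw : w ∈ U) (hk : k ∈ U)
    (h1 : off s.len U k ≤ off s.len V w) (h2 : off s.len V w < off s.len U k + s.len k) :
    s.eF w = k := by
  have h3 := h.halfF.eq w hw
  exact eq_of_off_add_eq (len := s.len) (s := s.bF w) (t := off s.len V w - off s.len U k)
    (h.halfF.mem w hw) hk (h.halfF.lt w hw) (by omega) (by omega)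

theorem Stored.eL_eq (h : Stored S U V s) {w k : ℕ} (hw : w ∈ U) (hk : k ∈ U)
    (h1 : off s.len V k ≤ off s.len U w) (h2 : off s.len U w < off s.len V k + s.len k) :
    s.eL w = k := by
  have h3 := h.halfL.eq w hw
  have hV : ∀ y ∈ U, y ∈ V := fun y hy => h.layout.perm.mem_iff.2 hy
  exact eq_of_off_add_eq (len := s.len) (s := s.bL w) (t := off s.len U w - off s.len V k)
    (hV _ (h.halfL.mem w hw)) (hV _ hk) (h.halfL.lt w hw) (by omega) (by omega)

theorem Stored.with_heavy (h : Stored S U V s) (a b : List ℕ) (n : ℕ) :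
    Stored S U V ({s with heavyU := a, heavyV := b, steps := n} : St σ) :=
  ⟨h.layout, h.alloc, h.dllU, h.dllV, h.halfL, h.halfF, h.order, h.dollar_mem, h.dollar_ch⟩

theorem Stored.fresh_notMem (h : Stored S U V s) {x : ℕ} (hx : s.fresh ≤ x) : x ∉ U :=
  fun hm => absurd (h.alloc x hm) (by omega)

/-- The first node of `U` points to the first node of `V`, and conversely. -/
theorem Stored.first_edges (h : Stored S U V s) (hS : IsText S) {i : ℕ} (hi : i ∈ U)
    (hci : s.ch i = ⊥) : s.eF i ∈ U ∧ s.bF i = 0 ∧ off s.len U (s.eF i) = 0 ∧ s.eL (s.eF i) = i := by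
  have h0 := (h.layout.off_dollar hS hi hci).2
  have h1 := h.halfF.eq i hi
  have h2 := h.halfF.mem i hi
  exact ⟨h2, by omega, by omega, h.eL_eq h2 hi (by omega) (by omega)⟩

variable {c : σ} {i g w : ℕ} {P G A B : List ℕ}

theorem Stored.insertNode_dllU (h : Stored S (A ++ w :: B) V s) :
    DLL (s.insertNode c i g w).uPrev (s.insertNode c i g w).uNext (s.insertNode c i g w).uHead
      (s.insertNode c i g w).uTail (A ++ w :: s.fresh :: B) ∧
    (s.insertNode c i g w).order = A ++ w :: s.fresh :: B := by
  refine ⟨h.dllU.insert h.layout.nodupU (h.fresh_notMem le_rfl), ?_⟩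
  have hnd := h.layout.nodupU
  rw [List.nodup_middle, List.nodup_cons, List.mem_append, not_or] at hnd
  simp only [St.insertNode, h.order]
  exact insertIdx_idxOf hnd.1.1

theorem Stored.insertNode_dllV (h : Stored S U (i :: (P ++ G)) s)
    (hg : (i :: P).getLast? = some g) :
    DLL (s.insertNode c i g w).vPrev (s.insertNode c i g w).vNext (s.insertNode c i g w).vHead
      (s.insertNode c i g w).vTail (s.fresh :: (P ++ i :: G)) := by
  have hnd := h.layout.nodupV
  have hx : s.fresh ∉ i :: (P ++ G) := fun hm =>
    h.fresh_notMem le_rfl (h.layout.perm.mem_iff.1 hm)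
  have hv : s.vNext i = (P ++ G).head? := DLL.next_eq (A := []) h.dllV
  have h1 := h.dllV.replace_head hnd hx
  rw [← hv] at h1
  have hnd1 : (s.fresh :: (P ++ G)).Nodup :=
    List.nodup_cons.2 ⟨fun hm => hx (by simp only [List.mem_cons]; exact Or.inr hm),
      (List.nodup_cons.1 hnd).2⟩
  have hi1 : i ∉ s.fresh :: (P ++ G) := by
    rw [List.mem_cons, not_or]
    exact ⟨by rintro rfl; exact hx (by simp), (List.nodup_cons.1 hnd).1⟩
  -- If P is empty, the node found by the search is i itself; after x has replaced i at the front, i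
  -- goes behind x.
  rcases List.eq_nil_or_concat P with rfl | ⟨P0, g', rfl⟩
  · simp only [List.getLast?_singleton, Option.some.injEq] at hg
    subst hg
    have := DLL.insert (A := []) (B := G) h1 (by simpa using hnd1) (by simpa using hi1)
    simpa [St.insertNode] using this
  · have hg' : g' = g := by simpa [List.getLast?_cons] using hg
    subst hg'
    have hne : g' ≠ i := by rintro rfl; exact hi1 (by simp)
    have := DLL.insert (A := s.fresh :: P0) (B := G) (y := g') (by simpa using h1)
      (by simpa using hnd1) (by simpa using hi1)
    simpa [St.insertNode, hne] using this

theorem Stored.insertNode_halfL (h : Stored S U V s) (hS : IsText S) {q : ℕ} (hq : 0 < q)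
    (hi : i ∈ U) (hci : s.ch i = ⊥) {lst' fst' : ℕ → ℕ}
    (hbd : ∀ k ∈ U, off s.len V k < q → off s.len V k + s.len k ≤ q)
    (hsh : Shifted q i s.fresh U (off s.len U) (off s.len V) lst' fst') :
    Half (s.fresh :: U) (s.fresh :: U) lst' fst' (Function.update s.len s.fresh 1)
      (s.insertNode c i g w).eL (s.insertNode c i g w).bL (s.insertNode c i g w).inV := by
  obtain ⟨h1, h2, h3, h4⟩ := h.first_edges hS hi hci
  have hx := h.fresh_notMem le_rfl
  exact h.halfL.insertL hq hi (fun y hy w hw => off_inj h.layout.pos hy hw)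
    (h.layout.off_dollar hS hi hci).2.1 h1 h4 h3 hx hx hbd hsh.lst_eq hsh.lst_new hsh.fst_eq
    hsh.fst_old hsh.fst_new
    (fun k hk => Function.update_of_ne (by rintro rfl; exact hx hk) _ _) (by simp)

/-- The state after the insertion, if no DBWT-repetition has to be split. -/
theorem Stored.insertNode (h : Stored S (A ++ w :: B) (i :: (P ++ G)) s) (hS : IsText S)
    (hc : c ≠ ⊥) (hci : s.ch i = ⊥) (hA : tot s.len (A ++ [w]) = rk (c :: S) 0)
    (hP : tot s.len (i :: P) = rk (c :: S) 0) (hg : (i :: P).getLast? = some g) :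
    Stored (c :: S) (A ++ w :: s.fresh :: B) (s.fresh :: (P ++ i :: G)) (s.insertNode c i g w) := by
  have hx : s.fresh ∉ A ++ w :: B := h.fresh_notMem le_rfl
  have hi : i ∈ A ++ w :: B := h.layout.perm.mem_iff.1 (by simp)
  have hxi : s.fresh ≠ i := by intro e; exact hx (e ▸ hi)
  have hq := rk_zero_pos hS hc
  have e1 : (A ++ [w]) ++ B = A ++ w :: B := by simp
  have e2 : (A ++ [w]) ++ s.fresh :: B = A ++ w :: s.fresh :: B := by simp
  have L0 : Layout S ((A ++ [w]) ++ B) (i :: (P ++ G)) s.ch s.len := by rw [e1]; exact h.layout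
  obtain ⟨L, hsh⟩ := L0.grow hS hc hci (by rw [e1]; exact hx) hA hP
  rw [e1, e2] at hsh
  rw [e2] at L
  have hmem : ∀ y, y ∈ A ++ w :: s.fresh :: B ↔ y ∈ s.fresh :: (A ++ w :: B) := by
    intro y; simp only [List.mem_append, List.mem_cons]; tauto
  obtain ⟨h1, h2, h3, h4⟩ := h.first_edges hS hi hci
  obtain ⟨d1, d2⟩ := h.insertNode_dllU (c := c) (i := i) (g := g)
  refine ⟨L, ?_, d1, h.insertNode_dllV hg, ?_, ?_, d2, ?_, ?_⟩
  · intro y hy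
    rw [hmem] at hy
    rcases List.mem_cons.1 hy with rfl | hy
    · simp [St.insertNode]
    · have := h.alloc y hy
      simp only [St.insertNode]; omega
  · refine (h.insertNode_halfL hS hq hi hci ?_ hsh).congr hmem hmem (fun _ _ => rfl) (fun _ _ => rfl)
      (fun _ _ => rfl) (fun _ _ => rfl) (fun _ _ => rfl) (fun _ _ => rfl)
    intro k hk hlt
    have := off_add_le_of_lt (B := G) (k := k) hP (h.layout.perm.mem_iff.2 hk) hlt
    exact this
  · have hlen : ∀ k ∈ A ++ w :: B, Function.update s.len s.fresh 1 k = s.len k := fun k hk =>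
      Function.update_of_ne (by rintro rfl; exact hx hk) _ _
    refine (h.halfF.insertF hq hi (h.layout.off_dollar hS hi hci).2.2 hx hx ?_ hsh.fst_eq hsh.fst_old
      hsh.fst_new hsh.lst_eq hsh.lst_new hlen (by simp)).congr hmem hmem
      (fun _ _ => rfl) (fun _ _ => rfl) (fun _ _ => rfl) (fun _ _ => rfl) (fun _ _ => rfl)
      (fun _ _ => rfl)
    intro k hk hlt
    rw [← e1] at hk hlt ⊢
    exact off_add_le_of_lt hA hk hlt
  · simp only [St.insertNode]; simp
  · simp only [St.insertNode]
    rw [Function.update_of_ne hxi, Function.update_self]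

end InsertNode


/-! ### The situation in which a repetition has to be cut. -/

section Cut

variable {σ : Type} [LinearOrder σ] [OrderBot σ] {S : List σ} {s : St σ} {c : σ}
  {A B P G : List ℕ} {i j d g y : ℕ}

/-- The insertion requires that the node `j` is split after its first `d` positions. -/
structure Cut (S : List σ) (s : St σ) (c : σ) (A B P G : List ℕ) (i j d g y : ℕ) : Prop where
  stored : Stored S (A ++ j :: B) (i :: (P ++ G)) s
  text : IsText S
  ne_bot : c ≠ ⊥
  dollar : s.ch i = ⊥
  pos : 0 < d
  lt : d < s.len j
  totU : tot s.len A + d = rk (c :: S) 0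
  totV : tot s.len (i :: P) = rk (c :: S) 0
  last : (i :: P).getLast? = some g
  head : G.head? = some y
  edge : s.eF y = j
  label : s.bF y = d

/-- The state in which the new nodes have been created and linked. -/
def cutState (s : St σ) (c : σ) (i g j d y : ℕ) : St σ :=
  (s.insertNode c i g j).splitLink j d s.fresh y

def cutU (s : St σ) (A B : List ℕ) (j : ℕ) : List ℕ := A ++ j :: s.fresh :: (s.fresh + 1) :: B

def cutV (s : St σ) (P G : List ℕ) (i j : ℕ) : List ℕ :=
  insAfter j (s.fresh + 1) (s.fresh :: (P ++ i :: G))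

namespace Cut

theorem mem_i (h : Cut S s c A B P G i j d g y) : i ∈ A ++ j :: B :=
  h.stored.layout.perm.mem_iff.1 (by simp)

theorem mem_y (h : Cut S s c A B P G i j d g y) : y ∈ A ++ j :: B :=
  h.stored.layout.perm.mem_iff.1 (by
    have := List.mem_of_mem_head? (Option.mem_def.2 h.head)
    simp [this])

theorem x_notMem (h : Cut S s c A B P G i j d g y) : s.fresh ∉ A ++ j :: B :=
  h.stored.fresh_notMem le_rfl

theorem z_notMem (h : Cut S s c A B P G i j d g y) : s.fresh + 1 ∉ A ++ j :: B :=
  h.stored.fresh_notMem (by omega)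

theorem ne_of_mem (h : Cut S s c A B P G i j d g y) {k : ℕ} (hk : k ∈ A ++ j :: B) :
    k ≠ s.fresh ∧ k ≠ s.fresh + 1 :=
  ⟨fun e => h.x_notMem (e ▸ hk), fun e => h.z_notMem (e ▸ hk)⟩

/-- A node that is cut in its interior has length at least 2, the node of `$` has length 1. -/
theorem ne_ji (h : Cut S s c A B P G i j d g y) : j ≠ i := by
  intro e
  have h1 := (h.stored.layout.off_dollar h.text h.mem_i h.dollar).2.1
  have h2 := h.lt
  have h3 := h.pos
  rw [e] at h2
  omega

theorem ne_yi (h : Cut S s c A B P G i j d g y) : y ≠ i := by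
  intro e
  have hnd := h.stored.layout.nodupV
  have := List.mem_of_mem_head? (Option.mem_def.2 h.head)
  rw [List.nodup_cons] at hnd
  exact hnd.1 (by simp [← e, this])

theorem mem_cutU (h : Cut S s c A B P G i j d g y) (k : ℕ) : k ∈ cutU s A B j ↔
    k ∈ (s.fresh + 1) :: s.fresh :: (A ++ j :: B) := by
  simp only [cutU, List.mem_append, List.mem_cons]; tauto

/-- From here on, positions in the new state are known relative to those in the old one; the new
part of u_j starts right behind the new `$`, at q + 1. -/
theorem layout (h : Cut S s c A B P G i j d g y) :
    Layout (c :: S) (cutU s A B j) (cutV s P G i j) (cutState s c i g j d y).ch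
      (cutState s c i g j d y).len ∧
    Shifted (rk (c :: S) 0) i s.fresh (A ++ j :: B) (off s.len (A ++ j :: B))
      (off s.len (i :: (P ++ G))) (off (cutState s c i g j d y).len (cutU s A B j))
      (off (cutState s c i g j d y).len (cutV s P G i j)) ∧
    off (cutState s c i g j d y).len (cutU s A B j) (s.fresh + 1) = rk (c :: S) 0 + 1 ∧
    off (cutState s c i g j d y).len (cutV s P G i j) (s.fresh + 1) =
      off (cutState s c i g j d y).len (cutV s P G i j) j + d := by
  have hj := h.ne_of_mem (k := j) (by simp)
  obtain ⟨V', ch', len', e1, e2, e3, h4⟩ := h.stored.layout.splitGrow h.text h.ne_bot h.dollar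
    h.x_notMem h.z_notMem (by omega) h.ne_ji h.pos h.lt h.totU h.totV
  have e2' : (cutState s c i g j d y).ch = ch' := by
    rw [e2]
    simp [cutState, St.splitLink, St.insertNode, Function.update_of_ne, h.ne_ji, hj.1]
  have e3' : (cutState s c i g j d y).len = len' := by
    rw [e3]
    simp [cutState, St.splitLink, St.insertNode, Function.update_of_ne, hj.1]
  rw [e2', e3']
  subst e1
  exact h4

theorem len_eq (h : Cut S s c A B P G i j d g y) : (∀ k ∈ A ++ j :: B, k ≠ j →
    (cutState s c i g j d y).len k = s.len k) ∧ (cutState s c i g j d y).len j = d ∧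
    (cutState s c i g j d y).len (s.fresh + 1) = s.len j - d ∧
    (cutState s c i g j d y).len s.fresh = 1 := by
  have hj := h.ne_of_mem (k := j) (by simp)
  refine ⟨fun k hk hkj => ?_, ?_, ?_, ?_⟩
  · have hk' := h.ne_of_mem hk
    simp [cutState, St.splitLink, St.insertNode, Function.update_of_ne, hk'.1, hk'.2, hkj]
  · simp [cutState, St.splitLink, St.insertNode]
  · simp [cutState, St.splitLink, St.insertNode, Function.update_of_ne, hj.1, hj.2.symm]
  · simp [cutState, St.splitLink, St.insertNode, Function.update_of_ne, hj.1.symm]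

theorem dllU (h : Cut S s c A B P G i j d g y) :
    DLL (cutState s c i g j d y).uPrev (cutState s c i g j d y).uNext
      (cutState s c i g j d y).uHead (cutState s c i g j d y).uTail (cutU s A B j) ∧
    (cutState s c i g j d y).order = cutU s A B j := by
  obtain ⟨h1, h2⟩ := h.stored.insertNode_dllU (c := c) (i := i) (g := g)
  have hnd := h.layout.1.nodupU
  have hz := h.z_notMem
  simp only [cutU, List.nodup_append, List.nodup_cons, List.mem_cons, List.mem_append] at hnd hz
  have hnd1 : ((A ++ [j]) ++ s.fresh :: B).Nodup := by
    simp only [List.nodup_append, List.nodup_cons, List.mem_cons, List.append_assoc,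
      List.cons_append, List.nil_append]
    grind
  rw [List.append_cons] at h1 h2
  have h3 := h1.insert (x := s.fresh + 1) hnd1 (by simp; simp at hz; tauto)
  constructor
  · have e : cutU s A B j = (A ++ [j]) ++ s.fresh :: (s.fresh + 1) :: B := by simp [cutU]
    rw [e]; exact h3
  · simp only [cutState, St.splitLink, h2]
    rw [insertIdx_idxOf]
    · simp [cutU, St.insertNode]
    · intro hm
      exact (List.nodup_append.1 hnd1).2.2 _ hm _ (by simp) rfl

theorem dllV (h : Cut S s c A B P G i j d g y) :
    DLL (cutState s c i g j d y).vPrev (cutState s c i g j d y).vNext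
      (cutState s c i g j d y).vHead (cutState s c i g j d y).vTail (cutV s P G i j) := by
  have h1 := h.stored.insertNode_dllV (c := c) (w := j) h.last
  have hnd0 := h.stored.layout.nodupV
  have hxV : s.fresh ∉ i :: (P ++ G) := fun hm => h.x_notMem (h.stored.layout.perm.mem_iff.1 hm)
  have hzV : s.fresh + 1 ∉ i :: (P ++ G) := fun hm =>
    h.z_notMem (h.stored.layout.perm.mem_iff.1 hm)
  have hp : (s.fresh :: (P ++ i :: G)).Perm (s.fresh :: i :: (P ++ G)) :=
    List.perm_middle.cons _
  have hnd : (s.fresh :: (P ++ i :: G)).Nodup := hp.nodup_iff.2 (List.nodup_cons.2 ⟨hxV, hnd0⟩)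
  have hjV : j ∈ s.fresh :: (P ++ i :: G) :=
    hp.mem_iff.2 (List.mem_cons_of_mem _ (h.stored.layout.perm.mem_iff.2 (by simp)))
  obtain ⟨C, E, e⟩ := List.append_of_mem hjV
  have hz : s.fresh + 1 ∉ s.fresh :: (P ++ i :: G) := by
    rw [hp.mem_iff, List.mem_cons, not_or]; exact ⟨by omega, hzV⟩
  unfold cutV
  rw [e] at h1 hnd hz ⊢
  have h2 := h1.insert hnd hz
  have hnd' := hnd
  rw [List.nodup_middle, List.nodup_cons, List.mem_append, not_or] at hnd'
  rw [insAfter_eq hnd'.1.1 hnd'.1.2]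
  exact h2

theorem boundV (h : Cut S s c A B P G i j d g y) : ∀ k ∈ A ++ j :: B,
    off s.len (i :: (P ++ G)) k < rk (c :: S) 0 →
    off s.len (i :: (P ++ G)) k + s.len k ≤ rk (c :: S) 0 := fun _ hk hlt =>
  off_add_le_of_lt (B := G) h.totV (h.stored.layout.perm.mem_iff.2 hk) hlt

/-- The F-interval of y is the first one at or after q, and its edge points to the place of the cut.
-/
theorem off_y (h : Cut S s c A B P G i j d g y) : off s.len (i :: (P ++ G)) y = rk (c :: S) 0 := by
  have h1 := h.stored.halfF.eq y h.mem_y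
  have hnd := h.stored.layout.nodupU
  rw [List.nodup_middle, List.nodup_cons, List.mem_append, not_or] at hnd
  rw [h.edge, h.label, off_append_right hnd.1.1] at h1
  have := h.totU
  rw [show off s.len (j :: B) j = 0 by simp [off]] at h1
  omega

/-- The edges of `E_L` when the edge from the new part of `u_j` has been added. -/
theorem halfL (h : Cut S s c A B P G i j d g y) :
    Half ((s.fresh + 1) :: s.fresh :: (A ++ j :: B)) (s.fresh :: (A ++ j :: B))
      (off (cutState s c i g j d y).len (cutU s A B j))
      (off (cutState s c i g j d y).len (cutV s P G i j)) (Function.update s.len s.fresh 1)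
      (cutState s c i g j d y).eL (cutState s c i g j d y).bL (cutState s c i g j d y).inV := by
  obtain ⟨L, hsh, hzU, hzV⟩ := h.layout
  have h1 := h.stored.insertNode_halfL (c := c) (g := g) (w := j) h.text
    (rk_zero_pos h.text h.ne_bot) h.mem_i h.dollar h.boundV hsh
  -- The F-interval of y starts where the new part of u_j starts, so the edge from there to y has
  -- label 0.
  have hfy : off (cutState s c i g j d y).len (cutV s P G i j) y = rk (c :: S) 0 + 1 := by
    rw [hsh.fst_eq y h.mem_y h.ne_yi, h.off_y, shift, if_pos le_rfl]
  have hy := h.ne_of_mem h.mem_y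
  have hz : s.fresh + 1 ∉ s.fresh :: (A ++ j :: B) := by
    rw [List.mem_cons, not_or]; exact ⟨by omega, h.z_notMem⟩
  refine (h1.addSource_first (m := 0) hz (List.mem_cons_of_mem _ h.mem_y)
    (by rw [hzU, hfy]) ?_ ?_).congr (fun _ => Iff.rfl) (fun _ => Iff.rfl) (fun _ _ => rfl)
    (fun _ _ => rfl) (fun _ _ => rfl) (fun _ _ => rfl) (fun _ _ => rfl) ?_
  · rw [Function.update_of_ne hy.1]
    exact h.stored.layout.pos y h.mem_y
  · intro w hw hew
    have := h1.eq w hw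
    rw [hew, hfy] at this
    omega
  · intro k hk
    have hkz : k ≠ s.fresh + 1 := fun e => hz (e ▸ hk)
    simp only [cutState, St.splitLink]
    rcases eq_or_ne k y with rfl | hky
    · simp [St.insertNode]
    · rw [Function.update_of_ne hky, Function.update_of_ne hky]
      exact Function.update_of_ne hkz _ _

/-- A DBWT-repetition that starts in the former F-interval of `j` has an edge to `j`. -/
theorem eL_eq (h : Cut S s c A B P G i j d g y) {w : ℕ} (hw : w ∈ cutU s A B j)
    (h1 : off (cutState s c i g j d y).len (cutV s P G i j) j ≤
      off (cutState s c i g j d y).len (cutU s A B j) w)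
    (h2 : off (cutState s c i g j d y).len (cutU s A B j) w <
      off (cutState s c i g j d y).len (cutV s P G i j) j + s.len j) :
    (cutState s c i g j d y).eL w = j := by
  obtain ⟨L, hsh, hzU, hzV⟩ := h.layout
  obtain ⟨l1, l2, l3, l4⟩ := h.len_eq
  have hw' := (h.mem_cutU w).1 hw
  have h3 := h.halfL.eq w hw'
  have h4 := h.halfL.lt w hw'
  have h5 := h.halfL.mem w hw'
  have hV : ∀ k, k ∈ cutU s A B j → k ∈ cutV s P G i j := fun k hk => L.perm.mem_iff.2 hk
  by_contra hne
  set k := (cutState s c i g j d y).eL w with hk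
  have hlk : (cutState s c i g j d y).len k = Function.update s.len s.fresh 1 k := by
    rcases List.mem_cons.1 h5 with e | h5
    · rw [e, l4, Function.update_self]
    · rw [l1 k h5 hne, Function.update_of_ne (h.ne_of_mem h5).1]
  have hkV : k ∈ cutV s P G i j := hV k ((h.mem_cutU k).2 (List.mem_cons_of_mem _ h5))
  have hjV : j ∈ cutV s P G i j := hV j (by simp [cutU])
  have hzV' : s.fresh + 1 ∈ cutV s P G i j := hV _ (by simp [cutU])
  rw [← hlk] at h4
  have h6 := h.lt
  -- In the first d positions the target is j by disjointness. Further on it would have to be the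
  -- new part, which is not yet a target of any edge.
  by_cases hlt : off (cutState s c i g j d y).len (cutU s A B j) w <
      off (cutState s c i g j d y).len (cutV s P G i j) j + d
  · exact hne (eq_of_off_add_eq (len := (cutState s c i g j d y).len)
      (s := (cutState s c i g j d y).bL w)
      (t := off (cutState s c i g j d y).len (cutU s A B j) w -
        off (cutState s c i g j d y).len (cutV s P G i j) j) hkV hjV h4 (by omega) (by omega))
  · have : k = s.fresh + 1 := eq_of_off_add_eq (len := (cutState s c i g j d y).len)
      (s := (cutState s c i g j d y).bL w)
      (t := off (cutState s c i g j d y).len (cutU s A B j) w -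
        off (cutState s c i g j d y).len (cutV s P G i j) (s.fresh + 1)) hkV hzV' h4
        (by omega) (by omega)
    rcases List.mem_cons.1 h5 with e | h5
    · omega
    · exact (h.ne_of_mem h5).2 this

end Cut

end Cut


section InsAfter

variable {j z : ℕ} {l : List ℕ}

theorem head?_insAfter : (insAfter j z l).head? = l.head? := by
  rcases l with _ | ⟨a, l⟩
  · rfl
  · simp only [insAfter]; split_ifs with h <;> simp [h]

theorem mem_insAfter_of_ne {a : ℕ} (ha : a ≠ z) : a ∈ insAfter j z l ↔ a ∈ l := by
  by_cases h : j ∈ l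
  · rw [mem_insAfter h]; simp [ha]
  · rw [insAfter_of_notMem h]

theorem length_insAfter_le (hl : l.Nodup) : (insAfter j z l).length ≤ l.length + 1 := by
  by_cases h : j ∈ l
  · rw [(insAfter_perm hl h).length_eq]; simp
  · rw [insAfter_of_notMem h]; omega

theorem mem_of_mem_insAfter (hz : z ∈ insAfter j z l) (hzl : z ∉ l) : j ∈ l := by
  by_contra h
  rw [insAfter_of_notMem h] at hz
  exact hzl hz

end InsAfter

section Cut

variable {σ : Type} [LinearOrder σ] [OrderBot σ] {S : List σ} {s : St σ} {c : σ}
  {A B P G : List ℕ} {i j d g y : ℕ}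

namespace Cut

/-- The nodes of `V` whose edges of `E_F` lead to the second part of `u_j`. -/
theorem exists_run (h : Cut S s c A B P G i j d g y) : ∃ M E, G = M ++ E ∧
    (∀ v ∈ A ++ j :: B, v ∈ M ↔ s.eF v = j ∧ d ≤ s.bF v) ∧ (∀ v ∈ G, v ∈ A ++ j :: B ∧ v ≠ i) ∧
    (∀ v ∈ M, s.eF v = j) ∧ ∀ v ∈ E, s.eF v ≠ j := by
  have hnd := h.stored.layout.nodupV
  have hgo : ∀ v ∈ G, rk (c :: S) 0 ≤ off s.len (i :: (P ++ G)) v := by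
    intro v hv
    rw [← List.cons_append] at hnd ⊢
    have : v ∉ i :: P := fun hm => (List.nodup_append.1 hnd).2.2 v hm v hv rfl
    rw [off_append_right this, h.totV]; omega
  have hU : ∀ v ∈ G, v ∈ A ++ j :: B := fun v hv =>
    h.stored.layout.perm.mem_iff.1 (by simp [hv])
  have hsort : G.Pairwise (fun a b => off s.len (i :: (P ++ G)) a < off s.len (i :: (P ++ G)) b) := by
    have := pairwise_off hnd h.stored.layout.posV
    exact (List.pairwise_append.1 (List.pairwise_cons.1 this).2).2.1
  have hj : off s.len (A ++ j :: B) j + d = rk (c :: S) 0 := by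
    have := h.stored.halfF.eq y h.mem_y
    rwa [h.edge, h.label, h.off_y] at this
  -- The bounds are the place of the cut and the end of u_j; nothing in G starts before q, so M is
  -- an initial part of G.
  obtain ⟨A0, M, E, e, h1, h2, h3⟩ := exists_append_of_sorted hsort (rk (c :: S) 0)
    (off s.len (A ++ j :: B) j + s.len j) (by have := h.lt; omega)
  have hA0 : A0 = [] := by
    rcases A0 with _ | ⟨a, A0⟩
    · rfl
    · have h4 := h1 a (by simp)
      have h5 := hgo a (by rw [e]; simp)
      omega
  subst hA0
  rw [List.nil_append] at e
  have hM : ∀ v ∈ M, s.eF v = j := fun v hv => by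
    have h4 := h2 v hv
    exact h.stored.eF_eq (hU v (by rw [e]; simp [hv])) (by simp) (by omega) h4.2
  have hE : ∀ v ∈ E, s.eF v ≠ j := by
    intro v hv hc
    have hvU := hU v (by rw [e]; simp [hv])
    have h4 := h3 v hv
    have h5 := h.stored.halfF.eq v hvU
    have h6 := h.stored.halfF.lt v hvU
    rw [hc] at h5 h6
    omega
  refine ⟨M, E, e, fun v hv => ⟨fun hm => ⟨hM v hm, ?_⟩, ?_⟩, fun v hv => ⟨hU v hv, ?_⟩, hM, hE⟩
  · have h4 := (h2 v hm).1
    have h5 := h.stored.halfF.eq v hv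
    rw [hM v hm] at h5
    omega
  · rintro ⟨h4, h5⟩
    have h6 := h.stored.halfF.eq v hv
    rw [h4] at h6
    have hvV := h.stored.layout.perm.mem_iff.2 hv
    rw [← List.cons_append] at hvV
    rcases List.mem_append.1 hvV with h7 | h7
    -- A node of i :: P starts before q, so its edge cannot lead into j at an offset of d or more.
    · have h8 := off_add_le (len := s.len) h7
      have h9 := h.stored.layout.pos v hv
      rw [← List.cons_append, off_append_left h7] at h6
      rw [h.totV] at h8
      omega
    · rw [e] at h7
      rcases List.mem_append.1 h7 with h8 | h8
      · exact h8
      · exact absurd h4 (hE v h8)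
  · rintro rfl
    exact (List.nodup_cons.1 hnd).1 (by simp [hv])

/-- The edges of `E_F`, except the one of the new part of `v_j`. -/
theorem halfF (h : Cut S s c A B P G i j d g y) {M : List ℕ}
    (hM : ∀ v ∈ A ++ j :: B, v ∈ M ↔ s.eF v = j ∧ d ≤ s.bF v) (hxM : s.fresh ∉ M) :
    Half (s.fresh :: (A ++ j :: B)) ((s.fresh + 1) :: s.fresh :: (A ++ j :: B))
      (off (cutState s c i g j d y).len (cutV s P G i j))
      (off (cutState s c i g j d y).len (cutU s A B j))
      (cutState s c i g j d y).len
      ((cutState s c i g j d y).splitInU (insAfter j (s.fresh + 1) M) j d (s.fresh + 1) y).eF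
      ((cutState s c i g j d y).splitInU (insAfter j (s.fresh + 1) M) j d (s.fresh + 1) y).bF
      ((cutState s c i g j d y).splitInU (insAfter j (s.fresh + 1) M) j d (s.fresh + 1) y).inU ∧
    ∀ α, 2 ≤ α → (∀ k, (A ++ j :: B).countP (fun v => s.eF v = k) < α) → ∀ k,
      (s.fresh :: (A ++ j :: B)).countP (fun v =>
        ((cutState s c i g j d y).splitInU (insAfter j (s.fresh + 1) M) j d (s.fresh + 1) y).eF v = k)
        < α := by
  obtain ⟨L, hsh, hzU, hzV⟩ := h.layout
  obtain ⟨l1, l2, l3, l4⟩ := h.len_eq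
  obtain ⟨f1, f2, f3, f4⟩ := h.stored.first_edges h.text h.mem_i h.dollar
  have hjU : j ∈ A ++ j :: B := by simp
  have hj := h.ne_of_mem hjU
  have hi := h.ne_of_mem h.mem_i
  have hy := h.ne_of_mem h.mem_y
  have hhd := h.ne_of_mem f1
  have hpos := h.pos
  have hlt := h.lt
  set q := rk (c :: S) 0 with hq
  have hq0 : 0 < q := rk_zero_pos h.text h.ne_bot
  have hjq : off s.len (A ++ j :: B) j + d = q := by
    have := h.stored.halfF.eq y h.mem_y
    rwa [h.edge, h.label, h.off_y] at this
  have hbz : ∀ k ∈ A ++ j :: B, Function.update (off s.len (A ++ j :: B)) (s.fresh + 1) q k =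
      off s.len (A ++ j :: B) k := fun k hk => Function.update_of_ne (h.ne_of_mem hk).2 _ _
  -- The edges are treated in the order cut, then insertion, as for the layouts. In the intermediate
  -- stage the new part starts at q; the shift then moves it to q + 1.
  have H1 := h.stored.halfF.splitTarget (d := d) (z := s.fresh + 1) (f := some y)
    (base' := Function.update (off s.len (A ++ j :: B)) (s.fresh + 1) q)
    (len' := (cutState s c i g j d y).len) hjU h.z_notMem hbz
    (by rw [Function.update_self, hjq]) l1 l2
    (fun v hv w hw => off_inj h.stored.layout.posV (h.stored.layout.perm.mem_iff.2 hv)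
      (h.stored.layout.perm.mem_iff.2 hw)) (by rw [l3]; omega) (by simp) (by
      rintro _ ⟨⟩
      refine ⟨h.mem_y, h.edge, h.label.ge, fun w hw hew hdw => ?_⟩
      have := h.stored.halfF.eq w hw
      rw [hew] at this
      rw [h.off_y]; omega)
  -- The edge of i has label 0 < d, so it is not redirected.
  have ei : (if s.eF i = j ∧ d ≤ s.bF i then s.fresh + 1 else s.eF i) = s.eF i :=
    if_neg (by omega)
  have hxK : s.fresh ∉ (s.fresh + 1) :: (A ++ j :: B) := by
    rw [List.mem_cons, not_or]; exact ⟨by omega, h.x_notMem⟩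
  have H2 := H1.insertF (x := s.fresh) (i := i) (q := q)
    (pos' := off (cutState s c i g j d y).len (cutV s P G i j))
    (base' := off (cutState s c i g j d y).len (cutU s A B j))
    (len' := (cutState s c i g j d y).len) hq0 h.mem_i
    (h.stored.layout.off_dollar h.text h.mem_i h.dollar).2.2 h.x_notMem hxK ?_ hsh.fst_eq
    hsh.fst_old hsh.fst_new ?_ hsh.lst_new (fun _ _ => rfl) l4
  · simp only [ei] at H2
    have hMz : ∀ v, v ≠ s.fresh + 1 → (v ∈ insAfter j (s.fresh + 1) M ↔ v ∈ M) := fun v hv =>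
      mem_insAfter_of_ne hv
    have hiM : i ∉ M := by rw [hM i h.mem_i]; omega
    have eqF : ∀ v ∈ s.fresh :: (A ++ j :: B),
        ((cutState s c i g j d y).splitInU (insAfter j (s.fresh + 1) M) j d (s.fresh + 1) y).eF v =
        Function.update (Function.update (fun v => if s.eF v = j ∧ d ≤ s.bF v then s.fresh + 1
          else s.eF v) s.fresh (s.eF i)) i s.fresh v ∧
        ((cutState s c i g j d y).splitInU (insAfter j (s.fresh + 1) M) j d (s.fresh + 1) y).bF v =
        Function.update (Function.update (fun v => if s.eF v = j ∧ d ≤ s.bF v then s.bF v - d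
          else s.bF v) s.fresh 0) i 0 v := by
      intro v hv
      have hvz : v ≠ s.fresh + 1 := by
        rcases List.mem_cons.1 hv with rfl | hv
        · omega
        · exact (h.ne_of_mem hv).2
      simp only [St.splitInU, hMz v hvz, cutState, St.splitLink, St.insertNode,
        Function.update_of_ne hvz]
      rcases eq_or_ne v i with rfl | hvi
      · simp [hiM]
      · rw [Function.update_of_ne hvi, Function.update_of_ne hvi, Function.update_of_ne hvi,
          Function.update_of_ne hvi]
        rcases List.mem_cons.1 hv with rfl | hv
        · simp [hxM]
        · have hvx := (h.ne_of_mem hv).1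
          simp only [Function.update_of_ne hvx, hM v hv, and_self]
    refine ⟨H2.congr (fun _ => Iff.rfl) (fun k => ?_) (fun _ _ => rfl) (fun _ _ => rfl)
      (fun _ _ => rfl) (fun v hv => (eqF v hv).1) (fun v hv => (eqF v hv).2) ?_, ?_⟩
    · simp only [List.mem_cons]; tauto
    · intro k hk
      simp only [St.splitInU, cutState, St.splitLink, St.insertNode]
      have hzj := hj.2.symm
      have hxz : s.fresh ≠ s.fresh + 1 := by omega
      rcases eq_or_ne k (s.eF i) with rfl | hkh
      · rcases eq_or_ne (s.eF i) j with e | e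
        · simp [e, hj.2, Ne.symm hy.1]
        · simp [e, hhd.2]
      · rw [Function.update_of_ne hkh]
        rcases eq_or_ne k j with rfl | hkj
        · simp [hkh, hj.1, hj.2]
        · rcases eq_or_ne k s.fresh with rfl | hkx
          · simp [hkj, hkh]
          · rcases eq_or_ne k (s.fresh + 1) with rfl | hkz
            · simp [hkj]
            · simp [hkj, hkh, hkx, hkz]
    · intro α hα hc k
      -- The cut only divides edges among the two parts, and the insertion keeps the numbers below
      -- α; the edge of the new part of v_j is not counted yet.
      have h3 := countP_insert_lt (x := s.fresh) (s := i) (α := α) h.stored.layout.nodupU h.mem_i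
        h.x_notMem (e := fun v => if s.eF v = j ∧ d ≤ s.bF v then s.fresh + 1 else s.eF v) (by
          intro v hv
          have := h.ne_of_mem (h.stored.halfF.mem v hv)
          split_ifs
          · omega
          · exact this.1) hα (fun k => (countP_split_le (fun v hv =>
            (h.ne_of_mem (h.stored.halfF.mem v hv)).2)).trans_lt (hc _)) k
      simp only [ei] at h3
      refine lt_of_le_of_lt (List.countP_mono_left fun v hv => ?_) h3
      simp only [(eqF v hv).1]
      exact id
  · intro k hk hkq
    rcases List.mem_cons.1 hk with rfl | hk
    · rw [Function.update_self] at hkq; omega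
    · rw [hbz k hk] at hkq ⊢
      -- Only after the cut does no repetition straddle q: the first part of u_j ends there.
      rcases eq_or_ne k j with rfl | hkj
      · rw [l2]; omega
      · rw [l1 k hk hkj]
        rcases off_trichotomy (len := s.len) hk hjU hkj with h5 | h5
        · omega
        · omega
  · intro k hk
    rcases List.mem_cons.1 hk with rfl | hk
    · rw [Function.update_self, hzU, shift, if_pos le_rfl]
    · rw [hbz k hk]; exact hsh.lst_eq k hk

end Cut

end Cut


/-! ### The redirection of edges after a cut, and its cost. -/

section SplitRun

variable {σ : Type} [LinearOrder σ] [OrderBot σ]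

/-- The state `t` stores a graph in which the new part `z` of the node `j` has been created and linked,
but has no edge of `E_F` yet, and the edges of `E_L` to it still lead to `j`, whose former length is
`len j`. -/
structure PartlySplit (T : List σ) (U V N : List ℕ) (t : St σ) (j z d : ℕ) (len : ℕ → ℕ) : Prop where
  layout : Layout T U V t.ch t.len
  mem : ∀ k, k ∈ U ↔ k ∈ z :: N
  notMem : z ∉ N
  nodup : N.Nodup
  memj : j ∈ N
  pos : 0 < d
  len_j : t.len j = d
  len_eq : ∀ k ∈ N, k ≠ j → t.len k = len k
  len_z : len j = t.len z + d
  off_z : off t.len V z = off t.len V j + d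
  alloc : ∀ x ∈ U, x < t.fresh
  dllU : DLL t.uPrev t.uNext t.uHead t.uTail U
  dllV : DLL t.vPrev t.vNext t.vHead t.vTail V
  order : t.order = U
  dollar_mem : t.dollar ∈ U
  dollar_ch : t.ch t.dollar = ⊥
  halfF : Half N U (off t.len V) (off t.len U) t.len t.eF t.bF t.inU
  halfL : Half U N (off t.len U) (off t.len V) len t.eL t.bL t.inV
  eL_eq : ∀ w ∈ U, off t.len V j ≤ off t.len U w → off t.len U w < off t.len V j + len j → t.eL w = j
  bL_z : t.bL z = 0

namespace PartlySplit

variable {T : List σ} {U V N : List ℕ} {t : St σ} {j z d α : ℕ} {len : ℕ → ℕ}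

theorem mem_U (h : PartlySplit T U V N t j z d len) {k : ℕ} (hk : k ∈ N) : k ∈ U :=
  (h.mem k).2 (List.mem_cons_of_mem _ hk)

theorem z_mem (h : PartlySplit T U V N t j z d len) : z ∈ U := (h.mem z).2 (by simp)

theorem perm (h : PartlySplit T U V N t j z d len) : U.Perm (z :: N) :=
  (List.perm_ext_iff_of_nodup h.layout.nodupU (List.nodup_cons.2 ⟨h.notMem, h.nodup⟩)).2 h.mem

theorem mem_V (h : PartlySplit T U V N t j z d len) {k : ℕ} (hk : k ∈ U) : k ∈ V :=
  h.layout.perm.mem_iff.2 hk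

theorem ne_z (h : PartlySplit T U V N t j z d len) {k : ℕ} (hk : k ∈ N) : k ≠ z :=
  fun e => h.notMem (e ▸ hk)

/-- Compared with N, the list U has the single further source z. -/
theorem countP_eL_le (h : PartlySplit T U V N t j z d len)
    (hc : ∀ k, N.countP (fun v => t.eL v = k) < α) (k : ℕ) : U.countP (fun v => t.eL v = k) ≤ α := by
  rw [h.perm.countP_eq, List.countP_cons]
  have := hc k
  split_ifs <;> omega

/-- The new edge of `E_F`. -/
theorem exists_splitOutV (h : PartlySplit T U V N t j z d len) {n : ℕ} (hn : t.fresh ≤ n + 1)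
    (hF : ∀ k, N.countP (fun v => t.eF v = k) < α) (hL : ∀ k, N.countP (fun v => t.eL v = k) < α)
    (m : ℕ) : ∃ f b, ∃ r ≤ α + 3, ex (splitOutV d n z (t.get j)) (t.tk m).toM =
      (f, ((t.splitOutV z f b (t.eF j)).tk (m + r)).toM) ∧
      f ∈ U ∧
      Half U U (off t.len V) (off t.len U) t.len (t.splitOutV z f b (t.eF j)).eF
        (t.splitOutV z f b (t.eF j)).bF (t.splitOutV z f b (t.eF j)).inU ∧
      (∀ k ≠ f, U.countP (fun v => (t.splitOutV z f b (t.eF j)).eF v = k) < α) ∧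
      U.countP (fun v => (t.splitOutV z f b (t.eF j)).eF v = f) ≤ α := by
  set k0 := t.eF j with hk0
  have hk0U : k0 ∈ U := h.halfF.mem j h.memj
  have hej : off t.len U k0 + t.bF j = off t.len V j := h.halfF.eq j h.memj
  have hlj : t.bF j < t.len k0 := h.halfF.lt j h.memj
  have hzV : z ∈ V := h.mem_V h.z_mem
  have hjV : j ∈ V := h.mem_V (h.mem_U h.memj)
  have hoz := h.off_z
  have hnd := h.layout.nodupU
  obtain ⟨C, E, hE⟩ := List.append_of_mem hk0U
  have hk0C : k0 ∉ C := by
    intro hm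
    rw [hE] at hnd
    exact (List.nodup_append.1 hnd).2.2 _ hm _ (by simp) rfl
  have hoff : ∀ w ∈ k0 :: E, off t.len U w = tot t.len C + off t.len (k0 :: E) w := by
    intro w hw
    have : w ∉ C := by
      intro hm
      rw [hE] at hnd
      exact (List.nodup_append.1 hnd).2.2 _ hm _ hw rfl
    rw [hE, off_append_right this]
  have hk0o : off t.len U k0 = tot t.len C := by
    rw [hoff k0 (by simp)]; simp [off]
  have htot : tot t.len C + tot t.len (k0 :: E) = tot t.len V := by
    rw [tot_perm h.layout.perm, hE, tot_append]
  have hzt := off_add_le (len := t.len) hzV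
  have hz0 := h.layout.pos z h.z_mem
  have hlen : (k0 :: E).length ≤ n + 1 := by
    have h1 := length_le_of_nodup_lt hnd h.alloc
    rw [hE, List.length_append] at h1
    omega
  obtain ⟨f, b, r, hf, hfb, hb, hr, hex⟩ := ex_locate (k0 :: E) (n + 1) k0 (t.bF j + d) (t.tk m)
    (by
      have := h.dllU.2.2.1
      rw [hE] at this
      exact (segTo_append.1 this).2) rfl (by simp only [St.tk]; omega) hlen
    (by rw [hE] at hnd; exact (List.nodup_append.1 hnd).2.1)
  simp only [St.tk] at hfb hb
  have hfU : f ∈ U := by rw [hE]; exact List.mem_append_right _ hf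
  have hfo := hoff f hf
  have hfz : off t.len U f + b = off t.len V z := by omega
  -- The repetitions that the walk passes behind the first one start in the former F-interval of j,
  -- so their edges lead to j; at most α edges do.
  have hidx : (k0 :: E).idxOf f ≤ α := by
    rcases eq_or_ne f k0 with e | hne
    · rw [e]; simp
    · have hfE : f ∈ E := (List.mem_cons.1 hf).resolve_left hne
      obtain ⟨E1, E2, hE2⟩ := List.append_of_mem hfE
      have hfE1 : f ∉ E1 := by
        intro hm
        rw [hE, hE2] at hnd
        have := (List.nodup_cons.1 (List.nodup_append.1 hnd).2.1).2
        exact (List.nodup_append.1 this).2.2 _ hm _ (by simp) rfl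
      have hi : (k0 :: E).idxOf f = (E1 ++ [f]).length := by
        rw [hE2, List.idxOf_cons_ne _ hne.symm, List.idxOf_append_of_notMem hfE1]
        simp
      rw [hi]
      refine le_trans ?_ (h.countP_eL_le hL j)
      have hsub : (E1 ++ [f]).Sublist U := by
        rw [hE, hE2, show C ++ k0 :: (E1 ++ f :: E2) = (C ++ [k0]) ++ (E1 ++ [f]) ++ E2 by simp]
        exact (List.sublist_append_right _ _).trans (List.sublist_append_left _ _)
      have hsort := pairwise_off hnd h.layout.pos
      refine le_trans (le_of_eq ?_) (hsub.countP_le (p := fun v => decide (t.eL v = j)))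
      symm
      rw [List.countP_eq_length]
      intro w hw
      have hwU : w ∈ U := hsub.subset hw
      have hwf : off t.len U w ≤ off t.len U f := by
        rcases List.mem_append.1 hw with hw | hw
        · rw [hE, hE2] at hsort
          have := (List.pairwise_cons.1 (List.pairwise_append.1 hsort).2.1).2
          have := (List.pairwise_append.1 this).2.2 w hw f (by simp)
          rw [← hE2, ← hE] at this
          exact this.le
        · rw [List.mem_singleton.1 hw]
      have hkw : off t.len U k0 < off t.len U w := by
        rw [hE, hE2] at hsort
        have := (List.pairwise_cons.1 (List.pairwise_append.1 hsort).2.1).1 w (by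
          rcases List.mem_append.1 hw with hw | hw
          · simp [hw]
          · simp [List.mem_singleton.1 hw])
        rwa [← hE2, ← hE] at this
      have hkl : off t.len U k0 + t.len k0 ≤ off t.len U w := by
        rcases off_trichotomy (len := t.len) hk0U hwU (by rintro rfl; omega) with h1 | h1 <;> omega
      have := h.len_z
      exact decide_eq_true (h.eL_eq w hwU (by omega) (by omega))
  obtain ⟨r', hr', hex'⟩ := ex_splitOutV (d := d) (N := n) (z := z) (tj := t.get j) (t.tk m) hex
  refine ⟨f, b, r', by omega, ?_, hfU, ?_, ?_⟩
  · rw [hex', ← St.tk_tk]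
    rfl
  · by_cases hne : f = k0
    · have H := h.halfF.addSource h.notMem hfU hfz hb h.memj hne.symm (by omega)
      refine H.congr h.mem (fun _ => Iff.rfl) (fun _ _ => rfl) (fun _ _ => rfl) (fun _ _ => rfl)
        (fun _ _ => rfl) (fun _ _ => rfl) (fun k _ => ?_)
      simp [St.splitOutV, hne]
    -- A node of V before z with an edge to f would lie before j, as z directly follows j. Then the
    -- start of j would be in f as well, and f would be the target of j.
    · have H := h.halfF.addSource_first h.notMem hfU hfz hb (by
        intro w hw hwf
        by_contra hlt
        have hwe := h.halfF.eq w hw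
        have hwl := h.halfF.lt w hw
        rw [hwf] at hwe hwl
        have hwj : w ≠ j := by rintro rfl; exact hne (hwf.symm.trans hk0.symm)
        have h1 := h.len_j
        have h2 := off_trichotomy (len := t.len) (h.mem_V (h.mem_U hw)) hjV hwj
        have h3 := h.layout.pos w (h.mem_U hw)
        exact hne (eq_of_off_add_eq (len := t.len) (s := off t.len V j - off t.len U f)
          (t := t.bF j) hfU hk0U (by omega) hlj (by omega)))
      refine H.congr h.mem (fun _ => Iff.rfl) (fun _ _ => rfl) (fun _ _ => rfl) (fun _ _ => rfl)
        (fun _ _ => rfl) (fun _ _ => rfl) (fun k _ => ?_)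
      simp [St.splitOutV, hne]
  -- The only additional edge is the one from z to f, so only f can reach α.
  · have key : ∀ k, U.countP (fun v => (t.splitOutV z f b k0).eF v = k) =
        N.countP (fun v => t.eF v = k) + if f = k then 1 else 0 := by
      intro k
      rw [h.perm.countP_eq, List.countP_cons]
      congr 1
      · refine List.countP_congr fun v hv => ?_
        simp [St.splitOutV, Function.update_of_ne (h.ne_z hv)]
      · simp [St.splitOutV]
    refine ⟨fun k hk => ?_, ?_⟩
    · rw [key, if_neg hk.symm]; exact hF k
    · rw [key, if_pos rfl]; exact hF f

/-- The edges of `E_L` to the new part. -/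
theorem exists_splitInV (h : PartlySplit T U V N t j z d len) {n f b k0 : ℕ} (hn : t.fresh ≤ n + 1)
    (hL : ∀ k, N.countP (fun v => t.eL v = k) < α) (m : ℕ) :
    ∃ M g, ∃ r ≤ 2 * α + 3, ex (splitInV j d n z (t.inV j)) ((t.splitOutV z f b k0).tk m).toM =
      ((), (((t.splitOutV z f b k0).splitInV M j d z g).tk (m + r)).toM) ∧
      Half U U (off t.len U) (off t.len V) t.len ((t.splitOutV z f b k0).splitInV M j d z g).eL
        ((t.splitOutV z f b k0).splitInV M j d z g).bL
        ((t.splitOutV z f b k0).splitInV M j d z g).inV ∧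
      ((t.splitOutV z f b k0).splitInV M j d z g).eL z = t.eL z ∧
      (∀ k ≠ t.eL z, U.countP
        (fun v => ((t.splitOutV z f b k0).splitInV M j d z g).eL v = k) < α) ∧
      U.countP (fun v => ((t.splitOutV z f b k0).splitInV M j d z g).eL v = t.eL z) ≤ α := by
  have hnd := h.layout.nodupU
  have hsort := pairwise_off hnd h.layout.pos
  have hzj := (h.ne_z h.memj).symm
  obtain ⟨A, M, B, e, hA, hM, hB, hhd⟩ := h.halfL.exists_run (fun _ => Iff.rfl) hsort h.memj h.eL_eq
  have hlen : M.length ≤ α := by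
    rw [← countP_run hA hM hB, ← e]
    exact h.countP_eL_le hL j
  have hlen' : M.length ≤ n + 1 := by
    have h1 := length_le_of_nodup_lt hnd h.alloc
    rw [e, List.length_append, List.length_append] at h1
    omega
  have hseg : SegTo t.uNext (M ++ B) none := by
    have := h.dllU.2.2.1
    rw [e] at this
    exact (segTo_append.1 this).2
  have hndM : (M ++ B).Nodup := by rw [e] at hnd; exact (List.nodup_append.1 hnd).2.1
  obtain ⟨r, hr, hex⟩ := ex_splitInV (j := j) (d := d) (N := n) (z := z) M B
    ((t.splitOutV z f b k0).tk m) hzj hndM hseg hM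
    (fun v hv => hB v (List.mem_of_mem_head? hv)) hlen'
  have hMU : ∀ v ∈ U, (v ∈ M ∧ d ≤ t.bL v ↔ t.eL v = j ∧ d ≤ t.bL v) := by
    intro v hv
    refine ⟨fun h1 => ⟨hM v h1.1, h1.2⟩, fun h1 => ⟨?_, h1.2⟩⟩
    rw [e] at hv
    rcases List.mem_append.1 hv with h2 | h2
    · exact absurd h1.1 (hA v h2)
    · rcases List.mem_append.1 h2 with h3 | h3
      · exact h3
      · exact absurd h1.1 (hB v h3)
  have hsubM : ∀ v ∈ M, v ∈ U := fun v hv => by rw [e]; simp [hv]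
  have hsortM : M.Pairwise (fun a b => off t.len U a < off t.len U b) := by
    have := hsort
    rw [e] at this
    have h1 := (List.pairwise_append.1 (List.pairwise_append.1 this).2.1).1
    rw [← e] at h1
    exact h1
  have H := h.halfL.splitTarget (z := z) (d := d) (f := M.find? (fun v => decide (d ≤ t.bL v)))
    (base' := off t.len V) (len' := t.len) h.memj h.notMem (fun _ _ => rfl) h.off_z h.len_eq h.len_j
    (fun v hv w hw => off_inj h.layout.pos hv hw)
    (by rw [h.len_z])
    (by
      intro hno v hv hvj
      rw [List.find?_eq_none] at hno
      by_contra hge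
      have := ((hMU v hv).2 ⟨hvj, by omega⟩).1
      exact hno v this (by simpa using hge))
    (by
      intro v hv
      obtain ⟨h1, h2, h3⟩ := find?_eq_some_iff_pos hsortM hv
      refine ⟨hsubM v h1, hM v h1, by simpa using h2, fun w hw hwj hwd => ?_⟩
      exact h3 w ((hMU w hw).2 ⟨hwj, hwd⟩).1 (by simpa using hwd))
  set g := M.find? (fun v => decide (d ≤ t.bL v)) with hg
  -- The edge of z has label 0 < d, so the redirection does not affect it even if z is in the run.
  have hzl : ((t.splitOutV z f b k0).splitInV M j d z g).eL z = t.eL z := by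
    simp only [St.splitInV, St.splitOutV, h.bL_z]
    rw [if_neg]
    have := h.pos
    omega
  have eqL : ∀ v ∈ U, ((t.splitOutV z f b k0).splitInV M j d z g).eL v =
      if t.eL v = j ∧ d ≤ t.bL v then z else t.eL v := by
    intro v hv
    by_cases h1 : t.eL v = j ∧ d ≤ t.bL v
    · rw [if_pos h1]; exact if_pos ((hMU v hv).2 h1)
    · rw [if_neg h1]; exact if_neg (fun h2 => h1 ((hMU v hv).1 h2))
  -- The edges into j are divided among j and z; beyond that there is only the edge of z itself.
  have key : ∀ k, U.countP (fun v => ((t.splitOutV z f b k0).splitInV M j d z g).eL v = k) ≤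
      N.countP (fun v => t.eL v = if k = z then j else k) + if t.eL z = k then 1 else 0 := by
    intro k
    rw [h.perm.countP_eq, List.countP_cons]
    refine add_le_add ?_ ?_
    · refine le_trans (le_of_eq ?_) (countP_split_le (e := t.eL) (b := t.bL) (z := z) (j := j) (d := d)
        (fun v hv => h.ne_z (h.halfL.mem v (h.mem_U hv))))
      refine List.countP_congr fun v hv => ?_
      rw [eqL v (h.mem_U hv)]
    · rw [hzl]; simp
  refine ⟨M, g, r, by omega, ?_, ?_, hzl, ?_, ?_⟩
  · rw [← hhd]
    refine hex.trans ?_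
    rw [← St.tk_tk]
    rfl
  · refine H.congr (fun _ => Iff.rfl) h.mem (fun _ _ => rfl) (fun _ _ => rfl) (fun _ _ => rfl)
      eqL (fun v hv => ?_) (fun k _ => rfl)
    by_cases h1 : t.eL v = j ∧ d ≤ t.bL v
    · rw [if_pos h1]; exact if_pos ((hMU v hv).2 h1)
    · rw [if_neg h1]; exact if_neg (fun h2 => h1 ((hMU v hv).1 h2))
  · intro k hk
    have := key k
    rw [if_neg hk.symm] at this
    exact this.trans_lt (hL _)
  · have := key (t.eL z)
    rw [if_pos rfl] at this
    have := hL (if t.eL z = z then j else t.eL z)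
    omega

end PartlySplit

/-- The test for heavy nodes. -/
theorem Stored.exists_splitHeavy {T : List σ} {U V : List ℕ} {t : St σ} (h : Stored T U V t) {α z f : ℕ}
    (hz : z ∈ U) (hf : f ∈ U) (hF : ∀ k ≠ f, U.countP (fun v => t.eF v = k) < α)
    (hL : ∀ k ≠ t.eL z, U.countP (fun v => t.eL v = k) < α)
    (hU : t.heavyU = []) (hV : t.heavyV = []) (m : ℕ) :
    ∃ a b, ∃ r ≤ 2 * α + 5, ex (splitHeavy α z f) (t.tk m).toM =
      ((), (({t with heavyU := a, heavyV := b} : St σ).tk (m + r)).toM) ∧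
      a = U.filter (fun x => α ≤ U.countP fun y => t.eF y = x) ∧
      b = V.filter (fun x => α ≤ U.countP fun y => t.eL y = x) := by
  have hnd := h.layout.nodupU
  have hndV := h.layout.nodupV
  have hp := h.layout.perm
  obtain ⟨A, M, B, e, hA, hM, hB, hhd⟩ := h.halfF.exists_run (fun x => hp.mem_iff)
    (pairwise_off hndV h.layout.posV) hf (fun w hw => h.eF_eq hw hf)
  have hf' := h.halfL.mem z hz
  obtain ⟨A', M', B', e', hA', hM', hB', hhd'⟩ := h.halfL.exists_run (fun x => Iff.rfl)
    (pairwise_off hnd h.layout.pos) hf' (fun w hw => h.eL_eq hw hf')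
  have hseg : SegTo t.vNext (M ++ B) none := by
    have := h.dllV.2.2.1
    rw [e] at this
    exact (segTo_append.1 this).2
  have hseg' : SegTo t.uNext (M' ++ B') none := by
    have := h.dllU.2.2.1
    rw [e'] at this
    exact (segTo_append.1 this).2
  obtain ⟨r, hr, hex⟩ := ex_splitHeavy (α := α) (z := z) (h := f) (t.tk m) M B M' B' hseg hM
    (fun v hv => hB v (List.mem_of_mem_head? hv)) hhd hseg' hM'
    (fun v hv => hB' v (List.mem_of_mem_head? hv)) hhd'
  have c1 : U.countP (fun v => t.eF v = f) = M.length := by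
    rw [← hp.countP_eq, e, countP_run hA hM hB]
  have c2 : U.countP (fun v => t.eL v = t.eL z) = M'.length := by
    rw [← countP_run hA' hM' hB', ← e']
  refine ⟨if α ≤ M.length then [f] else [], if α ≤ M'.length then [t.eL z] else [], r, hr,
    hex.trans ?_, ?_, ?_⟩
  · rw [← St.tk_tk]
    simp only [St.splitHeavy, St.tk, hU, hV]
  -- All nodes but f have fewer than α edges, so testing f alone determines the array.
  · rw [filter_eq_ite hnd hf, ← c1]
    · simp
    · intro x hx hc
      by_contra hne
      have := hF x hne
      simp at hc
      omega
  · rw [filter_eq_ite hndV (hp.mem_iff.2 hf'), ← c2]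
    · simp
    · intro x hx hc
      by_contra hne
      have := hL x hne
      simp at hc
      omega

end SplitRun


/-! ### Execution of the whole split. -/

section CutRun

variable {σ : Type} [LinearOrder σ] [OrderBot σ] {S : List σ} {s : St σ} {c : σ}
  {A B P G : List ℕ} {i j d g y α : ℕ}

/-- No node has more than `α` of the edges `e`, and all but one have fewer. -/
def FewHeavy (α : ℕ) (U : List ℕ) (e : ℕ → ℕ) : Prop :=
  ∃ f, (∀ k ≠ f, U.countP (fun v => e v = k) < α) ∧ U.countP (fun v => e v = f) ≤ α

/-- The arrays hold the heavy nodes. -/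
def HeavyStored (α : ℕ) (U V : List ℕ) (s : St σ) : Prop :=
  s.heavyU.Perm (U.filter fun x => α ≤ U.countP fun y => s.eF y = x) ∧
    s.heavyV.Perm (V.filter fun x => α ≤ U.countP fun y => s.eL y = x)

namespace Cut

theorem fresh_notMem_G (h : Cut S s c A B P G i j d g y) : s.fresh ∉ G ∧ s.fresh + 1 ∉ G :=
  ⟨fun hm => h.x_notMem (h.stored.layout.perm.mem_iff.1 (by simp [hm])),
    fun hm => h.z_notMem (h.stored.layout.perm.mem_iff.1 (by simp [hm]))⟩

theorem cutState_eF (_ : Cut S s c A B P G i j d g y) {v : ℕ} (hv : v ≠ s.fresh) (hvi : v ≠ i) :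
    (cutState s c i g j d y).eF v = if v = s.fresh + 1 then (s.insertNode c i g j).eF j else s.eF v := by
  simp only [cutState, St.splitLink, St.insertNode]
  split_ifs with h1
  · rw [h1]; simp
  · rw [Function.update_of_ne h1, Function.update_of_ne hvi, Function.update_of_ne hv]

/-- It packs all that the rest of the split needs, so that the text and the insertion can be
forgotten. -/
theorem partlySplit (h : Cut S s c A B P G i j d g y) {M : List ℕ}
    (hM : ∀ v ∈ A ++ j :: B, v ∈ M ↔ s.eF v = j ∧ d ≤ s.bF v) (hxM : s.fresh ∉ M) :
    PartlySplit (c :: S) (cutU s A B j) (cutV s P G i j) (s.fresh :: (A ++ j :: B))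
      ((cutState s c i g j d y).splitInU (insAfter j (s.fresh + 1) M) j d (s.fresh + 1) y)
      j (s.fresh + 1) d (Function.update s.len s.fresh 1) := by
  obtain ⟨L, hsh, hzU, hzV⟩ := h.layout
  obtain ⟨l1, l2, l3, l4⟩ := h.len_eq
  have hj := h.ne_of_mem (k := j) (by simp)
  have hlt := h.lt
  have hzN : s.fresh + 1 ∉ s.fresh :: (A ++ j :: B) := by
    rw [List.mem_cons, not_or]; exact ⟨by omega, h.z_notMem⟩
  refine {
    layout := L
    mem := h.mem_cutU
    notMem := hzN
    nodup := List.nodup_cons.2 ⟨h.x_notMem, h.stored.layout.nodupU⟩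
    memj := by simp
    pos := h.pos
    len_j := l2
    len_eq := ?_
    len_z := ?_
    off_z := hzV
    alloc := ?_
    dllU := h.dllU.1
    dllV := h.dllV
    order := h.dllU.2
    dollar_mem := ?_
    dollar_ch := ?_
    halfF := (h.halfF hM hxM).1.congr (fun _ => Iff.rfl) h.mem_cutU (fun _ _ => rfl)
      (fun _ _ => rfl) (fun _ _ => rfl) (fun _ _ => rfl) (fun _ _ => rfl) (fun _ _ => rfl)
    halfL := h.halfL.congr h.mem_cutU (fun _ => Iff.rfl) (fun _ _ => rfl) (fun _ _ => rfl)
      (fun _ _ => rfl) (fun _ _ => rfl) (fun _ _ => rfl) (fun _ _ => rfl)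
    eL_eq := ?_
    bL_z := ?_ }
  · intro k hk hkj
    rcases List.mem_cons.1 hk with rfl | hk
    · rw [Function.update_self]; exact l4
    · rw [Function.update_of_ne (h.ne_of_mem hk).1]; exact l1 k hk hkj
  · rw [Function.update_of_ne hj.1]
    change s.len j = (cutState s c i g j d y).len (s.fresh + 1) + d
    rw [l3]; omega
  · intro x hx
    change x < s.fresh + 1 + 1
    rcases List.mem_cons.1 ((h.mem_cutU x).1 hx) with rfl | hx
    · omega
    · rcases List.mem_cons.1 hx with rfl | hx
      · omega
      · have := h.stored.alloc x hx; omega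
  · change s.fresh ∈ _
    rw [h.mem_cutU]; simp
  · change (cutState s c i g j d y).ch s.fresh = ⊥
    have hi := (h.ne_of_mem h.mem_i).1.symm
    simp [cutState, St.splitLink, St.insertNode, Function.update_of_ne hi]
  · intro w hw h1 h2
    rw [Function.update_of_ne hj.1] at h2
    exact h.eL_eq hw h1 h2
  · change (cutState s c i g j d y).bL (s.fresh + 1) = 0
    exact Function.update_self (s.fresh + 1) 0 _

/-- The first node of U is the one whose edge leads to i and is taken over; the edge from the new
part of u_j is not counted yet. -/
theorem countP_eL_lt (h : Cut S s c A B P G i j d g y) (hα : 2 ≤ α)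
    (hL : ∀ k, (A ++ j :: B).countP (fun v => s.eL v = k) < α) (k : ℕ) :
    (s.fresh :: (A ++ j :: B)).countP (fun v => (cutState s c i g j d y).eL v = k) < α := by
  obtain ⟨f1, f2, f3, f4⟩ := h.stored.first_edges h.text h.mem_i h.dollar
  have h3 := countP_insert_lt (x := s.fresh) (s := s.eF i) h.stored.layout.nodupU f1
    h.x_notMem (e := s.eL) (fun v hv => (h.ne_of_mem (h.stored.halfL.mem v hv)).1) hα hL k
  refine lt_of_le_of_lt (List.countP_mono_left fun v hv => ?_) h3
  have hvz : v ≠ s.fresh + 1 := by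
    rcases List.mem_cons.1 hv with rfl | hv
    · omega
    · exact (h.ne_of_mem hv).2
  simp only [cutState, St.splitLink, St.insertNode, Function.update_of_ne hvz, f4]
  exact id

/-- The redirection of the edges of `E_F`. -/
theorem exists_splitInU (h : Cut S s c A B P G i j d g y)
    (hF : ∀ k, (A ++ j :: B).countP (fun v => s.eF v = k) < α) (m : ℕ) :
    ∃ M : List ℕ, ∃ r ≤ 2 * α + 3, s.fresh ∉ M ∧
      (∀ v ∈ A ++ j :: B, v ∈ M ↔ s.eF v = j ∧ d ≤ s.bF v) ∧
      ex (splitInU j d (s.fresh + 1) (s.fresh + 1) y) ((cutState s c i g j d y).tk m).toM =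
      ((), (((cutState s c i g j d y).splitInU (insAfter j (s.fresh + 1) M) j d (s.fresh + 1) y).tk
        (m + r)).toM) := by
  obtain ⟨M, E, hG, hM, hGU, hMj, hEj⟩ := h.exists_run
  obtain ⟨hxG, hzG⟩ := h.fresh_notMem_G
  have hj := h.ne_of_mem (k := j) (by simp)
  have hMG : ∀ v ∈ M, v ∈ G := fun v hv => by rw [hG]; simp [hv]
  have hEG : ∀ v ∈ E, v ∈ G := fun v hv => by rw [hG]; simp [hv]
  have hxM : s.fresh ∉ M := fun hm => hxG (hMG _ hm)
  have hzM : s.fresh + 1 ∉ M := fun hm => hzG (hMG _ hm)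
  have hndV := h.layout.1.nodupV
  have hcut : cutV s P G i j = insAfter j (s.fresh + 1) (s.fresh :: (P ++ [i])) ++
      (insAfter j (s.fresh + 1) M ++ insAfter j (s.fresh + 1) E) := by
    rw [← insAfter_append, ← hG, ← insAfter_append]
    simp [cutV]
  have hseg := h.dllV.2.2.1
  rw [hcut] at hseg hndV
  have hndM : M.Nodup := by
    have := h.stored.layout.nodupV
    rw [hG] at this
    exact (List.nodup_append.1 (List.nodup_append.1 (List.nodup_cons.1 this).2).2.1).1
  have hlen := length_insAfter_le (j := j) (z := s.fresh + 1) hndM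
  -- All nodes of M have edges to j in the state before the update, which is balanced.
  have hMlen : M.length < α := by
    refine lt_of_le_of_lt ?_ (hF j)
    have hsub : M.Subperm (A ++ j :: B) :=
      List.subperm_of_subset hndM fun v hv => (hGU v (hMG v hv)).1
    refine le_trans (le_of_eq ?_) (hsub.countP_le (p := fun v => decide (s.eF v = j)))
    symm
    rw [List.countP_eq_length]
    exact fun v hv => decide_eq_true (hMj v hv)
  have hMlt := length_le_of_nodup_lt hndM fun v hv => h.stored.alloc v (hGU v (hMG v hv)).1
  have hvx : ∀ v ∈ G, v ≠ s.fresh ∧ v ≠ i ∧ v ≠ s.fresh + 1 := fun v hv =>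
    ⟨fun e => hxG (e ▸ hv), (hGU v hv).2, fun e => hzG (e ▸ hv)⟩
  obtain ⟨r, hr, hex⟩ := ex_splitInU (j := j) (d := d) (N := s.fresh + 1) (z := s.fresh + 1) (y := y)
    (insAfter j (s.fresh + 1) M) (insAfter j (s.fresh + 1) E) ((cutState s c i g j d y).tk m) hj.2.symm
    (List.nodup_append.1 hndV).2.1 (by rw [← insAfter_append, ← hG, head?_insAfter, h.head])
    (segTo_append.1 hseg).2 (by
      intro v hv
      change (cutState s c i g j d y).eF v = j
      -- The new part of v_j starts with a copy of the edge of v_j, so the loop also meets it if v_j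
      -- is in the run. This does no harm, since that edge is overwritten afterwards.
      by_cases hvz : v = s.fresh + 1
      · subst hvz
        have hjM := mem_of_mem_insAfter hv hzM
        have hi := (h.ne_of_mem h.mem_i).2.symm
        rw [h.cutState_eF (by omega) hi, if_pos rfl]
        simp only [St.insertNode]
        rw [Function.update_of_ne h.ne_ji, Function.update_of_ne hj.1]
        exact hMj j hjM
      · rw [mem_insAfter_of_ne hvz] at hv
        have h1 := hvx v (hMG v hv)
        rw [h.cutState_eF h1.1 h1.2.1, if_neg hvz]
        exact hMj v hv) (by
      intro v hv
      rw [head?_insAfter] at hv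
      have hv := List.mem_of_mem_head? hv
      change (cutState s c i g j d y).eF v ≠ j
      have h1 := hvx v (hEG v hv)
      rw [h.cutState_eF h1.1 h1.2.1, if_neg h1.2.2]
      exact hEj v hv) (by omega)
  refine ⟨M, r, by omega, hxM, hM, hex.trans ?_⟩
  rw [← St.tk_tk]
  rfl

/-- The split. -/
theorem exists_splitNode (h : Cut S s c A B P G i j d g y) (τ : ℕ) (hα : 2 ≤ α)
    (hF : ∀ k, (A ++ j :: B).countP (fun v => s.eF v = k) < α)
    (hL : ∀ k, (A ++ j :: B).countP (fun v => s.eL v = k) < α)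
    (hU : s.heavyU = []) (hV : s.heavyV = []) (m : ℕ) :
    ∃ t : St σ, ∃ r ≤ 7 * α + τ + 30, ex (splitNode τ α j d s.fresh y)
        ((s.insertNode c i g j).tk m).toM = (s.fresh + 1, (t.tk (m + r)).toM) ∧
      Stored (c :: S) (cutU s A B j) (cutV s P G i j) t ∧ t.ch = (cutState s c i g j d y).ch ∧
      t.len = (cutState s c i g j d y).len ∧ t.btree = s.btree ∧ t.steps = s.steps ∧
      FewHeavy α (cutU s A B j) t.eF ∧ FewHeavy α (cutU s A B j) t.eL ∧
      HeavyStored α (cutU s A B j) (cutV s P G i j) t := by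
  have hj := h.ne_of_mem (k := j) (by simp)
  have hy := h.ne_of_mem h.mem_y
  have e1 : ex (readReg (fun m : Machine σ => m.fresh)) ((s.insertNode c i g j).tk m).toM =
    (s.fresh + 1, ((s.insertNode c i g j).tk (m + 1)).toM) := rfl
  have e2 : ex (readCell j) ((s.insertNode c i g j).tk (m + 1)).toM =
    ((s.insertNode c i g j).get j, ((s.insertNode c i g j).tk (m + 2)).toM) := rfl
  have e3 : ex (splitLink τ j d s.fresh y ((s.insertNode c i g j).get j))
      ((s.insertNode c i g j).tk (m + 2)).toM =
      (s.fresh + 1, ((cutState s c i g j d y).tk (m + 2 + (12 + τ))).toM) := by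
    have := ex_splitLink τ j d s.fresh y ((s.insertNode c i g j).tk (m + 2)) hy.2 hj.2
      (show s.fresh ≠ s.fresh + 1 by omega)
    refine this.trans ?_
    rw [← St.tk_tk (cutState s c i g j d y)]
    rfl
  obtain ⟨M, r4, hr4, hxM, hM, e4⟩ := h.exists_splitInU hF (m + 2 + (12 + τ))
  have hp := h.partlySplit hM hxM
  have cF := (h.halfF hM hxM).2 α hα hF
  have cL := h.countP_eL_lt (d := d) hα hL
  set s4 := (cutState s c i g j d y).splitInU (insAfter j (s.fresh + 1) M) j d (s.fresh + 1) y with hs4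
  have e5 : ex (readCell j) (s4.tk (m + 2 + (12 + τ) + r4)).toM =
    (s4.get j, (s4.tk (m + 2 + (12 + τ) + r4 + 1)).toM) := rfl
  have hfr : s4.fresh ≤ s.fresh + 1 + 1 := le_rfl
  obtain ⟨f, b, r6, hr6, e6, hfU, hHF, hcF, hcF'⟩ := hp.exists_splitOutV hfr cF cL
    (m + 2 + (12 + τ) + r4 + 1)
  obtain ⟨M2, g2, r7, hr7, e7, hHL, hzL, hcL, hcL'⟩ := hp.exists_splitInV (f := f) (b := b)
    (k0 := s4.eF j) hfr cL (m + 2 + (12 + τ) + r4 + 1 + r6)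
  set s6 := (s4.splitOutV (s.fresh + 1) f b (s4.eF j)).splitInV M2 j d (s.fresh + 1) g2 with hs6
  have hst : Stored (c :: S) (cutU s A B j) (cutV s P G i j) s6 :=
    { layout := hp.layout
      alloc := hp.alloc
      dllU := hp.dllU
      dllV := hp.dllV
      halfL := hHL
      halfF := hHF
      order := hp.order
      dollar_mem := hp.dollar_mem
      dollar_ch := hp.dollar_ch }
  obtain ⟨a1, a2, r8, hr8, e8, ha1, ha2⟩ := hst.exists_splitHeavy (α := α) hp.z_mem hfU hcF
    (by rw [hzL]; exact hcL) hU hV (m + 2 + (12 + τ) + r4 + 1 + r6 + r7)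
  have hm : m + 2 + (12 + τ) + r4 + 1 + r6 + r7 + r8 = m + (2 + (12 + τ) + r4 + 1 + r6 + r7 + r8) := by
    omega
  refine ⟨{s6 with heavyU := a1, heavyV := a2}, 2 + (12 + τ) + r4 + 1 + r6 + r7 + r8, by omega, ?_,
    hst.with_heavy a1 a2 s6.steps, rfl, rfl, rfl, rfl, ⟨f, hcF, hcF'⟩, ⟨_, hcL, hcL'⟩, ?_, ?_⟩
  · rw [splitNode_eq, ← hm]
    unfold splitParts
    rw [ex_bind, e1, ex_bind, e2, ex_bind, e3, ex_bind, e4, ex_bind, e5, ex_bind, e6, ex_bind]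
    have e7' : ex (splitInV j d (s.fresh + 1) (s.fresh + 1) (s4.get j).inV)
      (((s4.splitOutV (s.fresh + 1) f b (s4.eF j)).tk (m + 2 + (12 + τ) + r4 + 1 + r6)).toM) = _ := e7
    simp only
    rw [e7', ex_bind]
    simp only
    rw [e8]
    rfl
  · rw [ha1]
  · rw [ha2]

end Cut

end CutRun


/-! ### Execution of the modifying part of the update. -/

section UpdateTail

variable {σ : Type} [LinearOrder σ] [OrderBot σ] {S : List σ} {s t : St σ} {c : σ}
  {U V U' V' A B P G : List ℕ} {i j d g w y α : ℕ}

theorem treeCost_mono {τ m n : ℕ} (h : m ≤ n) : treeCost τ m ≤ treeCost τ n := by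
  unfold treeCost
  have : Nat.log 2 (m + 1) ≤ Nat.log 2 (n + 1) := Nat.log_mono_right (by omega)
  gcongr

/-- A node keeps its status if its character and its next node stay the same and the next node is
not `$`. -/
theorem St.cond_congr {X X' T T' : List ℕ} {hd tl hd' tl' : Option ℕ}
    (h : DLL s.uPrev s.uNext hd tl (X ++ y :: T)) (h' : DLL t.uPrev t.uNext hd' tl' (X' ++ y :: T'))
    (hT : T'.head? = T.head?) (hy : t.ch y = s.ch y)
    (hb : ∀ b ∈ T.head?, s.ch b ≠ ⊥ ∧ t.ch b = s.ch b) : t.cond y = s.cond y := by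
  rw [St.cond_eq h, St.cond_eq h']
  rcases T with _ | ⟨b, T⟩
  · rw [List.head?_nil, List.head?_eq_none_iff] at hT
    rw [hT]
    simp [condL]
  · obtain ⟨T'', rfl⟩ : ∃ T'', T' = b :: T'' := by
      rcases T' with _ | ⟨b', T'⟩
      · simp at hT
      · simp only [List.head?_cons, Option.some.injEq] at hT
        exact ⟨T', by rw [hT]⟩
    obtain ⟨h1, h2⟩ := hb b rfl
    exact condL_congr hy h1 h2

theorem DLL.prev_of_head {prev next : ℕ → Option ℕ} {X T : List ℕ} {hd tl : Option ℕ} {b : ℕ}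
    (h : DLL prev next hd tl (X ++ y :: T)) (hb : b ∈ T.head?) : prev b = some y := by
  obtain ⟨T', rfl⟩ : ∃ T', T = b :: T' := by
    rcases T with _ | ⟨b', T'⟩
    · simp at hb
    · simp only [List.head?_cons, Option.mem_def, Option.some.injEq] at hb
      exact ⟨T', by rw [hb]⟩
  rw [List.append_cons] at h
  rw [h.prev_eq]
  simp

/-- The node after `y` does not have the label `$` if `y` does not precede the node `i` that has. -/
theorem Stored.next_ne_bot (h : Stored S U V s) (hS : IsText S) (hi : i ∈ U) (hci : s.ch i = ⊥)
    {X T : List ℕ} (hU : U = X ++ y :: T) (hp : some y ≠ s.uPrev i) {b : ℕ} (hb : b ∈ T.head?) :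
    b ≠ i ∧ s.ch b ≠ ⊥ ∧ b ∈ U := by
  have hbU : b ∈ U := by
    rw [hU]
    have := List.mem_of_mem_head? hb
    simp [this]
  have hbi : b ≠ i := by
    rintro rfl
    have := h.dllU
    rw [hU] at this
    exact hp (this.prev_of_head hb).symm
  exact ⟨hbi, fun e => hbi (h.layout.dollar_unique hS hbU e hi hci), hbU⟩

theorem Stored.uPrev_mem (h : Stored S U V s) (hi : i ∈ U) : ∀ p ∈ s.uPrev i, p ∈ U := by
  intro p hp
  obtain ⟨X, T, hU⟩ := List.append_of_mem hi
  have h1 := h.dllU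
  rw [hU] at h1
  rw [h1.prev_eq] at hp
  rw [hU]
  have := List.mem_of_getLast? hp
  simp [this]

/-- Here o is the node that is cut. It is deleted and, unless it precedes i, not inserted again,
which is right because it then fails the condition. All other untouched nodes keep their status. -/
theorem Stored.exists_insertPhase (τ : ℕ) {x : ℕ} {z o : Option ℕ} (h : Stored S U V s)
    (h' : Stored (c :: S) U' V' t) (hcS : IsText (c :: S)) (hi : i ∈ U)
    (hUU : ∀ y ∈ U, y ∈ U') (hnew : ∀ y ∈ U', y ∈ U ∨ y = x ∨ some y = z) (hx : x ∈ U')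
    (hz : ∀ y ∈ z, y ∈ U') (hxU : x ∉ U) (hzU : ∀ y ∈ z, y ∉ U)
    (hmono : ∀ y ∈ U, y ≠ i → off t.len V' y = shift (rk (c :: S) 0) (off s.len V y))
    (hct : t.btree.Complete) (hin : t.btree.inorder =
      V.filter (fun y => s.cond y && decide (y ≠ i ∧ some y ≠ s.uPrev i ∧ some y ≠ o)))
    (hcond : ∀ y ∈ U, y ≠ i → some y ≠ s.uPrev i →
      (some y = o → t.cond y = false) ∧ (some y ≠ o → t.cond y = s.cond y)) :
    ∃ t', ∃ n ≤ 4 * treeCost τ V'.length, ex (insertPhase τ i x (s.uPrev i) z) t.toM =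
      ((), ({t with btree := t', steps := t.steps + n} : St σ).toM) ∧ t'.Complete ∧
      t'.inorder = V'.filter t.cond := by
  have hmem : ∀ y ∈ t.btree.inorder, y ∈ U ∧ s.cond y = true ∧ y ≠ i ∧ some y ≠ s.uPrev i ∧
      some y ≠ o := by
    intro y hy
    rw [hin, List.mem_filter] at hy
    simp only [Bool.and_eq_true, decide_eq_true_eq] at hy
    exact ⟨h.layout.perm.mem_iff.1 hy.1, hy.2⟩
  refine ex_insertPhase τ h' hcS (hUU i hi) hx (fun p hp => hUU p (h.uPrev_mem hi p hp)) hz hct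
    (fun y hy => h'.layout.perm.mem_iff.2 (hUU y (hmem y hy).1)) ?_ ?_ ?_
  · have hs : (t.btree.inorder).Pairwise (fun a b => off s.len V a < off s.len V b) := by
      rw [hin]
      exact (pairwise_off h.layout.nodupV h.layout.posV).filter _
    -- The entries left in the tree differ from i and are moved by a monotone shift, so the tree
    -- stays sorted with respect to the new V.
    refine hs.imp_of_mem fun {a b} ha hb hab => ?_
    obtain ⟨a1, -, a2, -⟩ := hmem a ha
    obtain ⟨b1, -, b2, -⟩ := hmem b hb
    rw [hmono a a1 a2, hmono b b1 b2]
    unfold shift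
    split_ifs <;> omega
  · intro y hy hyi hyx hyp hyz
    have hyU : y ∈ U := by
      rcases hnew y hy with h1 | h1 | h1
      · exact h1
      · exact absurd h1 hyx
      · exact absurd h1 hyz
    obtain ⟨h1, h2⟩ := hcond y hyU hyi hyp
    by_cases ho : some y = o
    · rw [h1 ho]
      simp only [Bool.false_eq_true, iff_false]
      exact fun hm => (hmem y hm).2.2.2.2 ho
    · rw [h2 ho, hin, List.mem_filter]
      simp only [Bool.and_eq_true, decide_eq_true_eq, h.layout.perm.mem_iff]
      tauto
  · intro y hy hyy
    obtain ⟨h1, h2, h3, h4, h5⟩ := hmem y hy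
    rcases hyy with e | e | e | e
    · exact absurd e h3
    · exact absurd (e ▸ h1) hxU
    · exact absurd e h4
    · exact absurd h1 (hzU y e.symm)

/-- The bound for the number of steps of `update` with `n` nodes. -/
def updateCost (τ α n : ℕ) : ℕ := 8 * treeCost τ (n + 2) + 7 * α + 2 * τ + 60

/-- The state `t`, with the B-tree of the nodes in `V` that satisfy the condition. -/
structure Output (α : ℕ) (S : List σ) (U V : List ℕ) (t : St σ) : Prop where
  stored : Stored S U V t
  fewF : FewHeavy α U t.eF
  fewL : FewHeavy α U t.eL
  heavy : HeavyStored α U V t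
  complete : t.btree.Complete
  inorder : t.btree.inorder = V.filter t.cond

/-- No exception is needed, so the exceptional node 0 is arbitrary. -/
theorem FewHeavy.of_lt {e : ℕ → ℕ} (h : ∀ k, U.countP (fun v => e v = k) < α) : FewHeavy α U e :=
  ⟨0, fun k _ => h k, (h 0).le⟩

theorem HeavyStored.of_lt (hF : ∀ k, U.countP (fun v => t.eF v = k) < α)
    (hL : ∀ k, U.countP (fun v => t.eL v = k) < α) (hU : t.heavyU = []) (hV : t.heavyV = []) :
    HeavyStored α U V t := by
  constructor
  · rw [hU, List.filter_eq_nil_iff.2]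
    intro k _
    have := hF k
    simpa using this
  · rw [hV, List.filter_eq_nil_iff.2]
    intro k _
    have := hL k
    simpa using this

/-- The state before the update. -/
structure Input (α : ℕ) (S : List σ) (U V : List ℕ) (s : St σ) : Prop where
  stored : Stored S U V s
  ltF : ∀ k, U.countP (fun v => s.eF v = k) < α
  ltL : ∀ k, U.countP (fun v => s.eL v = k) < α
  heavyU : s.heavyU = []
  heavyV : s.heavyV = []
  complete : s.btree.Complete
  inorder : s.btree.inorder = V.filter s.cond

theorem Input.tk (h : Input α S U V s) (n : ℕ) : Input α S U V (s.tk n) :=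
  ⟨h.stored.with_btree _ _, h.ltF, h.ltL, h.heavyU, h.heavyV, h.complete, h.inorder⟩

/-- The update if no node is split. -/
theorem Input.exists_updateTail_grow (h : Input α S (A ++ w :: B) (i :: (P ++ G)) s) (τ : ℕ)
    (hα : 2 ≤ α) (hS : IsText S)
    (hc : c ≠ ⊥) (hci : s.ch i = ⊥) (hA : tot s.len (A ++ [w]) = rk (c :: S) 0)
    (hP : tot s.len (i :: P) = rk (c :: S) 0) (hg : (i :: P).getLast? = some g) :
    ∃ t, ex (updateTail τ α c i (s.get i) g w none) s.toM = ((), t.toM) ∧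
      t.steps ≤ s.steps + (7 * treeCost τ ((i :: (P ++ G)).length + 2) + 14 + τ) ∧
      Output α (c :: S) (A ++ w :: s.fresh :: B) (s.fresh :: (P ++ i :: G)) t := by
  have hst := h.stored
  have hi : i ∈ A ++ w :: B := hst.layout.perm.mem_iff.1 (by simp)
  have hxU : s.fresh ∉ A ++ w :: B := hst.fresh_notMem le_rfl
  have hw : w ∈ A ++ w :: B := by simp
  obtain ⟨f1, f2, f3, f4⟩ := hst.first_edges hS hi hci
  have hne : ∀ v ∈ A ++ w :: B, v ≠ s.fresh := fun v hv e => hxU (e ▸ hv)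
  obtain ⟨tr1, n1, hn1, e1, c1, i1⟩ := ex_deletePhase τ (i := i) (o := s.uPrev i) (j := none) hst hS hi
    (hst.uPrev_mem hi) (by simp) h.complete h.inorder
  have hst1 : Stored S (A ++ w :: B) (i :: (P ++ G))
    ({s with btree := tr1, steps := s.steps + n1} : St σ) := hst.with_btree _ _
  have hvn : s.vNext i ≠ some s.fresh := by
    have hv : DLL s.vPrev s.vNext s.vHead s.vTail ([] ++ i :: (P ++ G)) := hst.dllV
    rw [hv.next_eq]
    intro e
    have := List.mem_of_mem_head? (Option.mem_def.2 e)
    exact hxU (hst.layout.perm.mem_iff.1 (List.mem_cons_of_mem _ this))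
  have e2 := ex_insertNode τ c i g w ({s with btree := tr1, steps := s.steps + n1} : St σ)
    (hne i hi) (hne w hw) (hne _ f1) hvn
  have hst2 := hst1.insertNode hS hc hci hA hP hg
  set s2 := (({s with btree := tr1, steps := s.steps + n1} : St σ).insertNode c i g w).tk (14 + τ)
    with hs2
  have hst2' : Stored (c :: S) (A ++ w :: s.fresh :: B) (s.fresh :: (P ++ i :: G)) s2 :=
    hst2.with_btree _ _
  have hch : ∀ v ∈ A ++ w :: B, v ≠ i → s2.ch v = s.ch v := by
    intro v hv hvi
    change Function.update (Function.update s.ch s.fresh ⊥) i c v = s.ch v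
    rw [Function.update_of_ne hvi, Function.update_of_ne (hne v hv)]
  have hchx : s2.ch s.fresh = ⊥ := by
    change Function.update (Function.update s.ch s.fresh ⊥) i c s.fresh = ⊥
    rw [Function.update_of_ne (hne i hi).symm, Function.update_self]
  have hgrow := (show Layout S ((A ++ [w]) ++ B) (i :: (P ++ G)) s.ch s.len by
    simpa using hst.layout).grow hS hc hci (x := s.fresh) (by simpa using hxU) hA hP
  obtain ⟨tr3, n3, hn3, e3, c3, i3⟩ := hst.exists_insertPhase (i := i) τ (x := s.fresh) (z := none)
    (o := none) hst2'
    (isText_cons hS hc) hi (fun y hy => by simp at hy ⊢; tauto) (fun y hy => by simp at hy ⊢; tauto)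
    (by simp) (by simp) hxU (by simp) (fun y hy hyi => hgrow.2.fst_eq y (by simpa using hy) hyi)
    c1 i1 (by
      intro y hy hyi hyp
      refine ⟨by simp, fun _ => ?_⟩
      -- The next node is unchanged; it is not `$` because y does not precede i.
      have key : ∀ X T X' T', A ++ w :: B = X ++ y :: T → A ++ w :: s.fresh :: B = X' ++ y :: T' →
          T'.head? = T.head? → s2.cond y = s.cond y := by
        intro X T X' T' hX hX' hT
        have hd := hst.dllU
        have hd' := hst2'.dllU
        rw [hX] at hd
        rw [hX'] at hd'
        refine St.cond_congr hd hd' hT (hch y hy hyi) fun b hb => ?_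
        obtain ⟨b1, b2, b3⟩ := hst.next_ne_bot hS hi hci hX hyp hb
        exact ⟨b2, hch b b3 b1⟩
      rcases List.mem_append.1 hy with hyA | hyB
      · obtain ⟨A1, A2, rfl⟩ := List.append_of_mem hyA
        refine key A1 (A2 ++ w :: B) A1 (A2 ++ w :: s.fresh :: B) (by simp) (by simp) ?_
        cases A2 <;> simp
      · rcases List.mem_cons.1 hyB with rfl | hyB
        -- The node w gets the new `$` as its successor, and the condition looks past it.
        · rw [St.cond_eq hst.dllU, St.cond_eq hst2'.dllU]
          refine condL_dollar (hch y hy hyi) hchx fun b hb => ?_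
          obtain ⟨b1, b2, b3⟩ := hst.next_ne_bot hS hi hci rfl hyp hb
          exact ⟨b2, hch b b3 b1⟩
        · obtain ⟨B1, B2, rfl⟩ := List.append_of_mem hyB
          exact key (A ++ w :: B1) B2 (A ++ w :: s.fresh :: B1) B2 (by simp) (by simp) rfl)
  have cF : ∀ k, (A ++ w :: s.fresh :: B).countP (fun v => s2.eF v = k) < α := by
    intro k
    have h3 := countP_insert_lt (x := s.fresh) (s := i) hst.layout.nodupU hi hxU (e := s.eF)
      (fun v hv => hne _ (hst.halfF.mem v hv)) hα h.ltF k
    have hp : (A ++ w :: s.fresh :: B).Perm (s.fresh :: (A ++ w :: B)) := by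
      rw [List.append_cons, List.append_cons A w B]; exact List.perm_middle
    rw [hp.countP_eq]
    exact h3
  have cL : ∀ k, (A ++ w :: s.fresh :: B).countP (fun v => s2.eL v = k) < α := by
    intro k
    have h3 := countP_insert_lt (x := s.fresh) (s := s.eF i) hst.layout.nodupU f1 hxU (e := s.eL)
      (fun v hv => hne _ (hst.halfL.mem v hv)) hα h.ltL k
    have hp : (A ++ w :: s.fresh :: B).Perm (s.fresh :: (A ++ w :: B)) := by
      rw [List.append_cons, List.append_cons A w B]; exact List.perm_middle
    rw [hp.countP_eq]
    rw [f4] at h3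
    exact h3
  refine ⟨{s2 with btree := tr3, steps := s2.steps + n3}, ?_, ?_, hst2'.with_btree _ _,
    FewHeavy.of_lt cF, FewHeavy.of_lt cL, HeavyStored.of_lt cF cL h.heavyU h.heavyV, c3, i3⟩
  · unfold updateTail
    have e1' : ex (deletePhase τ i (s.get i).uPrev ((none : Option (ℕ × ℕ × ℕ)).map (fun t => t.1)))
      s.toM = _ := e1
    rw [ex_bind, e1', ex_bind]
    simp only
    have e2' : ex (insertNode τ c i (s.get i) g w)
      (({s with btree := tr1, steps := s.steps + n1} : St σ).toM) = (s.fresh, s2.toM) := e2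
    rw [e2', ex_bind]
    exact e3
  · have hl : (s.fresh :: (P ++ i :: G)).length = (i :: (P ++ G)).length + 1 := by simp; omega
    rw [hl] at hn3
    have m1 := treeCost_mono (τ := τ) (show (i :: (P ++ G)).length ≤ (i :: (P ++ G)).length + 2 by omega)
    have m2 := treeCost_mono (τ := τ)
      (show (i :: (P ++ G)).length + 1 ≤ (i :: (P ++ G)).length + 2 by omega)
    change s.steps + n1 + (14 + τ) + n3 ≤ _
    omega

set_option maxHeartbeats 1000000 in
/-- The update if a node is split. -/
theorem Input.exists_updateTail_cut (h : Input α S (A ++ j :: B) (i :: (P ++ G)) s) (τ : ℕ)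
    (hα : 2 ≤ α) (hcut : Cut S s c A B P G i j d g y) :
    ∃ t, ex (updateTail τ α c i (s.get i) g j (some (j, d, y))) s.toM = ((), t.toM) ∧
      t.steps ≤ s.steps + (7 * treeCost τ ((i :: (P ++ G)).length + 2) + 7 * α + 2 * τ + 44) ∧
      Output α (c :: S) (cutU s A B j) (cutV s P G i j) t := by
  have hst := h.stored
  have hS := hcut.text
  have hc := hcut.ne_bot
  have hci := hcut.dollar
  have hi := hcut.mem_i
  have hj : j ∈ A ++ j :: B := by simp
  have hxU := hcut.x_notMem
  obtain ⟨f1, f2, f3, f4⟩ := hst.first_edges hS hi hci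
  obtain ⟨tr1, n1, hn1, e1, c1, i1⟩ := ex_deletePhase τ (i := i) (o := s.uPrev i) (j := some j) hst hS hi
    (hst.uPrev_mem hi) (by simp) h.complete h.inorder
  have hcut1 : Cut S ({s with btree := tr1, steps := s.steps + n1} : St σ) c A B P G i j d g y :=
    { stored := hst.with_btree _ _
      text := hS
      ne_bot := hc
      dollar := hci
      pos := hcut.pos
      lt := hcut.lt
      totU := hcut.totU
      totV := hcut.totV
      last := hcut.last
      head := hcut.head
      edge := hcut.edge
      label := hcut.label }
  have hvn : s.vNext i ≠ some s.fresh := by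
    have hv : DLL s.vPrev s.vNext s.vHead s.vTail ([] ++ i :: (P ++ G)) := hst.dllV
    rw [hv.next_eq]
    intro e
    have := List.mem_of_mem_head? (Option.mem_def.2 e)
    exact hxU (hst.layout.perm.mem_iff.1 (List.mem_cons_of_mem _ this))
  have e2 := ex_insertNode τ c i g j ({s with btree := tr1, steps := s.steps + n1} : St σ)
    (hcut.ne_of_mem hi).1 (hcut.ne_of_mem hj).1 (hcut.ne_of_mem f1).1 hvn
  obtain ⟨t, r, hr, e4, hst4, htc, htl, htb, hts, hfF, hfL, hhe⟩ := hcut1.exists_splitNode τ hα h.ltF h.ltL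
    h.heavyU h.heavyV (14 + τ)
  have hst4' : Stored (c :: S) (cutU s A B j) (cutV s P G i j) (t.tk (14 + τ + r)) :=
    hst4.with_btree _ _
  have hch : ∀ v ∈ A ++ j :: B, v ≠ i → t.ch v = s.ch v := by
    intro v hv hvi
    have hv' := hcut.ne_of_mem hv
    rw [htc]
    change Function.update (Function.update (Function.update s.ch s.fresh ⊥) i c) (s.fresh + 1)
      (Function.update (Function.update s.ch s.fresh ⊥) i c j) v = s.ch v
    rw [Function.update_of_ne hv'.2, Function.update_of_ne hvi, Function.update_of_ne hv'.1]
  have hchx : t.ch s.fresh = ⊥ := by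
    rw [htc]
    change Function.update (Function.update (Function.update s.ch s.fresh ⊥) i c) (s.fresh + 1)
      (Function.update (Function.update s.ch s.fresh ⊥) i c j) s.fresh = ⊥
    rw [Function.update_of_ne (by omega), Function.update_of_ne (hcut.ne_of_mem hi).1.symm,
      Function.update_self]
  have hchz : t.ch (s.fresh + 1) = s.ch j := by
    rw [htc]
    change Function.update (Function.update (Function.update s.ch s.fresh ⊥) i c) (s.fresh + 1)
      (Function.update (Function.update s.ch s.fresh ⊥) i c j) (s.fresh + 1) = s.ch j
    rw [Function.update_self, Function.update_of_ne hcut.ne_ji,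
      Function.update_of_ne (hcut.ne_of_mem hj).1]
  have hlen : t.len = (cutState s c i g j d y).len := htl
  obtain ⟨L, hsh, -, -⟩ := hcut.layout
  have hdU : DLL t.uPrev t.uNext t.uHead t.uTail (A ++ j :: s.fresh :: (s.fresh + 1) :: B) := hst4.dllU
  obtain ⟨tr3, n3, hn3, e3, c3, i3⟩ := hst.exists_insertPhase (i := i) τ (x := s.fresh)
    (z := some (s.fresh + 1)) (o := some j) hst4'
    (isText_cons hS hc) hi (fun y hy => (hcut.mem_cutU y).2 (by simp at hy ⊢; tauto))
    (fun y hy => by have := (hcut.mem_cutU y).1 hy; simp at this ⊢; tauto)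
    ((hcut.mem_cutU _).2 (by simp)) (by rintro y ⟨⟩; exact (hcut.mem_cutU _).2 (by simp)) hxU
    (by rintro y ⟨⟩; exact hcut.z_notMem)
    (fun y hy hyi => by change off t.len _ y = _; rw [hlen]; exact hsh.fst_eq y hy hyi)
    (by change t.btree.Complete; rw [htb]; exact c1)
    (by change t.btree.inorder = _; rw [htb]; exact i1) (by
      intro y hy hyi hyp
      change (some y = some j → t.cond y = false) ∧ (some y ≠ some j → t.cond y = s.cond y)
      refine ⟨fun e => ?_, fun hne => ?_⟩
      -- The first part of the cut node is followed by `$` and then by its second part, with the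
      -- same character, so it fails the condition.
      · obtain rfl : y = j := by simpa using e
        rw [St.cond_eq hdU]
        have hyb : s.ch y ≠ ⊥ := fun e' => hyi (hst.layout.dollar_unique hS hy e' hi hci)
        simp [condL, hchx, hchz, hch y hy hyi, hyb]
      have key : ∀ X T X' T', A ++ j :: B = X ++ y :: T →
          A ++ j :: s.fresh :: (s.fresh + 1) :: B = X' ++ y :: T' →
          T'.head? = T.head? → t.cond y = s.cond y := by
        intro X T X' T' hX hX' hT
        have hd := hst.dllU
        have hd' := hdU
        rw [hX] at hd
        rw [hX'] at hd'
        refine St.cond_congr hd hd' hT (hch y hy hyi) fun b hb => ?_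
        obtain ⟨b1, b2, b3⟩ := hst.next_ne_bot hS hi hci hX hyp hb
        exact ⟨b2, hch b b3 b1⟩
      rcases List.mem_append.1 hy with hyA | hyB
      · obtain ⟨A1, A2, rfl⟩ := List.append_of_mem hyA
        refine key A1 (A2 ++ j :: B) A1 (A2 ++ j :: s.fresh :: (s.fresh + 1) :: B) (by simp) (by simp) ?_
        cases A2 <;> simp
      · have hyB := (List.mem_cons.1 hyB).resolve_left (by simpa using hne)
        obtain ⟨B1, B2, rfl⟩ := List.append_of_mem hyB
        exact key (A ++ j :: B1) B2 (A ++ j :: s.fresh :: (s.fresh + 1) :: B1) B2 (by simp) (by simp) rfl)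
  refine ⟨{t with btree := tr3, steps := t.steps + (14 + τ + r) + n3}, ?_, ?_, hst4'.with_btree _ _,
    hfF, hfL, hhe, c3, i3⟩
  · unfold updateTail
    have e1' : ex (deletePhase τ i (s.get i).uPrev ((some (j, d, y)).map (fun t => t.1)))
      s.toM = _ := e1
    rw [ex_bind, e1', ex_bind]
    simp only
    have e2' : ex (insertNode τ c i (s.get i) g j)
      (({s with btree := tr1, steps := s.steps + n1} : St σ).toM) = _ := e2
    rw [e2']
    simp only [ex_bind, ex_pure]
    have e4' : ex (splitNode τ α j d s.fresh y)
      ((({s with btree := tr1, steps := s.steps + n1} : St σ).insertNode c i g j).tk (14 + τ)).toM = _ :=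
      e4
    rw [e4']
    exact e3
  · have hl : (cutV s P G i j).length = (i :: (P ++ G)).length + 2 := by
      rw [L.perm.length_eq, hst.layout.perm.length_eq]
      simp [cutU]; omega
    rw [hl] at hn3
    have m1 := treeCost_mono (τ := τ) (show (i :: (P ++ G)).length ≤ (i :: (P ++ G)).length + 2 by omega)
    change t.steps + (14 + τ + r) + n3 ≤ _
    rw [hts]
    change s.steps + n1 + (14 + τ + r) + n3 ≤ _
    omega

end UpdateTail


/-! ### Execution of the whole update. -/

section Update

variable {σ : Type} [LinearOrder σ] [OrderBot σ] {S : List σ} {s : St σ} {c : σ}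
  {U V P G : List ℕ} {i g α : ℕ}

/-- The search in the B-tree finds the last node before the place of the new F-interval. -/
theorem Input.exists_search (h : Input α S U (i :: (P ++ G)) s) (τ : ℕ) {q : ℕ}
    (hg : (i :: P).getLast? = some g) (hcg : s.cond g = true)
    (hkey : ∀ y ∈ U, (y ∈ i :: P ↔ off s.len (i :: (P ++ G)) y < q) ∧
      (off s.len (i :: (P ++ G)) y < q ↔ s.ch y < c ∨ s.ch y = c ∧ off s.len U y < off s.len U i)) :
    ∃ n ≤ treeCost τ (i :: (P ++ G)).length,
      ex (searchTree τ i c s.btree none) (s.tk 3).toM = (some g, (s.tk (3 + n)).toM) := by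
  have hst := h.stored
  have hi : i ∈ U := hst.layout.perm.mem_iff.1 (by simp)
  have hk : ∀ y ∈ U, s.keyLt y (s.ch y) i c ↔ off s.len (i :: (P ++ G)) y < q := by
    intro y hy
    rw [(hkey y hy).2, off_lt_iff_idxOf hst.layout.pos hy hi, ← hst.order]
    rfl
  have hU : ∀ y ∈ i :: (P ++ G), y ∈ U := fun y hy => hst.layout.perm.mem_iff.1 hy
  have hin := h.inorder
  have hmem : ∀ y ∈ s.btree.inorder, y ∈ U := fun y hy => by
    rw [hin] at hy; exact hU y (List.mem_filter.1 hy).1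
  have hsort : s.btree.inorder.Pairwise
      (fun a b => off s.len (i :: (P ++ G)) a < off s.len (i :: (P ++ G)) b) := by
    rw [hin]; exact (pairwise_off hst.layout.nodupV hst.layout.posV).filter _
  obtain ⟨n, hn, hex⟩ := ex_searchTree τ i c s.btree none s (hsort.imp_of_mem fun {a b} ha hb hab => by
    rw [hk a (hmem a ha), hk b (hmem b hb)]; omega) 3
  have hb := treeCost_bound (τ := τ) h.complete
    (show s.btree.inorder.length ≤ (i :: (P ++ G)).length by rw [hin]; exact List.length_filter_le _ _)
  refine ⟨n, ?_, ?_⟩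
  · have : (2 * τ + 3) * (s.btree.height + 1) ≤ (2 * τ + 5) * (s.btree.height + 1) := by gcongr; omega
    omega
  · rw [hex]
    congr 1
    obtain ⟨P0, hP0⟩ : ∃ P0, i :: P = P0 ++ [g] := by
      rw [List.getLast?_eq_some_iff] at hg
      exact hg
    have hnd := hst.layout.nodupV
    have e1 : i :: (P ++ G) = P0 ++ [g] ++ G := by rw [← hP0]; simp
    have hgP : g ∈ i :: P := by rw [hP0]; simp
    have hgU : g ∈ U := hU g (by rw [e1]; simp)
    -- The nodes with smaller keys are those of i :: P; its last node g is stored, so it is the last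
    -- stored one among them.
    have hG : (G.filter s.cond).filter (fun y => decide (s.keyLt y (s.ch y) i c)) = [] := by
      rw [List.filter_eq_nil_iff]
      intro y hy
      have hyG := (List.mem_filter.1 hy).1
      have hyU : y ∈ U := hU y (by simp [hyG])
      rw [decide_eq_true_eq, hk y hyU, ← (hkey y hyU).1]
      rw [← List.cons_append] at hnd
      exact fun hm => (List.nodup_append.1 hnd).2.2 y hm y hyG rfl
    have hgk : s.keyLt g (s.ch g) i c := (hk g hgU).2 ((hkey g hgU).1.1 hgP)
    rw [hin, e1, List.filter_append, List.filter_append, hG, List.append_nil, List.filter_append,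
      List.filter_append, List.filter_cons_of_pos hcg, List.filter_nil]
    simp [hgk]

/-- The update operation. -/
theorem Input.exists_update (h : Input α S U V s) (τ : ℕ) (hα : 2 ≤ α) (hS : IsText S) (hc : c ≠ ⊥)
    (havoid : ∀ A g B, U = A ++ g :: B → B.head? = some s.dollar → s.ch g ≠ c) :
    ∃ t U' V', ex (update τ α c) s.toM = ((), t.toM) ∧
      t.steps ≤ s.steps + updateCost τ α U.length ∧ Output α (c :: S) U' V' t := by
  have hst := h.stored
  have hi := hst.dollar_mem
  have hci := hst.dollar_ch
  have hq0 := rk_zero_pos hS hc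
  obtain ⟨P, G, hV, htot, hkey⟩ := hst.layout.exists_insertion hS hc hi hci
  have hVl : V.length = U.length := hst.layout.perm.length_eq
  subst hV
  obtain ⟨g, hg⟩ : ∃ g, (s.dollar :: P).getLast? = some g :=
    ⟨_, List.getLast?_eq_some_getLast (by simp)⟩
  obtain ⟨P0, hP0⟩ : ∃ P0, s.dollar :: P = P0 ++ [g] := by
    rwa [List.getLast?_eq_some_iff] at hg
  have e1 : s.dollar :: (P ++ G) = P0 ++ g :: G := by
    rw [← List.cons_append, hP0]; simp
  have hgP : g ∈ s.dollar :: P := by rw [hP0]; simp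
  have hgU : g ∈ U := hst.layout.perm.mem_iff.1 (by rw [e1]; simp)
  -- The node g is the last one of the part of V that lies before q.
  have hmax : ∀ y ∈ U, off s.len (s.dollar :: (P ++ G)) y < rk (c :: S) 0 →
      off s.len (s.dollar :: (P ++ G)) y ≤ off s.len (s.dollar :: (P ++ G)) g := by
    intro y hy hyq
    have hyP := (hkey y hy).1.2 hyq
    rw [hP0] at hyP
    rcases List.mem_append.1 hyP with h1 | h1
    · have hs := pairwise_off hst.layout.nodupV hst.layout.posV
      rw [e1] at hs ⊢
      exact ((List.pairwise_append.1 hs).2.2 y h1 g (by simp)).le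
    · rw [List.mem_singleton.1 h1]
  have hcg : s.cond g = true := by
    obtain ⟨A, B, hU⟩ := List.append_of_mem hgU
    have hd := hst.dllU
    rw [hU] at hd
    rw [St.cond_eq hd]
    exact hst.layout.condL_last hS hi hci hgU (fun y hy => (hkey y hy).2) ((hkey g hgU).1.1 hgP) hmax hU
      (havoid A g B hU)
  obtain ⟨n, hn, hsearch⟩ := h.exists_search τ hg hcg hkey
  have hnext : s.vNext g = G.head? := by
    have hd := hst.dllV
    rw [e1] at hd
    exact hd.next_eq
  have htr := treeCost_mono (τ := τ) (show (s.dollar :: (P ++ G)).length ≤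
    (s.dollar :: (P ++ G)).length + 2 by omega)
  have hgrow : ∀ A w B, U = A ++ w :: B → tot s.len (A ++ [w]) = rk (c :: S) 0 →
      s.findCut g = (some w, none) → ∃ t U' V', ex (update τ α c) s.toM = ((), t.toM) ∧
      t.steps ≤ s.steps + updateCost τ α U.length ∧ Output α (c :: S) U' V' t := by
    intro A w B hU hA hf
    obtain ⟨k, hk, hu⟩ := ex_update τ α c s hsearch hf
    subst hU
    obtain ⟨t, e, ht, ho⟩ := (h.tk k).exists_updateTail_grow τ hα hS hc hci hA htot hg
    refine ⟨t, _, _, hu.trans e, ?_, ho⟩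
    rw [hVl] at ht hn htr
    change t.steps ≤ s.steps + k + _ at ht
    unfold updateCost
    omega
  -- Without a node behind g, q is the length of S and the new `$` goes to the end of U. Otherwise y
  -- starts at q, and its edge tells which repetition contains q and at which offset.
  rcases G with _ | ⟨y, G⟩
  · obtain ⟨A, w, hU⟩ : ∃ A w, U = A ++ [w] := by
      rcases List.eq_nil_or_concat U with e | ⟨A, w, e⟩
      · rw [e] at hi; simp at hi
      · exact ⟨A, w, by rw [e]; simp⟩
    refine hgrow A w [] hU ?_ ?_
    · rw [← hU, hst.layout.total, ← htot, ← hst.layout.totalV, List.append_nil]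
    · unfold St.findCut
      rw [hnext]
      simp only [List.head?_nil]
      have := hst.dllU.2.1
      rw [this, hU]
      simp
  · have hyV : y ∈ s.dollar :: (P ++ y :: G) := by simp
    have hyU : y ∈ U := hst.layout.perm.mem_iff.1 hyV
    have hyP : y ∉ s.dollar :: P := by
      have hnd := hst.layout.nodupV
      rw [← List.cons_append] at hnd
      exact fun hm => (List.nodup_append.1 hnd).2.2 y hm y (by simp) rfl
    have hoy : off s.len (s.dollar :: (P ++ y :: G)) y = rk (c :: S) 0 := by
      rw [← List.cons_append, off_append_right hyP, htot]; simp [off]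
    have hjU := hst.halfF.mem y hyU
    have hje := hst.halfF.eq y hyU
    have hjl := hst.halfF.lt y hyU
    rw [hoy] at hje
    obtain ⟨A, B, hU⟩ := List.append_of_mem hjU
    have hoj : off s.len U (s.eF y) = tot s.len A := by
      have hnd := hst.layout.nodupU
      rw [hU] at hnd
      have : s.eF y ∉ A := fun hm => (List.nodup_append.1 hnd).2.2 _ hm _ (by simp) rfl
      rw [hU, off_append_right this]; simp [off]
    by_cases hb : 0 < s.bF y
    · have hf : s.findCut g = (some (s.eF y), some (s.eF y, s.bF y, y)) := by
        unfold St.findCut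
        rw [hnext]
        simp [hb]
      obtain ⟨k, hk, hu⟩ := ex_update τ α c s hsearch hf
      have h0 := h.tk k
      have hst0 := h0.stored
      rw [hU] at h0 hst0
      have hcut : Cut S (s.tk k) c A B P (y :: G) s.dollar (s.eF y) (s.bF y) g y :=
        { stored := hst0
          text := hS
          ne_bot := hc
          dollar := hci
          pos := hb
          lt := hjl
          totU := by rw [← hje, hoj]; rfl
          totV := htot
          last := hg
          head := rfl
          edge := rfl
          label := rfl }
      obtain ⟨t, e, ht, ho⟩ := h0.exists_updateTail_cut τ hα hcut
      refine ⟨t, _, _, hu.trans e, ?_, ho⟩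
      rw [hVl] at ht hn htr
      change t.steps ≤ s.steps + k + _ at ht
      unfold updateCost
      omega
    -- Label 0 means that q is already the start of a repetition; since q > 0, this repetition has a
    -- predecessor w.
    · rcases List.eq_nil_or_concat A with e | ⟨A', w, e⟩
      · rw [e] at hoj
        simp only [tot] at hoj
        omega
      · rw [List.concat_eq_append] at e
        subst e
        refine hgrow A' w (s.eF y :: B) (by rw [hU]; simp) (by omega) ?_
        unfold St.findCut
        rw [hnext]
        have hd := hst.dllU
        rw [hU] at hd
        simp [hb, hd.prev_eq]

end Update


/-! ### Heavy repetitions and F-intervals as numbers of edges. -/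

section Covers

variable {σ : Type} [LinearOrder σ] [OrderBot σ] {S : List σ} {D : DBWT S} {a : Fin D.k → ℕ}
  {U V : List ℕ} {s : St σ} {α : ℕ}

/-- An F-interval has exactly one edge of `E_F`, to the repetition that covers its start. -/
theorem Matches.card_repCovers (M : Matches D a U V s.len) (h : Stored S U V s) (i : Fin D.k) :
    (Finset.univ.filter (fun j => D.RepCovers i j)).card = U.countP (fun y => s.eF y = a i) := by
  rw [M.U_eq]
  refine card_filter_univ (List.Perm.refl _) _ fun j => ?_
  have hi := (M.mem_U (a i)).2 ⟨i, rfl⟩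
  have hj := (M.mem_U (a j)).2 ⟨j, rfl⟩
  rw [M.repCovers h.layout, decide_eq_true_eq]
  refine ⟨fun h1 => h.eF_eq hj hi h1.1 h1.2, fun e => ?_⟩
  have h1 := h.halfF.eq _ hj
  have h2 := h.halfF.lt _ hj
  rw [e] at h1 h2
  omega

theorem Matches.card_intCovers (M : Matches D a U V s.len) (h : Stored S U V s) (j : Fin D.k) :
    (Finset.univ.filter (fun i => D.IntCovers j i)).card = U.countP (fun y => s.eL y = a j) := by
  rw [M.U_eq]
  refine card_filter_univ (List.Perm.refl _) _ fun i => ?_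
  have hi := (M.mem_U (a i)).2 ⟨i, rfl⟩
  have hj := (M.mem_U (a j)).2 ⟨j, rfl⟩
  rw [M.intCovers h.layout, decide_eq_true_eq]
  refine ⟨fun h1 => h.eL_eq hi hj h1.1 h1.2, fun e => ?_⟩
  have h1 := h.halfL.eq _ hi
  have h2 := h.halfL.lt _ hi
  rw [e] at h1 h2
  omega

theorem Half.countP_eq_zero {N K : List ℕ} {pos base len e b : ℕ → ℕ} {first : ℕ → Option ℕ}
    (h : Half N K pos base len e b first) {k : ℕ} (hk : k ∉ K) : N.countP (fun y => e y = k) = 0 := by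
  rw [List.countP_eq_zero]
  intro y hy
  rw [decide_eq_true_eq]
  exact fun e => hk (e ▸ h.mem y hy)

theorem Matches.lt_of_balanced (M : Matches D a U V s.len) (h : Stored S U V s) (hα : 0 < α)
    (hD : D.Balanced α) : (∀ k, U.countP (fun y => s.eF y = k) < α) ∧
      ∀ k, U.countP (fun y => s.eL y = k) < α := by
  constructor
  · intro k
    by_cases hk : k ∈ U
    · obtain ⟨i, rfl⟩ := (M.mem_U k).1 hk
      have := Finset.eq_empty_iff_forall_notMem.1 hD.1 i
      simp only [DBWT.heavyReps, Finset.mem_filter, Finset.mem_univ, true_and, not_le,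
        M.card_repCovers h] at this
      exact this
    · rw [h.halfF.countP_eq_zero hk]; exact hα
  · intro k
    by_cases hk : k ∈ U
    · obtain ⟨i, rfl⟩ := (M.mem_U k).1 hk
      have := Finset.eq_empty_iff_forall_notMem.1 hD.2 i
      simp only [DBWT.heavyInts, Finset.mem_filter, Finset.mem_univ, true_and, not_le,
        M.card_intCovers h] at this
      exact this
    · rw [h.halfL.countP_eq_zero hk]; exact hα

theorem FewHeavy.countP_le {e : ℕ → ℕ} (h : FewHeavy α U e) (k : ℕ) :
    U.countP (fun v => e v = k) ≤ α := by
  obtain ⟨f, h1, h2⟩ := h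
  rcases eq_or_ne k f with rfl | hk
  · exact h2
  · exact (h1 k hk).le

/-- Since no number exceeds α and at most one reaches it, the bounds 2α + 1 and 2 of the theorem are
met with room to spare. -/
theorem Matches.heavyReps_card (M : Matches D a U V s.len) (h : Stored S U V s)
    (hf : FewHeavy α U s.eF) : D.heavyReps (2 * α + 1) = ∅ ∧ (D.heavyReps α).card ≤ 1 := by
  constructor
  · rw [Finset.eq_empty_iff_forall_notMem]
    intro i
    simp only [DBWT.heavyReps, Finset.mem_filter, Finset.mem_univ, true_and, not_le, M.card_repCovers h]
    have := hf.countP_le (a i)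
    omega
  · obtain ⟨f, h1, h2⟩ := hf
    have key : ∀ i ∈ D.heavyReps α, a i = f := by
      intro i hi
      simp only [DBWT.heavyReps, Finset.mem_filter, Finset.mem_univ, true_and,
        M.card_repCovers h] at hi
      by_contra hne
      exact absurd (h1 _ hne) (not_lt.2 hi)
    exact Finset.card_le_one.2 fun i hi j hj => M.inj ((key i hi).trans (key j hj).symm)

theorem Matches.heavyInts_card (M : Matches D a U V s.len) (h : Stored S U V s)
    (hf : FewHeavy α U s.eL) : D.heavyInts (2 * α + 1) = ∅ ∧ (D.heavyInts α).card ≤ 1 := by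
  constructor
  · rw [Finset.eq_empty_iff_forall_notMem]
    intro i
    simp only [DBWT.heavyInts, Finset.mem_filter, Finset.mem_univ, true_and, not_le, M.card_intCovers h]
    have := hf.countP_le (a i)
    omega
  · obtain ⟨f, h1, h2⟩ := hf
    have key : ∀ i ∈ D.heavyInts α, a i = f := by
      intro i hi
      simp only [DBWT.heavyInts, Finset.mem_filter, Finset.mem_univ, true_and,
        M.card_intCovers h] at hi
      by_contra hne
      exact absurd (h1 _ hne) (not_lt.2 hi)
    exact Finset.card_le_one.2 fun i hi j hj => M.inj ((key i hi).trans (key j hj).symm)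

end Covers

/-! ### Suffixes of the text. -/

section Text

variable {σ : Type} [LinearOrder σ] [OrderBot σ] {T : List σ} {δ : ℕ} {c : σ}

theorem suffixOf_succ (hδ : δ + 1 ≤ T.length) (hc : T[T.length - (δ + 1)]? = some c) :
    suffixOf T (δ + 1) = c :: suffixOf T δ := by
  obtain ⟨h, rfl⟩ := List.getElem?_eq_some_iff.1 hc
  unfold suffixOf
  rw [List.drop_eq_getElem_cons h]
  congr 2
  omega

theorem isText_suffixOf (hT : IsText T) (h1 : 1 ≤ δ) : IsText (suffixOf T δ) := by
  obtain ⟨w, rfl, hw⟩ := hT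
  refine ⟨w.drop ((w ++ [⊥]).length - δ), ?_, fun h => hw (List.mem_of_mem_drop h)⟩
  unfold suffixOf
  rw [List.drop_append_of_le_length]
  simp only [List.length_append, List.length_singleton]
  omega

/-- The character before a nonempty suffix is not the last one, and `$` occurs only there. -/
theorem ne_bot_of_getElem? (hT : IsText T) (h1 : 1 ≤ δ) (hδ : δ + 1 ≤ T.length)
    (hc : T[T.length - (δ + 1)]? = some c) : c ≠ ⊥ := by
  obtain ⟨w, rfl, hw⟩ := hT
  rintro rfl
  rw [List.length_append, List.length_singleton] at hc hδ
  rw [List.getElem?_append_left (by omega)] at hc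
  exact hw (List.mem_of_getElem? hc)

end Text

/-! ### The real bound for the number of steps. -/

section Bounds

/-- For k ≥ 1 one has k + 3 ≤ 4k. The summand 2 counts the nodes that the update can add, the
summand 1 comes from the bound for the height. -/
theorem natLog_le_logb {k : ℕ} (hk : 1 ≤ k) : (Nat.log 2 (k + 2 + 1) : ℝ) ≤ Real.logb 2 k + 2 := by
  have h1 : (Nat.log 2 (k + 2 + 1) : ℝ) ≤ Real.logb 2 ((k + 2 + 1 : ℕ) : ℝ) := by
    have := Real.natLog_le_logb (k + 2 + 1) 2
    exact_mod_cast this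
  have hk0 : (0 : ℝ) < k := by exact_mod_cast hk
  have hk1 : (1 : ℝ) ≤ k := by exact_mod_cast hk
  refine h1.trans ?_
  have h2 : Real.logb 2 k + 2 = Real.logb 2 (k * 4) := by
    rw [Real.logb_mul hk0.ne' (by norm_num), show (4 : ℝ) = 2 ^ (2 : ℕ) by norm_num, Real.logb_pow,
      Real.logb_self_eq_one (by norm_num)]
    norm_num
  rw [h2]
  refine Real.logb_le_logb_of_le (by norm_num) (by positivity) ?_
  push_cast
  linarith

/-- With the bound log₂ k + 2 for the logarithm, the cost is at most (16τ + 40) log₂ k + 7α + 50τ +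
228; the constant term is absorbed by α, and 235 = 228 + 7. -/
theorem updateCost_le (τ : ℕ) {α k : ℕ} (hα : 2 ≤ α) (hk : 1 ≤ k) :
    (updateCost τ α k : ℝ) ≤ (50 * τ + 235) * (α + Real.logb 2 k) := by
  have h1 := natLog_le_logb hk
  have h2 : (0 : ℝ) ≤ Real.logb 2 k := Real.logb_nonneg (by norm_num) (by exact_mod_cast hk)
  have h3 : (2 : ℝ) ≤ α := by exact_mod_cast hα
  have hτ : (0 : ℝ) ≤ τ := Nat.cast_nonneg τ
  have h4 := mul_le_mul_of_nonneg_left h1 hτ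
  have h5 := mul_nonneg hτ h2
  have h6 := mul_le_mul_of_nonneg_left h3 hτ
  unfold updateCost treeCost
  push_cast
  nlinarith

end Bounds

end RComp

theorem mainTheorem7 (τ : ℕ) : ∃ C : ℝ, ∀ (σ : Type) [LinearOrder σ] [OrderBot σ]
    (T : List σ) (δ : ℕ) (c : σ) (α : ℕ) (D : DBWT (suffixOf T δ)) (a : Fin D.k → ℕ)
    (B : Finset (Fin D.k)) (m : Machine σ),
    IsText T → 1 ≤ δ → δ + 1 ≤ T.length → T[T.length - (δ + 1)]? = some c →
    2 ≤ α → D.Balanced α → D.NeighboursAvoid c →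
    StoresGraph α D a B m → (∀ g, g ∈ B ↔ D.SearchCond g) →
    ∃ m' : Machine σ, ((update τ α c).run m).2 = m' ∧
      (m'.steps : ℝ) - m.steps ≤ C * (α + Real.logb 2 D.k) ∧
      ∃ (D' : DBWT (suffixOf T (δ + 1))) (a' : Fin D'.k → ℕ) (B' : Finset (Fin D'.k)),
        D'.Balanced (2 * α + 1) ∧ (D'.heavyReps α).card ≤ 2 ∧ (D'.heavyInts α).card ≤ 2 ∧
        StoresGraph α D' a' B' m' ∧ (∀ g, g ∈ B' ↔ D'.SearchCond g) := by
  classical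
  refine ⟨50 * τ + 235, ?_⟩
  intro σ _ _ T δ c α D a B m hT hδ hδT hcT hα hbal hav hG hB
  have hS := isText_suffixOf hT hδ
  have hc := ne_bot_of_getElem? hT hδ hδT hcT
  have hsuf := suffixOf_succ hδT hcT
  obtain ⟨s, rfl⟩ : ∃ s : St σ, m = s.toM := ⟨St.ofM m, (St.toM_ofM m).symm⟩
  rw [hsuf]
  have hinj : Function.Injective a := by
    intro i j hij
    have := (hG.edgesLF i j).2 hij
    simpa [DBWT.graph] using this
  obtain ⟨M, L⟩ := D.matches_layout hS (a := a) (ch := s.ch) (len := s.len) hinj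
    (fun i => (Prod.ext_iff.1 (hG.labelsU i)).2) (fun i => (Prod.ext_iff.1 (hG.labelsU i)).1)
  set U := D.uOrder.map a with hUd
  set V := D.vOrder.map a with hVd
  have hUk : U.length = D.k := by simp [hUd, DBWT.uOrder]
  obtain ⟨hst, -, htc, hti⟩ := (storesGraph_iff hS M L hB).1 hG
  obtain ⟨hF, hL⟩ := M.lt_of_balanced hst (by omega) hbal
  have hin : Input α (suffixOf T δ) U V s :=
    { stored := hst
      ltF := hF
      ltL := hL
      -- The arrays hold the heavy nodes, and a balanced DBWT has none; so the program may just push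
      -- the new ones.
      heavyU := by
        have : s.heavyU.Perm _ := hG.arrayU
        rw [hbal.1] at this
        simpa using this
      heavyV := by
        have : s.heavyV.Perm _ := hG.arrayV
        rw [hbal.2] at this
        simpa using this
      complete := htc
      inorder := hti }
  have havoid : ∀ A g B, U = A ++ g :: B → B.head? = some s.dollar → s.ch g ≠ c := by
    intro A g B hU hB hg
    -- The node g is the left neighbour of the node of `$`.
    obtain ⟨B', rfl⟩ : ∃ B', B = s.dollar :: B' := by
      rcases B with _ | ⟨b, B'⟩
      · simp at hB
      · simp only [List.head?_cons, Option.some.injEq] at hB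
        exact ⟨B', by rw [hB]⟩
    refine (hav (A.length + 1) ?_).1 A.length rfl ?_
    · rw [M.charAt L, hU]
      simp [hst.dollar_ch]
    · rw [M.charAt L, hU]
      simp [hg]
  obtain ⟨t, U', V', he, hsteps, ho⟩ := hin.exists_update τ hα hS hc havoid
  refine ⟨t.toM, congrArg Prod.snd he, ?_, ?_⟩
  · have hk : 1 ≤ D.k := by
      rw [← hUk]
      exact List.length_pos_of_mem hst.dollar_mem
    refine le_trans ?_ (updateCost_le τ hα hk)
    rw [hUk] at hsteps
    have : (t.steps : ℝ) ≤ s.steps + updateCost τ α D.k := by exact_mod_cast hsteps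
    change (t.steps : ℝ) - s.steps ≤ _
    linarith
  · obtain ⟨D', a', M'⟩ := ho.stored.layout.exists_matches
    obtain ⟨r1, r2⟩ := M'.heavyReps_card ho.stored ho.fewF
    obtain ⟨i1, i2⟩ := M'.heavyInts_card ho.stored ho.fewL
    -- The set of stored nodes is taken to be the one that the invariant prescribes; that the B-tree
    -- holds exactly this set is part of `Output`.
    refine ⟨D', a', Finset.univ.filter D'.SearchCond, ⟨r1, i1⟩, by omega, by omega, ?_, by simp⟩
    exact (storesGraph_iff (isText_cons hS hc) M' ho.stored.layout (by simp)).2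
      ⟨ho.stored, ho.heavy, ho.complete, ho.inorder⟩
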